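/- There is a single real-RAM algorithm with the following property. Let $n \ge 0$, let $s>0$, and let $C_i = p_i + [0,s]^3$, $i=1,\dots,n$, be closed axis-aligned cubes in $\mathbb{R}^3$ of common side length $s$, given by their lowest corners $p_1,\dots,p_n\in\mathbb{R}^3$ and by $s$. Given this input, the algorithm computes boxes $R_1,\dots,R_m$ such that $m = O(n)$, the boxes are pairwise disjoint as point sets (so that no two of them share an interior or a boundary point that belongs to both), and $$R_1\cup\dots\cup R_m = C_1\cup\dots\cup C_n .$$ Its worst-case running time over inputs with $n$ cubes is $O(n\log^2 n)$ as $n \to \infty$. The implied constants are absolute. Here a box is a product $I_1\times I_2\times I_3$ of nonempty bounded intervals, each of which is open, closed or half-open (a one-point interval $[a,a]$ is allowed); in the output it is described by its six endpoints together with, for each endpoint, whether it is included. The real RAM has registers and arrays of real numbers and of natural numbers, with arithmetic $+,-,\times,\div$ and comparisons on reals, addition, truncated subtraction and comparison on natural numbers, and array access at computed indices, each at unit cost. -/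

import Mathlib

open Filter Asymptotics

/-! ### Cubes and boxes -/

/-- The closed axis-aligned cube with side length `s` and lowest corner `p`. -/
def closedCube {d : ℕ} (p : Fin d → ℝ) (s : ℝ) : Set (Fin d → ℝ) :=
  {x | ∀ j, p j ≤ x j ∧ x j ≤ p j + s}

/-- An axis-aligned box: a product of `d` bounded intervals, each of which is open, closed or
half-open. `loClosed j` (`hiClosed j`) says whether the `j`-th interval contains its lower (upper)
endpoint. -/
structure Box (d : ℕ) where
  lo : Fin d → ℝ
  hi : Fin d → ℝ
  loClosed : Fin d → Prop
  hiClosed : Fin d → Prop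

/-- The point set of a box. -/
def Box.toSet {d : ℕ} (B : Box d) : Set (Fin d → ℝ) :=
  {x | ∀ j, (B.lo j < x j ∨ B.loClosed j ∧ x j = B.lo j) ∧
    (x j < B.hi j ∨ B.hiClosed j ∧ x j = B.hi j)}

/-- The finite family `B` of nonempty boxes is a partition of `U`: the boxes are pairwise disjoint
as point sets (they share neither interior nor boundary points) and their union is `U`. -/
structure IsDisjointBoxDecomposition {d m : ℕ} (B : Fin m → Box d) (U : Set (Fin d → ℝ)) :
    Prop where
  nonempty : ∀ k, (B k).toSet.Nonempty
  disjoint : Pairwise fun k l => Disjoint (B k).toSet (B l).toSet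
  iUnion_eq : ⋃ k, (B k).toSet = U

/-! ### The real RAM

A program handles natural numbers (with `+`, truncated `-`, `<`) and real numbers
(with `+`, `-`, `*`, `/`, `<`), kept in numbered registers and in numbered arrays. A program text
is finite and mentions finitely many registers and arrays; arrays are accessed at computed
indices. There is no rounding, no real constants other than natural numbers, and no conversion
between the two sorts. Every operation, memory access and test costs one unit of time. -/

namespace RealRAM

/-- A memory configuration. -/
structure State where
  natReg : ℕ → ℕ
  realReg : ℕ → ℝ
  natArr : ℕ → ℕ → ℕ
  realArr : ℕ → ℕ → ℝ

/-- Natural-number expressions; `arr a e` is the entry of array `a` at index `e`. -/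
inductive NatExpr where
  | const (c : ℕ)
  | reg (r : ℕ)
  | arr (a : ℕ) (e : NatExpr)
  | add (e f : NatExpr)
  | sub (e f : NatExpr)

/-- The value of a natural-number expression. -/
def NatExpr.eval (σ : State) : NatExpr → ℕ
  | const c => c
  | reg r => σ.natReg r
  | arr a e => σ.natArr a (e.eval σ)
  | add e f => e.eval σ + f.eval σ
  | sub e f => e.eval σ - f.eval σ

/-- The time to evaluate a natural-number expression. -/
def NatExpr.cost : NatExpr → ℕ
  | const _ => 1
  | reg _ => 1
  | arr _ e => e.cost + 1
  | add e f => e.cost + f.cost + 1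
  | sub e f => e.cost + f.cost + 1

/-- Real expressions; `arr a e` is the entry of array `a` at index `e`. -/
inductive RealExpr where
  | const (c : ℕ)
  | reg (r : ℕ)
  | arr (a : ℕ) (e : NatExpr)
  | add (e f : RealExpr)
  | sub (e f : RealExpr)
  | mul (e f : RealExpr)
  | div (e f : RealExpr)

/-- The value of a real expression (a quotient by zero is zero). -/
noncomputable def RealExpr.eval (σ : State) : RealExpr → ℝ
  | const c => (c : ℝ)
  | reg r => σ.realReg r
  | arr a e => σ.realArr a (e.eval σ)
  | add e f => e.eval σ + f.eval σ
  | sub e f => e.eval σ - f.eval σ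
  | mul e f => e.eval σ * f.eval σ
  | div e f => e.eval σ / f.eval σ

/-- The time to evaluate a real expression. -/
def RealExpr.cost : RealExpr → ℕ
  | const _ => 1
  | reg _ => 1
  | arr _ e => e.cost + 1
  | add e f => e.cost + f.cost + 1
  | sub e f => e.cost + f.cost + 1
  | mul e f => e.cost + f.cost + 1
  | div e f => e.cost + f.cost + 1

/-- Tests. -/
inductive Test where
  | natLt (e f : NatExpr)
  | realLt (e f : RealExpr)
  | not (b : Test)
  | and (b c : Test)

/-- The truth of a test. -/
def Test.Holds (σ : State) : Test → Prop
  | natLt e f => e.eval σ < f.eval σ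
  | realLt e f => e.eval σ < f.eval σ
  | not b => ¬ b.Holds σ
  | and b c => b.Holds σ ∧ c.Holds σ

/-- The time to evaluate a test. -/
def Test.cost : Test → ℕ
  | natLt e f => e.cost + f.cost + 1
  | realLt e f => e.cost + f.cost + 1
  | not b => b.cost + 1
  | and b c => b.cost + c.cost + 1

/-- Programs. -/
inductive Prog where
  | skip
  | setNat (r : ℕ) (e : NatExpr)
  | setReal (r : ℕ) (e : RealExpr)
  | storeNat (a : ℕ) (i e : NatExpr)
  | storeReal (a : ℕ) (i : NatExpr) (e : RealExpr)
  | seq (P Q : Prog)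
  | ite (b : Test) (P Q : Prog)
  | while (b : Test) (P : Prog)

/-- Assign `v` to natural-number register `r`. -/
def State.setNat (σ : State) (r v : ℕ) : State :=
  { σ with natReg := Function.update σ.natReg r v }

/-- Assign `v` to real register `r`. -/
noncomputable def State.setReal (σ : State) (r : ℕ) (v : ℝ) : State :=
  { σ with realReg := Function.update σ.realReg r v }

/-- Assign `v` to entry `i` of natural-number array `a`. -/
def State.storeNat (σ : State) (a i v : ℕ) : State :=
  { σ with natArr := Function.update σ.natArr a (Function.update (σ.natArr a) i v) }

/-- Assign `v` to entry `i` of real array `a`. -/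
noncomputable def State.storeReal (σ : State) (a i : ℕ) (v : ℝ) : State :=
  { σ with realArr := Function.update σ.realArr a (Function.update (σ.realArr a) i v) }

/-- `Exec P σ t τ`: started in `σ`, the program `P` halts in `τ` after exactly `t` units of
time. -/
inductive Exec : Prog → State → ℕ → State → Prop where
  | skip (σ) : Exec .skip σ 1 σ
  | setNat (σ r e) : Exec (.setNat r e) σ (e.cost + 1) (σ.setNat r (e.eval σ))
  | setReal (σ r e) : Exec (.setReal r e) σ (e.cost + 1) (σ.setReal r (e.eval σ))
  | storeNat (σ a i e) :
      Exec (.storeNat a i e) σ (i.cost + e.cost + 1) (σ.storeNat a (i.eval σ) (e.eval σ))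
  | storeReal (σ a i e) :
      Exec (.storeReal a i e) σ (i.cost + e.cost + 1) (σ.storeReal a (i.eval σ) (e.eval σ))
  | seq {P Q σ σ' τ t u} : Exec P σ t σ' → Exec Q σ' u τ → Exec (.seq P Q) σ (t + u) τ
  | iteTrue {b P Q σ τ t} : b.Holds σ → Exec P σ t τ → Exec (.ite b P Q) σ (b.cost + 1 + t) τ
  | iteFalse {b P Q σ τ t} : ¬ b.Holds σ → Exec Q σ t τ → Exec (.ite b P Q) σ (b.cost + 1 + t) τ
  | whileTrue {b P σ σ' τ t u} : b.Holds σ → Exec P σ t σ' → Exec (.while b P) σ' u τ →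
      Exec (.while b P) σ (b.cost + 1 + t + u) τ
  | whileFalse {b P σ} : ¬ b.Holds σ → Exec (.while b P) σ (b.cost + 1) σ

/-- The initial memory for `n` cubes of side length `s` with lowest corners `p i`: natural-number
register `0` holds `n`, real register `0` holds `s`, entry `i < n` of real array `j` (`j = 0, 1, 2`)
holds the `j`-th coordinate of `p i`, and everything else is zero. -/
noncomputable def cubesInput {n : ℕ} (s : ℝ) (p : Fin n → Fin 3 → ℝ) : State where
  natReg r := if r = 0 then n else 0
  realReg r := if r = 0 then s else 0
  natArr _ _ := 0
  realArr a i := if h : a < 3 ∧ i < n then p ⟨i, h.2⟩ ⟨a, h.1⟩ else 0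

/-- The number of boxes in the output, read from natural-number register `0`. -/
def State.outCount (σ : State) : ℕ := σ.natReg 0

/-- The `k`-th box of the output: for `j = 0, 1, 2`, its `j`-th interval has the endpoints stored at
index `k` in the real arrays `3 + j` (lower) and `6 + j` (upper), which belong to the interval if
and only if the entry `k` of the natural-number array `j`, respectively `3 + j`, is nonzero. -/
def State.outBox (σ : State) (k : ℕ) : Box 3 where
  lo j := σ.realArr (3 + j) k
  hi j := σ.realArr (6 + j) k
  loClosed j := σ.natArr j k ≠ 0
  hiClosed j := σ.natArr (3 + j) k ≠ 0

end RealRAM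

/-! Only the order of the face coordinates matters. In each dimension the `2 n` faces ("cuts") are
sorted, equal coordinates by number, so that lower faces precede upper ones; the rank of a real
number is the number of cuts that it has passed. By `IsSort.passed_iff` and `Setup.in_iff` a cube
becomes a half-open box `(lo, hi]` of ranks whose ends are all distinct. A box of ranks pulls back
to a box of reals, and the question which endpoints belong to it is answered by the kinds of the
cuts that bound it.

The `x`-axis and the `z`-axis are divided greedily into slabs (`runs_slabProg`). The cubes are
congruent, so lower and upper faces come in the same order, and each interval `(lo, hi]` is cut
once, at a breakpoint `E`, into `(lo, E]` and the possibly empty `(E, hi]`. A cube therefore falls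
into four pieces. Each lies in one column (an `x`-slab times a `z`-slab), touches there the left or
the right wall, and either reaches up to the ceiling or down to the floor. Above a point `(x, y)` of
a column, the pieces that reach up cover everything above the least `lo`, and those that reach down
everything below the greatest `hi`. If the two ranges overlap, the whole slab is covered. So the
lowest piece reaching up is made responsible for its own part, or for the whole slab in the case of
overlap, and the highest piece reaching down is responsible for its own part if there is no overlap.
`Layout.exists_emit_iff` and `Layout.Emit.unique` say that these regions partition the union.

A sweep in the direction of `z` computes the regions. Within a column the `y`-axis is divided into
rows, and for each row and each of the four kinds only the farthest reach from the wall is needed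
(`Layout.cond_iff`). The reaches are kept in four trees that support "raise a range of rows to at
least `a`" and "find the next row at which some value leaves given bounds". The region of a piece is
output along maximal runs of rows with the same profile, that is, with the same values as far as
they matter between the present reach and the new one; a run needs at most three boxes
(`rowRegion_eq`). Pieces that reach down disappear during the sweep, but a maximum cannot be undone.
So they are first inserted in backward order, with the overwritten tags logged, and the forward
sweep restores the tags from the log.

Both the size of the output and the time depend on the total number of profile changes, which a
potential bounds. `pot` counts, row by row, the jumps of the reach of a family and the jumps of the
other families that stick out above it, minus twice the jumps of the families that reach the other
way. Inserting a piece flattens or hides nearly all jumps that its output meets, so the potential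
pays for the changes up to a constant (`pot_raise`); removing a piece of the other direction raises
it by a constant only (`pot_lower`). The constants come from congruence again: no `y`-interval of a
column is contained properly in another, so inside the rows of a piece a superlevel set of a reach
is an initial segment together with a final one (`Layout.rowVal_flank`) and changes at most twice.
As the potential starts nonpositive and ends nonnegative, the changes add up to `O(n)`
(`sum_upCuts_le`), and for the pieces that reach down the same argument runs backward in time
(`sum_downCuts_le`).

Every run and every update costs `O(log n)`, as does each step of the tournament sort, so the bound
reached in `runs_unionProg` is `O(n log n)`, which is stronger than what is claimed. -/

namespace RealRAM

/-! ### Execution with a time bound -/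

/-- Started in `σ`, the program `P` halts within time `T` in a state that satisfies `Q`. -/
def Runs (P : Prog) (σ : State) (T : ℕ) (Q : State → Prop) : Prop :=
  ∃ t τ, Exec P σ t τ ∧ t ≤ T ∧ Q τ

theorem Runs.mono {P : Prog} {σ : State} {T T' : ℕ} {Q Q' : State → Prop}
    (h : Runs P σ T Q) (hT : T ≤ T') (hQ : ∀ τ, Q τ → Q' τ) : Runs P σ T' Q' := by
  obtain ⟨t, τ, h1, h2, h3⟩ := h
  exact ⟨t, τ, h1, h2.trans hT, hQ τ h3⟩

theorem Runs.seq {P P' : Prog} {σ : State} {T T' : ℕ} {R Q : State → Prop}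
    (h : Runs P σ T R) (h' : ∀ τ, R τ → Runs P' τ T' Q) : Runs (.seq P P') σ (T + T') Q := by
  obtain ⟨t, τ, h1, h2, h3⟩ := h
  obtain ⟨u, ρ, k1, k2, k3⟩ := h' τ h3
  exact ⟨t + u, ρ, .seq h1 k1, by omega, k3⟩

theorem Runs.ite {b : Test} {P P' : Prog} {σ : State} {T : ℕ} {Q : State → Prop}
    (h : b.Holds σ → Runs P σ T Q) (h' : ¬ b.Holds σ → Runs P' σ T Q) :
    Runs (.ite b P P') σ (b.cost + 1 + T) Q := by
  by_cases hb : b.Holds σ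
  · obtain ⟨t, τ, h1, h2, h3⟩ := h hb
    exact ⟨_, τ, .iteTrue hb h1, by omega, h3⟩
  · obtain ⟨t, τ, h1, h2, h3⟩ := h' hb
    exact ⟨_, τ, .iteFalse hb h1, by omega, h3⟩

/-! ### Frames -/

/-- The natural-number registers that a program writes. -/
def Prog.wN : Prog → List ℕ
  | setNat r _ => [r]
  | seq P Q => P.wN ++ Q.wN
  | ite _ P Q => P.wN ++ Q.wN
  | .while _ P => P.wN
  | _ => []

/-- The real registers that a program writes. -/
def Prog.wR : Prog → List ℕ
  | setReal r _ => [r]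
  | seq P Q => P.wR ++ Q.wR
  | ite _ P Q => P.wR ++ Q.wR
  | .while _ P => P.wR
  | _ => []

/-- The natural-number arrays that a program writes. -/
def Prog.wNA : Prog → List ℕ
  | storeNat a _ _ => [a]
  | seq P Q => P.wNA ++ Q.wNA
  | ite _ P Q => P.wNA ++ Q.wNA
  | .while _ P => P.wNA
  | _ => []

/-- The real arrays that a program writes. -/
def Prog.wRA : Prog → List ℕ
  | storeReal a _ _ => [a]
  | seq P Q => P.wRA ++ Q.wRA
  | ite _ P Q => P.wRA ++ Q.wRA
  | .while _ P => P.wRA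
  | _ => []

/-- The states `σ` and `τ` agree on everything that `P` does not write. -/
structure Frame (P : Prog) (σ τ : State) : Prop where
  natReg : ∀ r, r ∉ P.wN → τ.natReg r = σ.natReg r
  realReg : ∀ r, r ∉ P.wR → τ.realReg r = σ.realReg r
  natArr : ∀ a, a ∉ P.wNA → τ.natArr a = σ.natArr a
  realArr : ∀ a, a ∉ P.wRA → τ.realArr a = σ.realArr a

theorem Frame.refl (P : Prog) (σ : State) : Frame P σ σ :=
  ⟨fun _ _ => rfl, fun _ _ => rfl, fun _ _ => rfl, fun _ _ => rfl⟩

theorem Frame.trans {P : Prog} {σ τ ρ : State} (h : Frame P σ τ) (h' : Frame P τ ρ) :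
    Frame P σ ρ :=
  ⟨fun r hr => (h'.1 r hr).trans (h.1 r hr), fun r hr => (h'.2 r hr).trans (h.2 r hr),
    fun r hr => (h'.3 r hr).trans (h.3 r hr), fun r hr => (h'.4 r hr).trans (h.4 r hr)⟩

theorem Frame.sub {P P' : Prog} {σ τ : State} (h : Frame P σ τ) (h1 : P.wN ⊆ P'.wN)
    (h2 : P.wR ⊆ P'.wR) (h3 : P.wNA ⊆ P'.wNA) (h4 : P.wRA ⊆ P'.wRA) : Frame P' σ τ :=
  ⟨fun r hr => h.1 r fun hh => hr (h1 hh), fun r hr => h.2 r fun hh => hr (h2 hh),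
    fun r hr => h.3 r fun hh => hr (h3 hh), fun r hr => h.4 r fun hh => hr (h4 hh)⟩

/-- The write lists are read off the program text, so a specification need only describe what its
program changes; that everything else survives becomes a membership question about short lists. -/
theorem Exec.frame {P : Prog} {σ τ : State} {t : ℕ} (h : Exec P σ t τ) : Frame P σ τ := by
  induction h with
  | skip σ => exact Frame.refl _ _
  | setNat σ r e =>
    refine ⟨fun r' hr => ?_, fun _ _ => rfl, fun _ _ => rfl, fun _ _ => rfl⟩
    simp only [Prog.wN, List.mem_singleton] at hr
    simp [State.setNat, hr]
  | setReal σ r e =>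
    refine ⟨fun _ _ => rfl, fun r' hr => ?_, fun _ _ => rfl, fun _ _ => rfl⟩
    simp only [Prog.wR, List.mem_singleton] at hr
    simp [State.setReal, hr]
  | storeNat σ a i e =>
    refine ⟨fun _ _ => rfl, fun _ _ => rfl, fun r' hr => ?_, fun _ _ => rfl⟩
    simp only [Prog.wNA, List.mem_singleton] at hr
    simp [State.storeNat, hr]
  | storeReal σ a i e =>
    refine ⟨fun _ _ => rfl, fun _ _ => rfl, fun _ _ => rfl, fun r' hr => ?_⟩
    simp only [Prog.wRA, List.mem_singleton] at hr
    simp [State.storeReal, hr]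
  | seq _ _ h1 h2 =>
    exact (h1.sub (List.subset_append_left _ _) (List.subset_append_left _ _)
      (List.subset_append_left _ _) (List.subset_append_left _ _)).trans
      (h2.sub (List.subset_append_right _ _) (List.subset_append_right _ _)
      (List.subset_append_right _ _) (List.subset_append_right _ _))
  | iteTrue _ _ h1 =>
    exact h1.sub (List.subset_append_left _ _) (List.subset_append_left _ _)
      (List.subset_append_left _ _) (List.subset_append_left _ _)
  | iteFalse _ _ h2 =>
    exact h2.sub (List.subset_append_right _ _) (List.subset_append_right _ _)
      (List.subset_append_right _ _) (List.subset_append_right _ _)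
  | whileTrue _ _ _ h1 h2 => exact Frame.trans ⟨h1.1, h1.2, h1.3, h1.4⟩ h2
  | whileFalse _ => exact Frame.refl _ _

theorem Runs.frame {P : Prog} {σ : State} {T : ℕ} {Q : State → Prop} (h : Runs P σ T Q) :
    Runs P σ T fun τ => Q τ ∧ Frame P σ τ := by
  obtain ⟨t, τ, h1, h2, h3⟩ := h
  exact ⟨t, τ, h1, h2, h3, h1.frame⟩

/-! ### Loops -/

/-- The rule behind the amortized bounds: `B` is a budget from which each pass pays for its own
body, whose time `T` may vary from pass to pass, and for one test. Each pass pays at least one unit,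
so the loop halts; the final failing test is paid separately. -/
theorem Runs.while_budget {b : Test} {P : Prog} {σ₀ : State} (I : State → Prop) (B : State → ℕ)
    (h : ∀ σ, Frame P σ₀ σ → I σ → b.Holds σ →
      ∃ T, Runs P σ T fun τ => I τ ∧ B τ + T + (b.cost + 1) ≤ B σ) (h0 : I σ₀) :
    Runs (.while b P) σ₀ (B σ₀ + (b.cost + 1))
      fun τ => I τ ∧ ¬ b.Holds τ ∧ Frame P σ₀ τ := by
  have key : ∀ k σ, B σ ≤ k → Frame P σ₀ σ → I σ → Runs (.while b P) σ (B σ + (b.cost + 1))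
      fun τ => I τ ∧ ¬ b.Holds τ ∧ Frame P σ₀ τ := by
    intro k
    induction k with
    | zero =>
      intro σ hk hF hI
      by_cases hb : b.Holds σ
      · obtain ⟨T, t, τ, _, _, _, h2⟩ := h σ hF hI hb
        omega
      · exact ⟨_, σ, .whileFalse hb, by omega, hI, hb, hF⟩
    | succ k ih =>
      intro σ hk hF hI
      by_cases hb : b.Holds σ
      · obtain ⟨T, t, τ, hE, hT, hI', h2⟩ := h σ hF hI hb
        obtain ⟨u, ρ, k1, k2, k3⟩ := ih τ (by omega) (hF.trans hE.frame) hI'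
        exact ⟨_, ρ, .whileTrue hb hE k1, by omega, k3⟩
      · exact ⟨_, σ, .whileFalse hb, by omega, hI, hb, hF⟩
  exact key _ σ₀ le_rfl (Frame.refl _ _) h0

theorem Runs.while_count {b : Test} {P : Prog} {σ₀ : State} (I : State → Prop) (m : State → ℕ)
    (T : ℕ) (h : ∀ σ, Frame P σ₀ σ → I σ → b.Holds σ →
      Runs P σ T fun τ => I τ ∧ m τ < m σ) (h0 : I σ₀) :
    Runs (.while b P) σ₀ (m σ₀ * (T + (b.cost + 1)) + (b.cost + 1))
      fun τ => I τ ∧ ¬ b.Holds τ ∧ Frame P σ₀ τ := by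
  refine Runs.while_budget I (fun σ => m σ * (T + (b.cost + 1))) (fun σ hF hI hb => ⟨T, ?_⟩) h0
  refine (h σ hF hI hb).mono le_rfl fun τ hτ => ⟨hτ.1, ?_⟩
  have := Nat.mul_le_mul_right (T + (b.cost + 1)) (Nat.succ_le_of_lt hτ.2)
  simp only [Nat.succ_mul] at this
  omega

theorem Runs.seq_of {P P' : Prog} {σ : State} {T T₁ T₂ : ℕ} {R Q : State → Prop}
    (h : Runs P σ T₁ R) (h' : ∀ τ, R τ → Frame P σ τ → Runs P' τ T₂ Q) (hT : T₁ + T₂ ≤ T) :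
    Runs (.seq P P') σ T Q :=
  (h.frame.seq fun τ hτ => h' τ hτ.1 hτ.2).mono hT fun _ h => h

theorem Runs.while_of {b : Test} {P : Prog} {σ₀ : State} {T : ℕ} {Q : State → Prop}
    (I : State → Prop) (m : State → ℕ) (T₁ : ℕ) (h0 : I σ₀)
    (h : ∀ σ, Frame P σ₀ σ → I σ → b.Holds σ → Runs P σ T₁ fun τ => I τ ∧ m τ < m σ)
    (hQ : ∀ τ, Frame P σ₀ τ → I τ → ¬ b.Holds τ → Q τ)
    (hT : m σ₀ * (T₁ + (b.cost + 1)) + (b.cost + 1) ≤ T) : Runs (.while b P) σ₀ T Q :=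
  (Runs.while_count I m T₁ h h0).mono hT fun τ hτ => hQ τ hτ.2.2 hτ.1 hτ.2.1

/-! ### Programs without loops -/

/-- Whether a program has no loops. -/
def Prog.isLine : Prog → Bool
  | seq P Q => P.isLine && Q.isLine
  | ite _ P Q => P.isLine && Q.isLine
  | .while _ _ => false
  | _ => true

open Classical in
/-- The effect of a program without loops. -/
noncomputable def Prog.run : Prog → State → State
  | skip, σ => σ
  | setNat r e, σ => σ.setNat r (e.eval σ)
  | setReal r e, σ => σ.setReal r (e.eval σ)
  | storeNat a i e, σ => σ.storeNat a (i.eval σ) (e.eval σ)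
  | storeReal a i e, σ => σ.storeReal a (i.eval σ) (e.eval σ)
  | seq P Q, σ => Q.run (P.run σ)
  | ite b P Q, σ => if b.Holds σ then P.run σ else Q.run σ
  | .while _ _, σ => σ

/-- A bound for the running time of a program without loops. -/
def Prog.maxCost : Prog → ℕ
  | skip => 1
  | setNat _ e => e.cost + 1
  | setReal _ e => e.cost + 1
  | storeNat _ i e => i.cost + e.cost + 1
  | storeReal _ i e => i.cost + e.cost + 1
  | seq P Q => P.maxCost + Q.maxCost
  | ite b P Q => b.cost + 1 + max P.maxCost Q.maxCost
  | .while _ _ => 0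

/-- A program without loops is a function on memories, so its specification splits into simplifying
`P.run σ` and bounding a number computed from the text. -/
theorem Runs.line {P : Prog} {σ : State} {T : ℕ} {Q : State → Prop} (h : P.isLine = true)
    (hT : P.maxCost ≤ T) (hQ : Q (P.run σ)) : Runs P σ T Q := by
  have key : ∀ (P : Prog) σ, P.isLine = true → ∃ t ≤ P.maxCost, Exec P σ t (P.run σ) := by
    intro P
    induction P with
    | skip => exact fun σ _ => ⟨_, le_rfl, .skip σ⟩
    | setNat r e => exact fun σ _ => ⟨_, le_rfl, .setNat σ r e⟩
    | setReal r e => exact fun σ _ => ⟨_, le_rfl, .setReal σ r e⟩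
    | storeNat a i e => exact fun σ _ => ⟨_, le_rfl, .storeNat σ a i e⟩
    | storeReal a i e => exact fun σ _ => ⟨_, le_rfl, .storeReal σ a i e⟩
    | seq P Q ih1 ih2 =>
      intro σ h
      simp only [Prog.isLine, Bool.and_eq_true] at h
      obtain ⟨t, h1, h2⟩ := ih1 σ h.1
      obtain ⟨u, k1, k2⟩ := ih2 (P.run σ) h.2
      exact ⟨t + u, Nat.add_le_add h1 k1, .seq h2 k2⟩
    | ite b P Q ih1 ih2 =>
      intro σ h
      simp only [Prog.isLine, Bool.and_eq_true] at h
      by_cases hb : b.Holds σ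
      · obtain ⟨t, h1, h2⟩ := ih1 σ h.1
        refine ⟨b.cost + 1 + t, ?_, ?_⟩
        · simp only [Prog.maxCost]; omega
        · simp only [Prog.run, if_pos hb]; exact .iteTrue hb h2
      · obtain ⟨t, h1, h2⟩ := ih2 σ h.2
        refine ⟨b.cost + 1 + t, ?_, ?_⟩
        · simp only [Prog.maxCost]; omega
        · simp only [Prog.run, if_neg hb]; exact .iteFalse hb h2
    | _ => exact fun σ h => by simp [Prog.isLine] at h
  obtain ⟨t, h1, h2⟩ := key P σ h
  exact ⟨t, _, h2, h1.trans hT, hQ⟩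

/-! ### Reading a memory after a write -/

@[simp] theorem setNat_natReg (σ : State) (r v r' : ℕ) :
    (σ.setNat r v).natReg r' = if r' = r then v else σ.natReg r' := by
  simp [State.setNat, Function.update_apply]
@[simp] theorem setNat_realReg (σ : State) (r v : ℕ) : (σ.setNat r v).realReg = σ.realReg := rfl
@[simp] theorem setNat_natArr (σ : State) (r v : ℕ) : (σ.setNat r v).natArr = σ.natArr := rfl
@[simp] theorem setNat_realArr (σ : State) (r v : ℕ) : (σ.setNat r v).realArr = σ.realArr := rfl
@[simp] theorem setReal_natReg (σ : State) (r : ℕ) (v : ℝ) :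
    (σ.setReal r v).natReg = σ.natReg := rfl
@[simp] theorem setReal_natArr (σ : State) (r : ℕ) (v : ℝ) :
    (σ.setReal r v).natArr = σ.natArr := rfl
@[simp] theorem storeNat_natReg (σ : State) (a i v : ℕ) :
    (σ.storeNat a i v).natReg = σ.natReg := rfl
@[simp] theorem storeNat_realReg (σ : State) (a i v : ℕ) :
    (σ.storeNat a i v).realReg = σ.realReg := rfl
@[simp] theorem storeNat_natArr (σ : State) (a i v a' : ℕ) :
    (σ.storeNat a i v).natArr a' = if a' = a then Function.update (σ.natArr a) i v
      else σ.natArr a' := by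
  simp [State.storeNat, Function.update_apply]
@[simp] theorem storeNat_realArr (σ : State) (a i v : ℕ) :
    (σ.storeNat a i v).realArr = σ.realArr := rfl
@[simp] theorem storeReal_natReg (σ : State) (a i : ℕ) (v : ℝ) :
    (σ.storeReal a i v).natReg = σ.natReg := rfl
@[simp] theorem storeReal_realReg (σ : State) (a i : ℕ) (v : ℝ) :
    (σ.storeReal a i v).realReg = σ.realReg := rfl
@[simp] theorem storeReal_natArr (σ : State) (a i : ℕ) (v : ℝ) :
    (σ.storeReal a i v).natArr = σ.natArr := rfl
@[simp] theorem storeReal_realArr (σ : State) (a i : ℕ) (v : ℝ) (a' : ℕ) :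
    (σ.storeReal a i v).realArr a' = if a' = a then Function.update (σ.realArr a) i v
      else σ.realArr a' := by
  simp [State.storeReal, Function.update_apply]

/-! ### Abbreviations for program texts -/

instance : Add NatExpr := ⟨.add⟩
instance : Sub NatExpr := ⟨.sub⟩

/-- A constant. -/
abbrev nat (c : ℕ) : NatExpr := .const c

/-- The content of a natural-number register. -/
abbrev reg (r : ℕ) : NatExpr := .reg r

/-- An entry of a natural-number array. -/
abbrev arr (a : ℕ) (e : NatExpr) : NatExpr := .arr a e

/-- The maximum of two natural numbers. -/
def emax (e f : NatExpr) : NatExpr := e + (f - e)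

/-- The minimum of two natural numbers. -/
def emin (e f : NatExpr) : NatExpr := e - (e - f)

/-- The comparison `e < f`. -/
abbrev lt (e f : NatExpr) : Test := .natLt e f

/-- The comparison `e ≤ f`. -/
abbrev le (e f : NatExpr) : Test := .not (.natLt f e)

/-- The assignment of a natural-number register. -/
abbrev set (r : ℕ) (e : NatExpr) : Prog := .setNat r e

infixr:60 " ;; " => Prog.seq

@[simp] theorem eval_add (σ : State) (e f : NatExpr) :
    (e + f).eval σ = e.eval σ + f.eval σ := rfl
@[simp] theorem eval_sub (σ : State) (e f : NatExpr) :
    (e - f).eval σ = e.eval σ - f.eval σ := rfl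
@[simp] theorem eval_const (σ : State) (c : ℕ) : (NatExpr.const c).eval σ = c := rfl
@[simp] theorem eval_reg (σ : State) (r : ℕ) : (NatExpr.reg r).eval σ = σ.natReg r := rfl
@[simp] theorem eval_arr (σ : State) (a : ℕ) (e : NatExpr) :
    (NatExpr.arr a e).eval σ = σ.natArr a (e.eval σ) := rfl
@[simp] theorem eval_emax (σ : State) (e f : NatExpr) :
    (emax e f).eval σ = max (e.eval σ) (f.eval σ) := by
  simp only [emax, eval_add, eval_sub]; omega
@[simp] theorem eval_emin (σ : State) (e f : NatExpr) :
    (emin e f).eval σ = min (e.eval σ) (f.eval σ) := by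
  simp only [emin, eval_sub]; omega

@[simp] theorem holds_lt (σ : State) (e f : NatExpr) :
    (Test.natLt e f).Holds σ ↔ e.eval σ < f.eval σ := Iff.rfl
@[simp] theorem holds_not (σ : State) (b : Test) : (Test.not b).Holds σ ↔ ¬ b.Holds σ := Iff.rfl
@[simp] theorem holds_and (σ : State) (b c : Test) :
    (Test.and b c).Holds σ ↔ b.Holds σ ∧ c.Holds σ := Iff.rfl
@[simp] theorem holds_realLt (σ : State) (e f : RealExpr) :
    (Test.realLt e f).Holds σ ↔ e.eval σ < f.eval σ := Iff.rfl

@[simp] theorem cost_add (e f : NatExpr) : (e + f).cost = e.cost + f.cost + 1 := rfl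
@[simp] theorem cost_sub (e f : NatExpr) : (e - f).cost = e.cost + f.cost + 1 := rfl

@[simp] theorem Prog.run_seq (P Q : Prog) (σ : State) :
    (Prog.seq P Q).run σ = Q.run (P.run σ) := rfl
@[simp] theorem Prog.run_setNat (r : ℕ) (e : NatExpr) (σ : State) :
    (Prog.setNat r e).run σ = σ.setNat r (e.eval σ) := rfl
@[simp] theorem Prog.run_storeNat (a : ℕ) (i e : NatExpr) (σ : State) :
    (Prog.storeNat a i e).run σ = σ.storeNat a (i.eval σ) (e.eval σ) := rfl
@[simp] theorem Prog.run_storeReal (a : ℕ) (i : NatExpr) (e : RealExpr) (σ : State) :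
    (Prog.storeReal a i e).run σ = σ.storeReal a (i.eval σ) (e.eval σ) := rfl
@[simp] theorem Prog.run_skip (σ : State) : Prog.skip.run σ = σ := rfl
open Classical in
@[simp] theorem Prog.run_ite (b : Test) (P Q : Prog) (σ : State) :
    (Prog.ite b P Q).run σ = if b.Holds σ then P.run σ else Q.run σ := rfl

end RealRAM


/-! ### Complete binary trees in heap order

The nodes of the tree of depth `K` are `1, …, 2 ^ (K + 1) - 1`; the children of `v` are `2 v` and
`2 v + 1`, and the leaves are `2 ^ K, …, 2 ^ (K + 1) - 1`. -/

namespace HeapTree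

/-- `v` is a node at height `m` above the leaves. -/
def Lvl (K m v : ℕ) : Prop := m ≤ K ∧ 2 ^ (K - m) ≤ v ∧ v < 2 ^ (K - m + 1)

theorem lvl_leaf {K p : ℕ} : Lvl K 0 p ↔ 2 ^ K ≤ p ∧ p < 2 ^ (K + 1) := by simp [Lvl]

theorem Lvl.div {K m v : ℕ} (h : Lvl K m v) (hm : m < K) : Lvl K (m + 1) (v / 2) := by
  obtain ⟨_, h1, h2⟩ := h
  obtain ⟨j, rfl⟩ : ∃ j, K = m + 1 + j := ⟨K - (m + 1), by omega⟩
  have e1 : m + 1 + j - m = j + 1 := by omega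
  have e2 : m + 1 + j - (m + 1) = j := by omega
  rw [e1] at h1 h2
  refine ⟨by omega, ?_, ?_⟩ <;> rw [e2] <;> rw [pow_succ] at * <;> omega

theorem Lvl.child {K m v c : ℕ} (h : Lvl K (m + 1) v) (hc : c / 2 = v) : Lvl K m c := by
  obtain ⟨h0, h1, h2⟩ := h
  obtain ⟨j, rfl⟩ : ∃ j, K = m + 1 + j := ⟨K - (m + 1), by omega⟩
  have e1 : m + 1 + j - m = j + 1 := by omega
  have e2 : m + 1 + j - (m + 1) = j := by omega
  rw [e2] at h1 h2
  refine ⟨by omega, ?_, ?_⟩ <;> rw [e1] <;> rw [pow_succ] at * <;> omega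

theorem div_two_pow_succ (p m : ℕ) : p / 2 ^ (m + 1) = p / 2 ^ m / 2 := by
  rw [pow_succ, Nat.div_div_eq_div_mul]

theorem Lvl.anc {K p m : ℕ} (h : Lvl K 0 p) (hm : m ≤ K) : Lvl K m (p / 2 ^ m) := by
  induction m with
  | zero => simpa using h
  | succ m ih => rw [div_two_pow_succ]; exact (ih (by omega)).div (by omega)

theorem Lvl.pos {K m v : ℕ} (h : Lvl K m v) : 0 < v :=
  lt_of_lt_of_le (by positivity) h.2.1

theorem Lvl.lt {K m v : ℕ} (h : Lvl K m v) : v < 2 ^ (K + 1) :=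
  h.2.2.trans_le (Nat.pow_le_pow_right (by norm_num) (by omega))

theorem Lvl.lt_size {K m v : ℕ} (h : Lvl K (m + 1) v) : v < 2 ^ K :=
  h.2.2.trans_le (Nat.pow_le_pow_right (by norm_num) (by have := h.1; omega))

theorem Lvl.zero_of_size_le {K m v : ℕ} (h : Lvl K m v) (hv : 2 ^ K ≤ v) : m = 0 := by
  cases m with
  | zero => rfl
  | succ m => have := h.lt_size; omega

theorem Lvl.succ_of_lt_size {K m v : ℕ} (h : Lvl K m v) (hv : v < 2 ^ K) : ∃ k, m = k + 1 := by
  cases m with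
  | zero => have := (lvl_leaf.1 h).1; omega
  | succ m => exact ⟨m, rfl⟩

theorem Lvl.unique {K m m' v : ℕ} (h : Lvl K m v) (h' : Lvl K m' v) : m = m' := by
  obtain ⟨a, b, c⟩ := h
  obtain ⟨a', b', c'⟩ := h'
  have h1 : K - m < K - m' + 1 := (Nat.pow_lt_pow_iff_right (by norm_num : 1 < 2)).1 (b.trans_lt c')
  have h2 : K - m' < K - m + 1 := (Nat.pow_lt_pow_iff_right (by norm_num : 1 < 2)).1 (b'.trans_lt c)
  omega

theorem lvl_root (K : ℕ) : Lvl K K 1 := by simp [Lvl]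

theorem Lvl.eq_one {K v : ℕ} (h : Lvl K K v) : v = 1 := by
  obtain ⟨_, h1, h2⟩ := h
  simp at h1 h2
  omega

/-- The maximum of `tag` over the ancestors of `p` of height at most `m`. -/
def pathMax (tag : ℕ → ℕ) (p : ℕ) : ℕ → ℕ
  | 0 => tag p
  | m + 1 => max (pathMax tag p m) (tag (p / 2 ^ (m + 1)))

theorem pathMax_le {tag : ℕ → ℕ} {p m x : ℕ} :
    pathMax tag p m ≤ x ↔ ∀ j ≤ m, tag (p / 2 ^ j) ≤ x := by
  induction m with
  | zero => simp [pathMax]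
  | succ m ih =>
    simp only [pathMax, max_le_iff, ih]
    constructor
    · rintro ⟨h1, h2⟩ j hj
      rcases Nat.lt_or_ge m j with h | h
      · obtain rfl : j = m + 1 := by omega
        exact h2
      · exact h1 j h
    · exact fun h => ⟨fun j hj => h j (by omega), h _ le_rfl⟩

/-- `mn` and `mx` hold, for each node, the least and the greatest value of `pathMax` over the
leaves below it; this is expressed by recursion from the leaves. -/
structure AggAt (K : ℕ) (tag mn mx : ℕ → ℕ) (v : ℕ) : Prop where
  leaf : 2 ^ K ≤ v → mn v = tag v ∧ mx v = tag v
  node : v < 2 ^ K → mn v = max (tag v) (min (mn (v + v)) (mn (v + v + 1))) ∧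
    mx v = max (tag v) (max (mx (v + v)) (mx (v + v + 1)))

/-- `AggAt` at all nodes. -/
def Agg (K : ℕ) (tag mn mx : ℕ → ℕ) : Prop :=
  ∀ v, 0 < v → v < 2 ^ (K + 1) → AggAt K tag mn mx v

/-- Induction from the leaves: taking the maximum with the tag of `v` is monotone, so it commutes
with the minimum and the maximum over the two children. Attainment is recorded because the search
must conclude from a violated aggregate that there is a violating leaf. -/
theorem Agg.spec {K : ℕ} {tag mn mx : ℕ → ℕ} (h : Agg K tag mn mx) {m v : ℕ} (hv : Lvl K m v) :
    ((∀ p, p / 2 ^ m = v → mn v ≤ pathMax tag p m) ∧ ∃ p, p / 2 ^ m = v ∧ pathMax tag p m = mn v) ∧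
    ((∀ p, p / 2 ^ m = v → pathMax tag p m ≤ mx v) ∧
      ∃ p, p / 2 ^ m = v ∧ pathMax tag p m = mx v) := by
  induction m generalizing v with
  | zero =>
    have := (h v hv.pos hv.lt).leaf (lvl_leaf.1 hv).1
    simp [pathMax, this.1, this.2]
  | succ m ih =>
    obtain ⟨e1, e2⟩ := (h v hv.pos hv.lt).node hv.lt_size
    obtain ⟨⟨a1, pa, a2, a3⟩, b1, pb, b2, b3⟩ := ih (hv.child (c := v + v) (by omega))
    obtain ⟨⟨c1, pc, c2, c3⟩, d1, pd, d2, d3⟩ := ih (hv.child (c := v + v + 1) (by omega))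
    have step : ∀ p, p / 2 ^ (m + 1) = v → p / 2 ^ m = v + v ∨ p / 2 ^ m = v + v + 1 := by
      intro p hp
      rw [div_two_pow_succ] at hp
      omega
    have up : ∀ p, p / 2 ^ m = v + v ∨ p / 2 ^ m = v + v + 1 → p / 2 ^ (m + 1) = v := by
      intro p hp
      rw [div_two_pow_succ]
      omega
    refine ⟨⟨fun p hp => ?_, ?_⟩, fun p hp => ?_, ?_⟩
    · rw [pathMax, hp, e1]
      rcases step p hp with h | h
      · have := a1 p h; omega
      · have := c1 p h; omega
    · rcases le_total (mn (v + v)) (mn (v + v + 1)) with hh | hh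
      · refine ⟨pa, up _ (.inl a2), ?_⟩
        rw [pathMax, up _ (.inl a2), e1]; omega
      · refine ⟨pc, up _ (.inr c2), ?_⟩
        rw [pathMax, up _ (.inr c2), e1]; omega
    · rw [pathMax, hp, e2]
      rcases step p hp with h | h
      · have := b1 p h; omega
      · have := d1 p h; omega
    · rcases le_total (mx (v + v)) (mx (v + v + 1)) with hh | hh
      · refine ⟨pd, up _ (.inr d2), ?_⟩
        rw [pathMax, up _ (.inr d2), e2]; omega
      · refine ⟨pb, up _ (.inl b2), ?_⟩
        rw [pathMax, up _ (.inl b2), e2]; omega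

/-- `v` is one of the maximal nodes whose leaves all lie strictly between the leaves `l` and `r`. -/
def Acted (K l r v : ℕ) : Prop :=
  ∃ m ≤ K, Lvl K m v ∧ l / 2 ^ m < v ∧ v < r / 2 ^ m ∧
    ¬ (l / 2 ^ (m + 1) < v / 2 ∧ v / 2 < r / 2 ^ (m + 1))

/-- If `l < p < r`, the ancestors of `p` lie strictly between those of `l` and `r` at height `0`,
whereas at the root all three coincide; the last height at which the strict inequalities hold gives
a maximal node above `p`. The converse is monotonicity of division. -/
theorem exists_acted_iff {K l r p : ℕ} (hl : Lvl K 0 l) (hp : Lvl K 0 p) :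
    (∃ m ≤ K, Acted K l r (p / 2 ^ m)) ↔ l < p ∧ p < r := by
  constructor
  · rintro ⟨m, hm, m', hm', h1, h2, h3, -⟩
    obtain rfl : m = m' := (hp.anc hm).unique h1
    exact ⟨lt_of_not_ge fun h => absurd (Nat.div_le_div_right (c := 2 ^ m) h) (by omega),
      lt_of_not_ge fun h => absurd (Nat.div_le_div_right (c := 2 ^ m) h) (by omega)⟩
  · intro h
    by_contra hcon
    have key : ∀ m ≤ K, l / 2 ^ m < p / 2 ^ m ∧ p / 2 ^ m < r / 2 ^ m := by
      intro m
      induction m with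
      | zero => simpa using h
      | succ m ih =>
        intro hm
        by_contra hc
        obtain ⟨i1, i2⟩ := ih (by omega)
        rw [div_two_pow_succ p] at hc
        exact hcon ⟨m, by omega, m, by omega, hp.anc (by omega), i1, i2, hc⟩
    have := key K le_rfl
    rw [(hl.anc le_rfl).eq_one, (hp.anc le_rfl).eq_one] at this
    omega

open Classical in
/-- The tag of a node after the updates `S`: update `j` raises everything strictly between the
leaves `l j` and `r j` to at least `a j`. -/
noncomputable def tagOf {ι : Type*} (K : ℕ) (S : Finset ι) (l r a : ι → ℕ) (v : ℕ) : ℕ :=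
  S.sup fun j => if Acted K (l j) (r j) v then a j else 0

/-- Tags are never pushed down: a leaf reads the maximum over its ancestors, and by
`exists_acted_iff` an update marks an ancestor of exactly the leaves strictly between its ends. -/
theorem pathMax_tagOf {ι : Type*} {K : ℕ} {S : Finset ι} {l r a : ι → ℕ}
    (hl : ∀ j ∈ S, Lvl K 0 (l j)) {p : ℕ} (hp : Lvl K 0 p) :
    pathMax (tagOf K S l r a) p K = S.sup fun j => if l j < p ∧ p < r j then a j else 0 := by
  refine eq_of_forall_ge_iff fun x => ?_
  simp only [pathMax_le, tagOf, Finset.sup_le_iff]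
  constructor
  · intro h j hj
    split_ifs with hc
    · obtain ⟨m, hm, ha⟩ := (exists_acted_iff (hl j hj) hp).2 hc
      simpa [ha] using h m hm j hj
    · exact Nat.zero_le _
  · intro h m hm j hj
    split_ifs with hc
    · simpa [(exists_acted_iff (hl j hj) hp).1 ⟨m, hm, hc⟩] using h j hj
    · exact Nat.zero_le _

theorem tagOf_insert {ι : Type*} [DecidableEq ι] {K : ℕ} {S : Finset ι} {l r a : ι → ℕ} {i : ι}
    (v : ℕ) [Decidable (Acted K (l i) (r i) v)] :
    tagOf K (insert i S) l r a v =
      if Acted K (l i) (r i) v then max (tagOf K S l r a v) (a i) else tagOf K S l r a v := by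
  simp only [tagOf, Finset.sup_insert]
  split_ifs <;> simp [max_comm]

end HeapTree


namespace RealRAM
open HeapTree

/-! ### Setting up the tree -/

/-- Copies the number of cubes to register `1`, its double to register `2`, and clears
register `0`. -/
def countProg : Prog := set 1 (reg 0) ;; set 2 (reg 1 + reg 1) ;; set 0 (nat 0) ;; set 3 (nat 1)

/-- Doubles register `3` until it is large enough. -/
def sizeProg : Prog :=
  .while (lt (reg 3) (reg 2 + reg 2 + reg 2 + reg 2 + nat 2)) (set 3 (reg 3 + reg 3))

/-- Stores in array `6` the parent of each node. -/
def parProg : Prog :=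
  set 35 (nat 1) ;; .while (lt (reg 35) (reg 3))
    (.storeNat 6 (reg 35 + reg 35) (reg 35) ;; .storeNat 6 (reg 35 + reg 35 + nat 1) (reg 35) ;;
      set 35 (reg 35 + nat 1))

/-- Stores in array `7` the first leaf below each node. -/
def firstProg : Prog :=
  set 35 (reg 3 + reg 3) ;; .while (lt (nat 1) (reg 35))
    (set 35 (reg 35 - nat 1) ;;
      .ite (lt (reg 35) (reg 3)) (.storeNat 7 (reg 35) (arr 7 (reg 35 + reg 35)))
        (.storeNat 7 (reg 35) (reg 35)))

/-- The tree of depth `K` has been set up. -/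
structure TreeAt (K : ℕ) (σ : State) : Prop where
  size : σ.natReg 3 = 2 ^ K
  par : ∀ v < 2 ^ (K + 1), σ.natArr 6 v = v / 2
  first : ∀ m v, Lvl K m v → σ.natArr 7 v = v * 2 ^ m

theorem runs_countProg (σ : State) (n : ℕ) (h : σ.natReg 0 = n) :
    Runs countProg σ 12 fun τ => τ.natReg 0 = 0 ∧ τ.natReg 1 = n ∧ τ.natReg 2 = 2 * n ∧
      τ.natReg 3 = 1 := by
  refine Runs.line rfl (by decide) ?_
  simp [countProg, h]
  omega

/-- It is applied with `N = 2 n`, which gives at least `8 n + 2` leaves: one for each of the `8 n`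
row records, and spare ones because an update concerns the leaves strictly between two others. The
upper bound keeps the tree linear in `n`. -/
theorem runs_sizeProg (σ : State) (N : ℕ) (h : σ.natReg 2 = N) (h3 : σ.natReg 3 = 1) :
    Runs sizeProg σ (80 * (N + 1)) fun τ => ∃ K, τ.natReg 3 = 2 ^ K ∧ 4 * N + 2 ≤ 2 ^ K ∧
      2 ^ K < 2 * (4 * N + 2) := by
  refine Runs.while_of (fun σ => σ.natReg 2 = N ∧ ∃ K, σ.natReg 3 = 2 ^ K ∧
    2 ^ K < 2 * (4 * N + 2)) (fun σ => 4 * N + 2 - σ.natReg 3) 4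
    ⟨h, 0, by simpa using h3, by simp; omega⟩ ?_ ?_ ?_
  · rintro τ - ⟨h2, K, hK, hlt⟩ hb
    refine Runs.line rfl (by decide) ?_
    simp [h2, hK] at hb ⊢
    have := Nat.pos_of_ne_zero (pow_ne_zero K (two_ne_zero (α := ℕ)))
    exact ⟨⟨K + 1, by ring, by rw [pow_succ]; omega⟩, by omega⟩
  · rintro τ - ⟨h2, K, hK, hlt⟩ hb
    refine ⟨K, hK, ?_, hlt⟩
    simp [h2, hK] at hb
    omega
  · rw [h3]; simp [Test.cost, NatExpr.cost]; omega

/-- The machine cannot halve natural numbers, so each node is recorded once and for all as the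
parent of its two children. -/
theorem runs_parProg (σ : State) (K : ℕ) (h : σ.natReg 3 = 2 ^ K) (h6 : ∀ v, σ.natArr 6 v = 0) :
    Runs parProg σ (30 * 2 ^ K) fun τ => ∀ v < 2 ^ (K + 1), τ.natArr 6 v = v / 2 := by
  have hp := Nat.pos_of_ne_zero (pow_ne_zero K (two_ne_zero (α := ℕ)))
  refine Runs.seq_of (T₁ := 2) (T₂ := 30 * 2 ^ K - 2) (R := fun τ => τ.natReg 35 = 1)
    (Runs.line rfl (by decide) (by simp)) (fun τ h35 hF => ?_) (by omega)
  have h3 : τ.natReg 3 = 2 ^ K := (hF.natReg 3 (by decide)).trans h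
  have h6' : ∀ v, τ.natArr 6 v = 0 := fun v => by rw [hF.natArr 6 (by decide), h6]
  refine Runs.while_of (fun σ => σ.natReg 3 = 2 ^ K ∧ 0 < σ.natReg 35 ∧
      ∀ v < 2 * σ.natReg 35, σ.natArr 6 v = v / 2) (fun σ => 2 ^ K - σ.natReg 35) 18
    -- Entries `0` and `1` are never written; they rely on the memory being zero initially.
    ⟨h3, by omega, fun v hv => by rw [h6']; omega⟩ ?_ ?_ ?_
  · rintro ρ - ⟨a, b, c⟩ hb
    refine Runs.line rfl (by decide) ?_
    simp [a] at hb ⊢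
    refine ⟨fun v hv => ?_, by omega⟩
    simp only [Function.update_apply]
    split_ifs with e1 e2
    · omega
    · omega
    · exact c v (by omega)
  · rintro ρ - ⟨a, b, c⟩ hb v hv
    simp [a] at hb
    exact c v (by rw [pow_succ] at hv; omega)
  · simp [Test.cost, NatExpr.cost, h35]
    omega

/-- Nodes are visited in decreasing order, so the entry of the left child is already there. The
table replaces the multiplication `v * 2 ^ m`; with it a search can tell in which of two subtrees a
given leaf lies. -/
theorem runs_firstProg (σ : State) (K : ℕ) (h : σ.natReg 3 = 2 ^ K) :
    Runs firstProg σ (60 * 2 ^ K) fun τ => ∀ m v, Lvl K m v → τ.natArr 7 v = v * 2 ^ m := by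
  have hp := Nat.pos_of_ne_zero (pow_ne_zero K (two_ne_zero (α := ℕ)))
  refine Runs.seq_of (T₁ := 4) (T₂ := 60 * 2 ^ K - 4) (R := fun τ => τ.natReg 35 = 2 ^ (K + 1))
    (Runs.line rfl (by decide) (by simp [h, pow_succ]; omega)) (fun τ h35 hF => ?_) (by omega)
  have h3 : τ.natReg 3 = 2 ^ K := (hF.natReg 3 (by decide)).trans h
  refine Runs.while_of (fun σ => σ.natReg 3 = 2 ^ K ∧ 0 < σ.natReg 35 ∧
      σ.natReg 35 ≤ 2 ^ (K + 1) ∧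
      ∀ m v, σ.natReg 35 ≤ v → Lvl K m v → σ.natArr 7 v = v * 2 ^ m)
    (fun σ => σ.natReg 35 - 1) 24
    ⟨h3, by rw [h35]; positivity, h35.le, fun m v hv hl => by
      have := hl.lt; omega⟩ ?_ ?_ ?_
  · rintro ρ - ⟨a, b, c, d⟩ hb
    refine Runs.line rfl (by decide) ?_
    simp [a] at hb ⊢
    split_ifs with hlt
    · simp [a]
      refine ⟨⟨by omega, by omega, fun m v hv hl => ?_⟩, by omega⟩
      simp only [Function.update_apply]
      split_ifs with e
      · subst e
        obtain ⟨k, rfl⟩ := hl.succ_of_lt_size (by omega)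
        rw [d k _ (by omega) (hl.child (by omega)), pow_succ]
        ring
      · exact d m v (by omega) hl
    · simp [a]
      refine ⟨⟨by omega, by omega, fun m v hv hl => ?_⟩, by omega⟩
      simp only [Function.update_apply]
      split_ifs with e
      · subst e
        rw [hl.zero_of_size_le (by omega)]
        simp
      · exact d m v (by omega) hl
  · rintro ρ - ⟨a, b, c, d⟩ hb m v hl
    simp at hb
    exact d m v (by have := hl.pos; omega) hl
  · simp [Test.cost, NatExpr.cost, h35, pow_succ]
    omega

/-- Reads the number of cubes and sets up the tree. -/
def treeProg : Prog := countProg ;; sizeProg ;; parProg ;; firstProg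

theorem runs_treeProg (σ : State) (n : ℕ) (h : σ.natReg 0 = n) (h6 : ∀ v, σ.natArr 6 v = 0) :
    Runs treeProg σ (3000 * (n + 1)) fun τ => ∃ K, TreeAt K τ ∧ 8 * n + 2 ≤ 2 ^ K ∧
      2 ^ K < 2 * (8 * n + 2) ∧ τ.natReg 0 = 0 ∧ τ.natReg 1 = n ∧ τ.natReg 2 = 2 * n := by
  refine Runs.seq_of (T₂ := 3000 * (n + 1) - 12) (runs_countProg σ n h)
    (fun τ ⟨a0, a1, a2, a3⟩ hF => ?_) (by omega)
  refine Runs.seq_of (T₂ := 2800 * (n + 1)) (runs_sizeProg τ _ a2 a3)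
    (fun τ' ⟨K, b1, b2, b3⟩ hF' => ?_) (by omega)
  refine Runs.seq_of (T₂ := 60 * 2 ^ K) (runs_parProg τ' K b1 fun v => by
      rw [hF'.natArr 6 (by decide), hF.natArr 6 (by decide), h6])
    (fun ρ c hG => ?_) (by omega)
  refine (runs_firstProg ρ K ?_).frame.mono le_rfl fun ρ' ⟨d, hG'⟩ => ⟨K, ⟨?_, ?_, d⟩, by omega,
    by omega, ?_, ?_, ?_⟩
  · rw [hG.natReg 3 (by decide), b1]
  · rw [hG'.natReg 3 (by decide), hG.natReg 3 (by decide), b1]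
  · rwa [hG'.natArr 6 (by decide)]
  · rw [hG'.natReg _ (by decide), hG.natReg _ (by decide), hF'.natReg _ (by decide), a0]
  · rw [hG'.natReg _ (by decide), hG.natReg _ (by decide), hF'.natReg _ (by decide), a1]
  · rw [hG'.natReg _ (by decide), hG.natReg _ (by decide), hF'.natReg _ (by decide), a2]

end RealRAM


namespace RealRAM
open HeapTree

/-! ### Climbing towards the root -/

/-- Moves register `r` from a node to the root and executes `pull` at each node on the way. -/
def climbProg (r : ℕ) (pull : Prog) : Prog :=
  .while (lt (nat 1) (reg r)) (set r (arr 6 (reg r)) ;; pull)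

/-- `W σ u` says that node `u` is up to date; executing `pull` at `u` brings `u` up to date and
can spoil only the parent of `u`. Then climbing repairs all proper ancestors of a node. -/
theorem runs_climbProg {r : ℕ} {pull : Prog} {K Tp T : ℕ} {σ : State} (W : State → ℕ → Prop)
    (I : State → Prop) (X : ℕ → Prop)
    (hpull : ∀ ρ v, I ρ → ρ.natReg r = v → 0 < v → v < 2 ^ K → Runs pull ρ Tp fun τ => I τ ∧
      τ.natReg r = v ∧ W τ v ∧ ∀ u, u ≠ v → u ≠ v / 2 → W ρ u → W τ u)
    (hset : ∀ ρ v, I ρ → I (ρ.setNat r v))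
    (hW : ∀ ρ u v, W ρ u → W (ρ.setNat r v) u)
    (hpar : ∀ ρ, I ρ → ∀ v < 2 ^ (K + 1), ρ.natArr 6 v = v / 2)
    (hI : I σ) (h0 : 0 < σ.natReg r) (h1 : σ.natReg r < 2 ^ (K + 1))
    (hσ : ∀ u, 0 < u → ¬ X u → (∀ j, u ≠ σ.natReg r / 2 ^ (j + 1)) → W σ u)
    (hT : K * (Tp + 7) + 4 ≤ T) :
    Runs (climbProg r pull) σ T fun τ => I τ ∧ ∀ u, 0 < u → ¬ X u → W τ u := by
  -- Outside `X`, only the proper ancestors of the current node may be out of date. `X` exempts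
  -- nodes that a later climb from another leaf will repair. The measure is the depth of the current
  -- node.
  refine Runs.while_of (fun ρ => I ρ ∧ 0 < ρ.natReg r ∧ ρ.natReg r < 2 ^ (K + 1) ∧
    ∀ u, 0 < u → ¬ X u → (∀ j, u ≠ ρ.natReg r / 2 ^ (j + 1)) → W ρ u)
    (fun ρ => Nat.log 2 (ρ.natReg r)) (3 + Tp) ⟨hI, h0, h1, hσ⟩ ?_ ?_ ?_
  · rintro ρ - ⟨a, b, c, d⟩ hb
    simp at hb
    have h2 := hpar ρ a _ c
    refine Runs.seq_of (T₁ := 3) (R := fun τ => τ = ρ.setNat r (ρ.natReg r / 2))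
      (Runs.line rfl le_rfl (by simp [h2])) (fun τ hτ _ => ?_) le_rfl
    have hlt : ρ.natReg r / 2 < 2 ^ K := by rw [pow_succ] at c; omega
    refine (hpull τ (ρ.natReg r / 2) (by rw [hτ]; exact hset _ _ a) (by simp [hτ]) (by omega)
      hlt).mono le_rfl ?_
    rintro τ' ⟨i1, i2, i3, i4⟩
    refine ⟨⟨i1, by omega, ?_, fun u hu hX hj => ?_⟩, ?_⟩
    · rw [i2, pow_succ]; omega
    · rw [i2] at hj
      by_cases hv : u = ρ.natReg r / 2
      · rw [hv]; exact i3
      · refine i4 u hv (by simpa using hj 0) (hτ ▸ hW _ _ _ (d u hu hX fun j hjj => ?_))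
        cases j with
        | zero => exact hv (by simpa using hjj)
        | succ j =>
          refine hj j ?_
          rw [Nat.div_div_eq_div_mul, ← pow_succ', hjj]
    · rw [i2, Nat.log_div_base]
      have := Nat.log_pos (b := 2) (by norm_num) (show 2 ≤ ρ.natReg r by omega)
      omega
  · rintro ρ - ⟨a, b, c, d⟩ hb
    simp at hb
    refine ⟨a, fun u hu hX => d u hu hX fun j hj => ?_⟩
    have : ρ.natReg r = 1 := by omega
    rw [this] at hj
    have : 1 / 2 ^ (j + 1) = 0 := Nat.div_eq_of_lt (by simp)
    omega
  · have : Nat.log 2 (σ.natReg r) ≤ K := by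
      have := Nat.log_lt_of_lt_pow h0.ne' h1
      omega
    have := Nat.mul_le_mul_right (3 + Tp + 4) this
    simp only [Test.cost, NatExpr.cost]
    have e : 3 + Tp + 4 = Tp + 7 := by omega
    rw [e] at this
    refine le_trans ?_ hT
    have e' : 3 + Tp + (1 + 1 + 1 + 1) = Tp + 7 := by omega
    rw [e']
    omega

/-! ### Tournament sort -/

section sort
variable {α : Type*} [LinearOrder α]

/-- The winner of two players; `0` is no player, and `i + 1` stands for `i`. -/
def winner (key : ℕ → α) (a b : ℕ) : ℕ :=
  if a = 0 then b else if b = 0 then a else if key (b - 1) < key (a - 1) then b else a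

/-- The winner stored at `v` is up to date, where the active players are those in `A`. -/
def WinAt (K : ℕ) (key : ℕ → α) (A : Finset ℕ) (win : ℕ → ℕ) (v : ℕ) : Prop :=
  (2 ^ K ≤ v → v < 2 ^ (K + 1) → win v = if v - 2 ^ K ∈ A then v - 2 ^ K + 1 else 0) ∧
    (v < 2 ^ K → win v = winner key (win (v + v)) (win (v + v + 1)))

/-- The sorting order: by key, then by number. -/
def lexKey (key : ℕ → α) (i : ℕ) : α ×ₗ ℕ := toLex (key i, i)

theorem winAt_spec {K : ℕ} {key : ℕ → α} {A : Finset ℕ} {win : ℕ → ℕ}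
    (h : ∀ v, 0 < v → WinAt K key A win v) {m v : ℕ} (hv : Lvl K m v) :
    (win v = 0 → ∀ i ∈ A, (2 ^ K + i) / 2 ^ m ≠ v) ∧
    (win v ≠ 0 → win v - 1 ∈ A ∧ (2 ^ K + (win v - 1)) / 2 ^ m = v ∧
      ∀ i ∈ A, (2 ^ K + i) / 2 ^ m = v → lexKey key (win v - 1) ≤ lexKey key i) := by
  induction m generalizing v with
  | zero =>
    have hl := lvl_leaf.1 hv
    have := (h v hv.pos).1 hl.1 hl.2
    simp only [pow_zero, Nat.div_one]
    by_cases hA : v - 2 ^ K ∈ A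
    · rw [if_pos hA] at this
      rw [this, Nat.add_sub_cancel]
      refine ⟨fun h => absurd h (by omega), fun _ => ⟨hA, by omega, fun i hi hiv => ?_⟩⟩
      obtain rfl : i = v - 2 ^ K := by omega
      simp
    · rw [if_neg hA] at this
      refine ⟨fun _ i hi hiv => hA ?_, fun h => absurd this h⟩
      obtain rfl : i = v - 2 ^ K := by omega
      exact hi
  | succ m ih =>
    have e := (h v hv.pos).2 hv.lt_size
    obtain ⟨a0, a1⟩ := ih (hv.child (c := v + v) (by omega))
    obtain ⟨b0, b1⟩ := ih (hv.child (c := v + v + 1) (by omega))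
    have step : ∀ i, (2 ^ K + i) / 2 ^ (m + 1) = v ↔
        ((2 ^ K + i) / 2 ^ m = v + v ∨ (2 ^ K + i) / 2 ^ m = v + v + 1) := by
      intro i
      rw [div_two_pow_succ]
      omega
    simp only [ne_eq, step, not_or]
    rw [e, winner]
    by_cases ha : win (v + v) = 0
    · rw [if_pos ha]
      refine ⟨fun hb i hi => ⟨a0 ha i hi, b0 hb i hi⟩, fun hb => ?_⟩
      obtain ⟨c1, c2, c3⟩ := b1 hb
      refine ⟨c1, .inr c2, fun i hi hiv => c3 i hi (hiv.resolve_left (a0 ha i hi))⟩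
    · rw [if_neg ha]
      obtain ⟨c1, c2, c3⟩ := a1 ha
      by_cases hb : win (v + v + 1) = 0
      · rw [if_pos hb]
        exact ⟨fun h => absurd h ha, fun _ => ⟨c1, .inl c2, fun i hi hiv =>
          c3 i hi (hiv.resolve_right (b0 hb i hi))⟩⟩
      · rw [if_neg hb]
        obtain ⟨d1, d2, d3⟩ := b1 hb
        split_ifs with hlt
        · refine ⟨fun h => absurd h hb, fun _ => ⟨d1, .inr d2, fun i hi hiv => ?_⟩⟩
          rcases hiv with hiv | hiv
          · refine le_trans ?_ (c3 i hi hiv)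
            exact (Prod.Lex.toLex_lt_toLex.2 (.inl hlt)).le
          · exact d3 i hi hiv
        · refine ⟨fun h => absurd h ha, fun _ => ⟨c1, .inl c2, fun i hi hiv => ?_⟩⟩
          rcases hiv with hiv | hiv
          · exact c3 i hi hiv
          · refine le_trans ?_ (d3 i hi hiv)
            -- Players below the left child have the smaller numbers, so keeping the left winner
            -- when the keys are equal realizes the tie-break in `lexKey`.
            have hij : win (v + v) - 1 ≤ win (v + v + 1) - 1 := by
              by_contra hcon
              have := Nat.div_le_div_right (c := 2 ^ m)
                (show 2 ^ K + (win (v + v + 1) - 1) ≤ 2 ^ K + (win (v + v) - 1) by omega)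
              omega
            rcases lt_or_eq_of_le (not_lt.1 hlt) with hk | hk
            · exact (Prod.Lex.toLex_lt_toLex.2 (.inl hk)).le
            · exact Prod.Lex.toLex_le_toLex.2 (.inr ⟨hk, hij⟩)

/-- `ord` lists `0, …, m - 1` in increasing order, and `rank` is its inverse. -/
structure IsSort (m : ℕ) (key : ℕ → α) (ord rank : ℕ → ℕ) : Prop where
  ord_lt : ∀ t < m, ord t < m
  rank_ord : ∀ t < m, rank (ord t) = t
  rank_lt : ∀ i < m, rank i < m
  ord_rank : ∀ i < m, ord (rank i) = i
  lt : ∀ t u, t < u → u < m → lexKey key (ord t) < lexKey key (ord u)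

theorem IsSort.rank_lt_rank {m : ℕ} {key : ℕ → α} {ord rank : ℕ → ℕ} (h : IsSort m key ord rank)
    {i j : ℕ} (hi : i < m) (hj : j < m) : rank i < rank j ↔ lexKey key i < lexKey key j := by
  have key' : ∀ i j, i < m → j < m → rank i < rank j → lexKey key i < lexKey key j := by
    intro i j hi hj hij
    have := h.lt _ _ hij (h.rank_lt j hj)
    rwa [h.ord_rank i hi, h.ord_rank j hj] at this
  refine ⟨key' i j hi hj, fun hlt => ?_⟩
  by_contra hcon
  rcases eq_or_lt_of_le (not_lt.1 hcon) with e | e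
  · have : i = j := by rw [← h.ord_rank i hi, ← h.ord_rank j hj, e]
    subst this
    exact lt_irrefl _ hlt
  · exact lt_asymm hlt (key' j i hj hi e)

/-- Recomputes the winner at the node in register `50`. -/
def pullWin (cmp : Test) : Prog :=
  set 51 (arr 8 (reg 50 + reg 50)) ;; set 52 (arr 8 (reg 50 + reg 50 + nat 1)) ;;
  .ite (lt (reg 51) (nat 1)) (.storeNat 8 (reg 50) (reg 52))
    (.ite (lt (reg 52) (nat 1)) (.storeNat 8 (reg 50) (reg 51))
      (set 51 (reg 51 - nat 1) ;; set 52 (reg 52 - nat 1) ;;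
        .ite cmp (.storeNat 8 (reg 50) (reg 52 + nat 1)) (.storeNat 8 (reg 50) (reg 51 + nat 1))))

/-- Builds the tournament of the players `0, …, m - 1`, where register `49` holds `m`. -/
def buildWin (cmp : Test) : Prog :=
  set 50 (reg 3 + reg 3) ;; .while (lt (nat 1) (reg 50))
    (set 50 (reg 50 - nat 1) ;;
      .ite (lt (reg 50) (reg 3)) (pullWin cmp)
        (.ite (lt (reg 50) (reg 3 + reg 49)) (.storeNat 8 (reg 50) (reg 50 - reg 3 + nat 1))
          (.storeNat 8 (reg 50) (nat 0))))

/-- Takes the winner out of the tournament, as number `t` (register `53`) of the sorted list. -/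
def popWin (cmp : Test) (ordA rankA : ℕ) : Prog :=
  (set 54 (arr 8 (nat 1) - nat 1) ;; .storeNat ordA (reg 53) (reg 54) ;;
    .storeNat rankA (reg 54) (reg 53) ;; set 50 (reg 3 + reg 54) ;;
    .storeNat 8 (reg 50) (nat 0)) ;; climbProg 50 (pullWin cmp) ;; set 53 (reg 53 + nat 1)

/-- Sorts `0, …, m - 1`, where register `49` holds `m`; the test `cmp` compares the keys of the
players in registers `52` and `51`. -/
def sortProg (cmp : Test) (ordA rankA : ℕ) : Prog :=
  buildWin cmp ;; set 53 (nat 0) ;; .while (lt (reg 53) (reg 49)) (popWin cmp ordA rankA)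

/-- The memory agrees with `σ` outside the registers `rs` and the arrays `as`. -/
structure Agree (rs as : List ℕ) (σ τ : State) : Prop where
  natReg : ∀ r, r ∉ rs → τ.natReg r = σ.natReg r
  realReg : ∀ r, τ.realReg r = σ.realReg r
  natArr : ∀ a, a ∉ as → τ.natArr a = σ.natArr a
  realArr : ∀ a, τ.realArr a = σ.realArr a

theorem Frame.agree {P : Prog} {σ τ : State} {rs as : List ℕ} (h : Frame P σ τ)
    (h1 : P.wN ⊆ rs) (h2 : P.wNA ⊆ as) (h3 : P.wR = []) (h4 : P.wRA = []) : Agree rs as σ τ :=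
  ⟨fun r hr => h.1 r fun hh => hr (h1 hh), fun r => h.2 r (by simp [h3]),
    fun r hr => h.3 r fun hh => hr (h2 hh), fun r => h.4 r (by simp [h4])⟩

theorem Agree.trans {rs as : List ℕ} {σ τ ρ : State} (h : Agree rs as σ τ)
    (h' : Agree rs as τ ρ) : Agree rs as σ ρ :=
  ⟨fun r hr => (h'.1 r hr).trans (h.1 r hr), fun r => (h'.2 r).trans (h.2 r),
    fun r hr => (h'.3 r hr).trans (h.3 r hr), fun r => (h'.4 r).trans (h.4 r)⟩

/-- The test `cmp` compares the keys of the players in registers `52` and `51`, in any memory that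
agrees with `σ` outside the registers and arrays that sorting writes. -/
def Compares (cmp : Test) (key : ℕ → α) (ordA rankA : ℕ) (σ : State) : Prop :=
  ∀ τ, Agree [50, 51, 52, 53, 54] [8, ordA, rankA] σ τ →
    (cmp.Holds τ ↔ key (τ.natReg 52) < key (τ.natReg 51))

theorem Compares.agree {cmp : Test} {key : ℕ → α} {ordA rankA : ℕ} {σ τ : State}
    (h : Compares cmp key ordA rankA σ)
    (h' : Agree [50, 51, 52, 53, 54] [8, ordA, rankA] σ τ) : Compares cmp key ordA rankA τ :=
  fun ρ hρ => h ρ (h'.trans hρ)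

theorem runs_pullWin {cmp : Test} {key : ℕ → α} {ordA rankA v : ℕ} {σ : State}
    (hc : Compares cmp key ordA rankA σ) (hv : σ.natReg 50 = v) :
    Runs (pullWin cmp) σ (cmp.cost + 40) fun τ =>
      τ.natReg 50 = v ∧ τ.natArr 8 = Function.update (σ.natArr 8) v
        (winner key (σ.natArr 8 (v + v)) (σ.natArr 8 (v + v + 1))) ∧
      Agree [50, 51, 52, 53, 54] [8, ordA, rankA] σ τ := by
  have hF : ∀ τ, Frame (pullWin cmp) σ τ →
      Agree [50, 51, 52, 53, 54] [8, ordA, rankA] σ τ := fun τ h =>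
    h.agree (by simp [pullWin, Prog.wN]) (by simp [pullWin, Prog.wNA]) rfl rfl
  refine Runs.mono (Runs.line (P := pullWin cmp) (σ := σ) (T := cmp.cost + 40)
    (Q := fun τ => τ.natReg 50 = v ∧ τ.natArr 8 = Function.update (σ.natArr 8) v
        (winner key (σ.natArr 8 (v + v)) (σ.natArr 8 (v + v + 1)))) rfl ?_ ?_).frame le_rfl
    fun τ hτ => ⟨hτ.1.1, hτ.1.2, hF τ hτ.2⟩
  · simp [pullWin, Prog.maxCost, Test.cost, NatExpr.cost]; omega
  · have hcmp := hc ((((σ.setNat 51 (σ.natArr 8 (v + v))).setNat 52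
        (σ.natArr 8 (v + v + 1))).setNat 51 (σ.natArr 8 (v + v) - 1)).setNat 52
        (σ.natArr 8 (v + v + 1) - 1)) ⟨by simp +contextual, by simp, by simp, by simp⟩
    simp only [setNat_natReg] at hcmp
    norm_num at hcmp
    simp only [pullWin, Prog.run_seq, Prog.run_setNat, Prog.run_ite, Prog.run_storeNat,
      eval_add, eval_sub, eval_const, eval_reg, eval_arr, hv, setNat_natReg, setNat_natArr,
      holds_lt]
    norm_num [hv]
    rw [winner]
    by_cases ha : σ.natArr 8 (v + v) = 0
    · simp [ha, hv]
    · by_cases hb : σ.natArr 8 (v + v + 1) = 0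
      · simp [ha, hb, hv]
      · by_cases hk : key (σ.natArr 8 (v + v + 1) - 1) < key (σ.natArr 8 (v + v) - 1)
        · have e : σ.natArr 8 (v + v + 1) - 1 + 1 = σ.natArr 8 (v + v + 1) := by omega
          simp [ha, hb, hk, hcmp, hv, e]
        · have e : σ.natArr 8 (v + v) - 1 + 1 = σ.natArr 8 (v + v) := by omega
          simp [ha, hb, hk, hcmp, hv, e]

end sort
end RealRAM


/-! ### Correctness and running time of the tournament sort -/

namespace RealRAM
open HeapTree
section sort
variable {α : Type*} [LinearOrder α]

theorem WinAt.congr {K : ℕ} {key : ℕ → α} {A : Finset ℕ} {win win' : ℕ → ℕ} {u : ℕ}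
    (h : WinAt K key A win u) (h0 : win' u = win u) (h1 : win' (u + u) = win (u + u))
    (h2 : win' (u + u + 1) = win (u + u + 1)) : WinAt K key A win' u := by
  refine ⟨fun a b => ?_, fun a => ?_⟩
  · rw [h0, h.1 a b]
  · rw [h0, h1, h2, h.2 a]

theorem winAt_update {K : ℕ} {key : ℕ → α} {A : Finset ℕ} {win : ℕ → ℕ} {v : ℕ} (h0 : 0 < v)
    (hv : v < 2 ^ K) :
    WinAt K key A (Function.update win v (winner key (win (v + v)) (win (v + v + 1)))) v := by
  refine ⟨fun a => by omega, fun _ => ?_⟩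
  rw [Function.update_self, Function.update_of_ne (by omega), Function.update_of_ne (by omega)]

theorem winAt_update_of_ne {K : ℕ} {key : ℕ → α} {A : Finset ℕ} {win : ℕ → ℕ} {u v x : ℕ}
    (h : WinAt K key A win u) (h1 : u ≠ v) (h2 : u ≠ v / 2) :
    WinAt K key A (Function.update win v x) u :=
  h.congr (Function.update_of_ne h1 _ _) (Function.update_of_ne (by omega) _ _)
    (Function.update_of_ne (by omega) _ _)

theorem runs_buildWin {cmp : Test} {key : ℕ → α} {ordA rankA K m : ℕ} {σ : State}
    (hc : Compares cmp key ordA rankA σ) (hK : σ.natReg 3 = 2 ^ K) (hm : σ.natReg 49 = m) :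
    Runs (buildWin cmp) σ (2 * 2 ^ K * (cmp.cost + 60)) fun τ =>
      ∀ v, 0 < v → WinAt K key (Finset.range m) (τ.natArr 8) v := by
  have hp := Nat.pos_of_ne_zero (pow_ne_zero K (two_ne_zero (α := ℕ)))
  refine Runs.seq_of (T₁ := 4) (T₂ := (2 * 2 ^ K - 1) * (cmp.cost + 60) + 4)
    (R := fun τ => τ.natReg 50 = 2 ^ (K + 1))
    (Runs.line rfl (by decide) (by simp [hK, pow_succ]; omega)) (fun τ h50 hF => ?_) ?_
  · have hA : Agree [50, 51, 52, 53, 54] [8, ordA, rankA] σ τ :=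
      hF.agree (by simp [Prog.wN]) (by simp [Prog.wNA]) rfl rfl
    refine Runs.while_of (fun ρ => 0 < ρ.natReg 50 ∧ ρ.natReg 50 ≤ 2 ^ (K + 1) ∧
      Agree [50, 51, 52, 53, 54] [8, ordA, rankA] σ ρ ∧
      ∀ v, ρ.natReg 50 ≤ v → WinAt K key (Finset.range m) (ρ.natArr 8) v)
      (fun ρ => ρ.natReg 50 - 1) (cmp.cost + 56)
      ⟨by rw [h50]; positivity, h50.le, hA, fun v hv =>
        ⟨fun _ _ => by omega, fun h => by rw [h50, pow_succ] at hv; omega⟩⟩ ?_ ?_ ?_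
    · rintro ρ - ⟨a, b, c, d⟩ hb
      simp at hb
      have h3 : ρ.natReg 3 = 2 ^ K := (c.natReg 3 (by simp)).trans hK
      have h49 : ρ.natReg 49 = m := (c.natReg 49 (by simp)).trans hm
      refine Runs.seq_of (T₁ := 4) (T₂ := cmp.cost + 52)
        (R := fun τ => τ = ρ.setNat 50 (ρ.natReg 50 - 1))
        (Runs.line rfl (by decide) (by simp)) (fun τ hτ hF => ?_) (by omega)
      have hAτ : Agree [50, 51, 52, 53, 54] [8, ordA, rankA] σ τ :=
        c.trans (hF.agree (by simp [Prog.wN]) (by simp [Prog.wNA]) rfl rfl)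
      have e50 : τ.natReg 50 = ρ.natReg 50 - 1 := by simp [hτ]
      have e3 : τ.natReg 3 = 2 ^ K := by simp [hτ, h3]
      have e49 : τ.natReg 49 = m := by simp [hτ, h49]
      have e8 : τ.natArr 8 = ρ.natArr 8 := by simp [hτ]
      refine (Runs.ite (T := cmp.cost + 46) (fun hlt => ?_) (fun hlt => ?_)).mono
        (by simp [Test.cost, NatExpr.cost]; omega) fun _ h => h
      · simp [e3] at hlt
        refine (runs_pullWin (hc.agree hAτ) rfl).mono (by omega) fun τ' ⟨i1, i2, i3⟩ => ?_
        rw [i1, i2, e50, e8]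
        refine ⟨⟨by omega, by omega, hAτ.trans i3, fun v hv => ?_⟩, by omega⟩
        by_cases e : v = ρ.natReg 50 - 1
        · rw [e]; exact winAt_update (by omega) (by omega)
        · exact winAt_update_of_ne (d v (by omega)) e (by omega)
      · simp [e3] at hlt
        refine Runs.mono (Runs.frame (T := 26) (Q := fun τ' => τ'.natReg 50 = ρ.natReg 50 - 1 ∧
          τ'.natArr 8 = Function.update (ρ.natArr 8) (ρ.natReg 50 - 1)
            (if ρ.natReg 50 - 1 - 2 ^ K ∈ Finset.range m then ρ.natReg 50 - 1 - 2 ^ K + 1 else 0))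
          (Runs.line rfl (by simp [Prog.maxCost, Test.cost, NatExpr.cost]) ?_)) (by omega) ?_
        · simp [e3, e49, e50]
          by_cases hi : ρ.natReg 50 - 1 < 2 ^ K + m
          · have : ρ.natReg 50 - 1 - 2 ^ K < m := by omega
            simp [hi, this, e50, e8]
          · have : ¬ ρ.natReg 50 - 1 - 2 ^ K < m := by omega
            simp [hi, this, e50, e8]
        · rintro τ' ⟨⟨i1, i2⟩, i3⟩
          rw [i1, i2]
          refine ⟨⟨by omega, by omega, hAτ.trans
            (i3.agree (by simp [Prog.wN]) (by simp [Prog.wNA]) rfl rfl), fun v hv => ?_⟩, by omega⟩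
          by_cases e : v = ρ.natReg 50 - 1
          · refine ⟨fun _ _ => ?_, fun _ => by omega⟩
            rw [e, Function.update_self]
          · exact winAt_update_of_ne (d v (by omega)) e (by omega)
    · rintro ρ - ⟨a, b, c, d⟩ hb v hv
      simp at hb
      exact d v (by omega)
    · simp only [h50, Test.cost, NatExpr.cost, pow_succ]
      have e : cmp.cost + 56 + (1 + 1 + 1 + 1) = cmp.cost + 60 := by omega
      have e' : 2 ^ K * 2 - 1 = 2 * 2 ^ K - 1 := by omega
      rw [e, e']
  · obtain ⟨k, hk⟩ : ∃ k, 2 * 2 ^ K = k + 1 := ⟨2 * 2 ^ K - 1, by omega⟩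
    rw [hk, Nat.add_sub_cancel, Nat.succ_mul]
    omega

/-- The first `t` steps of the sorting have been made. -/
structure SortInv (m : ℕ) (key : ℕ → α) (A : Finset ℕ) (t : ℕ) (ord rank : ℕ → ℕ) : Prop where
  subset : A ⊆ Finset.range m
  mem : ∀ i < m, i ∈ A ∨ ∃ u < t, ord u = i
  ord_lt : ∀ u < t, ord u < m
  rank_ord : ∀ u < t, rank (ord u) = u
  lt : ∀ u u', u < u' → u' < t → lexKey key (ord u) < lexKey key (ord u')
  lt_mem : ∀ u < t, ∀ i ∈ A, lexKey key (ord u) < lexKey key i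

/-- Listed and active numbers together exhaust `0, …, m - 1`, and fewer than `m` have been listed.
-/
theorem SortInv.nonempty {m t : ℕ} {key : ℕ → α} {A : Finset ℕ} {ord rank : ℕ → ℕ}
    (h : SortInv m key A t ord rank) (ht : t < m) : A.Nonempty := by
  by_contra hA
  rw [Finset.not_nonempty_iff_eq_empty] at hA
  have : Finset.range m ⊆ (Finset.range t).image ord := by
    intro i hi
    rcases h.mem i (Finset.mem_range.1 hi) with h' | ⟨u, hu, e⟩
    · simp [hA] at h'
    · exact Finset.mem_image.2 ⟨u, Finset.mem_range.2 hu, e⟩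
  have := (Finset.card_le_card this).trans Finset.card_image_le
  simp at this
  omega

/-- Since `rank` is a left inverse, `ord` is an injection of a finite set into itself and hence
onto; this makes `rank` a two-sided inverse. -/
theorem SortInv.isSort {m : ℕ} {key : ℕ → α} {A : Finset ℕ} {ord rank : ℕ → ℕ}
    (h : SortInv m key A m ord rank) : IsSort m key ord rank := by
  have inj : Set.InjOn ord (Finset.range m : Set ℕ) := fun u hu u' hu' e => by
    have a := h.rank_ord u (by simpa using hu)
    have b := h.rank_ord u' (by simpa using hu')
    rw [← a, ← b, e]
  have surj : (Finset.range m).image ord = Finset.range m :=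
    Finset.eq_of_subset_of_card_le (fun i hi => by
      obtain ⟨u, hu, rfl⟩ := Finset.mem_image.1 hi
      exact Finset.mem_range.2 (h.ord_lt u (Finset.mem_range.1 hu)))
      (by rw [Finset.card_image_of_injOn inj])
  have hs : ∀ i < m, ∃ u < m, ord u = i := fun i hi => by
    have : i ∈ (Finset.range m).image ord := by
      rw [surj]; exact Finset.mem_range.2 hi
    obtain ⟨u, hu, e⟩ := Finset.mem_image.1 this
    exact ⟨u, Finset.mem_range.1 hu, e⟩
  refine ⟨h.ord_lt, h.rank_ord, fun i hi => ?_, fun i hi => ?_, h.lt⟩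
  · obtain ⟨u, hu, rfl⟩ := hs i hi
    rwa [h.rank_ord u hu]
  · obtain ⟨u, hu, rfl⟩ := hs i hi
    rw [h.rank_ord u hu]

theorem SortInv.step {m t w : ℕ} {key : ℕ → α} {A : Finset ℕ} {ord rank : ℕ → ℕ}
    (h : SortInv m key A t ord rank) (hw : w ∈ A)
    (hmin : ∀ i ∈ A, lexKey key w ≤ lexKey key i) :
    SortInv m key (A.erase w) (t + 1) (Function.update ord t w) (Function.update rank w t) := by
  have ho : ∀ u < t, Function.update ord t w u = ord u := fun u hu =>
    Function.update_of_ne (by omega) _ _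
  have hne : ∀ u < t, ord u ≠ w := fun u hu e => by
    have := h.lt_mem u hu w hw
    rw [e] at this
    exact lt_irrefl _ this
  have hwm : w < m := Finset.mem_range.1 (h.subset hw)
  refine ⟨(Finset.erase_subset _ _).trans h.subset, fun i hi => ?_, fun u hu => ?_,
    fun u hu => ?_, fun u u' huu hu' => ?_, fun u hu i hi => ?_⟩
  · by_cases e : i = w
    · exact .inr ⟨t, by omega, by simp [e]⟩
    · rcases h.mem i hi with h' | ⟨u, hu, e'⟩
      · exact .inl (Finset.mem_erase.2 ⟨e, h'⟩)
      · exact .inr ⟨u, by omega, by rw [ho u hu, e']⟩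
  · rcases Nat.lt_succ_iff_lt_or_eq.1 hu with h' | rfl
    · rw [ho u h']; exact h.ord_lt u h'
    · simpa using hwm
  · rcases Nat.lt_succ_iff_lt_or_eq.1 hu with h' | rfl
    · rw [ho u h', Function.update_of_ne (hne u h')]; exact h.rank_ord u h'
    · simp
  · rcases Nat.lt_succ_iff_lt_or_eq.1 hu' with h' | rfl
    · rw [ho u (by omega), ho u' h']; exact h.lt u u' huu h'
    · rw [ho u huu, Function.update_self]; exact h.lt_mem u huu w hw
  · obtain ⟨hi1, hi2⟩ := Finset.mem_erase.1 hi
    rcases Nat.lt_succ_iff_lt_or_eq.1 hu with h' | rfl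
    · rw [ho u h']; exact h.lt_mem u h' i hi2
    · rw [Function.update_self]
      refine lt_of_le_of_ne (hmin i hi2) fun e => hi1 ?_
      have := congrArg (fun x => (ofLex x).2) e
      exact this.symm

/-- The winner at the root is the least active player. Clearing its leaf spoils only the ancestors
of that leaf, and one climb repairs them, so a step takes time proportional to the depth. -/
theorem runs_popWin {cmp : Test} {key : ℕ → α} {ordA rankA K m t : ℕ} {A : Finset ℕ} {σ : State}
    (ho : 8 < ordA) (hr : 8 < rankA) (hor : ordA ≠ rankA)
    (hc : Compares cmp key ordA rankA σ) (hT : TreeAt K σ) (hmK : m ≤ 2 ^ K) (ht : t < m)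
    (h53 : σ.natReg 53 = t) (hA : SortInv m key A t (σ.natArr ordA) (σ.natArr rankA))
    (hW : ∀ v, 0 < v → WinAt K key A (σ.natArr 8) v) :
    Runs (popWin cmp ordA rankA) σ ((K + 1) * (cmp.cost + 47)) fun τ =>
      τ.natReg 53 = t + 1 ∧ ∃ A', SortInv m key A' (t + 1) (τ.natArr ordA) (τ.natArr rankA) ∧
        ∀ v, 0 < v → WinAt K key A' (τ.natArr 8) v := by
  have hp := Nat.pos_of_ne_zero (pow_ne_zero K (two_ne_zero (α := ℕ)))
  obtain ⟨s0, s1⟩ := winAt_spec hW (lvl_root K)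
  have hw0 : σ.natArr 8 1 ≠ 0 := fun h0 => by
    obtain ⟨i, hi⟩ := hA.nonempty ht
    have him := Finset.mem_range.1 (hA.subset hi)
    have hl : Lvl K 0 (2 ^ K + i) := lvl_leaf.2 ⟨by omega, by rw [pow_succ]; omega⟩
    exact s0 h0 i hi (hl.anc le_rfl).eq_one
  obtain ⟨w1, w2, w3⟩ := s1 hw0
  set w := σ.natArr 8 1 - 1 with hw
  have hwm : w < m := Finset.mem_range.1 (hA.subset w1)
  refine Runs.seq_of (T₁ := 20) (T₂ := K * (cmp.cost + 47) + 8)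
    (R := fun τ => τ = ((((σ.setNat 54 w).storeNat ordA t w).storeNat rankA w t).setNat 50
      (2 ^ K + w)).storeNat 8 (2 ^ K + w) 0)
    (Runs.line rfl (by simp [Prog.maxCost, NatExpr.cost]) ?_) (fun τ hτ hF => ?_)
    (by rw [Nat.succ_mul]; omega)
  · simp [h53, hT.size, ← hw]
  have hAg : Agree [50, 51, 52, 53, 54] [8, ordA, rankA] σ τ :=
    hF.agree (by simp [Prog.wN]) (by simp [Prog.wNA]) rfl rfl
  have eo : τ.natArr ordA = Function.update (σ.natArr ordA) t w := by
    simp [hτ, hor, ho.ne']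
  have er : τ.natArr rankA = Function.update (σ.natArr rankA) w t := by
    simp [hτ, hor.symm, hr.ne']
  have e8 : τ.natArr 8 = Function.update (σ.natArr 8) (2 ^ K + w) 0 := by
    simp [hτ, ho.ne, hr.ne]
  have e6 : τ.natArr 6 = σ.natArr 6 := by
    have h1 : (6 : ℕ) ≠ ordA := by omega
    have h2 : (6 : ℕ) ≠ rankA := by omega
    simp [hτ, h1, h2]
  have e50 : τ.natReg 50 = 2 ^ K + w := by simp [hτ]
  have e53 : τ.natReg 53 = t := by simp [hτ, h53]
  have key1 := runs_climbProg (r := 50) (pull := pullWin cmp) (K := K) (Tp := cmp.cost + 40)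
    (T := K * (cmp.cost + 47) + 4) (σ := τ)
    (fun ρ u => WinAt K key (A.erase w) (ρ.natArr 8) u)
    (fun ρ => Agree [50, 51, 52, 53, 54] [8, ordA, rankA] σ ρ) (fun _ => False)
    (fun ρ v hI hv h0 hlt => (runs_pullWin (hc.agree hI) hv).mono le_rfl
      fun ρ' ⟨i1, i2, i3⟩ => ⟨hI.trans i3, i1, by rw [i2]; exact winAt_update h0 hlt,
        fun u hu hu2 hW => by rw [i2]; exact winAt_update_of_ne hW hu hu2⟩)
    (fun ρ v hI => hI.trans ⟨by simp +contextual, by simp, by simp, by simp⟩)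
    (fun ρ u v h => by simpa using h)
    (fun ρ hI v hv => by
      rw [hI.natArr 6 (by simp; omega)]; exact hT.par v hv) hAg
    (by omega) (by rw [e50, pow_succ]; omega) (fun u hu _ hj => ?_) le_rfl
  · refine Runs.seq_of (key1.frame) (fun ρ ⟨⟨_, j2⟩, j3⟩ _ => ?_) (le_refl (_ + 4))
    refine Runs.line rfl (by decide) ?_
    have n53 : ρ.natReg 53 = t := by
      rw [j3.natReg 53 (by simp [climbProg, pullWin, Prog.wN])]; exact e53
    have no : ρ.natArr ordA = τ.natArr ordA :=
      j3.natArr _ (by simp [climbProg, pullWin, Prog.wNA]; omega)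
    have nr : ρ.natArr rankA = τ.natArr rankA :=
      j3.natArr _ (by simp [climbProg, pullWin, Prog.wNA]; omega)
    refine ⟨by simp [n53], A.erase w, ?_, ?_⟩
    · simp only [Prog.run_setNat, setNat_natArr, no, nr, eo, er]
      exact hA.step w1 fun i hi => w3 i hi (((lvl_leaf.2 ⟨by omega, by
        have := Finset.mem_range.1 (hA.subset hi); rw [pow_succ]; omega⟩ :
          Lvl K 0 (2 ^ K + i)).anc le_rfl).eq_one)
    · simpa using j2
  · rw [e50] at hj
    rw [e8]
    by_cases e : u = 2 ^ K + w
    · refine ⟨fun _ _ => ?_, fun h => by omega⟩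
      subst e
      simp
    · refine winAt_update_of_ne (K := K) ?_ e (by simpa using hj 0)
      refine ⟨fun a b => ?_, (hW u hu).2⟩
      rw [(hW u hu).1 a b]
      have : u - 2 ^ K ≠ w := by omega
      simp [this]

theorem runs_sortProg {cmp : Test} {key : ℕ → α} {ordA rankA K m : ℕ} {σ : State}
    (ho : 8 < ordA) (hr : 8 < rankA) (hor : ordA ≠ rankA)
    (hc : Compares cmp key ordA rankA σ) (hT : TreeAt K σ) (hmK : m ≤ 2 ^ K)
    (hm : σ.natReg 49 = m) :
    Runs (sortProg cmp ordA rankA) σ (4 * 2 ^ K * (K + 1) * (cmp.cost + 60)) fun τ =>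
      IsSort m key (τ.natArr ordA) (τ.natArr rankA) := by
  have hp := Nat.pos_of_ne_zero (pow_ne_zero K (two_ne_zero (α := ℕ)))
  refine Runs.seq_of (T₂ := 2 * 2 ^ K * (K + 1) * (cmp.cost + 60)) (runs_buildWin hc hT.size hm)
    (fun τ hτ hF => ?_) ?_
  · have hAg : Agree [50, 51, 52, 53, 54] [8, ordA, rankA] σ τ :=
      hF.agree (by simp [Prog.wN, buildWin, pullWin]) (by simp [Prog.wNA, buildWin, pullWin])
        rfl rfl
    refine Runs.seq_of (T₁ := 2) (R := fun ρ => ρ.natReg 53 = 0 ∧ ρ.natArr = τ.natArr ∧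
      Agree [50, 51, 52, 53, 54] [8, ordA, rankA] σ ρ) (Runs.line rfl (by decide) ?_)
      (fun ρ ⟨h53, e8, hAg'⟩ _ => ?_) (T₂ := 2 ^ K * ((K + 1) * (cmp.cost + 47) + 4) + 4) ?_
    · exact ⟨by simp, by simp, hAg.trans ⟨by simp +contextual, by simp, by simp, by simp⟩⟩
    · refine Runs.while_of (fun ρ => ρ.natReg 53 ≤ m ∧
        Agree [50, 51, 52, 53, 54] [8, ordA, rankA] σ ρ ∧
        ∃ A, SortInv m key A (ρ.natReg 53) (ρ.natArr ordA) (ρ.natArr rankA) ∧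
          ∀ v, 0 < v → WinAt K key A (ρ.natArr 8) v) (fun ρ => m - ρ.natReg 53)
        ((K + 1) * (cmp.cost + 47)) ⟨by omega, hAg', Finset.range m, ?_, by rwa [e8]⟩ ?_ ?_ ?_
      · rw [h53]
        exact ⟨subset_rfl, fun i hi => .inl (Finset.mem_range.2 hi), by simp, by simp, by simp,
          by simp⟩
      · rintro ρ' - ⟨a, b, A, hA, hW⟩ hb
        have h49 : ρ'.natReg 49 = m := (b.natReg 49 (by simp)).trans hm
        simp [h49] at hb
        refine (runs_popWin ho hr hor (hc.agree b) ⟨?_, ?_, ?_⟩ hmK hb rfl hA hW).frame.mono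
          le_rfl fun ρ'' ⟨⟨i1, A', i2, i3⟩, hF⟩ => ⟨⟨by omega, b.trans ?_, A', by rwa [i1], i3⟩,
            by omega⟩
        · rw [b.natReg 3 (by simp), hT.size]
        · rw [b.natArr 6 (by simp; omega)]; exact hT.par
        · rw [b.natArr 7 (by simp; omega)]; exact hT.first
        · exact hF.agree (by simp [Prog.wN, popWin, climbProg, pullWin])
            (by simp [Prog.wNA, popWin, climbProg, pullWin]) rfl rfl
      · rintro ρ' - ⟨a, b, A, hA, hW⟩ hb
        have h49 : ρ'.natReg 49 = m := (b.natReg 49 (by simp)).trans hm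
        simp [h49] at hb
        have e : ρ'.natReg 53 = m := by omega
        rw [e] at hA
        exact hA.isSort
      · simp only [h53, Test.cost, NatExpr.cost]
        have := Nat.mul_le_mul_right ((K + 1) * (cmp.cost + 47) + 4) hmK
        simpa using this
    · have h1 : (K + 1) * (cmp.cost + 60) = (K + 1) * (cmp.cost + 47) + 13 * (K + 1) := by ring
      have h2 : 2 * 2 ^ K * (K + 1) * (cmp.cost + 60)
        = 2 ^ K * ((K + 1) * (cmp.cost + 60)) + 2 ^ K * ((K + 1) * (cmp.cost + 60)) := by ring
      have h3 : 2 ^ K * ((K + 1) * (cmp.cost + 47) + 4) ≤ 2 ^ K * ((K + 1) * (cmp.cost + 60)) :=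
        Nat.mul_le_mul_left _ (by omega)
      have h4 : 1 * 60 ≤ 2 ^ K * ((K + 1) * (cmp.cost + 60)) :=
        Nat.mul_le_mul hp (by nlinarith)
      omega
  · have : 2 * 2 ^ K * (cmp.cost + 60) * 1 ≤ 2 * 2 ^ K * (cmp.cost + 60) * (K + 1) :=
      Nat.mul_le_mul_left _ (by omega)
    have e : 4 * 2 ^ K * (K + 1) * (cmp.cost + 60) = 2 * 2 ^ K * (K + 1) * (cmp.cost + 60)
      + 2 * 2 ^ K * (K + 1) * (cmp.cost + 60) := by ring
    have e' : 2 * 2 ^ K * (K + 1) * (cmp.cost + 60) = 2 * 2 ^ K * (cmp.cost + 60) * (K + 1) := by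
      ring
    omega

end sort
end RealRAM


/-! ### Slabs -/

/-- The intervals `(lo i, hi i]` are cut by breakpoints: `κ x` is the greatest breakpoint below `x`,
and `(S i, E i]` is the slab that contains `lo i + 1`. -/
structure Slabs (n : ℕ) (lo hi S E κ : ℕ → ℕ) : Prop where
  le : ∀ i < n, S i ≤ lo i ∧ lo i < E i ∧ E i ≤ hi i
  own : ∀ i < n, ∀ x, S i < x → x ≤ E i → κ x = S i
  next : ∀ i < n, ∀ x, E i < x → x ≤ hi i → κ x = E i
  le_of_eq : ∀ i < n, ∀ x, κ x = S i → x ≤ E i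
  lt : ∀ x, 0 < x → κ x < x

/-- The intervals that start before `t` have been treated, and the last slab is `(s, e]`. -/
structure SlabInv (n : ℕ) (lo hi : ℕ → ℕ) (t s e : ℕ) (S E κ : ℕ → ℕ) : Prop where
  le : ∀ i < n, lo i < t → S i ≤ lo i ∧ lo i < E i ∧ E i ≤ hi i
  own : ∀ i < n, lo i < t → ∀ x, S i < x → x ≤ E i → κ x = S i
  next : ∀ i < n, lo i < t → ∀ x, E i < x → x ≤ hi i → κ x = E i
  le_of_eq : ∀ i < n, lo i < t → ∀ x, κ x = S i → x ≤ E i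
  lt : ∀ x, 0 < x → κ x < x
  s_le : s ≤ t
  s_le_e : s ≤ e
  eq_s : ∀ x, s < x → x ≤ e → κ x = s
  eq_e : ∀ x, e < x → κ x = e
  e_le : ∀ i < n, t ≤ lo i → e ≤ hi i

theorem SlabInv.skip {n t s e : ℕ} {lo hi S E κ : ℕ → ℕ} (h : SlabInv n lo hi t s e S E κ)
    (ht : ∀ i < n, lo i ≠ t) : SlabInv n lo hi (t + 1) s e S E κ := by
  have hl : ∀ i < n, lo i < t + 1 → lo i < t := fun i hi hlt => by have := ht i hi; omega
  exact ⟨fun i hi h' => h.le i hi (hl i hi h'), fun i hi h' => h.own i hi (hl i hi h'),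
    fun i hi h' => h.next i hi (hl i hi h'), fun i hi h' => h.le_of_eq i hi (hl i hi h'), h.lt,
    by have := h.s_le; omega, h.s_le_e, h.eq_s, h.eq_e, fun i hi h' => h.e_le i hi (by omega)⟩

/-- The last breakpoint already cuts the interval of `j`, because `lo j < e` and, by `e_le`, `e ≤ hi
j`; no new breakpoint is needed. -/
theorem SlabInv.same {n s e j : ℕ} {lo hi S E κ : ℕ → ℕ}
    (h : SlabInv n lo hi (lo j) s e S E κ) (hj : j < n)
    (inj : ∀ i < n, lo i = lo j → i = j) (hlt : lo j < e) :
    SlabInv n lo hi (lo j + 1) s e (Function.update S j s) (Function.update E j e) κ := by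
  have hs := h.s_le
  have hl : ∀ i < n, lo i < lo j + 1 → i ≠ j → lo i < lo j := fun i hi h1 h2 => by
    rcases Nat.lt_succ_iff_lt_or_eq.1 h1 with h | h
    · exact h
    · exact absurd (inj i hi h) h2
  refine ⟨fun i hi h' => ?_, fun i hi h' => ?_, fun i hi h' => ?_, fun i hi h' => ?_, h.lt,
    by omega, h.s_le_e, h.eq_s, h.eq_e, fun i hi h' => h.e_le i hi (by omega)⟩
  all_goals by_cases e : i = j
  · subst e; simpa using ⟨hs, hlt, h.e_le i hi le_rfl⟩
  · simpa [e] using h.le i hi (hl i hi h' e)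
  · subst e; simpa using h.eq_s
  · simpa [e] using h.own i hi (hl i hi h' e)
  · subst e; simpa using fun x hx _ => h.eq_e x hx
  · simpa [e] using h.next i hi (hl i hi h' e)
  · subst e
    simp only [Function.update_self]
    intro x hx
    by_contra hc
    have := h.eq_e x (by omega)
    omega
  · simpa [e] using h.le_of_eq i hi (hl i hi h' e)

/-- The last breakpoint does not reach beyond `lo j`, so `hi j` becomes the next one. Only values of
`κ` above `hi j` change: earlier intervals end before `hi j` and keep their data, and later ones end
after it, which restores `e_le`. -/
theorem SlabInv.new {n s e j : ℕ} {lo hi S E κ : ℕ → ℕ}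
    (h : SlabInv n lo hi (lo j) s e S E κ) (hj : j < n)
    (inj : ∀ i < n, lo i = lo j → i = j) (hlt : ∀ i < n, lo i < hi i)
    (mono : ∀ i < n, ∀ k < n, lo i < lo k → hi i < hi k) (hle : e ≤ lo j) :
    SlabInv n lo hi (lo j + 1) e (hi j) (Function.update S j e) (Function.update E j (hi j))
      fun x => if hi j < x then hi j else κ x := by
  have hl : ∀ i < n, lo i < lo j + 1 → i ≠ j → lo i < lo j := fun i hi h1 h2 => by
    rcases Nat.lt_succ_iff_lt_or_eq.1 h1 with h | h
    · exact h
    · exact absurd (inj i hi h) h2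
  have hj' := hlt j hj
  refine ⟨fun i hi h' => ?_, fun i hi h' => ?_, fun i hi h' => ?_, fun i hi h' => ?_,
    fun x hx => ?_, by omega, by omega, fun x h1 h2 => ?_, fun x hx => by simp [hx],
    fun i hi h' => (mono j hj i hi (by omega)).le⟩
  · by_cases e : i = j
    · subst e; simpa using ⟨hle, hj'⟩
    · simpa [e] using h.le i hi (hl i hi h' e)
  · by_cases e : i = j
    · subst e
      simp only [Function.update_self]
      intro x h1 h2
      rw [if_neg (by omega)]
      exact h.eq_e x h1
    · simp only [ne_eq, e, not_false_eq_true, Function.update_of_ne]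
      intro x h1 h2
      have := (h.le i hi (hl i hi h' e)).2.2
      have := mono i hi j hj (hl i hi h' e)
      rw [if_neg (by omega)]
      exact h.own i hi (hl i hi h' e) x h1 h2
  · by_cases e : i = j
    · subst e
      simp only [Function.update_self]
      intro x h1 h2
      omega
    · simp only [ne_eq, e, not_false_eq_true, Function.update_of_ne]
      intro x h1 h2
      have := mono i hi j hj (hl i hi h' e)
      rw [if_neg (by omega)]
      exact h.next i hi (hl i hi h' e) x h1 h2
  · by_cases e : i = j
    · subst e
      simp only [Function.update_self]
      intro x hx
      by_contra hc
      rw [if_pos (by omega)] at hx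
      omega
    · simp only [ne_eq, e, not_false_eq_true, Function.update_of_ne]
      intro x hx
      have h1 := h.le i hi (hl i hi h' e)
      have h2 := hl i hi h' e
      split_ifs at hx with hc
      · omega
      · exact h.le_of_eq i hi h2 x hx
  · split_ifs with hc
    · exact hc
    · exact h.lt x hx
  · rw [if_neg (by omega)]
    exact h.eq_e x h1

namespace RealRAM
open HeapTree

/-- Computes the slabs of one dimension, where register `1` holds `n`. -/
def slabProg (ordA rankA SA EA : ℕ) : Prog :=
  (set 35 (nat 0) ;; set 36 (nat 0) ;; set 37 (nat 0)) ;;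
  .while (lt (reg 35) (reg 2))
    (set 38 (arr ordA (reg 35)) ;;
      .ite (lt (reg 38) (reg 1))
        (.ite (lt (reg 35) (reg 37)) .skip
          (set 36 (reg 37) ;; set 37 (arr rankA (reg 1 + reg 38))) ;;
          .storeNat SA (reg 38) (reg 36) ;; .storeNat EA (reg 38) (reg 37)) .skip ;;
      set 35 (reg 35 + nat 1))

/-- Greedy stabbing: going through the lower ends in order, the upper end of the first interval that
is not yet cut becomes a breakpoint. The hypothesis `mono`, that lower and upper ends come in the
same order, ensures that a later interval still contains the last breakpoint whenever it starts
before it, and that no second breakpoint falls inside. -/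
theorem runs_slabProg {α : Type*} [LinearOrder α] {key : ℕ → α} {n ordA rankA SA EA : ℕ}
    {σ : State} (h1 : σ.natReg 1 = n) (h2 : σ.natReg 2 = 2 * n)
    (hs : IsSort (2 * n) key (σ.natArr ordA) (σ.natArr rankA))
    (hlt : ∀ i < n, σ.natArr rankA i < σ.natArr rankA (n + i))
    (mono : ∀ i < n, ∀ j < n, σ.natArr rankA i < σ.natArr rankA j →
      σ.natArr rankA (n + i) < σ.natArr rankA (n + j))
    (d1 : ordA ≠ SA) (d2 : ordA ≠ EA) (d3 : rankA ≠ SA) (d4 : rankA ≠ EA) (d5 : SA ≠ EA) :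
    Runs (slabProg ordA rankA SA EA) σ (100 * (n + 1)) fun τ =>
      ∃ κ, Slabs n (σ.natArr rankA) (fun i => σ.natArr rankA (n + i)) (τ.natArr SA)
        (τ.natArr EA) κ := by
  refine Runs.seq_of (T₁ := 6) (T₂ := 100 * n + 4) (R := fun τ => τ.natReg 35 = 0 ∧
    τ.natReg 36 = 0 ∧ τ.natReg 37 = 0) (Runs.line rfl (by decide) (by simp))
    (fun τ ⟨a, b, c⟩ hF => ?_) (by omega)
  have inj : ∀ i < n, ∀ j < n, σ.natArr rankA i = σ.natArr rankA j → i = j :=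
    fun i hi j hj e => by rw [← hs.ord_rank i (by omega), ← hs.ord_rank j (by omega), e]
  refine Runs.while_of (fun ρ => ρ.natReg 1 = n ∧ ρ.natReg 2 = 2 * n ∧
    ρ.natArr ordA = σ.natArr ordA ∧ ρ.natArr rankA = σ.natArr rankA ∧ ρ.natReg 35 ≤ 2 * n ∧
    ∃ κ, SlabInv n (σ.natArr rankA) (fun i => σ.natArr rankA (n + i)) (ρ.natReg 35)
      (ρ.natReg 36) (ρ.natReg 37) (ρ.natArr SA) (ρ.natArr EA) κ)
    (fun ρ => 2 * n - ρ.natReg 35) 40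
    ⟨by rw [hF.natReg 1 (by decide), h1], by rw [hF.natReg 2 (by decide), h2],
      hF.natArr _ (by simp [Prog.wNA]), hF.natArr _ (by simp [Prog.wNA]), by omega,
      -- Initially `0` is the only breakpoint.
      fun _ => 0, ?_⟩ ?_ ?_ ?_
  · rw [a, b, c]
    exact ⟨by simp, by simp, by simp, by simp, fun x hx => hx, le_rfl, le_rfl,
      fun x _ _ => by omega, fun _ _ => rfl, by simp⟩
  · rintro ρ - ⟨a1, a2, a3, a4, a5, κ, hI⟩ hb
    simp [a2] at hb
    have hid := hs.ord_lt _ hb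
    have hro := hs.rank_ord _ hb
    refine Runs.line rfl (by simp [Prog.maxCost, Test.cost, NatExpr.cost]) ?_
    simp only [Prog.run_seq, Prog.run_setNat, Prog.run_ite, Prog.run_storeNat,
      Prog.run_skip, eval_add, eval_const, eval_reg, eval_arr, holds_lt, setNat_natReg,
      setNat_natArr, a3, a1]
    set j := σ.natArr ordA (ρ.natReg 35) with hj
    norm_num
    by_cases hjn : j < n
    · rw [← hro] at hI
      by_cases hc : ρ.natReg 35 < ρ.natReg 37
      · simp [hjn, hc, a1, a2, a3, a4, d1, d2, d3, d4, d5, d5.symm]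
        refine ⟨⟨by omega, κ, ?_⟩, by omega⟩
        rw [← hro]
        exact hI.same hjn (fun i hi e => inj i hi j hjn e) (by rw [hro]; exact hc)
      · simp [hjn, hc, a1, a2, a3, a4, d1, d2, d3, d4, d5, d5.symm]
        have := hI.new hjn (fun i hi e => inj i hi j hjn e) hlt mono (by rw [hro]; omega)
        rw [hro] at this
        exact ⟨⟨by omega, _, this⟩, by omega⟩
    · simp [hjn, a1, a2, a3, a4]
      refine ⟨⟨by omega, κ, ?_⟩, by omega⟩
      refine hI.skip fun i hi e => hjn ?_
      rw [hj, ← e, hs.ord_rank i (by omega)]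
      exact hi
  · rintro ρ - ⟨a1, a2, a3, a4, a5, κ, hI⟩ hb
    simp [a2] at hb
    have hl : ∀ i < n, σ.natArr rankA i < ρ.natReg 35 := fun i hi => by
      have := hs.rank_lt i (by omega); omega
    exact ⟨κ, fun i hi => hI.le i hi (hl i hi), fun i hi => hI.own i hi (hl i hi),
      fun i hi => hI.next i hi (hl i hi), fun i hi => hI.le_of_eq i hi (hl i hi), hI.lt⟩
  · simp [a, Test.cost, NatExpr.cost]
    omega

/-! ### Cuts -/

/-- Appends the upper coordinates of the cubes to the lower ones. -/
def upperProg : Prog :=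
  set 35 (nat 0) ;; .while (lt (reg 35) (reg 1))
    (.storeReal 0 (reg 1 + reg 35) (.add (.arr 0 (reg 35)) (.reg 0)) ;;
      .storeReal 1 (reg 1 + reg 35) (.add (.arr 1 (reg 35)) (.reg 0)) ;;
      .storeReal 2 (reg 1 + reg 35) (.add (.arr 2 (reg 35)) (.reg 0)) ;;
      set 35 (reg 35 + nat 1))

theorem runs_upperProg {n : ℕ} {σ : State} (h1 : σ.natReg 1 = n) :
    Runs upperProg σ (40 * (n + 1)) fun τ => ∀ d < 3, ∀ i < n,
      τ.realArr d i = σ.realArr d i ∧ τ.realArr d (n + i) = σ.realArr d i + σ.realReg 0 := by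
  refine Runs.seq_of (T₁ := 2) (T₂ := 40 * n + 4) (R := fun τ => τ.natReg 35 = 0)
    (Runs.line rfl (by decide) (by simp)) (fun τ a hF => ?_) (by omega)
  refine Runs.while_of (fun ρ => ρ.natReg 1 = n ∧ ρ.realReg 0 = σ.realReg 0 ∧
    ρ.natReg 35 ≤ n ∧ ∀ d < 3, (∀ i < n, ρ.realArr d i = σ.realArr d i) ∧
      ∀ i < ρ.natReg 35, ρ.realArr d (n + i) = σ.realArr d i + σ.realReg 0)
    (fun ρ => n - ρ.natReg 35) 34
    ⟨by rw [hF.natReg 1 (by decide), h1], hF.realReg 0 (by decide), by omega, fun d hd =>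
      ⟨fun i _ => by rw [hF.realArr d (by simp [Prog.wRA])], fun i hi => by omega⟩⟩ ?_ ?_ ?_
  · rintro ρ - ⟨b1, b2, b3, b4⟩ hb
    simp [b1] at hb
    refine Runs.line rfl (by decide) ?_
    simp [b1, b2, RealExpr.eval]
    refine ⟨⟨by omega, fun d hd => ?_⟩, by omega⟩
    obtain ⟨c1, c2⟩ := b4 d hd
    have step : ∀ f : ℕ → ℝ, f = ρ.realArr d →
        (∀ i < n, Function.update f (n + ρ.natReg 35) (f (ρ.natReg 35) + σ.realReg 0) i =
          σ.realArr d i) ∧ ∀ i < ρ.natReg 35 + 1,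
        Function.update f (n + ρ.natReg 35) (f (ρ.natReg 35) + σ.realReg 0) (n + i) =
          σ.realArr d i + σ.realReg 0 := by
      rintro f rfl
      refine ⟨fun i hi => ?_, fun i hi => ?_⟩
      · rw [Function.update_of_ne (by omega), c1 i hi]
      · by_cases e : i = ρ.natReg 35
        · rw [e, Function.update_self, c1 _ hb]
        · rw [Function.update_of_ne (by omega), c2 i (by omega)]
    interval_cases d <;> simpa using step _ rfl
  · rintro ρ - ⟨b1, b2, b3, b4⟩ hb d hd i hi
    simp [b1] at hb
    exact ⟨(b4 d hd).1 i hi, (b4 d hd).2 i (by omega)⟩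
  · simp [a, Test.cost, NatExpr.cost]
    omega

/-- Compares two coordinates of dimension `d`. -/
def cmpReal (d : ℕ) : Test := .realLt (.arr d (reg 52)) (.arr d (reg 51))

theorem compares_cmpReal (d ordA rankA : ℕ) (σ : State) :
    Compares (cmpReal d) (σ.realArr d) ordA rankA σ := fun τ hτ => by
  simp [cmpReal, RealExpr.eval, hτ.realArr]

section
variable {n : ℕ} {s : ℝ} {v : ℕ → ℝ} {ord rank : ℕ → ℕ}

theorem IsSort.lower_lt_upper (h : IsSort (2 * n) v ord rank) (hs : 0 < s)
    (hv : ∀ i < n, v (n + i) = v i + s) (i : ℕ) (hi : i < n) : rank i < rank (n + i) := by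
  rw [h.rank_lt_rank (by omega) (by omega)]
  exact Prod.Lex.toLex_lt_toLex.2 (.inl (by simp only [hv i hi]; linarith))

/-- Passing to the upper faces adds `s` to all coordinates and `n` to all numbers, which preserves
both the order and the tie-break. This is how the congruence of the cubes enters: it yields the
slabs and, later, that no two pieces of a column are nested in the direction of `y`. -/
theorem IsSort.upper_lt_upper (h : IsSort (2 * n) v ord rank)
    (hv : ∀ i < n, v (n + i) = v i + s) (i : ℕ) (hi : i < n) (j : ℕ) (hj : j < n) :
    rank (n + i) < rank (n + j) ↔ rank i < rank j := by
  rw [h.rank_lt_rank (by omega) (by omega), h.rank_lt_rank (by omega) (by omega)]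
  simp only [lexKey, Prod.Lex.toLex_lt_toLex, hv i hi, hv j hj]
  simp

end

/-! ### Records of the rows -/

/-- The cube that the cut `c` belongs to. -/
def cubeOf (n c : ℕ) : ℕ := if c < n then c else c - n

/-- Appends a block of records with column keys from the arrays `A` and `B`. -/
def recProg (A B : ℕ) : Prog :=
  set 35 (nat 0) ;; .while (lt (reg 35) (reg 2))
    (.ite (lt (reg 35) (reg 1)) (set 36 (reg 35)) (set 36 (reg 35 - reg 1)) ;;
      .storeNat 19 (reg 37) (arr A (reg 36)) ;; .storeNat 20 (reg 37) (arr B (reg 36)) ;;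
      .storeNat 21 (reg 37) (arr 13 (reg 35)) ;; set 37 (reg 37 + nat 1) ;;
      set 35 (reg 35 + nat 1))

theorem runs_recProg {n A B b : ℕ} {σ : State} (hA : A < 19) (hB : B < 19)
    (h1 : σ.natReg 1 = n) (h2 : σ.natReg 2 = 2 * n) (h37 : σ.natReg 37 = b) :
    Runs (recProg A B) σ (100 * (n + 1)) fun τ => τ.natReg 37 = b + 2 * n ∧
      (∀ c < 2 * n, τ.natArr 19 (b + c) = σ.natArr A (cubeOf n c) ∧
        τ.natArr 20 (b + c) = σ.natArr B (cubeOf n c) ∧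
        τ.natArr 21 (b + c) = σ.natArr 13 c) ∧
      ∀ c < b, τ.natArr 19 c = σ.natArr 19 c ∧ τ.natArr 20 c = σ.natArr 20 c ∧
        τ.natArr 21 c = σ.natArr 21 c := by
  refine Runs.seq_of (T₁ := 2) (T₂ := 100 * n + 4) (R := fun τ => τ.natReg 35 = 0)
    (Runs.line rfl (by decide) (by simp)) (fun τ a hF => ?_) (by omega)
  have e37 : τ.natReg 37 = b := by rw [hF.natReg _ (by decide), h37]
  have eA : ∀ a, τ.natArr a = σ.natArr a := fun a => hF.natArr _ (by simp [Prog.wNA])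
  refine Runs.while_of (fun ρ => ρ.natReg 1 = n ∧ ρ.natReg 2 = 2 * n ∧
    ρ.natArr A = σ.natArr A ∧ ρ.natArr B = σ.natArr B ∧ ρ.natArr 13 = σ.natArr 13 ∧
    ρ.natReg 35 ≤ 2 * n ∧ ρ.natReg 37 = b + ρ.natReg 35 ∧
    (∀ c < ρ.natReg 35, ρ.natArr 19 (b + c) = σ.natArr A (cubeOf n c) ∧
        ρ.natArr 20 (b + c) = σ.natArr B (cubeOf n c) ∧
        ρ.natArr 21 (b + c) = σ.natArr 13 c) ∧
    ∀ c < b, ρ.natArr 19 c = σ.natArr 19 c ∧ ρ.natArr 20 c = σ.natArr 20 c ∧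
        ρ.natArr 21 c = σ.natArr 21 c) (fun ρ => 2 * n - ρ.natReg 35) 44
    ⟨by rw [hF.natReg 1 (by decide), h1], by rw [hF.natReg 2 (by decide), h2], eA A, eA B, eA 13,
      by omega, by omega, fun c hc => by omega, fun c _ => by simp [eA]⟩ ?_ ?_ ?_
  · rintro ρ - ⟨b1, b2, b3, b4, b5, b6, b7, b8, b9⟩ hb
    simp [b2] at hb
    refine (Runs.seq_of (T₁ := 10) (R := fun τ => τ = ρ.setNat 36 (cubeOf n (ρ.natReg 35)))
      (Runs.line rfl (by decide) ?_) (fun τ hτ _ => Runs.line (T := 34) rfl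
        (by simp [Prog.maxCost, NatExpr.cost]) ?_)) (by omega)
    · simp only [Prog.run_ite, holds_lt, eval_reg, b1, Prog.run_setNat, eval_sub, cubeOf]
      split_ifs <;> rfl
    · have n1 : A ≠ 19 := by omega
      have n2 : A ≠ 20 := by omega
      have n3 : A ≠ 21 := by omega
      have n4 : B ≠ 19 := by omega
      have n5 : B ≠ 20 := by omega
      have n6 : B ≠ 21 := by omega
      subst hτ
      simp [b1, b2, b3, b4, b5, b7, n1, n2, n3, n4, n5, n6]
      refine ⟨⟨by omega, by omega, fun c hc => ?_, fun c hc => ?_⟩, by omega⟩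
      · by_cases e : c = ρ.natReg 35
        · simp [e]
        · simpa [e] using b8 c (by omega)
      · have e : c ≠ b + ρ.natReg 35 := by omega
        simpa [e] using b9 c hc
  · rintro ρ - ⟨b1, b2, b3, b4, b5, b6, b7, b8, b9⟩ hb
    simp [b2] at hb
    exact ⟨by omega, fun c hc => b8 c (by omega), b9⟩
  · simp [a, Test.cost, NatExpr.cost]
    omega

/-- The disjunction of two tests. -/
abbrev tor (b c : Test) : Test := .not (.and (.not b) (.not c))

/-- Compares two records: by the column, then by the row. -/
def cmpRec : Test :=
  tor (lt (arr 19 (reg 52)) (arr 19 (reg 51))) (.and (le (arr 19 (reg 52)) (arr 19 (reg 51)))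
    (tor (lt (arr 20 (reg 52)) (arr 20 (reg 51))) (.and (le (arr 20 (reg 52)) (arr 20 (reg 51)))
      (lt (arr 21 (reg 52)) (arr 21 (reg 51))))))

/-- The key of a record. -/
def recKey (X Z Y : ℕ → ℕ) (c : ℕ) : ℕ ×ₗ ℕ ×ₗ ℕ := toLex (X c, toLex (Z c, Y c))

theorem recKey_lt {X Z Y : ℕ → ℕ} {c d : ℕ} : recKey X Z Y c < recKey X Z Y d ↔
    X c < X d ∨ X c = X d ∧ (Z c < Z d ∨ Z c = Z d ∧ Y c < Y d) := by
  simp [recKey, Prod.Lex.toLex_lt_toLex]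

theorem compares_cmpRec (σ : State) :
    Compares cmpRec (recKey (σ.natArr 19) (σ.natArr 20) (σ.natArr 21)) 22 23 σ := fun τ hτ => by
  simp only [cmpRec, holds_not, holds_and, holds_lt, eval_arr, eval_reg, recKey_lt,
    hτ.natArr 19 (by simp), hτ.natArr 20 (by simp), hτ.natArr 21 (by simp)]
  omega

end RealRAM


/-! ### Sorted cuts in the three dimensions -/

namespace RealRAM
open HeapTree

/-- The cuts of all dimensions have been sorted. -/
structure Cuts (n K : ℕ) (s : ℝ) (p : Fin n → Fin 3 → ℝ) (σ : State) : Prop where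
  reg1 : σ.natReg 1 = n
  reg2 : σ.natReg 2 = 2 * n
  tree : TreeAt K σ
  size : 8 * n + 2 ≤ 2 ^ K
  size_lt : 2 ^ K < 2 * (8 * n + 2)
  lower : ∀ (d : Fin 3) (i : Fin n), σ.realArr d i = p i d
  upper : ∀ d < 3, ∀ i < n, σ.realArr d (n + i) = σ.realArr d i + s
  sorted : ∀ d < 3, IsSort (2 * n) (σ.realArr d) (σ.natArr (9 + d)) (σ.natArr (12 + d))

theorem Cuts.congr {n K : ℕ} {s : ℝ} {p : Fin n → Fin 3 → ℝ} {σ τ : State} (h : Cuts n K s p σ)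
    (h1 : ∀ r ∈ [1, 2, 3], τ.natReg r = σ.natReg r)
    (h2 : ∀ a ∈ [6, 7, 9, 10, 11, 12, 13, 14], τ.natArr a = σ.natArr a)
    (h3 : ∀ a ∈ [0, 1, 2], τ.realArr a = σ.realArr a) : Cuts n K s p τ := by
  have h3' : ∀ d < 3, τ.realArr d = σ.realArr d := fun d hd => h3 d (by
    interval_cases d <;> simp)
  refine ⟨by rw [h1 1 (by simp), h.reg1], by rw [h1 2 (by simp), h.reg2],
    ⟨by rw [h1 3 (by simp), h.tree.size], by rw [h2 6 (by simp)]; exact h.tree.par,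
      by rw [h2 7 (by simp)]; exact h.tree.first⟩, h.size, h.size_lt,
    fun d i => by rw [h3' d d.2, h.lower],
    fun d hd => by rw [h3' d hd]; exact h.upper d hd, fun d hd => ?_⟩
  rw [h3' d hd, h2 (9 + d) (by interval_cases d <;> simp),
    h2 (12 + d) (by interval_cases d <;> simp)]
  exact h.sorted d hd

/-- Sorts the cuts of all dimensions. -/
def cutProg : Prog :=
  treeProg ;; upperProg ;; set 49 (reg 2) ;; sortProg (cmpReal 0) 9 12 ;;
    sortProg (cmpReal 1) 10 13 ;; sortProg (cmpReal 2) 11 14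

theorem TreeAt.congr {K : ℕ} {σ τ : State} (h : TreeAt K σ) (h3 : τ.natReg 3 = σ.natReg 3)
    (h6 : τ.natArr 6 = σ.natArr 6) (h7 : τ.natArr 7 = σ.natArr 7) : TreeAt K τ :=
  ⟨by rw [h3, h.size], by rw [h6]; exact h.par, by rw [h7]; exact h.first⟩

theorem runs_cutProg {n : ℕ} {s : ℝ} (p : Fin n → Fin 3 → ℝ) :
    Runs cutProg (cubesInput s p) (4000 * (n + 1) * (Nat.log 2 (16 * n + 4) + 1) * 16)
      fun τ => ∃ K, K ≤ Nat.log 2 (16 * n + 4) ∧ Cuts n K s p τ ∧ τ.natReg 0 = 0 := by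
  set L := Nat.log 2 (16 * n + 4) with hL
  have hnL : n + 1 ≤ (n + 1) * (L + 1) := Nat.le_mul_of_pos_right _ (by omega)
  have e0 : 4000 * (n + 1) * (L + 1) * 16 = 64000 * ((n + 1) * (L + 1)) := by ring
  rw [e0]
  refine Runs.seq_of (T₂ := 60000 * ((n + 1) * (L + 1))) (runs_treeProg (cubesInput s p) n
    (by simp [cubesInput]) (by simp [cubesInput]))
    (fun σ ⟨K, hT, hK, hK', a0, a1, a2⟩ hF => ?_) (by omega)
  -- From `2 ^ K < 2 * (8 * n + 2)`; it ties the depth of the trees to the logarithm in the time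
  -- bound.
  have hKL : K ≤ L := by
    rw [hL]
    exact Nat.le_log_of_pow_le (by norm_num) (by omega)
  have hr : ∀ a, σ.realArr a = (cubesInput s p).realArr a := fun a =>
    hF.realArr a (by simp [Prog.wRA, treeProg, countProg, sizeProg, parProg, firstProg])
  have hs : σ.realReg 0 = s := by
    rw [hF.realReg 0 (by decide)]; simp [cubesInput]
  refine Runs.seq_of (T₂ := 50000 * ((n + 1) * (L + 1))) (runs_upperProg a1)
    (fun τ hτ hF1 => ?_) (by omega)
  rw [hs] at hτ
  refine Runs.seq_of (T₁ := 2) (T₂ := 49000 * ((n + 1) * (L + 1))) (R := fun ρ => ρ.natReg 49 = 2 * n)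
    (Runs.line rfl (by decide) (by simp [hF1.natReg 2 (by decide), a2]))
    (fun ρ h49 hF2 => ?_) (by omega)
  have hTρ : TreeAt K ρ := hT.congr
    (by rw [hF2.natReg _ (by decide), hF1.natReg _ (by decide)])
    (by rw [hF2.natArr _ (by decide), hF1.natArr _ (by decide)])
    (by rw [hF2.natArr _ (by decide), hF1.natArr _ (by decide)])
  have hreal : ∀ d, ρ.realArr d = τ.realArr d := fun d => hF2.realArr d (by simp [Prog.wRA])
  have cost : ∀ d, 4 * 2 ^ K * (K + 1) * ((cmpReal d).cost + 60) ≤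
      16000 * ((n + 1) * (L + 1)) := fun d => by
    have : (cmpReal d).cost = 5 := rfl
    rw [this]
    have : 2 ^ K * (K + 1) ≤ (2 * (8 * n + 2)) * (L + 1) := Nat.mul_le_mul hK'.le (by omega)
    have e : 4 * 2 ^ K * (K + 1) * (5 + 60) = 260 * (2 ^ K * (K + 1)) := by ring
    have e' : 16 * ((n + 1) * (L + 1)) = 2 * (8 * n + 2) * (L + 1) + 12 * (L + 1) := by ring
    rw [e]
    omega
  refine Runs.seq_of (T₁ := 16000 * ((n + 1) * (L + 1))) (T₂ := 33000 * ((n + 1) * (L + 1)))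
    ((runs_sortProg (by norm_num) (by norm_num) (by norm_num) (compares_cmpReal 0 9 12 ρ) hTρ
      (m := 2 * n) (by omega) h49).mono (cost 0) fun _ h => h) (fun σ1 h1 hG1 => ?_) (by omega)
  have hT1 : TreeAt K σ1 := hTρ.congr (hG1.natReg _ (by decide)) (hG1.natArr _ (by decide))
    (hG1.natArr _ (by decide))
  have hreal1 : ∀ d, σ1.realArr d = τ.realArr d := fun d => by
    rw [hG1.realArr d (by simp [sortProg, buildWin, popWin, pullWin, climbProg, Prog.wRA]), hreal]
  refine Runs.seq_of (T₁ := 16000 * ((n + 1) * (L + 1))) (T₂ := 16000 * ((n + 1) * (L + 1)))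
    ((runs_sortProg (by norm_num) (by norm_num) (by norm_num) (compares_cmpReal 1 10 13 σ1) hT1
      (m := 2 * n) (by omega) (by rw [hG1.natReg _ (by decide), h49])).mono (cost 1)
      fun _ h => h) (fun σ2 h2 hG2 => ?_) (by omega)
  have hT2 : TreeAt K σ2 := hT1.congr (hG2.natReg _ (by decide)) (hG2.natArr _ (by decide))
    (hG2.natArr _ (by decide))
  have hreal2 : ∀ d, σ2.realArr d = τ.realArr d := fun d => by
    rw [hG2.realArr d (by simp [sortProg, buildWin, popWin, pullWin, climbProg, Prog.wRA]), hreal1]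
  refine (runs_sortProg (by norm_num) (by norm_num) (by norm_num) (compares_cmpReal 2 11 14 σ2) hT2
      (m := 2 * n) (by omega) (by rw [hG2.natReg _ (by decide), hG1.natReg _ (by decide),
        h49])).frame.mono (cost 2) fun σ3 ⟨h3, hG3⟩ => ⟨K, hKL, ⟨?_, ?_, ?_, hK, hK', ?_, ?_, ?_⟩, ?_⟩
  · rw [hG3.natReg _ (by decide), hG2.natReg _ (by decide), hG1.natReg _ (by decide),
      hF2.natReg _ (by decide), hF1.natReg _ (by decide), a1]
  · rw [hG3.natReg _ (by decide), hG2.natReg _ (by decide), hG1.natReg _ (by decide),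
      hF2.natReg _ (by decide), hF1.natReg _ (by decide), a2]
  · exact hT2.congr (hG3.natReg _ (by decide)) (hG3.natArr _ (by decide))
      (hG3.natArr _ (by decide))
  · intro d i
    rw [hG3.realArr d (by simp [sortProg, buildWin, popWin, pullWin, climbProg, Prog.wRA]),
      hreal2, (hτ d d.2 i i.2).1, hr]
    simp [cubesInput]
  · intro d hd i hi
    rw [hG3.realArr d (by simp [sortProg, buildWin, popWin, pullWin, climbProg, Prog.wRA]),
      hreal2, (hτ d hd i hi).2, (hτ d hd i hi).1]
  · intro d hd
    rw [hG3.realArr d (by simp [sortProg, buildWin, popWin, pullWin, climbProg, Prog.wRA]),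
      hreal2]
    interval_cases d
    · rw [hreal] at h1
      rw [hG3.natArr _ (by decide), hG2.natArr _ (by decide), hG3.natArr _ (by decide),
        hG2.natArr _ (by decide)]
      exact h1
    · rw [hreal1] at h2
      rw [hG3.natArr _ (by decide), hG3.natArr _ (by decide)]
      exact h2
    · rw [hreal2] at h3
      exact h3
  · rw [hG3.natReg _ (by decide), hG2.natReg _ (by decide), hG1.natReg _ (by decide),
      hF2.natReg _ (by decide), hF1.natReg _ (by decide), a0]

/-! ### The layout of the rows -/

/-- The kind of a piece of a cube. In the direction of `x` it reaches from the beginning of a slab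
(`side = false`) or to the end of a slab (`side = true`); in the direction of `z` it reaches to the
end of a slab (`down = false`) or from the beginning of a slab (`down = true`). -/
structure Kind where
  down : Bool
  side : Bool
deriving DecidableEq

/-- The number of a kind. -/
def Kind.num : Kind → ℕ
  | ⟨false, false⟩ => 0
  | ⟨false, true⟩ => 1
  | ⟨true, false⟩ => 2
  | ⟨true, true⟩ => 3

/-- The array of the `x`-slabs that contain the pieces of a kind. -/
def Kind.arrX (q : Kind) : ℕ := if q.side then 15 else 16

/-- The array of the `z`-slabs that contain the pieces of a kind. -/
def Kind.arrZ (q : Kind) : ℕ := if q.down then 18 else 17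

/-- The row structure has been set up. -/
structure Setup (n K : ℕ) (s : ℝ) (p : Fin n → Fin 3 → ℝ) (σ : State) : Prop
    extends Cuts n K s p σ where
  slabX : ∃ κ, Slabs n (σ.natArr 12) (fun i => σ.natArr 12 (n + i)) (σ.natArr 15) (σ.natArr 16) κ
  slabZ : ∃ κ, Slabs n (σ.natArr 14) (fun i => σ.natArr 14 (n + i)) (σ.natArr 17) (σ.natArr 18) κ
  recs : ∀ (q : Kind), ∀ c < 2 * n,
    σ.natArr 19 (q.num * (2 * n) + c) = σ.natArr q.arrX (cubeOf n c) ∧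
    σ.natArr 20 (q.num * (2 * n) + c) = σ.natArr q.arrZ (cubeOf n c) ∧
    σ.natArr 21 (q.num * (2 * n) + c) = σ.natArr 13 c
  rows : IsSort (8 * n) (recKey (σ.natArr 19) (σ.natArr 20) (σ.natArr 21)) (σ.natArr 22)
    (σ.natArr 23)

/-- Sets up the row structure. -/
def layoutProg : Prog :=
  slabProg 9 12 15 16 ;; slabProg 11 14 17 18 ;; set 37 (nat 0) ;; recProg 16 17 ;;
    recProg 15 17 ;; recProg 16 18 ;; recProg 15 18 ;; set 49 (reg 2 + reg 2 + reg 2 + reg 2) ;;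
    sortProg cmpRec 22 23

/-- Each of the `4 n` pieces contributes two records, its ends in the direction of `y`, keyed by its
column. After sorting by column and then by `y`, the records of a column are contiguous and serve
the four kinds in common, so the pieces of all kinds occupy intervals of the same list of rows. -/
theorem runs_layoutProg {n K : ℕ} {s : ℝ} {p : Fin n → Fin 3 → ℝ} {σ : State} (hs : 0 < s)
    (h : Cuts n K s p σ) :
    Runs layoutProg σ (10000 * (n + 1) * (K + 1)) fun τ => Setup n K s p τ := by
  have hnL : n + 1 ≤ (n + 1) * (K + 1) := Nat.le_mul_of_pos_right _ (by omega)
  have e0 : 10000 * (n + 1) * (K + 1) = 10000 * ((n + 1) * (K + 1)) := by ring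
  rw [e0]
  refine Runs.seq_of (T₂ := 9900 * ((n + 1) * (K + 1))) (runs_slabProg h.reg1 h.reg2
    (h.sorted 0 (by norm_num)) ((h.sorted 0 (by norm_num)).lower_lt_upper hs (h.upper 0 (by norm_num)))
    (fun i hi j hj => ((h.sorted 0 (by norm_num)).upper_lt_upper (h.upper 0 (by norm_num)) i hi j hj).2)
    (by norm_num) (by norm_num) (by norm_num) (by norm_num) (by norm_num))
    (fun σ1 ⟨κx, hx⟩ hF1 => ?_) (by omega)
  have h1 : Cuts n K s p σ1 := h.congr (fun r hr => hF1.natReg r (by revert r; decide))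
    (fun a ha => hF1.natArr a (by revert a; decide)) (fun a ha => hF1.realArr a (by revert a; decide))
  refine Runs.seq_of (T₂ := 9800 * ((n + 1) * (K + 1))) (runs_slabProg h1.reg1 h1.reg2
    (h1.sorted 2 (by norm_num)) ((h1.sorted 2 (by norm_num)).lower_lt_upper hs (h1.upper 2 (by norm_num)))
    (fun i hi j hj => ((h1.sorted 2 (by norm_num)).upper_lt_upper (h1.upper 2 (by norm_num)) i hi j hj).2)
    (by norm_num) (by norm_num) (by norm_num) (by norm_num) (by norm_num))
    (fun σ2 ⟨κz, hz⟩ hF2 => ?_) (by omega)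
  refine Runs.seq_of (T₁ := 2) (R := fun ρ => ρ.natReg 37 = 0) (T₂ := 9700 * ((n + 1) * (K + 1)))
    (Runs.line rfl (by decide) (by simp)) (fun σ3 a37 hF3 => ?_) (by omega)
  have h3 : Cuts n K s p σ3 := h1.congr
    (fun r hr => by rw [hF3.natReg r (by revert r; decide), hF2.natReg r (by revert r; decide)])
    (fun r hr => by rw [hF3.natArr r (by revert r; decide), hF2.natArr r (by revert r; decide)])
    (fun r hr => by rw [hF3.realArr r (by revert r; decide), hF2.realArr r (by revert r; decide)])
  have rec1 := fun σ (hσ : Cuts n K s p σ) A B b hA hB h37 =>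
    (runs_recProg (σ := σ) (A := A) (B := B) (b := b) hA hB hσ.reg1 hσ.reg2 h37)
  have cg : ∀ {A B : ℕ} {σ τ : State}, Cuts n K s p σ → Frame (recProg A B) σ τ →
      Cuts n K s p τ := fun hσ hF => hσ.congr (fun r hr => hF.natReg r (by simp [recProg, Prog.wN]; revert r; decide))
    (fun a ha => hF.natArr a (by simp [recProg, Prog.wNA]; revert a; decide))
    (fun a ha => hF.realArr a (by simp [recProg, Prog.wRA]))
  have ar : ∀ {A B : ℕ} {σ τ : State}, Frame (recProg A B) σ τ → ∀ a ∈ [12, 13, 14, 15, 16, 17, 18],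
      τ.natArr a = σ.natArr a := fun hF a ha =>
    hF.natArr a (by simp [recProg, Prog.wNA]; revert a; decide)
  refine Runs.seq_of (T₂ := 9600 * ((n + 1) * (K + 1))) (rec1 σ3 h3 16 17 _ (by norm_num)
    (by norm_num) a37) (fun σ4 ⟨r1, r2, r3⟩ G1 => ?_) (by omega)
  have h4 := cg h3 G1
  refine Runs.seq_of (T₂ := 9500 * ((n + 1) * (K + 1))) (rec1 σ4 h4 15 17 _ (by norm_num)
    (by norm_num) r1) (fun σ5 ⟨s1, s2, s3⟩ G2 => ?_) (by omega)
  have h5 := cg h4 G2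
  refine Runs.seq_of (T₂ := 9400 * ((n + 1) * (K + 1))) (rec1 σ5 h5 16 18 _ (by norm_num)
    (by norm_num) s1) (fun σ6 ⟨t1, t2, t3⟩ G3 => ?_) (by omega)
  have h6 := cg h5 G3
  refine Runs.seq_of (T₂ := 9300 * ((n + 1) * (K + 1))) (rec1 σ6 h6 15 18 _ (by norm_num)
    (by norm_num) t1) (fun σ7 ⟨u1, u2, u3⟩ G4 => ?_) (by omega)
  have h7 := cg h6 G4
  refine Runs.seq_of (T₁ := 8) (R := fun ρ => ρ.natReg 49 = 8 * n) (T₂ := 9200 * ((n + 1) * (K + 1)))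
    (Runs.line rfl (by decide) (by simp [h7.reg2]; omega)) (fun σ8 a49 hF8 => ?_) (by omega)
  have h8 : Cuts n K s p σ8 := h7.congr (fun r hr => hF8.natReg r (by revert r; decide))
    (fun a ha => hF8.natArr a (by simp [Prog.wNA])) (fun a ha => hF8.realArr a (by simp [Prog.wRA]))
  have cost : 4 * 2 ^ K * (K + 1) * (cmpRec.cost + 60) ≤ 9200 * ((n + 1) * (K + 1)) := by
    have e1 : cmpRec.cost = 37 := rfl
    rw [e1]
    have : 2 ^ K * (K + 1) ≤ (2 * (8 * n + 2)) * (K + 1) := Nat.mul_le_mul h.size_lt.le (by omega)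
    have e : 4 * 2 ^ K * (K + 1) * (37 + 60) = 388 * (2 ^ K * (K + 1)) := by ring
    have e' : 16 * ((n + 1) * (K + 1)) = 2 * (8 * n + 2) * (K + 1) + 12 * (K + 1) := by ring
    rw [e]
    omega
  refine ((runs_sortProg (by norm_num) (by norm_num) (by norm_num) (compares_cmpRec σ8) h8.tree
    (m := 8 * n) (by have := h.size; omega) a49).frame.mono cost) fun σ9 ⟨hs9, hF9⟩ => ?_
  have h9 : Cuts n K s p σ9 := h8.congr (fun r hr => hF9.natReg r (by revert r; decide))
    (fun a ha => hF9.natArr a (by revert a; decide)) (fun a ha => hF9.realArr a (by revert a; decide))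
  have m49 : ∀ a ∈ [12, 13, 14, 15, 16, 17, 18, 19, 20, 21], σ9.natArr a = σ7.natArr a :=
    fun a ha => by rw [hF9.natArr a (by revert a; decide), hF8.natArr a (by simp [Prog.wNA])]
  have m4 : ∀ a ∈ [12, 13, 14, 15, 16, 17, 18], σ9.natArr a = σ3.natArr a := fun a ha => by
    rw [m49 a (by revert a; decide), ar G4 a ha, ar G3 a ha, ar G2 a ha, ar G1 a ha]
  have m41 : ∀ a ∈ [12, 13, 14, 15, 16, 17, 18], σ3.natArr a = σ9.natArr a := fun a ha =>
    (m4 a ha).symm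
  have m42 : ∀ a ∈ [12, 13, 14, 15, 16, 17, 18], σ4.natArr a = σ9.natArr a := fun a ha => by
    rw [m4 a ha, ar G1 a ha]
  have m43 : ∀ a ∈ [12, 13, 14, 15, 16, 17, 18], σ5.natArr a = σ9.natArr a := fun a ha => by
    rw [ar G2 a ha, m42 a ha]
  have m44 : ∀ a ∈ [12, 13, 14, 15, 16, 17, 18], σ6.natArr a = σ9.natArr a := fun a ha => by
    rw [ar G3 a ha, m43 a ha]
  refine ⟨h9, ⟨κx, ?_⟩, ⟨κz, ?_⟩, fun q c hc => ?_, ?_⟩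
  · rw [m4 12 (by decide), m4 15 (by decide), m4 16 (by decide), hF3.natArr 12 (by decide),
      hF3.natArr 15 (by decide), hF3.natArr 16 (by decide), hF2.natArr 12 (by decide),
      hF2.natArr 15 (by decide), hF2.natArr 16 (by decide), hF1.natArr 12 (by decide)]
    exact hx
  · rw [m4 14 (by decide), m4 17 (by decide), m4 18 (by decide), hF3.natArr 14 (by decide),
      hF3.natArr 17 (by decide), hF3.natArr 18 (by decide), hF2.natArr 14 (by decide)]
    exact hz
  · rw [m49 19 (by decide), m49 20 (by decide), m49 21 (by decide)]
    obtain ⟨_ | _, _ | _⟩ := q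
    · simp only [Kind.num, Kind.arrX, Kind.arrZ]
      obtain ⟨x1, x2, x3⟩ := r2 c hc
      rw [m41 _ (by decide), Nat.zero_add] at x1 x2 x3
      rw [Nat.zero_mul, Nat.zero_add, (u3 c (by omega)).1, (u3 c (by omega)).2.1,
        (u3 c (by omega)).2.2, (t3 c (by omega)).1, (t3 c (by omega)).2.1, (t3 c (by omega)).2.2,
        (s3 c (by omega)).1, (s3 c (by omega)).2.1, (s3 c (by omega)).2.2]
      exact ⟨x1, x2, x3⟩
    · simp only [Kind.num, Kind.arrX, Kind.arrZ]
      obtain ⟨x1, x2, x3⟩ := s2 c hc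
      rw [m42 _ (by decide)] at x1 x2 x3
      have e : 1 * (2 * n) + c = 0 + 2 * n + c := by ring
      rw [e, (u3 _ (by omega)).1, (u3 _ (by omega)).2.1,
        (u3 _ (by omega)).2.2, (t3 _ (by omega)).1, (t3 _ (by omega)).2.1, (t3 _ (by omega)).2.2]
      exact ⟨x1, x2, x3⟩
    · simp only [Kind.num, Kind.arrX, Kind.arrZ]
      obtain ⟨x1, x2, x3⟩ := t2 c hc
      rw [m43 _ (by decide)] at x1 x2 x3
      have e : 2 * (2 * n) + c = 0 + 2 * n + 2 * n + c := by ring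
      rw [e, (u3 _ (by omega)).1, (u3 _ (by omega)).2.1, (u3 _ (by omega)).2.2]
      exact ⟨x1, x2, x3⟩
    · simp only [Kind.num, Kind.arrX, Kind.arrZ]
      obtain ⟨x1, x2, x3⟩ := u2 c hc
      rw [m44 _ (by decide)] at x1 x2 x3
      have e : 3 * (2 * n) + c = 0 + 2 * n + 2 * n + 2 * n + c := by ring
      rw [e]
      exact ⟨x1, x2, x3⟩
  · rw [hF9.natArr 19 (by decide), hF9.natArr 20 (by decide), hF9.natArr 21 (by decide)]
    exact hs9

end RealRAM


namespace RealRAM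
open HeapTree

/-! ### Updating a tree

The tree number `k` keeps its tags and aggregates in the arrays `24 + k`, `28 + k`, `32 + k`; the
array `36 + k` is its log. -/

/-- Recomputes the aggregates at the node in register `48`. -/
def pullNode (k : ℕ) : Prog :=
  .ite (lt (reg 48) (reg 3))
    (.storeNat (28 + k) (reg 48) (emax (arr (24 + k) (reg 48))
        (emin (arr (28 + k) (reg 48 + reg 48)) (arr (28 + k) (reg 48 + reg 48 + nat 1)))) ;;
      .storeNat (32 + k) (reg 48) (emax (arr (24 + k) (reg 48))
        (emax (arr (32 + k) (reg 48 + reg 48)) (arr (32 + k) (reg 48 + reg 48 + nat 1)))))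
    (.storeNat (28 + k) (reg 48) (arr (24 + k) (reg 48)) ;;
      .storeNat (32 + k) (reg 48) (arr (24 + k) (reg 48)))

/-- Sets the tag of the node in register `48` to `e`, after saving the old tag in the log. -/
def actNode (k : ℕ) (e : NatExpr) : Prog :=
  (set 57 e ;; .storeNat (36 + k) (reg 5 + reg 48) (arr (24 + k) (reg 48)) ;;
    .storeNat (24 + k) (reg 48) (reg 57)) ;; pullNode k

/-- The test whether the node in register `r` is a right child. -/
def isRight (r : ℕ) : Test := lt (arr 6 (reg r) + arr 6 (reg r)) (reg r)

/-- Changes the tags of the maximal nodes between the leaves in registers `46` and `47`. -/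
def actsProg (k : ℕ) (e : NatExpr) : Prog :=
  .while (lt (nat 1) (reg 46))
    (.ite (.and (lt (reg 46 + nat 1) (reg 47)) (.not (isRight 46)))
        (set 48 (reg 46 + nat 1) ;; actNode k e) .skip ;;
      .ite (.and (lt (reg 46 + nat 1) (reg 47)) (isRight 47))
        (set 48 (reg 47 - nat 1) ;; actNode k e) .skip ;;
      set 46 (arr 6 (reg 46)) ;; set 47 (arr 6 (reg 47)))

/-- Changes the tags of the maximal nodes between the leaves in registers `55` and `56`, and
repairs the aggregates. -/
def updProg (k : ℕ) (e : NatExpr) : Prog :=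
  (set 46 (reg 55) ;; set 47 (reg 56)) ;; actsProg k e ;;
    set 48 (reg 55) ;; climbProg 48 (pullNode k) ;; set 48 (reg 56) ;; climbProg 48 (pullNode k)

theorem AggAt_update {K : ℕ} {tag mn mx : ℕ → ℕ} {u v x y z : ℕ} (h : AggAt K tag mn mx u)
    (h1 : u ≠ v) (h2 : u ≠ v / 2) :
    AggAt K (Function.update tag v x) (Function.update mn v y) (Function.update mx v z) u := by
  refine ⟨fun hu => ?_, fun hu => ?_⟩
  · simpa [h1] using h.leaf hu
  · have a : u + u ≠ v := by omega
    have b : u + u + 1 ≠ v := by omega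
    simpa [h1, a, b] using h.node hu

/-- The predicate that the aggregates of tree `k` at node `u` are up to date. -/
def AggOk (K k : ℕ) (σ : State) (u : ℕ) : Prop :=
  AggAt K (σ.natArr (24 + k)) (σ.natArr (28 + k)) (σ.natArr (32 + k)) u

theorem runs_pullNode {k K v : ℕ} {σ : State} (h3 : σ.natReg 3 = 2 ^ K) (hv : σ.natReg 48 = v)
    (hv0 : 0 < v) :
    Runs (pullNode k) σ 60 fun τ => τ.natReg = σ.natReg ∧ AggOk K k τ v ∧
      (∀ u, u ≠ v → u ≠ v / 2 → AggOk K k σ u → AggOk K k τ u) ∧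
      τ.natArr (24 + k) = σ.natArr (24 + k) := by
  have n1 : 24 + k ≠ 28 + k := by omega
  have n2 : 24 + k ≠ 32 + k := by omega
  have n3 : 28 + k ≠ 32 + k := by omega
  have hne1 : v + v ≠ v := by omega
  have hne2 : v + v + 1 ≠ v := by omega
  have key : ∀ x y, AggAt K (σ.natArr (24 + k)) (Function.update (σ.natArr (28 + k)) v x)
      (Function.update (σ.natArr (32 + k)) v y) v → ∀ τ : State, τ.natReg = σ.natReg →
      τ.natArr (24 + k) = σ.natArr (24 + k) →
      τ.natArr (28 + k) = Function.update (σ.natArr (28 + k)) v x →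
      τ.natArr (32 + k) = Function.update (σ.natArr (32 + k)) v y →
      τ.natReg = σ.natReg ∧ AggOk K k τ v ∧
      (∀ u, u ≠ v → u ≠ v / 2 → AggOk K k σ u → AggOk K k τ u) ∧
      τ.natArr (24 + k) = σ.natArr (24 + k) := by
    intro x y hxy τ e1 e2 e3 e4
    refine ⟨e1, by rw [AggOk, e2, e3, e4]; exact hxy, fun u h1 h2 h => ?_, e2⟩
    have := AggAt_update (x := σ.natArr (24 + k) v) (y := x) (z := y) h h1 h2
    rw [Function.update_eq_self] at this
    rwa [AggOk, e2, e3, e4]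
  refine Runs.line rfl (by simp [pullNode, Prog.maxCost, Test.cost, NatExpr.cost, emax, emin]) ?_
  by_cases hlt : v < 2 ^ K
  · refine key (max (σ.natArr (24 + k) v) (min (σ.natArr (28 + k) (v + v))
      (σ.natArr (28 + k) (v + v + 1)))) (max (σ.natArr (24 + k) v) (max (σ.natArr (32 + k) (v + v))
      (σ.natArr (32 + k) (v + v + 1)))) ⟨fun h => by omega, fun _ => ?_⟩ _ ?_ ?_ ?_ ?_
    · simp [hne2, hv0.ne']
    all_goals simp [pullNode, h3, hv, hlt, n1, n2, n3, n1.symm, n2.symm, n3.symm]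
  · refine key (σ.natArr (24 + k) v) (σ.natArr (24 + k) v)
      ⟨fun _ => by simp, fun h => by omega⟩ _ ?_ ?_ ?_ ?_
    all_goals simp [pullNode, h3, hv, hlt, n1, n2, n3, n1.symm, n2.symm, n3.symm]

theorem runs_actNode {k K v st x : ℕ} {e : NatExpr} {σ : State} (h3 : σ.natReg 3 = 2 ^ K)
    (hv : σ.natReg 48 = v) (hv0 : 0 < v) (h5 : σ.natReg 5 = st) (he : e.eval σ = x) :
    Runs (actNode k e) σ (e.cost + 70) fun τ => (∀ r, r ≠ 57 → τ.natReg r = σ.natReg r) ∧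
      AggOk K k τ v ∧ (∀ u, u ≠ v → u ≠ v / 2 → AggOk K k σ u → AggOk K k τ u) ∧
      τ.natArr (24 + k) = Function.update (σ.natArr (24 + k)) v x ∧
      τ.natArr (36 + k) = Function.update (σ.natArr (36 + k)) (st + v) (σ.natArr (24 + k) v) := by
  have n1 : 36 + k ≠ 24 + k := by omega
  have n2 : 28 + k ≠ 24 + k := by omega
  have n3 : 28 + k ≠ 36 + k := by omega
  have n4 : 32 + k ≠ 24 + k := by omega
  have n5 : 32 + k ≠ 36 + k := by omega
  have n6 : 24 + k ≠ 36 + k := by omega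
  refine Runs.seq_of (T₁ := e.cost + 10) (T₂ := 60)
    (R := fun τ => τ = ((σ.setNat 57 x).storeNat (36 + k) (st + v) (σ.natArr (24 + k) v)).storeNat
      (24 + k) v x)
    (Runs.line rfl (by simp [Prog.maxCost, NatExpr.cost]) ?_) (fun τ hτ _ => ?_) (by omega)
  · simp [he, hv, h5]
  · refine (runs_pullNode (k := k) (K := K) (by simp [hτ, h3]) (by simp [hτ, hv]) hv0).frame.mono
      le_rfl fun τ' ⟨⟨i1, i2, i3, i4⟩, hF⟩ => ⟨fun r hr => by simp [i1, hτ, hr], i2,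
        fun u h1 h2 h => i3 u h1 h2 ?_, ?_, ?_⟩
    · have := AggAt_update (x := x) (y := σ.natArr (28 + k) v) (z := σ.natArr (32 + k) v) h h1 h2
      simp only [Function.update_eq_self] at this
      simpa [AggOk, hτ, n1, n2, n3, n4, n5, n6] using this
    · rw [i4]; simp [hτ, n6]
    · rw [hF.natArr _ (by simp [pullNode, Prog.wNA])]; simp [hτ, n1]

/-- `v` is a maximal node between `l` and `r`, at height `m`. -/
def ActedAt (l r m v : ℕ) : Prop :=
  l / 2 ^ m < v ∧ v < r / 2 ^ m ∧ ¬ (l / 2 ^ (m + 1) < v / 2 ∧ v / 2 < r / 2 ^ (m + 1))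

/-- At each height the maximal nodes are the right neighbour of the ancestor of `l`, if that
ancestor is a left child, and the left neighbour of the ancestor of `r`, if that one is a right
child. These are the two tests of `actsProg`. -/
theorem actedAt_iff {l r m v : ℕ} : ActedAt l r m v ↔ l / 2 ^ m + 1 < r / 2 ^ m ∧
    (l / 2 ^ m % 2 = 0 ∧ v = l / 2 ^ m + 1 ∨ r / 2 ^ m % 2 = 1 ∧ v = r / 2 ^ m - 1) := by
  rw [ActedAt, div_two_pow_succ, div_two_pow_succ]
  generalize l / 2 ^ m = x
  generalize r / 2 ^ m = y
  omega

theorem ActedAt.lvl {K l r m v : ℕ} (h : ActedAt l r m v) (hm : m ≤ K) (hl : Lvl K 0 l)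
    (hr : Lvl K 0 r) : Lvl K m v :=
  ⟨hm, (hl.anc hm).2.1.trans h.1.le, h.2.1.trans (hr.anc hm).2.2⟩

theorem acted_iff {K l r v : ℕ} (hl : Lvl K 0 l) (hr : Lvl K 0 r) :
    Acted K l r v ↔ ∃ m ≤ K, ActedAt l r m v :=
  ⟨fun ⟨m, hm, _, h⟩ => ⟨m, hm, h⟩, fun ⟨m, hm, h⟩ => ⟨m, hm, h.lvl hm hl hr, h⟩⟩

/-- The state of the loop of `actsProg`: the nodes in `D` have been treated. -/
structure ActsInv (K k st : ℕ) (l r : ℕ) (g tag log : ℕ → ℕ) (D : ℕ → Prop) (σ : State) :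
    Prop where
  reg3 : σ.natReg 3 = 2 ^ K
  reg5 : σ.natReg 5 = st
  par : ∀ v < 2 ^ (K + 1), σ.natArr 6 v = v / 2
  tag_of : ∀ v, D v → σ.natArr (24 + k) v = g v
  tag_of_not : ∀ v, ¬ D v → σ.natArr (24 + k) v = tag v
  log_of : ∀ v, D v → σ.natArr (36 + k) (st + v) = tag v
  log_of_not : ∀ c, (∀ v, D v → c ≠ st + v) → σ.natArr (36 + k) c = log c
  agg : ∀ u, 0 < u → (∀ j, u ≠ l / 2 ^ (j + 1)) → (∀ j, u ≠ r / 2 ^ (j + 1)) → AggOk K k σ u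

/-- A new tag at `v` can spoil only the aggregates of its parent, and by `hpar` the parent is an
ancestor of `l` or of `r`. Those nodes are exempt in `ActsInv.agg` and are repaired by the climbs at
the end of the update. -/
theorem ActsInv.act {K k st l r v r' : ℕ} {g tag log : ℕ → ℕ} {D : ℕ → Prop} {σ : State}
    {e x : NatExpr} (h : ActsInv K k st l r g tag log D σ) (hx : x.eval σ = v) (hv : 0 < v)
    (hD : ¬ D v) (hpar : (∃ j, v / 2 = l / 2 ^ (j + 1)) ∨ ∃ j, v / 2 = r / 2 ^ (j + 1))
    (he : ∀ ρ : State, ρ.natReg 48 = v → ρ.natReg 5 = st → ρ.natReg 7 = r' →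
      ρ.natArr (24 + k) v = tag v → ρ.natArr (36 + k) (st + v) = log (st + v) → e.eval ρ = g v)
    (h7 : σ.natReg 7 = r') :
    Runs (set 48 x ;; actNode k e) σ (x.cost + e.cost + 71) fun τ =>
      ActsInv K k st l r g tag log (fun u => D u ∨ u = v) τ ∧
      ∀ q, q ≠ 57 → q ≠ 48 → τ.natReg q = σ.natReg q := by
  refine Runs.seq_of (T₁ := x.cost + 1) (T₂ := e.cost + 70) (R := fun τ => τ = σ.setNat 48 v)
    (Runs.line rfl le_rfl (by simp [hx])) (fun τ hτ _ => ?_) (by omega)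
  have hnl : σ.natArr (36 + k) (st + v) = log (st + v) := h.log_of_not _ fun u hu he => by
    obtain rfl : v = u := by omega
    exact hD hu
  refine (runs_actNode (k := k) (K := K) (v := v) (st := st) (x := g v) (by simp [hτ, h.reg3])
    (by simp [hτ]) hv (by simp [hτ, h.reg5]) (he τ (by simp [hτ]) (by simp [hτ, h.reg5])
      (by simp [hτ, h7]) (by simp [hτ, h.tag_of_not v hD]) (by simp [hτ, hnl]))).frame.mono le_rfl
    fun τ' ⟨⟨i1, i2, i3, i4, i5⟩, hF⟩ => ⟨⟨?_, ?_, ?_, ?_, ?_, ?_, ?_, ?_⟩, ?_⟩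
  · rw [i1 3 (by norm_num)]; simp [hτ, h.reg3]
  · rw [i1 5 (by norm_num)]; simp [hτ, h.reg5]
  · rw [hF.natArr 6 (by simp [actNode, pullNode, Prog.wNA]; omega)]
    simpa [hτ] using h.par
  · rintro u (hu | rfl)
    · have : u ≠ v := fun e => hD (e ▸ hu)
      rw [i4]; simp [this, hτ, h.tag_of u hu]
    · rw [i4]; simp
  · intro u hu
    rw [i4]
    push Not at hu
    simp [hu.2, hτ, h.tag_of_not u hu.1]
  · rintro u (hu | rfl)
    · have : u ≠ v := fun e => hD (e ▸ hu)
      rw [i5]; simp [this, hτ, h.log_of u hu]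
    · rw [i5]; simp [hτ, h.tag_of_not u hD]
  · intro c hc
    rw [i5, Function.update_of_ne (hc v (.inr rfl))]
    simpa [hτ] using h.log_of_not c fun u hu => hc u (.inl hu)
  · intro u hu h1 h2
    by_cases e : u = v
    · rw [e]; exact i2
    · refine i3 u e ?_ (by simpa [AggOk, hτ] using h.agg u hu h1 h2)
      rintro rfl
      rcases hpar with ⟨j, hj⟩ | ⟨j, hj⟩
      · exact h1 j hj
      · exact h2 j hj
  · intro q h1 h2
    rw [i1 q h1]; simp [hτ, h2]

theorem ActsInv.congr {K k st l r : ℕ} {g tag log : ℕ → ℕ} {D D' : ℕ → Prop} {σ : State}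
    (h : ActsInv K k st l r g tag log D σ) (hD : ∀ v, D' v ↔ D v) :
    ActsInv K k st l r g tag log D' σ := by
  obtain rfl : D' = D := funext fun v => propext (hD v)
  exact h

theorem ActsInv.agree {K k st l r : ℕ} {g tag log : ℕ → ℕ} {D : ℕ → Prop} {σ τ : State}
    (h : ActsInv K k st l r g tag log D σ) (h3 : τ.natReg 3 = σ.natReg 3)
    (h5 : τ.natReg 5 = σ.natReg 5) (ha : τ.natArr = σ.natArr) :
    ActsInv K k st l r g tag log D τ := by
  obtain ⟨a1, a2, a3, a4, a5, a6, a7, a8⟩ := h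
  exact ⟨by rw [h3, a1], by rw [h5, a2], by rwa [ha], by rwa [ha], by rwa [ha], by rwa [ha],
    by rwa [ha], by simpa only [AggOk, ha] using a8⟩

/-- The expression `e` is evaluated while the tag and the log cell of the node still have their old
contents, so one lemma covers both uses: insertion takes the maximum with the old tag, and undoing
reads the log. At most two nodes per height are changed. -/
theorem runs_actsProg {K k st l r a : ℕ} {g tag log : ℕ → ℕ} {e : NatExpr} {σ : State}
    (hl : Lvl K 0 l) (hr : Lvl K 0 r)
    (h : ActsInv K k st l r g tag log (fun _ => False) σ) (h46 : σ.natReg 46 = l)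
    (h47 : σ.natReg 47 = r) (h7 : σ.natReg 7 = a)
    (he : ∀ v, ∀ ρ : State, ρ.natReg 48 = v → ρ.natReg 5 = st → ρ.natReg 7 = a →
      ρ.natArr (24 + k) v = tag v → ρ.natArr (36 + k) (st + v) = log (st + v) → e.eval ρ = g v) :
    Runs (actsProg k e) σ ((K + 1) * (2 * e.cost + 220)) fun τ =>
      ActsInv K k st l r g tag log (Acted K l r) τ := by
  refine Runs.while_of (fun ρ => ρ.natReg 7 = a ∧ ∃ m ≤ K, ρ.natReg 46 = l / 2 ^ m ∧
      ρ.natReg 47 = r / 2 ^ m ∧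
      ActsInv K k st l r g tag log (fun v => ∃ m' < m, ActedAt l r m' v) ρ)
    (fun ρ => Nat.log 2 (ρ.natReg 46)) (2 * e.cost + 200)
    ⟨h7, 0, by omega, by simp [h46], by simp [h47], h.congr fun v => by simp⟩ ?_ ?_ ?_
  · rintro ρ - ⟨a7, m, hm, b46, b47, hI⟩ hb
    simp [b46] at hb
    have hmK : m < K := by
      rcases Nat.lt_or_ge m K with h | h
      · exact h
      · obtain rfl : m = K := by omega
        have := (hl.anc (le_refl m)).eq_one
        omega
    have hparl : ρ.natArr 6 (l / 2 ^ m) = l / 2 ^ (m + 1) := by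
      rw [hI.par _ (hl.anc hm).lt, div_two_pow_succ]
    have hparr : ρ.natArr 6 (r / 2 ^ m) = r / 2 ^ (m + 1) := by
      rw [hI.par _ (hr.anc hm).lt, div_two_pow_succ]
    have el := div_two_pow_succ l m
    have er := div_two_pow_succ r m
    -- A node has only one height, so nothing treated at an earlier height is treated again, and the
    -- log keeps the tag from before the whole update.
    have nd : ∀ v, ActedAt l r m v → ¬ ∃ m' < m, ActedAt l r m' v := by
      rintro v hv ⟨m', hm', hv'⟩
      have := (hv.lvl hm hl hr).unique (hv'.lvl (by omega) hl hr)
      omega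
    refine Runs.seq_of (T₁ := e.cost + 91) (T₂ := e.cost + 105)
      (R := fun τ => ActsInv K k st l r g tag log (fun v => (∃ m' < m, ActedAt l r m' v) ∨
        (l / 2 ^ m + 1 < r / 2 ^ m ∧ l / 2 ^ m % 2 = 0 ∧ v = l / 2 ^ m + 1)) τ ∧
        ∀ q, q ≠ 57 → q ≠ 48 → τ.natReg q = ρ.natReg q)
      ((Runs.ite (T := e.cost + 76) (fun hc => ?_) fun hc => ?_).mono
        (by simp [Test.cost, NatExpr.cost, isRight]; omega) fun _ h => h)
      (fun τ ⟨hτ, hτr⟩ _ => ?_) (by omega)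
    · simp [isRight, b46, b47, hparl, el] at hc
      refine ((hI.act (v := l / 2 ^ m + 1) (by simp [b46]) (by omega)
        (nd _ (actedAt_iff.2 ⟨hc.1, .inl ⟨by omega, rfl⟩⟩)) (.inl ⟨m, by omega⟩) (he _) a7).mono
        (by simp [NatExpr.cost]; omega)) fun τ hτ => ⟨hτ.1.congr fun v => ?_, hτ.2⟩
      exact or_congr_right ⟨fun h => h.2.2, fun h => ⟨hc.1, by omega, h⟩⟩
    · simp [isRight, b46, b47, hparl, el] at hc
      refine Runs.line rfl (by simp [Prog.maxCost]) ⟨hI.congr fun v => ?_, by simp⟩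
      refine or_iff_left ?_
      omega
    · have c46 : τ.natReg 46 = l / 2 ^ m := by rw [hτr 46 (by norm_num) (by norm_num), b46]
      have c47 : τ.natReg 47 = r / 2 ^ m := by rw [hτr 47 (by norm_num) (by norm_num), b47]
      have hparl' : τ.natArr 6 (l / 2 ^ m) = l / 2 ^ (m + 1) := by
        rw [hτ.par _ (hl.anc hm).lt, div_two_pow_succ]
      have hparr' : τ.natArr 6 (r / 2 ^ m) = r / 2 ^ (m + 1) := by
        rw [hτ.par _ (hr.anc hm).lt, div_two_pow_succ]
      refine Runs.seq_of (T₁ := e.cost + 90) (T₂ := 6)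
        (R := fun τ => ActsInv K k st l r g tag log (fun v => (∃ m' < m + 1, ActedAt l r m' v)) τ ∧
          ∀ q, q ≠ 57 → q ≠ 48 → τ.natReg q = ρ.natReg q)
        ((Runs.ite (T := e.cost + 76) (fun hc => ?_) fun hc => ?_).mono
          (by simp [Test.cost, NatExpr.cost, isRight]; omega) fun _ h => h)
        (fun τ' ⟨hτ', hτr'⟩ _ => ?_) (by omega)
      · simp [isRight, c46, c47, hparr', er] at hc
        have hact : ActedAt l r m (r / 2 ^ m - 1) := actedAt_iff.2 ⟨hc.1, .inr ⟨by omega, rfl⟩⟩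
        -- The two nodes treated at one height cannot coincide: the left one is odd and the right
        -- one is even.
        refine ((hτ.act (v := r / 2 ^ m - 1) (by simp [c47]) (by omega)
          (fun h => h.elim (nd _ hact) (by omega)) (.inr ⟨m, by omega⟩) (he _)
          (by rw [hτr 7 (by norm_num) (by norm_num), a7])).mono
          (by simp [NatExpr.cost]; omega)) fun τ' hτ' => ⟨hτ'.1.congr fun v => ?_,
            fun q h1 h2 => by rw [hτ'.2 q h1 h2, hτr q h1 h2]⟩
        simp only [Nat.lt_succ_iff_lt_or_eq, or_and_right, exists_or, exists_eq_left, actedAt_iff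
          (m := m), or_assoc]
        refine or_congr_right ?_
        omega
      · simp [isRight, c46, c47, hparr', er] at hc
        refine Runs.line rfl (by simp [Prog.maxCost]) ⟨hτ.congr fun v => ?_, by simpa using hτr⟩
        simp only [Nat.lt_succ_iff_lt_or_eq, or_and_right, exists_or, exists_eq_left, actedAt_iff
          (m := m)]
        refine or_congr_right ?_
        omega
      · have d46 : τ'.natReg 46 = l / 2 ^ m := by rw [hτr' 46 (by norm_num) (by norm_num), b46]
        have d47 : τ'.natReg 47 = r / 2 ^ m := by rw [hτr' 47 (by norm_num) (by norm_num), b47]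
        have d7 : τ'.natReg 7 = a := by rw [hτr' 7 (by norm_num) (by norm_num), a7]
        have hparl2 : τ'.natArr 6 (l / 2 ^ m) = l / 2 ^ (m + 1) := by
          rw [hτ'.par _ (hl.anc hm).lt, div_two_pow_succ]
        have hparr2 : τ'.natArr 6 (r / 2 ^ m) = r / 2 ^ (m + 1) := by
          rw [hτ'.par _ (hr.anc hm).lt, div_two_pow_succ]
        refine Runs.line rfl (by decide) ⟨⟨by simp [d7], m + 1, by omega, by simp [d46, hparl2],
          by simp [d47, hparr2], hτ'.agree (by simp) (by simp) (by simp)⟩, ?_⟩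
        simp only [Prog.run_seq, Prog.run_setNat, eval_arr, eval_reg, setNat_natReg, d46, hparl2,
          b46]
        norm_num
        rw [el, Nat.log_div_base]
        have := Nat.log_pos (b := 2) (by norm_num) (show 2 ≤ l / 2 ^ m by omega)
        omega
  · rintro ρ - ⟨a7, m, hm, b46, b47, hI⟩ hb
    simp [b46] at hb
    refine hI.congr fun v => (acted_iff hl hr).trans ⟨?_, fun ⟨m', h1, h2⟩ => ⟨m', by omega, h2⟩⟩
    rintro ⟨m', h1, h2⟩
    refine ⟨m', ?_, h2⟩
    by_contra hc
    have hmK : m' = K := by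
      by_contra hne
      have := (hl.anc hm).2.1
      have hp : 2 ^ 1 ≤ 2 ^ (K - m) := Nat.pow_le_pow_right (by norm_num) (by omega)
      omega
    subst hmK
    have := (hl.anc le_rfl).eq_one
    have := (hr.anc le_rfl).eq_one
    have := h2.1
    have := h2.2.1
    omega
  · have hlog : Nat.log 2 (σ.natReg 46) ≤ K := by
      rw [h46]
      have := Nat.log_lt_of_lt_pow hl.pos.ne' hl.lt
      omega
    have := Nat.mul_le_mul_right (2 * e.cost + 204) hlog
    simp only [Test.cost, NatExpr.cost]
    have e1 : (K + 1) * (2 * e.cost + 220) = K * (2 * e.cost + 204) + 16 * K + 2 * e.cost + 220 := by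
      ring
    have e2 : 2 * e.cost + 200 + (1 + 1 + 1 + 1) = 2 * e.cost + 204 := by omega
    rw [e1, e2]
    omega

/-- Changing the tags leaves stale at most the ancestors of `l` and of `r`, and two climbs repair
them. The old tags end up in the log at the offset `st`, from where the update can be reverted. -/
theorem runs_updProg {K k st l r a : ℕ} {g tag log : ℕ → ℕ} {e : NatExpr} {σ : State}
    (hl : Lvl K 0 l) (hr : Lvl K 0 r) (hT : TreeAt K σ) (h5 : σ.natReg 5 = st)
    (h55 : σ.natReg 55 = l) (h56 : σ.natReg 56 = r) (h7 : σ.natReg 7 = a)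
    (htag : σ.natArr (24 + k) = tag) (hlog : σ.natArr (36 + k) = log)
    (hagg : ∀ u, 0 < u → AggOk K k σ u)
    (he : ∀ v, ∀ ρ : State, ρ.natReg 48 = v → ρ.natReg 5 = st → ρ.natReg 7 = a →
      ρ.natArr (24 + k) v = tag v → ρ.natArr (36 + k) (st + v) = log (st + v) → e.eval ρ = g v) :
    Runs (updProg k e) σ ((K + 1) * (2 * e.cost + 380)) fun τ =>
      (∀ v, Acted K l r v → τ.natArr (24 + k) v = g v) ∧
      (∀ v, ¬ Acted K l r v → τ.natArr (24 + k) v = tag v) ∧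
      (∀ v, Acted K l r v → τ.natArr (36 + k) (st + v) = tag v) ∧
      (∀ c, (∀ v, Acted K l r v → c ≠ st + v) → τ.natArr (36 + k) c = log c) ∧
      ∀ u, 0 < u → AggOk K k τ u := by
  have climb : ∀ ρ (X : ℕ → Prop) v, ρ.natReg 3 = 2 ^ K → (∀ v < 2 ^ (K + 1), ρ.natArr 6 v = v / 2) →
      ρ.natReg 48 = v → Lvl K 0 v →
      (∀ u, 0 < u → ¬ X u → (∀ j, u ≠ v / 2 ^ (j + 1)) → AggOk K k ρ u) →
      Runs (climbProg 48 (pullNode k)) ρ (K * 67 + 4) fun τ =>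
        (∀ u, 0 < u → ¬ X u → AggOk K k τ u) ∧ τ.natArr (24 + k) = ρ.natArr (24 + k) := by
    intro ρ X v h3 hpar h48 hv hX
    refine (runs_climbProg (r := 48) (pull := pullNode k) (K := K) (Tp := 60) (AggOk K k)
      (fun τ => τ.natReg 3 = 2 ^ K ∧ (∀ v < 2 ^ (K + 1), τ.natArr 6 v = v / 2) ∧
        τ.natArr (24 + k) = ρ.natArr (24 + k)) X ?_ ?_ ?_ ?_ ⟨h3, hpar, rfl⟩ (by rw [h48]; exact hv.pos)
      (by rw [h48]; exact hv.lt) (by rwa [h48]) le_rfl).mono le_rfl fun τ hτ => ⟨hτ.2, hτ.1.2.2⟩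
    · intro τ u ⟨i1, i2, i3⟩ hu hu0 _
      refine (runs_pullNode (k := k) i1 hu hu0).frame.mono le_rfl fun τ' ⟨⟨j1, j2, j3, j4⟩, hF⟩ =>
        ⟨⟨by rw [j1, i1], ?_, by rw [j4, i3]⟩, by rw [j1, hu], j2, j3⟩
      rwa [hF.natArr 6 (by simp [pullNode, Prog.wNA]; omega)]
    · intro τ u ⟨i1, i2, i3⟩
      simpa using ⟨i1, i2, i3⟩
    · intro τ u v h
      simpa [AggOk] using h
    · exact fun τ h => h.2.1
  have e0 : (K + 1) * (2 * e.cost + 380) = (K + 1) * (2 * e.cost + 220) + 160 * K + 160 := by ring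
  rw [e0]
  refine Runs.seq_of (T₁ := 4) (T₂ := (K + 1) * (2 * e.cost + 220) + 134 * K + 12)
    (R := fun τ => τ = (σ.setNat 46 l).setNat 47 r)
    (Runs.line rfl (by decide) (by simp [h55, h56])) (fun τ hτ _ => ?_) (by omega)
  refine Runs.seq_of (T₂ := 134 * K + 12) (runs_actsProg (K := K) (k := k) (st := st) (a := a)
    (g := g) (tag := tag) (log := log) hl hr ⟨by simp [hτ, hT.size], by simp [hτ, h5],
      by simpa [hτ] using hT.par, by simp, by simp [hτ, htag], by simp, by simp [hτ, hlog],
      fun u hu _ _ => by simpa [hτ, AggOk] using hagg u hu⟩ (by simp [hτ]) (by simp [hτ])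
    (by simp [hτ, h7]) he) (fun ρ hρ hF => ?_) (by omega)
  have r55 : ρ.natReg 55 = l := by
    rw [hF.natReg 55 (by simp [actsProg, actNode, pullNode, Prog.wN])]; simp [hτ, h55]
  have r56 : ρ.natReg 56 = r := by
    rw [hF.natReg 56 (by simp [actsProg, actNode, pullNode, Prog.wN])]; simp [hτ, h56]
  refine Runs.seq_of (T₁ := 2) (T₂ := 134 * K + 10) (R := fun τ => τ = ρ.setNat 48 l)
    (Runs.line rfl (by decide) (by simp [r55])) (fun τ1 hτ1 _ => ?_) (by omega)
  -- The first climb, from `l`, exempts the ancestors of `r`; the second one, from `r`, finds only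
  -- these out of date.
  refine Runs.seq_of (T₂ := 67 * K + 6) (climb τ1 (fun u => ∃ j, u = r / 2 ^ (j + 1)) l
    (by simp [hτ1, hρ.reg3]) (by simpa [hτ1] using hρ.par) (by simp [hτ1]) hl
    (fun u hu hX hj => by
      simpa [hτ1, AggOk] using hρ.agg u hu hj fun j e => hX ⟨j, e⟩))
    (fun τ2 ⟨hτ2, ht2⟩ hF2 => ?_) (by omega)
  refine Runs.seq_of (T₁ := 2) (T₂ := 67 * K + 4) (R := fun τ => τ = τ2.setNat 48 r)
    (Runs.line rfl (by decide) (by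
      rw [Prog.run_setNat, eval_reg, hF2.natReg 56 (by simp [climbProg, pullNode, Prog.wN])]
      simp [hτ1, r56])) (fun τ3 hτ3 _ => ?_) (by omega)
  refine (climb τ3 (fun _ => False) r ?_ ?_ (by simp [hτ3]) hr fun u hu _ hj => ?_).frame.mono
    (by omega) fun τ4 ⟨⟨hτ4, ht4⟩, hF4⟩ => ?_
  · rw [hτ3, setNat_natReg, hF2.natReg 3 (by simp [climbProg, pullNode, Prog.wN])]
    simp [hτ1, hρ.reg3]
  · rw [hτ3, setNat_natArr, hF2.natArr 6 (by simp [climbProg, pullNode, Prog.wNA]; omega)]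
    simpa [hτ1] using hρ.par
  · simpa [hτ3, AggOk] using hτ2 u hu fun ⟨j, e⟩ => hj j e
  · have et : τ4.natArr (24 + k) = ρ.natArr (24 + k) := by
      rw [ht4, hτ3, setNat_natArr, ht2, hτ1, setNat_natArr]
    have elog : τ4.natArr (36 + k) = ρ.natArr (36 + k) := by
      rw [hF4.natArr _ (by simp [climbProg, pullNode, Prog.wNA]), hτ3, setNat_natArr,
        hF2.natArr _ (by simp [climbProg, pullNode, Prog.wNA]), hτ1, setNat_natArr]
    rw [et, elog]
    exact ⟨hρ.tag_of, hρ.tag_of_not, hρ.log_of, hρ.log_of_not, fun u hu => hτ4 u hu not_false⟩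

end RealRAM


namespace RealRAM
open HeapTree

/-! ### Searching the trees -/

/-- Four programs in a row. -/
def forK (f : ℕ → Prog) : Prog := f 0 ;; f 1 ;; f 2 ;; f 3

/-- The four trees are set up and their aggregates are up to date. -/
structure Forest (K : ℕ) (σ : State) : Prop where
  tree : TreeAt K σ
  agg : ∀ k < 4, ∀ u, 0 < u → AggOk K k σ u

/-- The value of tree `k` at leaf `p`. -/
def leafVal (K : ℕ) (σ : State) (k p : ℕ) : ℕ := pathMax (σ.natArr (24 + k)) p K

theorem Forest.congr {K : ℕ} {σ τ : State} (h : Forest K σ) (h3 : τ.natReg 3 = σ.natReg 3)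
    (ha : ∀ a, a = 6 ∨ a = 7 ∨ 24 ≤ a ∧ a < 36 → τ.natArr a = σ.natArr a) : Forest K τ := by
  obtain ⟨⟨a1, a2, a3⟩, b⟩ := h
  refine ⟨⟨by rw [h3, a1], by rwa [ha 6 (by simp)], by rwa [ha 7 (by simp)]⟩, fun k hk u hu => ?_⟩
  rw [AggOk, ha _ (by omega), ha _ (by omega), ha _ (by omega)]
  exact b k hk u hu

/-- Computes in registers `15, …, 18` the values of the trees at the leaf in register `10`. -/
def valProg : Prog :=
  (set 35 (reg 10) ;; forK fun k => set (15 + k) (arr (24 + k) (reg 35))) ;;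
  .while (lt (nat 1) (reg 35))
    (set 35 (arr 6 (reg 35)) ;;
      forK fun k => set (15 + k) (emax (reg (15 + k)) (arr (24 + k) (reg 35))))

theorem forall_lt_four {P : ℕ → Prop} : (∀ k < 4, P k) ↔ P 0 ∧ P 1 ∧ P 2 ∧ P 3 :=
  ⟨fun h => ⟨h 0 (by omega), h 1 (by omega), h 2 (by omega), h 3 (by omega)⟩,
    fun h k hk => by interval_cases k <;> simp [h]⟩

theorem runs_valProg {K c : ℕ} {σ : State} (hc : Lvl K 0 c) (h : TreeAt K σ)
    (h10 : σ.natReg 10 = c) :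
    Runs valProg σ (80 * (K + 1)) fun τ => ∀ k < 4, τ.natReg (15 + k) = leafVal K σ k c := by
  refine Runs.seq_of (T₁ := 14) (R := fun τ => τ.natReg 35 = c ∧ ∀ k < 4, τ.natReg (15 + k) =
    σ.natArr (24 + k) c) (T₂ := 80 * K + 60) (Runs.line rfl (by decide) (by
      simp [forK, h10, forall_lt_four])) (fun τ ⟨a, b⟩ hF => ?_) (by omega)
  have hpar : ∀ v < 2 ^ (K + 1), τ.natArr 6 v = v / 2 := by
    rw [hF.natArr 6 (by decide)]; exact h.par
  refine Runs.while_of (fun ρ => (∀ a, ρ.natArr a = σ.natArr a) ∧ ∃ m ≤ K, ρ.natReg 35 = c / 2 ^ m ∧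
    ∀ k < 4, ρ.natReg (15 + k) = pathMax (σ.natArr (24 + k)) c m) (fun ρ => Nat.log 2 (ρ.natReg 35))
    50 ⟨fun a => hF.natArr a (by decide +revert), 0, by omega, by simp [a], fun k hk => b k hk⟩
    ?_ ?_ ?_
  · rintro ρ - ⟨ha, m, hm, h35, hv⟩ hb
    simp [h35] at hb
    have hmK : m < K := by
      rcases Nat.lt_or_ge m K with h | h
      · exact h
      · obtain rfl : m = K := by omega
        have := (hc.anc (le_refl m)).eq_one
        omega
    have hp : ρ.natArr 6 (c / 2 ^ m) = c / 2 ^ (m + 1) := by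
      rw [ha, h.par _ (hc.anc hm).lt, div_two_pow_succ]
    refine Runs.line rfl (by decide) ⟨⟨by simp [forK, ha], m + 1, hmK, ?_, ?_⟩, ?_⟩
    · simp [forK, h35, hp]
    · rw [forall_lt_four] at hv ⊢
      simp [forK, h35, hp, hv, pathMax, ha]
    · simp [forK, h35, hp]
      rw [div_two_pow_succ, Nat.log_div_base]
      have := Nat.log_pos (b := 2) (by norm_num) (show 2 ≤ c / 2 ^ m by omega)
      omega
  · rintro ρ - ⟨ha, m, hm, h35, hv⟩ hb k hk
    rw [hv k hk, leafVal]
    simp [h35] at hb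
    have hmK : m = K := by
      by_contra hne
      have := (hc.anc hm).2.1
      have hp : 2 ^ 1 ≤ 2 ^ (K - m) := Nat.pow_le_pow_right (by norm_num) (by omega)
      omega
    rw [hmK]
  · have : Nat.log 2 (τ.natReg 35) ≤ K := by
      rw [a]
      have := Nat.log_lt_of_lt_pow hc.pos.ne' hc.lt
      omega
    simp only [Test.cost, NatExpr.cost]
    omega

/-- The test whether all values below the node `e` satisfy the bounds, where the maximal tags above
the node are in the registers `27, …, 30`. -/
def sameTest (e : NatExpr) : Test :=
  let f k := Test.and (le (reg (19 + k)) (emax (reg (27 + k)) (arr (28 + k) e)))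
    (le (emax (reg (27 + k)) (arr (32 + k) e)) (reg (23 + k)))
  .and (f 0) (.and (f 1) (.and (f 2) (f 3)))

/-- Leaf `p` violates the bounds `A`, `B`. -/
def Bad (K : ℕ) (σ : State) (A B : ℕ → ℕ) (p : ℕ) : Prop :=
  ∃ k < 4, leafVal K σ k p < A k ∨ B k < leafVal K σ k p

/-- `acc k` is the maximal tag above node `u` in tree `k`. -/
def AccAt (K : ℕ) (σ : State) (acc : ℕ → ℕ) (m u : ℕ) : Prop :=
  ∀ k < 4, ∀ p, p / 2 ^ m = u → leafVal K σ k p = max (acc k) (pathMax (σ.natArr (24 + k)) p m)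

theorem AccAt.child {K m u c : ℕ} {σ : State} {acc : ℕ → ℕ} (h : AccAt K σ acc (m + 1) u)
    (hc : c / 2 = u) : AccAt K σ (fun k => max (acc k) (σ.natArr (24 + k) u)) m c := by
  intro k hk p hp
  have e : p / 2 ^ (m + 1) = u := by rw [div_two_pow_succ, hp, hc]
  rw [h k hk p e, pathMax, e]
  beta_reduce
  omega

/-- The values at the leaves below `u` are those inside the subtree, raised to the greatest tag
above `u`; as the aggregates are attained, their satisfying the bounds is equivalent to all leaves
satisfying them. -/
theorem holds_sameTest {K m u : ℕ} {σ τ : State} {acc A B : ℕ → ℕ} {e : NatExpr}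
    (h : Forest K σ) (hu : Lvl K m u) (hacc : AccAt K σ acc m u) (he : e.eval τ = u)
    (hA : ∀ k < 4, τ.natReg (19 + k) = A k) (hB : ∀ k < 4, τ.natReg (23 + k) = B k)
    (ha : ∀ k < 4, τ.natReg (27 + k) = acc k) (harr : ∀ a, τ.natArr a = σ.natArr a) :
    (sameTest e).Holds τ ↔ ∀ p, p / 2 ^ m = u → ¬ Bad K σ A B p := by
  have key : (sameTest e).Holds τ ↔ ∀ k < 4, A k ≤ max (acc k) (σ.natArr (28 + k) u) ∧
      max (acc k) (σ.natArr (32 + k) u) ≤ B k := by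
    rw [forall_lt_four] at *
    simp only [sameTest, holds_and, holds_not, holds_lt, eval_emax, eval_reg, eval_arr, he, hA, hB,
      ha, harr, not_lt]
  rw [key]
  have sp := fun k hk => Agg.spec (fun v hv _ => h.agg k hk v hv) hu
  constructor
  · rintro hk p hp ⟨k, hk4, hbad⟩
    obtain ⟨⟨a1, -⟩, a2, -⟩ := sp k hk4
    have := hk k hk4
    have := a1 p hp
    have := a2 p hp
    rw [hacc k hk4 p hp] at hbad
    omega
  · intro hp k hk4
    obtain ⟨⟨-, p1, b1, c1⟩, -, p2, b2, c2⟩ := sp k hk4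
    have h1 := hacc k hk4 p1 b1
    have h2 := hacc k hk4 p2 b2
    rw [c1] at h1
    rw [c2] at h2
    constructor
    · by_contra hc
      exact hp p1 b1 ⟨k, hk4, .inl (by omega)⟩
    · by_contra hc
      exact hp p2 b2 ⟨k, hk4, .inr (by omega)⟩

/-- Finds the last subtree right of the path to the leaf in register `10` that hangs off this path
and in which the bounds are violated. -/
def pathProg : Prog :=
  (set 35 (nat 1) ;; set 36 (nat 0) ;; forK fun k => set (27 + k) (nat 0)) ;;
  .while (lt (reg 35) (reg 3))
    ((forK fun k => set (27 + k) (emax (reg (27 + k)) (arr (24 + k) (reg 35)))) ;;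
      .ite (lt (reg 10) (arr 7 (reg 35 + reg 35 + nat 1)))
        (.ite (sameTest (reg 35 + reg 35 + nat 1)) .skip
            (set 36 (reg 35 + reg 35 + nat 1) ;; forK fun k => set (31 + k) (reg (27 + k))) ;;
          set 35 (reg 35 + reg 35))
        (set 35 (reg 35 + reg 35 + nat 1)))

/-- Finds the first leaf below the node in register `36` at which the bounds are violated. -/
def descendProg : Prog :=
  (set 35 (reg 36) ;; forK fun k => set (27 + k) (reg (31 + k))) ;;
  .while (lt (reg 35) (reg 3))
    ((forK fun k => set (27 + k) (emax (reg (27 + k)) (arr (24 + k) (reg 35)))) ;;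
      .ite (sameTest (reg 35 + reg 35)) (set 35 (reg 35 + reg 35 + nat 1))
        (set 35 (reg 35 + reg 35)))

/-- Finds the first leaf after the leaf in register `10` at which the bounds are violated. -/
def nextProg : Prog :=
  pathProg ;; .ite (lt (nat 0) (reg 36)) (descendProg ;; set 37 (reg 35)) (set 37 (reg 3 + reg 3))

/-- Node `w` at height `m` is the candidate for the search beyond leaf `x`. -/
def CandAt (K : ℕ) (σ : State) (A B : ℕ → ℕ) (x : ℕ) (cacc : ℕ → ℕ) (w : ℕ) : Prop :=
  (w = 0 ∧ ∀ p, x ≤ p → p < 2 ^ (K + 1) → ¬ Bad K σ A B p) ∨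
  ∃ m, Lvl K m w ∧ AccAt K σ cacc m w ∧ (∃ p, p / 2 ^ m = w ∧ Bad K σ A B p) ∧
    x ≤ w * 2 ^ m ∧ ∀ p, x ≤ p → p < w * 2 ^ m → ¬ Bad K σ A B p

theorem div_pow_eq_iff {p m w : ℕ} : p / 2 ^ m = w ↔ w * 2 ^ m ≤ p ∧ p < (w + 1) * 2 ^ m := by
  rw [Nat.div_eq_iff (by positivity)]
  have : 0 < 2 ^ m := by positivity
  constructor
  · rintro ⟨h1, h2⟩
    exact ⟨h1, by rw [Nat.add_mul, Nat.one_mul]; omega⟩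
  · rintro ⟨h1, h2⟩
    rw [Nat.add_mul, Nat.one_mul] at h2
    exact ⟨h1, by omega⟩

/-- Wherever the path to `c` turns left, the right child hangs off it, and these subtrees make up
the leaves after `c`. Deeper ones are nearer to `c`, so the last one that fails the test contains
the first violation. The tags above it are saved along with it for the descent. -/
theorem runs_pathProg {K c : ℕ} {A B : ℕ → ℕ} {σ : State} (hc : Lvl K 0 c) (h : Forest K σ)
    (h10 : σ.natReg 10 = c) (hA : ∀ k < 4, σ.natReg (19 + k) = A k)
    (hB : ∀ k < 4, σ.natReg (23 + k) = B k) :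
    Runs pathProg σ (260 * (K + 1)) fun τ => ∃ cacc, CandAt K σ A B (c + 1) cacc (τ.natReg 36) ∧
      ∀ k < 4, τ.natReg (31 + k) = cacc k := by
  refine Runs.seq_of (T₁ := 12) (R := fun τ => τ.natReg 35 = 1 ∧ τ.natReg 36 = 0 ∧
    ∀ k < 4, τ.natReg (27 + k) = 0) (T₂ := 260 * K + 240) (Runs.line rfl (by decide) (by
      simp [forK, forall_lt_four])) (fun τ ⟨a, b, b'⟩ hF => ?_) (by omega)
  have h3 := h.tree.size
  refine Runs.while_of (fun ρ => ∃ m ≤ K, ρ.natReg 35 = c / 2 ^ m ∧ 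
    ∃ acc cacc : ℕ → ℕ, AccAt K σ acc m (c / 2 ^ m) ∧ (∀ k < 4, ρ.natReg (27 + k) = acc k) ∧
      (∀ k < 4, ρ.natReg (31 + k) = cacc k) ∧
      CandAt K σ A B ((c / 2 ^ m + 1) * 2 ^ m) cacc (ρ.natReg 36))
    (fun ρ => K - Nat.log 2 (ρ.natReg 35)) 245 ⟨K, le_rfl, by rw [a, (hc.anc le_rfl).eq_one],
      fun _ => 0, fun k => τ.natReg (31 + k), fun k hk p hp => by simp [leafVal], b', fun _ _ => rfl, ?_⟩ ?_ ?_ ?_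
  · refine .inl ⟨b, fun p h1 h2 => ?_⟩
    rw [(hc.anc le_rfl).eq_one, pow_succ] at *
    omega
  · rintro ρ hG ⟨m', hm, h35, acc, cacc, hacc, e1, e2, hcand⟩ hb
    have g3 : ρ.natReg 3 = 2 ^ K := by
      rw [hG.natReg 3 (by decide), hF.natReg 3 (by decide), h3]
    have g10 : ρ.natReg 10 = c := by
      rw [hG.natReg 10 (by decide), hF.natReg 10 (by decide), h10]
    have garr : ∀ a, ρ.natArr a = σ.natArr a := fun a => by
      rw [hG.natArr a (by decide +revert), hF.natArr a (by decide +revert)]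
    have gA : ∀ k < 4, ρ.natReg (19 + k) = A k := fun k hk => by
      rw [hG.natReg _ (by decide +revert), hF.natReg _ (by decide +revert), hA k hk]
    have gB : ∀ k < 4, ρ.natReg (23 + k) = B k := fun k hk => by
      rw [hG.natReg _ (by decide +revert), hF.natReg _ (by decide +revert), hB k hk]
    simp [h35, g3] at hb
    obtain ⟨m, rfl⟩ := (hc.anc hm).succ_of_lt_size hb
    set v := c / 2 ^ (m + 1) with hv
    have hvl : Lvl K (m + 1) v := hc.anc hm
    have h1 : Lvl K m (v + v) := hvl.child (by omega)
    have h2 : Lvl K m (v + v + 1) := hvl.child (by omega)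
    have hlog : Nat.log 2 v < Nat.log 2 (v + v) ∧ Nat.log 2 v < Nat.log 2 (v + v + 1) ∧
        Nat.log 2 v < K := by
      have hv0 := hvl.pos.ne'
      have e : Nat.log 2 (v + v) = Nat.log 2 v + 1 := by
        rw [← two_mul, mul_comm]; exact Nat.log_mul_base (by norm_num) hv0
      have := Nat.log_mono_right (b := 2) (show v + v ≤ v + v + 1 by omega)
      have := Nat.log_lt_of_lt_pow (b := 2) hv0 hb
      omega
    have hcd : c / 2 ^ m = v + v ∨ c / 2 ^ m = v + v + 1 := by
      rw [div_two_pow_succ] at hv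
      omega
    have hfirst := h.tree.first m _ h2
    have hside : c < (v + v + 1) * 2 ^ m ↔ c / 2 ^ m = v + v := by
      rw [← Nat.div_lt_iff_lt_mul (by positivity)]
      omega
    refine Runs.seq_of (T₁ := 40) (R := fun τ => (∀ r, r < 27 ∨ 30 < r → τ.natReg r = ρ.natReg r) ∧
      (∀ a, τ.natArr a = σ.natArr a) ∧
      ∀ k < 4, τ.natReg (27 + k) = max (acc k) (σ.natArr (24 + k) v)) (T₂ := 200)
      (Runs.line rfl (by decide) ⟨?_, ?_, ?_⟩) (fun ρ' ⟨f1, f2, f3⟩ _ => ?_) (by norm_num)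
    · intro r hr
      have q1 : r ≠ 27 := by omega
      have q2 : r ≠ 28 := by omega
      have q3 : r ≠ 29 := by omega
      have q4 : r ≠ 30 := by omega
      simp [forK, q1, q2, q3, q4]
    · simp [forK, garr]
    · rw [forall_lt_four] at e1 ⊢
      simp [forK, e1, garr, h35]
    · have k35 : ρ'.natReg 35 = v := by rw [f1 35 (by omega), h35]
      have k36 := f1 36 (by omega)
      have hst := holds_sameTest (τ := ρ') (e := reg 35 + reg 35 + nat 1) (A := A) (B := B) h h2
        (hacc.child (by omega)) (by simp [k35])
        (fun k hk => by rw [f1 _ (by omega), gA k hk]) (fun k hk => by rw [f1 _ (by omega), gB k hk])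
        f3 f2
      have f31 : ∀ k < 4, ρ'.natReg (31 + k) = cacc k := fun k hk => by
        rw [f1 _ (by omega), e2 k hk]
      have k10 : ρ'.natReg 10 = c := by rw [f1 10 (by omega), g10]
      refine Runs.line rfl (by decide) ?_
      simp only [Prog.run_ite, holds_lt, eval_reg, eval_arr, eval_add, eval_const, k35, f2, hfirst,
        k10, hside]
      by_cases hl : c / 2 ^ m = v + v
      on_goal 1 => rw [if_pos hl]; by_cases hs : (sameTest (reg 35 + reg 35 + nat 1)).Holds ρ'
      · simp only [Prog.run_seq, Prog.run_ite, if_pos hs, Prog.run_skip, Prog.run_setNat, eval_add,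
          eval_reg, k35]
        refine ⟨⟨m, by omega, by simp [hl], _, cacc, by rw [hl]; exact hacc.child (by omega),
          by simpa [forall_lt_four] using f3, by simpa [forall_lt_four] using f31, ?_⟩,
          by simp [h35]; omega⟩
        have ee : (v + 1) * 2 ^ (m + 1) = (v + v + 1 + 1) * 2 ^ m := by rw [pow_succ]; ring
        have hs' := hst.1 hs
        have hle : (c / 2 ^ m + 1) * 2 ^ m ≤ (v + 1) * 2 ^ (m + 1) := by
          rw [ee, hl]; exact Nat.mul_le_mul_right _ (by omega)
        simp only [setNat_natReg, k36]
        norm_num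
        rcases hcand with ⟨w0, hw⟩ | ⟨mw, w1, w2, w3, w4, w5⟩
        · refine .inl ⟨w0, fun p p1 p2 => ?_⟩
          by_cases hp : (v + 1) * 2 ^ (m + 1) ≤ p
          · exact hw p hp p2
          · exact hs' p (div_pow_eq_iff.2 ⟨by rwa [hl] at p1, by omega⟩)
        · refine .inr ⟨mw, w1, w2, w3, hle.trans w4, fun p p1 p2 => ?_⟩
          by_cases hp : (v + 1) * 2 ^ (m + 1) ≤ p
          · exact w5 p hp p2
          · exact hs' p (div_pow_eq_iff.2 ⟨by rwa [hl] at p1, by omega⟩)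
      · simp only [Prog.run_seq, Prog.run_ite, if_neg hs, Prog.run_setNat, eval_add,
          eval_reg, k35, forK]
        refine ⟨⟨m, by omega, by simp [hl, k35], _, fun k => max (acc k) (σ.natArr (24 + k) v),
          by rw [hl]; exact hacc.child (by omega),
          by simpa [forall_lt_four] using f3, by simpa [forall_lt_four] using f3, ?_⟩,
          by simp [h35, k35]; omega⟩
        refine .inr ⟨m, by simpa [k35] using h2, by
          simpa [k35] using hacc.child (c := v + v + 1) (by omega), ?_, ?_, ?_⟩
        · rw [hst] at hs
          push Not at hs
          simpa [k35] using hs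
        · rw [hl]; simp [k35]
        · rw [hl]; simp [k35]; intro p h1 h2; omega
      · rw [if_neg hl]
        have hl' := hcd.resolve_left hl
        refine ⟨⟨m, by omega, by simp [hl', k35], _, cacc, by rw [hl']; exact hacc.child (by omega),
          by simpa [forall_lt_four] using f3, by simpa [forall_lt_four] using f31, ?_⟩,
          by simp [h35, k35]; omega⟩
        have ee : (v + 1) * 2 ^ (m + 1) = (v + v + 1 + 1) * 2 ^ m := by rw [pow_succ]; ring
        rw [hl', ← ee]
        simpa [k36] using hcand
  · rintro ρ hG ⟨m', hm, h35, acc, cacc, hacc, e1, e2, hcand⟩ hb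
    have g3 : ρ.natReg 3 = 2 ^ K := by
      rw [hG.natReg 3 (by decide), hF.natReg 3 (by decide), h3]
    simp [h35, g3] at hb
    have := (hc.anc hm).zero_of_size_le hb
    subst this
    exact ⟨cacc, by simpa using hcand, e2⟩
  · simp only [Test.cost, NatExpr.cost, a]
    simp
    omega

/-- Descending in the candidate subtree, to the left child unless all its leaves satisfy the bounds,
reaches the first violating leaf. If there is no candidate, the answer is `2 ^ (K + 1)`, one past
the last leaf. -/
theorem runs_nextProg {K c : ℕ} {A B : ℕ → ℕ} {σ : State} (hc : Lvl K 0 c) (h : Forest K σ)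
    (h10 : σ.natReg 10 = c) (hA : ∀ k < 4, σ.natReg (19 + k) = A k)
    (hB : ∀ k < 4, σ.natReg (23 + k) = B k) :
    Runs nextProg σ (520 * (K + 1)) fun τ => c < τ.natReg 37 ∧ τ.natReg 37 ≤ 2 ^ (K + 1) ∧
      (∀ p, c < p → p < τ.natReg 37 → ¬ Bad K σ A B p) ∧
      (τ.natReg 37 < 2 ^ (K + 1) → Bad K σ A B (τ.natReg 37)) := by
  refine Runs.seq_of (T₂ := 260 * K + 250) (runs_pathProg hc h h10 hA hB)
    (fun τ ⟨cacc, hcand, b⟩ hF => ?_) (by omega)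
  have a3 : τ.natReg 3 = 2 ^ K := by rw [hF.natReg 3 (by decide), h.tree.size]
  have aarr : ∀ a, τ.natArr a = σ.natArr a := fun a => hF.natArr a (by decide +revert)
  have aA : ∀ k < 4, τ.natReg (19 + k) = A k := fun k hk => by
    rw [hF.natReg _ (by decide +revert), hA k hk]
  have aB : ∀ k < 4, τ.natReg (23 + k) = B k := fun k hk => by
    rw [hF.natReg _ (by decide +revert), hB k hk]
  refine (Runs.ite (T := 260 * K + 246) (fun hpos => ?_) (fun hneg => ?_)).mono (by
    simp only [Test.cost, NatExpr.cost]; omega) fun _ h => h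
  · simp at hpos
    obtain ⟨mw, w1, w2, w3, w4, w5⟩ := hcand.resolve_left (by omega)
    have hK := w1.1
    refine Runs.seq_of (T₂ := 2) (T₁ := 260 * K + 240) (R := fun ρ => c < ρ.natReg 35 ∧
      ρ.natReg 35 ≤ 2 ^ (K + 1) ∧ (∀ p, c < p → p < ρ.natReg 35 → ¬ Bad K σ A B p) ∧
      Bad K σ A B (ρ.natReg 35)) ?_ (fun ρ hρ _ => Runs.line rfl (by decide) (by
        simpa using ⟨hρ.1, hρ.2.1, hρ.2.2.1, fun _ => hρ.2.2.2⟩)) (by omega)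
    refine Runs.seq_of (T₁ := 10) (T₂ := 260 * K + 220) (R := fun ρ => ρ.natReg 35 = τ.natReg 36 ∧
      ∀ k < 4, ρ.natReg (27 + k) = cacc k)
      (Runs.line rfl (by decide) (by rw [forall_lt_four] at b ⊢; simp [forK, b]))
      (fun ρ ⟨c1, c2⟩ hF' => ?_) (by omega)
    refine Runs.while_of (fun ρ => ∃ m v, Lvl K m v ∧ ρ.natReg 35 = v ∧ 
      ∃ acc : ℕ → ℕ, AccAt K σ acc m v ∧ (∀ k < 4, ρ.natReg (27 + k) = acc k) ∧
      (∃ p, p / 2 ^ m = v ∧ Bad K σ A B p) ∧ c + 1 ≤ v * 2 ^ m ∧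
      ∀ p, c + 1 ≤ p → p < v * 2 ^ m → ¬ Bad K σ A B p)
      (fun ρ => K - Nat.log 2 (ρ.natReg 35)) 200 ⟨mw, _, w1, c1, cacc, w2, c2, w3, w4, w5⟩ ?_ ?_ ?_
    · rintro ρ' hG ⟨m', v, hvl, h35, acc, hacc, e1, e2, e3, e4⟩ hb
      have g3 : ρ'.natReg 3 = 2 ^ K := by
        rw [hG.natReg 3 (by decide), hF'.natReg 3 (by decide), a3]
      have garr : ∀ a, ρ'.natArr a = σ.natArr a := fun a => by
        rw [hG.natArr a (by decide +revert), hF'.natArr a (by decide +revert), aarr]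
      have gA : ∀ k < 4, ρ'.natReg (19 + k) = A k := fun k hk => by
        rw [hG.natReg _ (by decide +revert), hF'.natReg _ (by decide +revert), aA k hk]
      have gB : ∀ k < 4, ρ'.natReg (23 + k) = B k := fun k hk => by
        rw [hG.natReg _ (by decide +revert), hF'.natReg _ (by decide +revert), aB k hk]
      simp [h35, g3] at hb
      obtain ⟨m, rfl⟩ := hvl.succ_of_lt_size hb
      have h1 : Lvl K m (v + v) := hvl.child (by omega)
      have h2 : Lvl K m (v + v + 1) := hvl.child (by omega)
      have hlog : Nat.log 2 v < Nat.log 2 (v + v) ∧ Nat.log 2 v < Nat.log 2 (v + v + 1) ∧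
          Nat.log 2 v < K := by
        have hv0 := hvl.pos.ne'
        have e : Nat.log 2 (v + v) = Nat.log 2 v + 1 := by
          rw [← two_mul, mul_comm]; exact Nat.log_mul_base (by norm_num) hv0
        have := Nat.log_mono_right (b := 2) (show v + v ≤ v + v + 1 by omega)
        have := Nat.log_lt_of_lt_pow (b := 2) hv0 hb
        omega
      refine Runs.seq_of (T₁ := 40) (R := fun τ => (∀ r, r < 27 ∨ 30 < r → τ.natReg r = ρ'.natReg r) ∧
        (∀ a, τ.natArr a = σ.natArr a) ∧
        ∀ k < 4, τ.natReg (27 + k) = max (acc k) (σ.natArr (24 + k) v)) (T₂ := 160)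
        (Runs.line rfl (by decide) ⟨?_, ?_, ?_⟩) (fun ρ' ⟨f1, f2, f3⟩ _ => ?_) (by norm_num)
      · intro r hr
        have q1 : r ≠ 27 := by omega
        have q2 : r ≠ 28 := by omega
        have q3 : r ≠ 29 := by omega
        have q4 : r ≠ 30 := by omega
        simp [forK, q1, q2, q3, q4]
      · simp [forK, garr]
      · rw [forall_lt_four] at e1 ⊢
        simp [forK, e1, garr, h35]
      · have k35 : ρ'.natReg 35 = v := by rw [f1 35 (by omega), h35]
        have hst := holds_sameTest (τ := ρ') (e := reg 35 + reg 35) (A := A) (B := B) h h1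
          (hacc.child (by omega)) (by simp [k35])
          (fun k hk => by rw [f1 _ (by omega), gA k hk]) (fun k hk => by rw [f1 _ (by omega), gB k hk])
          f3 f2
        have ee : v * 2 ^ (m + 1) = (v + v) * 2 ^ m := by rw [pow_succ]; ring
        rw [ee] at e3 e4
        refine Runs.line rfl (by decide) ?_
        simp only [Prog.run_ite]
        split_ifs with hs
        · have hs' := hst.1 hs
          have hle : (v + v) * 2 ^ m ≤ (v + v + 1) * 2 ^ m := Nat.mul_le_mul_right _ (by omega)
          refine ⟨⟨m, _, h2, by simp [k35], _, hacc.child (by omega),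
            by simpa [forall_lt_four] using f3, ?_, by omega, fun p p1 p2 => ?_⟩,
            by simp [h35, k35]; omega⟩
          · obtain ⟨p, p1, p2⟩ := e2
            refine ⟨p, ?_, p2⟩
            rw [div_two_pow_succ] at p1
            have : p / 2 ^ m ≠ v + v := fun h => hs' p h p2
            omega
          · by_cases hp : p < (v + v) * 2 ^ m
            · exact e4 p p1 hp
            · exact hs' p (div_pow_eq_iff.2 ⟨by omega, p2⟩)
        · rw [hst] at hs
          push Not at hs
          exact ⟨⟨m, _, h1, by simp [k35], _, hacc.child (by omega),
            by simpa [forall_lt_four] using f3, hs, e3, e4⟩, by simp [h35, k35]; omega⟩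
    · rintro ρ' hG ⟨m', v, hvl, h35, acc, hacc, e1, ⟨p, p1, p2⟩, e3, e4⟩ hb
      have g3 : ρ'.natReg 3 = 2 ^ K := by
        rw [hG.natReg 3 (by decide), hF'.natReg 3 (by decide), a3]
      simp [h35, g3] at hb
      have := hvl.zero_of_size_le hb
      subst this
      simp at p1 e3 e4
      rw [h35]
      exact ⟨by omega, hvl.lt.le, fun p h1 h2 => e4 p h1 h2, p1 ▸ p2⟩
    · simp only [Test.cost, NatExpr.cost]
      have : (K - Nat.log 2 (ρ.natReg 35)) * 204 ≤ K * 204 := Nat.mul_le_mul_right _ (by omega)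
      omega
  · simp at hneg
    have hw := (hcand.resolve_right fun ⟨m, w1, _⟩ => by have := w1.pos; omega).2
    have hlt := hc.lt
    refine Runs.line rfl (by simp [Prog.maxCost, NatExpr.cost]) ?_
    have e : 2 ^ K + 2 ^ K = 2 ^ (K + 1) := by rw [pow_succ]; ring
    simp [a3, e]
    exact ⟨hlt, fun p h1 h2 => hw p h1 h2⟩

end RealRAM


/-! ### Ranks of real numbers -/

/-- The number `x` lies above the cut `c` with coordinate `v c`: a cut `c < n` is a closed lower
endpoint, and a cut `c ≥ n` is a closed upper endpoint. -/
def Passed (n : ℕ) (v : ℕ → ℝ) (c : ℕ) (x : ℝ) : Prop := v c < x ∨ c < n ∧ x = v c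

theorem not_passed {n : ℕ} {v : ℕ → ℝ} {c : ℕ} {x : ℝ} :
    ¬ Passed n v c x ↔ x < v c ∨ ¬ c < n ∧ x = v c := by
  rw [Passed]
  constructor
  · intro h
    push Not at h
    rcases lt_or_eq_of_le h.1 with h' | h'
    · exact .inl h'
    · exact .inr ⟨fun hc => h.2 hc h', h'⟩
  · rintro (h | ⟨h, e⟩) (h' | ⟨h', e'⟩)
    · exact lt_asymm h h'
    · exact h.ne e'
    · exact h'.ne' e
    · exact h h'

open Classical in
/-- The number of cuts below `x`. -/
noncomputable def rankOf (n : ℕ) (v : ℕ → ℝ) (ord : ℕ → ℕ) (x : ℝ) : ℕ :=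
  ((Finset.range (2 * n)).filter fun t => Passed n v (ord t) x).card

theorem rankOf_le {n : ℕ} {v : ℕ → ℝ} {ord : ℕ → ℕ} {x : ℝ} : rankOf n v ord x ≤ 2 * n := by
  classical exact (Finset.card_le_card (Finset.filter_subset _ _)).trans (by simp)

theorem mem_iff_lt_card_of_lower {m : ℕ} {S : Finset ℕ} (hS : S ⊆ Finset.range m)
    (hl : ∀ t ∈ S, ∀ u < t, u ∈ S) (t : ℕ) : t ∈ S ↔ t < S.card := by
  constructor
  · intro ht
    have : Finset.range (t + 1) ⊆ S := fun u hu => by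
      rcases Nat.lt_succ_iff_lt_or_eq.1 (Finset.mem_range.1 hu) with h | h
      · exact hl t ht u h
      · exact h ▸ ht
    simpa using Finset.card_le_card this
  · intro ht
    by_contra hc
    have : S ⊆ Finset.range t := fun u hu => by
      rw [Finset.mem_range]
      by_contra h
      rcases Nat.lt_or_eq_of_le (not_lt.1 h) with h' | h'
      · exact hc (hl u hu t h')
      · exact hc (h' ▸ hu)
    have := Finset.card_le_card this
    simp at this
    omega

namespace RealRAM
open HeapTree

/-- The passed cuts form an initial segment of the sorted list. At equal coordinates this depends on
the tie-break: a number equal to the coordinate has passed the lower faces, which have numbers below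
`n` and come first, but not the upper faces. So the closedness of the cubes is encoded in the order
of the cuts. -/
theorem IsSort.passed_iff {n : ℕ} {v : ℕ → ℝ} {ord rank : ℕ → ℕ}
    (h : IsSort (2 * n) v ord rank) {t : ℕ} (ht : t < 2 * n) (x : ℝ) :
    Passed n v (ord t) x ↔ t < rankOf n v ord x := by
  classical
  have key : ∀ t < 2 * n, ∀ u < t, Passed n v (ord t) x → Passed n v (ord u) x := by
    intro t ht u hu hp
    have hlt : lexKey v (ord u) < lexKey v (ord t) := by
      rw [← h.rank_lt_rank (h.ord_lt u (by omega)) (h.ord_lt t ht), h.rank_ord u (by omega),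
        h.rank_ord t ht]
      exact hu
    rcases Prod.Lex.toLex_lt_toLex.1 hlt with h1 | ⟨h1, h2⟩
    · rcases hp with h3 | ⟨-, h3⟩
      · exact .inl (h1.trans h3)
      · exact .inl (h3 ▸ h1)
    · simp only at h1 h2
      rcases hp with h3 | ⟨h3, h4⟩
      · exact .inl (h1 ▸ h3)
      · exact .inr ⟨by omega, by rw [h4, h1]⟩
  rw [rankOf, ← mem_iff_lt_card_of_lower (m := 2 * n) (Finset.filter_subset _ _)]
  · simp [ht]
  · intro t ht u hu
    simp only [Finset.mem_filter, Finset.mem_range] at ht ⊢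
    exact ⟨by omega, key t ht.1 u hu ht.2⟩

/-- The points whose rank in dimension `j` lies in the interval `(l j, h j]`. -/
def rankBox (ι : Fin 3 → ℝ → ℕ) (l h : Fin 3 → ℕ) : Set (Fin 3 → ℝ) :=
  {x | ∀ j, l j < ι j (x j) ∧ ι j (x j) ≤ h j}

/-- The ranks of the coordinates in the memory `σ`. -/
noncomputable def State.iota (σ : State) (n : ℕ) (d : Fin 3) : ℝ → ℕ :=
  rankOf n (σ.realArr d) (σ.natArr (9 + d))

/-! ### Output of a box -/

/-- The test whether there are numbers between the cuts at the ranks in the registers `lo`, `hi`. -/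
def cutTest (d lo hi : ℕ) : Test :=
  .not (.and (.not (.realLt (.arr d (arr (9 + d) (reg lo))) (.arr d (arr (9 + d) (reg hi)))))
    (.not (.and (.not (.realLt (.arr d (arr (9 + d) (reg hi))) (.arr d (arr (9 + d) (reg lo)))))
      (.and (lt (arr (9 + d) (reg lo)) (reg 1)) (.not (lt (arr (9 + d) (reg hi)) (reg 1)))))))

/-- Stores one interval of the next box of the output. -/
def storeDim (d lo hi : ℕ) : Prog :=
  .storeReal (3 + d) (reg 0) (.arr d (arr (9 + d) (reg lo))) ;;
    .storeReal (6 + d) (reg 0) (.arr d (arr (9 + d) (reg hi))) ;;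
    .storeNat d (reg 0) (nat 1 - (arr (9 + d) (reg lo) + nat 1 - reg 1)) ;;
    .storeNat (3 + d) (reg 0) (arr (9 + d) (reg hi) + nat 1 - reg 1)

/-- Outputs the box between the ranks in the registers `42, …, 47` unless it is empty. -/
def putProg : Prog :=
  .ite (.and (cutTest 0 46 47) (.and (cutTest 1 42 43) (cutTest 2 44 45)))
    (storeDim 0 46 47 ;; storeDim 1 42 43 ;; storeDim 2 44 45 ;; set 0 (reg 0 + nat 1)) .skip

/-- The first boxes of the output decompose the set `R`. -/
structure OutPart (σ : State) (R : Set (Fin 3 → ℝ)) : Prop where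
  nonempty : ∀ k < σ.outCount, (σ.outBox k).toSet.Nonempty
  disjoint : ∀ k < σ.outCount, ∀ l < k, Disjoint (σ.outBox k).toSet (σ.outBox l).toSet
  mem : ∀ x, x ∈ R ↔ ∃ k < σ.outCount, x ∈ (σ.outBox k).toSet

theorem OutPart.congr {σ τ : State} {R : Set (Fin 3 → ℝ)} (h : OutPart σ R)
    (h0 : τ.natReg 0 = σ.natReg 0) (ha : ∀ a < 6, τ.natArr a = σ.natArr a)
    (hr : ∀ a, 3 ≤ a → a < 9 → τ.realArr a = σ.realArr a) : OutPart τ R := by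
  have hb : τ.outBox = σ.outBox := by
    funext k
    simp only [State.outBox, Box.mk.injEq]
    refine ⟨?_, ?_, ?_, ?_⟩ <;> funext j
    · rw [hr _ (by omega) (by omega)]
    · rw [hr _ (by omega) (by omega)]
    · rw [ha _ (by omega)]
    · rw [ha _ (by omega)]
  have hc : τ.outCount = σ.outCount := h0
  obtain ⟨h1, h2, h3⟩ := h
  exact ⟨by rwa [hb, hc], by rwa [hb, hc], by rwa [hb, hc]⟩

theorem OutPart.decomposition {σ : State} {R : Set (Fin 3 → ℝ)} (h : OutPart σ R) :
    IsDisjointBoxDecomposition (fun k : Fin σ.outCount => σ.outBox k) R := by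
  refine ⟨fun k => h.nonempty k k.2, fun k l hkl => ?_, ?_⟩
  · rcases lt_or_gt_of_ne (fun e => hkl (Fin.ext e) : (k : ℕ) ≠ l) with h' | h'
    · exact (h.disjoint l l.2 k h').symm
    · exact h.disjoint k k.2 l h'
  · ext x
    rw [h.mem, Set.mem_iUnion]
    exact ⟨fun ⟨k, hk⟩ => ⟨k.1, k.2, hk⟩, fun ⟨k, h1, h2⟩ => ⟨⟨k, h1⟩, h2⟩⟩

/-- The data that the sweep reads but does not change agree in `σ` and `τ`. -/
structure Static (σ τ : State) : Prop where
  reg1 : τ.natReg 1 = σ.natReg 1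
  reg2 : τ.natReg 2 = σ.natReg 2
  reg3 : τ.natReg 3 = σ.natReg 3
  natArr : ∀ a, 6 ≤ a → a < 24 → τ.natArr a = σ.natArr a
  realArr : ∀ a < 3, τ.realArr a = σ.realArr a

theorem Static.trans {σ τ ρ : State} (h : Static σ τ) (h' : Static τ ρ) : Static σ ρ :=
  ⟨h'.1.trans h.1, h'.2.trans h.2, h'.3.trans h.3, fun a h1 h2 => (h'.4 a h1 h2).trans (h.4 a h1 h2),
    fun a ha => (h'.5 a ha).trans (h.5 a ha)⟩

theorem Frame.static {P : Prog} {σ τ : State} (h : Frame P σ τ)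
    (h1 : ∀ r ∈ [1, 2, 3], r ∉ P.wN) (h2 : ∀ a ∈ P.wNA, a < 6 ∨ 24 ≤ a)
    (h3 : ∀ a ∈ P.wRA, 3 ≤ a) : Static σ τ :=
  ⟨h.natReg 1 (h1 1 (by simp)), h.natReg 2 (h1 2 (by simp)), h.natReg 3 (h1 3 (by simp)),
    fun a ha hb => h.natArr a fun hm => by have := h2 a hm; omega,
    fun a ha => h.realArr a fun hm => by have := h3 a hm; omega⟩

section put
variable {n : ℕ} {v : ℕ → ℝ} {ord : ℕ → ℕ}

/-- There are numbers between the cuts `c` and `c'`. -/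
def CutsApart (n : ℕ) (v : ℕ → ℝ) (c c' : ℕ) : Prop :=
  ¬ (¬ v c < v c' ∧ ¬ (¬ v c' < v c ∧ c < n ∧ ¬ c' < n))

/-- Between different coordinates the midpoint is a witness; at equal coordinates there is a number
between the cuts only if a lower face is followed by an upper one, and it is the coordinate itself.
-/
theorem cutsApart_iff {c c' : ℕ} :
    CutsApart n v c c' ↔ ∃ x, Passed n v c x ∧ ¬ Passed n v c' x := by
  simp only [not_passed]
  simp only [CutsApart, Passed]
  constructor
  · intro h
    by_cases h1 : v c < v c'
    · exact ⟨(v c + v c') / 2, .inl (by linarith), .inl (by linarith)⟩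
    · have h2 : ¬ v c' < v c ∧ c < n ∧ ¬ c' < n := by
        by_contra h2
        exact h ⟨h1, h2⟩
      exact ⟨v c, .inr ⟨h2.2.1, rfl⟩, .inr ⟨h2.2.2, le_antisymm (not_lt.1 h2.1) (not_lt.1 h1)⟩⟩
  · rintro ⟨x, h1, h2⟩ ⟨h3, h4⟩
    rcases h1 with h1 | ⟨h1, e1⟩ <;> rcases h2 with h2 | ⟨h2, e2⟩
    · exact h3 (h1.trans h2)
    · exact h3 (e2 ▸ h1)
    · exact h3 (e1 ▸ h2)
    · exact h4 ⟨by rw [← e1, ← e2]; exact lt_irrefl x, h1, h2⟩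

theorem holds_cutTest {σ : State} {d lo hi l h : ℕ} (hl : σ.natReg lo = l) (hh : σ.natReg hi = h)
    (h1 : σ.natReg 1 = n) : (cutTest d lo hi).Holds σ ↔
      CutsApart n (σ.realArr d) (σ.natArr (9 + d) l) (σ.natArr (9 + d) h) := by
  simp only [cutTest, holds_not, holds_and, holds_realLt, RealExpr.eval, eval_arr, eval_reg,
    holds_lt, hl, hh, h1, CutsApart]

/-- The interval between two cuts, as it is described in the output. -/
theorem mem_cut_interval {c c' : ℕ} {x : ℝ} :
    ((v c < x ∨ 1 - (c + 1 - n) ≠ 0 ∧ x = v c) ∧ (x < v c' ∨ c' + 1 - n ≠ 0 ∧ x = v c')) ↔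
      Passed n v c x ∧ ¬ Passed n v c' x := by
  have e1 : 1 - (c + 1 - n) ≠ 0 ↔ c < n := by omega
  have e2 : c' + 1 - n ≠ 0 ↔ ¬ c' < n := by omega
  rw [not_passed, Passed, e1, e2]

end put

/-- Cuts of different rank may have equal coordinates, so a nonempty box of ranks can contain no
point at all. The test recognizes this and drops the box, since the output must consist of nonempty
boxes. -/
theorem runs_putProg {n : ℕ} {σ : State} {R : Set (Fin 3 → ℝ)} {l h : Fin 3 → ℕ}
    (h1 : σ.natReg 1 = n)
    (hs : ∀ d < 3, IsSort (2 * n) (σ.realArr d) (σ.natArr (9 + d)) (σ.natArr (12 + d)))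
    (hl : ∀ j, l j < 2 * n) (hh : ∀ j, h j < 2 * n)
    (r46 : σ.natReg 46 = l 0) (r47 : σ.natReg 47 = h 0)
    (r42 : σ.natReg 42 = l 1) (r43 : σ.natReg 43 = h 1)
    (r44 : σ.natReg 44 = l 2) (r45 : σ.natReg 45 = h 2)
    (hR : OutPart σ R) (hdis : Disjoint R (rankBox (σ.iota n) l h)) :
    Runs putProg σ 250 fun τ => OutPart τ (R ∪ rankBox (σ.iota n) l h) ∧
      τ.natReg 0 ≤ σ.natReg 0 + 1 := by
  have key : ∀ x, x ∈ rankBox (σ.iota n) l h ↔ ∀ j : Fin 3,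
      Passed n (σ.realArr j) (σ.natArr (9 + j) (l j)) (x j) ∧
      ¬ Passed n (σ.realArr j) (σ.natArr (9 + j) (h j)) (x j) := fun x => by
    simp only [rankBox, Set.mem_ofPred_eq, State.iota]
    refine forall_congr' fun j => ?_
    rw [(hs j j.2).passed_iff (hl j), (hs j j.2).passed_iff (hh j), not_lt]
  have hne : (rankBox (σ.iota n) l h).Nonempty ↔ ∀ j : Fin 3, CutsApart n (σ.realArr j)
      (σ.natArr (9 + j) (l j)) (σ.natArr (9 + j) (h j)) := by
    simp only [cutsApart_iff]
    constructor
    · rintro ⟨x, hx⟩ j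
      exact ⟨x j, (key x).1 hx j⟩
    · intro hx
      choose x hx using hx
      exact ⟨x, (key x).2 hx⟩
  have htest : (Test.and (cutTest 0 46 47) (.and (cutTest 1 42 43) (cutTest 2 44 45))).Holds σ ↔
      (rankBox (σ.iota n) l h).Nonempty := by
    rw [hne, holds_and, holds_and, holds_cutTest r46 r47 h1, holds_cutTest r42 r43 h1,
      holds_cutTest r44 r45 h1, Fin.forall_fin_succ, Fin.forall_fin_two]
    rfl
  refine Runs.line rfl (by decide) ?_
  rw [putProg, Prog.run_ite]
  by_cases hb : (rankBox (σ.iota n) l h).Nonempty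
  · rw [if_pos (htest.2 hb)]
    set τ := (storeDim 0 46 47 ;; storeDim 1 42 43 ;; storeDim 2 44 45 ;;
      set 0 (reg 0 + nat 1)).run σ with hτ
    have h0 : τ.natReg 0 = σ.natReg 0 + 1 := by
      simp [hτ, storeDim]
    have hold : ∀ k < σ.natReg 0, (τ.outBox k).toSet = (σ.outBox k).toSet := by
      intro k hk
      congr 1
      simp only [State.outBox, Box.mk.injEq]
      refine ⟨?_, ?_, ?_, ?_⟩ <;> funext j <;> fin_cases j <;>
        simp [hτ, storeDim, hk.ne, RealExpr.eval]
    have hnew : (τ.outBox (σ.natReg 0)).toSet = rankBox (σ.iota n) l h := by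
      ext x
      rw [key]
      simp only [← mem_cut_interval, Box.toSet, Set.mem_ofPred_eq, Fin.forall_fin_succ,
        Fin.forall_fin_two, State.outBox]
      simp [hτ, storeDim, RealExpr.eval, r46, r47, r42, r43, r44, r45, h1]
    refine ⟨⟨fun k hk => ?_, fun k hk j hj => ?_, fun x => ?_⟩, h0.le⟩
    · rw [State.outCount, h0] at hk
      rcases Nat.lt_succ_iff_lt_or_eq.1 hk with hk | rfl
      · rw [hold k hk]; exact hR.nonempty k hk
      · rw [hnew]; exact hb
    · rw [State.outCount, h0] at hk
      rcases Nat.lt_succ_iff_lt_or_eq.1 hk with hk | rfl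
      · rw [hold k hk, hold j (by omega)]; exact hR.disjoint k hk j hj
      · rw [hnew, hold j hj]
        refine hdis.symm.mono_right fun x hx => (hR.mem x).2 ⟨j, hj, hx⟩
    · rw [Set.mem_union, hR.mem, State.outCount, State.outCount, h0]
      constructor
      · rintro (⟨k, hk, hx⟩ | hx)
        · exact ⟨k, by omega, by rwa [hold k hk]⟩
        · exact ⟨_, Nat.lt_succ_self _, by rwa [hnew]⟩
      · rintro ⟨k, hk, hx⟩
        rcases Nat.lt_succ_iff_lt_or_eq.1 hk with hk | rfl
        · exact .inl ⟨k, hk, by rwa [← hold k hk]⟩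
        · exact .inr (by rwa [hnew] at hx)
  · rw [if_neg fun h => hb (htest.1 h), Set.not_nonempty_iff_eq_empty.1 hb]
    simpa using hR

end RealRAM


/-! ### Profiles of rows, and output of boxes seen from one side -/

/-- The number of changes of `f` between `r₁` and `r₂`. -/
def cutCount {α : Type*} [DecidableEq α] (f : ℕ → α) (r₁ r₂ : ℕ) : ℕ :=
  ((Finset.range r₂).filter fun u => r₁ ≤ u ∧ u + 1 < r₂ ∧ f u ≠ f (u + 1)).card

theorem cutCount_lt {α : Type*} [DecidableEq α] {f : ℕ → α} {r r' r₂ : ℕ} (h : r < r')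
    (h' : r' < r₂) (hf : f (r' - 1) ≠ f r') : cutCount f r' r₂ < cutCount f r r₂ := by
  refine Finset.card_lt_card ⟨fun u hu => ?_, fun hs => ?_⟩
  · simp only [Finset.mem_filter, Finset.mem_range] at hu ⊢
    exact ⟨hu.1, by omega, hu.2.2⟩
  · have e : r' - 1 + 1 = r' := by omega
    have : r' - 1 ∈ (Finset.range r₂).filter fun u => r' ≤ u ∧ u + 1 < r₂ ∧ f u ≠ f (u + 1) :=
      hs (by simp only [Finset.mem_filter, Finset.mem_range, e]; exact ⟨by omega, by omega, h', hf⟩)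
    simp only [Finset.mem_filter] at this
    omega

/-- The number nearest to `w` between `L` and `U`. -/
def clampTo (L U w : ℕ) : ℕ := max L (min U w)

/-- The least number that has the same `clampTo L U` as `w`. -/
def lowB (L U w : ℕ) : ℕ := if w ≤ L then 0 else if w < U then w else U

/-- The greatest number up to `N` that has the same `clampTo L U` as `w`. -/
def highB (N L U w : ℕ) : ℕ := if w ≤ L then L else if w < U then w else N

/-- The fibres of a clamp are intervals, so agreement of profiles becomes a conjunction of lower and
upper bounds, which is what the aggregates of the trees can test. -/
theorem clampTo_eq_iff {N L U w w' : ℕ} (h : L < U) (hw' : w' ≤ N) :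
    clampTo L U w' = clampTo L U w ↔ lowB L U w ≤ w' ∧ w' ≤ highB N L U w := by
  simp only [clampTo, lowB, highB]
  split_ifs <;> omega

namespace RealRAM
open HeapTree

/-- The kind of the pieces on the other side of the same slabs. -/
def Kind.opp (q : Kind) : Kind := ⟨q.down, !q.side⟩

/-- The kind of the pieces that reach to the other end of the `z`-slab. -/
def Kind.cross (q : Kind) : Kind := ⟨!q.down, q.side⟩

/-- The kind that differs in both directions. -/
def Kind.copp (q : Kind) : Kind := ⟨!q.down, !q.side⟩

theorem Kind.num_lt (q : Kind) : q.num < 4 := by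
  obtain ⟨_ | _, _ | _⟩ := q <;> simp [num]

theorem Kind.exists_num {k : ℕ} (hk : k < 4) : ∃ q : Kind, q.num = k := by
  interval_cases k
  · exact ⟨⟨false, false⟩, rfl⟩
  · exact ⟨⟨false, true⟩, rfl⟩
  · exact ⟨⟨true, false⟩, rfl⟩
  · exact ⟨⟨true, true⟩, rfl⟩

theorem Kind.forall_iff (q : Kind) {P : Kind → Prop} :
    (∀ q, P q) ↔ P q ∧ P q.opp ∧ P q.cross ∧ P q.copp := by
  refine ⟨fun h => ⟨h _, h _, h _, h _⟩, fun ⟨h1, h2, h3, h4⟩ q' => ?_⟩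
  obtain ⟨a, b⟩ := q
  obtain ⟨c, d⟩ := q'
  cases a <;> cases b <;> cases c <;> cases d <;> assumption

/-- What the values of the four trees at a row mean for the insertion of a piece of kind `q` with
threshold `a`. -/
def prof (N a : ℕ) (q : Kind) (v : Kind → ℕ) : ℕ × ℕ × ℕ × ℕ :=
  if v q < a then (v q, clampTo (N - a) (N - v q) (v q.opp), clampTo (v q) a (v q.cross),
    clampTo (N - a) (N - v q) (v q.copp)) else (a, 0, 0, 0)

/-- The position `X` in the direction of `x` (as seen from the side of `q`) and `z` in the
direction of `z` belongs to the region that a piece adds. -/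
def Cond (N a base : ℕ) (q : Kind) (v : Kind → ℕ) (za zb w1 w2 X z : ℕ) : Prop :=
  base < X ∧ X ≤ a ∧ v q < X ∧ v q.opp < N + 1 - X ∧
    ((v q.cross < X ∧ v q.copp < N + 1 - X ∧ za < z ∧ z ≤ zb) ∨
      ¬ (v q.cross < X ∧ v q.copp < N + 1 - X) ∧ w1 < z ∧ z ≤ w2)

/-- Only positions with `v q < X ≤ a` count, and a comparison of another value with such an `X` does
not notice that the value is clamped to this range, mirrored for the kinds of the other side. If `a
≤ v q`, no position is left, which is why the profile is constant there. -/
theorem Cond.congr {N a base za zb w1 w2 X z : ℕ} {q : Kind} {v v' : Kind → ℕ} (ha : a ≤ N)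
    (h : prof N a q v = prof N a q v') :
    Cond N a base q v za zb w1 w2 X z ↔ Cond N a base q v' za zb w1 w2 X z := by
  simp only [prof, Cond] at *
  generalize v q = o at *
  generalize v' q = o' at *
  generalize v q.opp = p at *
  generalize v' q.opp = p' at *
  generalize v q.cross = c at *
  generalize v' q.cross = c' at *
  generalize v q.copp = d at *
  generalize v' q.copp = d' at *
  by_cases hX : base < X ∧ X ≤ a
  · split_ifs at h with h1 h2 h2
    · simp only [Prod.mk.injEq, clampTo] at h
      obtain ⟨rfl, e1, e2, e3⟩ := h
      by_cases hoX : o < X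
      · have a1 : p < N + 1 - X ↔ p' < N + 1 - X := by omega
        have a2 : c < X ↔ c' < X := by omega
        have a3 : d < N + 1 - X ↔ d' < N + 1 - X := by omega
        rw [a1, a2, a3]
      · simp [hoX]
    · simp only [Prod.mk.injEq] at h; omega
    · simp only [Prod.mk.injEq] at h; omega
    · have a1 : ¬ o < X := by omega
      have a2 : ¬ o' < X := by omega
      simp [a1, a2]
  · have : ¬ base < X ∨ ¬ X ≤ a := by omega
    rcases this with h | h <;> simp [h]

/-- Sets the bounds for the value of tree `k`. -/
def clampProg (k : ℕ) (L U : NatExpr) : Prog :=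
  .ite (le (reg (15 + k)) L) (set (19 + k) (nat 0) ;; set (23 + k) L)
    (.ite (lt (reg (15 + k)) U) (set (19 + k) (reg (15 + k)) ;; set (23 + k) (reg (15 + k)))
      (set (19 + k) U ;; set (23 + k) (reg 2)))

/-- Computes the bounds for the values that have the same profile as those in the registers
`15, …, 18`. -/
def boundProg (q : Kind) : Prog :=
  .ite (lt (reg (15 + q.num)) (reg 7))
    (set (19 + q.num) (reg (15 + q.num)) ;; set (23 + q.num) (reg (15 + q.num)) ;;
      clampProg q.opp.num (reg 2 - reg 7) (reg 2 - reg (15 + q.num)) ;;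
      clampProg q.cross.num (reg (15 + q.num)) (reg 7) ;;
      clampProg q.copp.num (reg 2 - reg 7) (reg 2 - reg (15 + q.num)))
    ((forK fun k => set (19 + k) (nat 0)) ;; (forK fun k => set (23 + k) (reg 2)) ;;
      set (19 + q.num) (reg 7))

theorem prof_eq_iff {N a : ℕ} {q : Kind} {v v' : Kind → ℕ} (ha : a ≤ N) (hv' : ∀ q, v' q ≤ N) :
    prof N a q v' = prof N a q v ↔
      if v q < a then (v q ≤ v' q ∧ v' q ≤ v q) ∧
        (lowB (N - a) (N - v q) (v q.opp) ≤ v' q.opp ∧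
          v' q.opp ≤ highB N (N - a) (N - v q) (v q.opp)) ∧
        (lowB (v q) a (v q.cross) ≤ v' q.cross ∧ v' q.cross ≤ highB N (v q) a (v q.cross)) ∧
        (lowB (N - a) (N - v q) (v q.copp) ≤ v' q.copp ∧
          v' q.copp ≤ highB N (N - a) (N - v q) (v q.copp))
      else (a ≤ v' q ∧ v' q ≤ N) ∧ (0 ≤ v' q.opp ∧ v' q.opp ≤ N) ∧
        (0 ≤ v' q.cross ∧ v' q.cross ≤ N) ∧ (0 ≤ v' q.copp ∧ v' q.copp ≤ N) := by
  by_cases h : v q < a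
  · rw [if_pos h, ← clampTo_eq_iff (by omega) (hv' _), ← clampTo_eq_iff (by omega) (hv' _),
      ← clampTo_eq_iff (by omega) (hv' _), prof, prof, if_pos h]
    by_cases h' : v' q = v q
    · simp [h', h]
    · refine iff_of_false ?_ (by omega)
      split_ifs <;> simp only [Prod.mk.injEq] <;> omega
  · rw [if_neg h, prof, prof, if_neg h]
    have h1 := hv' q
    have h2 := hv' q.opp
    have h3 := hv' q.cross
    have h4 := hv' q.copp
    by_cases h' : v' q < a
    · rw [if_pos h']
      refine iff_of_false ?_ (by omega)
      simp only [Prod.mk.injEq]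
      omega
    · rw [if_neg h']
      exact iff_of_true rfl (by omega)

theorem runs_boundProg {N a : ℕ} {q : Kind} {v : Kind → ℕ} {σ : State} (ha : a ≤ N)
    (h2 : σ.natReg 2 = N) (h7 : σ.natReg 7 = a) (hv : ∀ q, σ.natReg (15 + q.num) = v q) :
    Runs (boundProg q) σ 80 fun τ => ∃ A B : ℕ → ℕ,
      (∀ k < 4, τ.natReg (19 + k) = A k) ∧ (∀ k < 4, τ.natReg (23 + k) = B k) ∧
      ∀ v' : Kind → ℕ, (∀ q, v' q ≤ N) → ((∀ q, A q.num ≤ v' q ∧ v' q ≤ B q.num) ↔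
        prof N a q v' = prof N a q v) := by
  refine Runs.line (by obtain ⟨_ | _, _ | _⟩ := q <;> rfl)
    (by obtain ⟨_ | _, _ | _⟩ := q <;> decide)
    ⟨fun k => ((boundProg q).run σ).natReg (19 + k), fun k => ((boundProg q).run σ).natReg (23 + k),
      fun _ _ => rfl, fun _ _ => rfl, fun v' hv' => ?_⟩
  have hclamp : ∀ k L U ρ, (clampProg k L U).run ρ = (ρ.setNat (19 + k)
      (lowB (L.eval ρ) (U.eval ρ) (ρ.natReg (15 + k)))).setNat (23 + k)
      (if ρ.natReg (15 + k) ≤ L.eval ρ then L.eval (ρ.setNat (19 + k) 0) else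
        if ρ.natReg (15 + k) < U.eval ρ then (ρ.setNat (19 + k) (ρ.natReg (15 + k))).natReg (15 + k)
          else (ρ.setNat (19 + k) (U.eval ρ)).natReg 2) := by
    intro k L U ρ
    simp only [clampProg, Prog.run_ite, holds_not, holds_lt, eval_reg, not_lt, Prog.run_seq,
      Prog.run_setNat, lowB, eval_const]
    split_ifs <;> simp
  rw [prof_eq_iff ha hv', Kind.forall_iff q]
  simp only [boundProg, Prog.run_ite, holds_lt, eval_reg, h7, hv]
  split_ifs with hlt
  · obtain ⟨_ | _, _ | _⟩ := q <;>
    · have i0 := hv ⟨false, false⟩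
      have i1 := hv ⟨false, true⟩
      have i2 := hv ⟨true, false⟩
      have i3 := hv ⟨true, true⟩
      simp only [Kind.num, Kind.opp, Kind.cross, Kind.copp, Bool.not_true, Bool.not_false,
        Nat.reduceAdd] at i0 i1 i2 i3 hlt ⊢
      simp [hclamp, h2, h7, i0, i1, i2, i3, highB]
  · obtain ⟨_ | _, _ | _⟩ := q <;>
    · simp [Kind.num, Kind.opp, Kind.cross, Kind.copp, forK, h2, h7]

/-- A rank in dimension `0`, seen from the left or from the right. -/
def sideX (N : ℕ) (side : Bool) (x : ℕ) : ℕ := if side then N + 1 - x else x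

/-- The points in a box of ranks, where the ranks in dimension `0` are seen from a side. -/
def sideBox (ι : Fin 3 → ℝ → ℕ) (N : ℕ) (side : Bool) (x1 x2 y1 y2 z1 z2 : ℕ) :
    Set (Fin 3 → ℝ) :=
  {x | (x1 < sideX N side (ι 0 (x 0)) ∧ sideX N side (ι 0 (x 0)) ≤ x2) ∧
    (y1 < ι 1 (x 1) ∧ ι 1 (x 1) ≤ y2) ∧ z1 < ι 2 (x 2) ∧ ι 2 (x 2) ≤ z2}

/-- Outputs the box between the ranks in the registers `40, …, 45`. -/
def boxProg (side : Bool) : Prog :=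
  .ite (lt (reg 40) (reg 41))
    (bif side then set 46 (reg 2 - reg 41) ;; set 47 (reg 2 - reg 40) ;; putProg
      else set 46 (reg 40) ;; set 47 (reg 41) ;; putProg) .skip

theorem runs_boxProg {n x1 x2 y1 y2 z1 z2 : ℕ} {side : Bool} {σ : State} {R : Set (Fin 3 → ℝ)}
    (h1 : σ.natReg 1 = n) (h2 : σ.natReg 2 = 2 * n)
    (hs : ∀ d < 3, IsSort (2 * n) (σ.realArr d) (σ.natArr (9 + d)) (σ.natArr (12 + d)))
    (hx1 : side = true → 0 < x1) (hx2 : side = false → x2 < 2 * n) (hx3 : x2 ≤ 2 * n)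
    (hy1 : y1 < 2 * n) (hy2 : y2 < 2 * n)
    (hz1 : z1 < 2 * n) (hz2 : z2 < 2 * n) (r40 : σ.natReg 40 = x1) (r41 : σ.natReg 41 = x2)
    (r42 : σ.natReg 42 = y1) (r43 : σ.natReg 43 = y2)
    (r44 : σ.natReg 44 = z1) (r45 : σ.natReg 45 = z2)
    (hR : OutPart σ R) (hdis : Disjoint R (sideBox (σ.iota n) (2 * n) side x1 x2 y1 y2 z1 z2)) :
    Runs (boxProg side) σ 270 fun τ =>
      OutPart τ (R ∪ sideBox (σ.iota n) (2 * n) side x1 x2 y1 y2 z1 z2) ∧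
      τ.natReg 0 ≤ σ.natReg 0 + 1 := by
  refine (Runs.ite (T := 260) (fun hb => ?_) fun hb => ?_).mono (by decide) fun _ h => h
  · simp [r40, r41] at hb
    cases side with
    | false =>
      have e : sideBox (σ.iota n) (2 * n) false x1 x2 y1 y2 z1 z2 =
          rankBox (σ.iota n) ![x1, y1, z1] ![x2, y2, z2] := by
        ext x
        simp [sideBox, rankBox, sideX, Fin.forall_fin_succ, and_assoc]
      rw [e] at hdis ⊢
      have hx2 := hx2 rfl
      refine Runs.seq_of (T₁ := 2) (T₂ := 256) (R := fun ρ => ρ = σ.setNat 46 x1)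
        (Runs.line rfl (by decide) (by simp [r40])) (fun ρ hρ _ => ?_) (by omega)
      refine Runs.seq_of (T₁ := 2) (T₂ := 250) (R := fun τ => τ = ρ.setNat 47 x2)
        (Runs.line rfl (by decide) (by simp [r41, hρ])) (fun τ hτ _ => ?_) (by omega)
      have eι : τ.iota n = σ.iota n := by rw [hτ, hρ]; rfl
      refine (runs_putProg (n := n) (σ := τ) (R := R) (l := ![x1, y1, z1]) (h := ![x2, y2, z2])
        (by simp [hτ, hρ, h1]) (by simpa [hτ, hρ] using hs) ?_ ?_ (by simp [hτ, hρ])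
        (by simp [hτ]) (by simp [hτ, hρ, r42]) (by simp [hτ, hρ, r43]) (by simp [hτ, hρ, r44])
        (by simp [hτ, hρ, r45]) (hR.congr (by simp [hτ, hρ]) (by simp [hτ, hρ])
          (by simp [hτ, hρ])) (by rwa [eι])).mono le_rfl fun τ' hτ' => ?_
      · intro j; fin_cases j <;> simp <;> omega
      · intro j; fin_cases j <;> simp <;> omega
      · rw [eι] at hτ'
        exact ⟨hτ'.1, by simpa [hτ, hρ] using hτ'.2⟩
    | true =>
      have hx1 := hx1 rfl
      -- Seen from the right, `x1 < N + 1 - x ≤ x2` means `N - x2 < x ≤ N - x1`. The hypothesis `0 <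
      -- x1` makes the upper cut `N - x1` one of the `2 n` existing cuts.
      have e : sideBox (σ.iota n) (2 * n) true x1 x2 y1 y2 z1 z2 =
          rankBox (σ.iota n) ![2 * n - x2, y1, z1] ![2 * n - x1, y2, z2] := by
        ext x
        have := rankOf_le (n := n) (v := σ.realArr (0 : Fin 3)) (ord := σ.natArr (9 + (0 : Fin 3)))
          (x := x 0)
        simp only [sideBox, rankBox, sideX, Fin.forall_fin_succ, State.iota, Set.mem_ofPred_eq,
          if_true] at *
        simp
        intro _ _ _ _
        omega
      rw [e] at hdis ⊢
      refine Runs.seq_of (T₁ := 4) (T₂ := 256) (R := fun ρ => ρ = σ.setNat 46 (2 * n - x2))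
        (Runs.line rfl (by decide) (by simp [r41, h2])) (fun ρ hρ _ => ?_) (by omega)
      refine Runs.seq_of (T₁ := 4) (T₂ := 250) (R := fun τ => τ = ρ.setNat 47 (2 * n - x1))
        (Runs.line rfl (by decide) (by simp [r40, h2, hρ])) (fun τ hτ _ => ?_) (by omega)
      have eι : τ.iota n = σ.iota n := by rw [hτ, hρ]; rfl
      refine (runs_putProg (n := n) (σ := τ) (R := R) (l := ![2 * n - x2, y1, z1])
        (h := ![2 * n - x1, y2, z2])
        (by simp [hτ, hρ, h1]) (by simpa [hτ, hρ] using hs) ?_ ?_ (by simp [hτ, hρ])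
        (by simp [hτ]) (by simp [hτ, hρ, r42]) (by simp [hτ, hρ, r43]) (by simp [hτ, hρ, r44])
        (by simp [hτ, hρ, r45]) (hR.congr (by simp [hτ, hρ]) (by simp [hτ, hρ])
          (by simp [hτ, hρ])) (by rwa [eι])).mono le_rfl fun τ' hτ' => ?_
      · intro j; fin_cases j <;> simp <;> omega
      · intro j; fin_cases j <;> simp <;> omega
      · rw [eι] at hτ'
        exact ⟨hτ'.1, by simpa [hτ, hρ] using hτ'.2⟩
  · simp [r40, r41] at hb
    have e : sideBox (σ.iota n) (2 * n) side x1 x2 y1 y2 z1 z2 = ∅ := by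
      ext x
      simp [sideBox]
      omega
    rw [e]
    exact Runs.line rfl (by decide) (by simpa using hR)

end RealRAM


/-! ### The region added by a piece, as boxes over runs of equal profile -/

namespace RealRAM
open HeapTree

/-- The region that a piece of kind `q` adds in the rows `u ≤ r < u'`; `Y` gives the beginnings of
the rows and `V` the values of the trees at the rows. -/
def rowRegion (ι : Fin 3 → ℝ → ℕ) (N a base : ℕ) (q : Kind) (V : Kind → ℕ → ℕ) (Y : ℕ → ℕ)
    (za zb w1 w2 u u' : ℕ) : Set (Fin 3 → ℝ) :=
  {x | ∃ r, u ≤ r ∧ r < u' ∧ Y r < ι 1 (x 1) ∧ ι 1 (x 1) ≤ Y (r + 1) ∧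
    Cond N a base q (fun q => V q r) za zb w1 w2 (sideX N q.side (ι 0 (x 0))) (ι 2 (x 2))}

/-- The part of a region where the cross pieces are absent. -/
def boxA (ι : Fin 3 → ℝ → ℕ) (N a base : ℕ) (q : Kind) (v : Kind → ℕ) (za zb y1 y2 : ℕ) :
    Set (Fin 3 → ℝ) :=
  sideBox ι N q.side (max (max (v q) (v q.cross)) base)
    (min (min a (N - v q.opp)) (N - v q.copp)) y1 y2 za zb

/-- The part of a region where there is a cross piece of the same side. -/
def boxB (ι : Fin 3 → ℝ → ℕ) (N a base : ℕ) (q : Kind) (v : Kind → ℕ) (w1 w2 y1 y2 : ℕ) :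
    Set (Fin 3 → ℝ) :=
  sideBox ι N q.side (max (v q) base) (min (min a (N - v q.opp)) (v q.cross)) y1 y2 w1 w2

/-- The part of a region where there is a cross piece of the other side only. -/
def boxC (ι : Fin 3 → ℝ → ℕ) (N a base : ℕ) (q : Kind) (v : Kind → ℕ) (w1 w2 y1 y2 : ℕ) :
    Set (Fin 3 → ℝ) :=
  sideBox ι N q.side (max (max (v q) (v q.cross)) (max base (N - v q.copp)))
    (min a (N - v q.opp)) y1 y2 w1 w2

theorem le_of_rows {Y : ℕ → ℕ} {u u' : ℕ} (h : u ≤ u')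
    (hY : ∀ r, u ≤ r → r < u' → Y r ≤ Y (r + 1)) : Y u ≤ Y u' := by
  induction u', h using Nat.le_induction with
  | base => exact le_rfl
  | succ k hk ih => exact (ih fun r h1 h2 => hY r h1 (by omega)).trans (hY k hk (by omega))

theorem exists_row {Y : ℕ → ℕ} {u u' y : ℕ} (h : u ≤ u') (hY : ∀ r, u ≤ r → r < u' → Y r ≤ Y (r + 1)) :
    (∃ r, u ≤ r ∧ r < u' ∧ Y r < y ∧ y ≤ Y (r + 1)) ↔ Y u < y ∧ y ≤ Y u' := by
  induction u', h using Nat.le_induction with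
  | base => exact ⟨fun ⟨r, h1, h2, _⟩ => by omega, fun h => by omega⟩
  | succ m hm ih =>
    have ih := ih fun r h1 h2 => hY r h1 (by omega)
    have hmono : Y u ≤ Y m := le_of_rows hm fun r h1 h2 => hY r h1 (by omega)
    have hm1 := hY m hm (by omega)
    constructor
    · rintro ⟨r, h1, h2, h3, h4⟩
      rcases Nat.lt_succ_iff_lt_or_eq.1 h2 with h | rfl
      · have := ih.1 ⟨r, h1, h, h3, h4⟩
        omega
      · omega
    · rintro ⟨h1, h2⟩
      by_cases h : y ≤ Y m
      · obtain ⟨r, h3, h4, h5⟩ := ih.2 ⟨h1, h⟩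
        exact ⟨r, h3, by omega, h5⟩
      · exact ⟨m, hm, by omega, by omega, h2⟩

section region
variable {ι : Fin 3 → ℝ → ℕ} {N a base : ℕ} {q : Kind} {V : Kind → ℕ → ℕ} {Y : ℕ → ℕ}
  {za zb w1 w2 u u' r₂ : ℕ}

/-- Over a run of equal profile the region has the same cross-section in every row. In the direction
of `x` it is cut where the pieces of the other `z`-direction end: between those of the two walls
none is present (`boxA`), near the own wall one of the same side is present (`boxB`), and farther
away only one of the opposite side (`boxC`). -/
theorem rowRegion_eq (ha : a ≤ N) (huu : u < u')
    (hY : ∀ r, u ≤ r → r < u' → Y r ≤ Y (r + 1))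
    (hp : ∀ r, u ≤ r → r < u' → prof N a q (fun q => V q r) = prof N a q fun q => V q u) :
    rowRegion ι N a base q V Y za zb w1 w2 u u' =
      boxA ι N a base q (fun q => V q u) za zb (Y u) (Y u') ∪
      (boxB ι N a base q (fun q => V q u) w1 w2 (Y u) (Y u') ∪
      boxC ι N a base q (fun q => V q u) w1 w2 (Y u) (Y u')) := by
  ext x
  have h1 : x ∈ rowRegion ι N a base q V Y za zb w1 w2 u u' ↔
      (Y u < ι 1 (x 1) ∧ ι 1 (x 1) ≤ Y u') ∧ Cond N a base q (fun q => V q u) za zb w1 w2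
        (sideX N q.side (ι 0 (x 0))) (ι 2 (x 2)) := by
    rw [← exists_row huu.le hY]
    constructor
    · rintro ⟨r, a1, a2, a3, a4, a5⟩
      exact ⟨⟨r, a1, a2, a3, a4⟩, (Cond.congr ha (hp r a1 a2)).1 a5⟩
    · rintro ⟨⟨r, a1, a2, a3, a4⟩, a5⟩
      exact ⟨r, a1, a2, a3, a4, (Cond.congr ha (hp r a1 a2)).2 a5⟩
  rw [h1]
  simp only [boxA, boxB, boxC, sideBox, Set.mem_union, Set.mem_ofPred_eq, Cond]
  generalize sideX N q.side (ι 0 (x 0)) = X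
  omega

theorem boxA_disjoint {v : Kind → ℕ} {y1 y2 : ℕ} :
    Disjoint (boxA ι N a base q v za zb y1 y2) (boxB ι N a base q v w1 w2 y1 y2) ∧
    Disjoint (boxA ι N a base q v za zb y1 y2) (boxC ι N a base q v w1 w2 y1 y2) ∧
    Disjoint (boxB ι N a base q v w1 w2 y1 y2) (boxC ι N a base q v w1 w2 y1 y2) := by
  simp only [Set.disjoint_left, boxA, boxB, boxC, sideBox, Set.mem_ofPred_eq]
  refine ⟨fun x => ?_, fun x => ?_, fun x => ?_⟩ <;> omega

theorem rowRegion_append (h1 : u ≤ u') (h2 : u' ≤ r₂) :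
    rowRegion ι N a base q V Y za zb w1 w2 u r₂ = rowRegion ι N a base q V Y za zb w1 w2 u u' ∪
      rowRegion ι N a base q V Y za zb w1 w2 u' r₂ := by
  ext x
  constructor
  · rintro ⟨r, a1, a2, a3⟩
    rcases Nat.lt_or_ge r u' with h | h
    · exact .inl ⟨r, a1, h, a3⟩
    · exact .inr ⟨r, h, a2, a3⟩
  · rintro (⟨r, a1, a2, a3⟩ | ⟨r, a1, a2, a3⟩)
    · exact ⟨r, a1, by omega, a3⟩
    · exact ⟨r, by omega, a2, a3⟩

theorem rowRegion_disjoint (h1 : u ≤ u') (h2 : u' ≤ r₂)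
    (hY : ∀ r, u ≤ r → r < r₂ → Y r ≤ Y (r + 1)) :
    Disjoint (rowRegion ι N a base q V Y za zb w1 w2 u u')
      (rowRegion ι N a base q V Y za zb w1 w2 u' r₂) := by
  rw [Set.disjoint_left]
  rintro x ⟨r, a1, a2, a3, a4, -⟩ ⟨r', b1, b2, b3, b4, -⟩
  have := (exists_row h1 fun r c1 c2 => hY r c1 (by omega)).1 ⟨r, a1, a2, a3, a4⟩
  have := (exists_row h2 fun r c1 c2 => hY r (by omega) c2).1 ⟨r', b1, b2, b3, b4⟩
  omega

end region

/-! ### Output of the region of a piece -/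

/-- Outputs a box that is given by expressions. -/
def boxAtProg (side : Bool) (e1 e2 : NatExpr) (z1 z2 : ℕ) : Prog :=
  (set 40 e1 ;; set 41 e2 ;; set 44 (reg z1) ;; set 45 (reg z2)) ;; boxProg side

/-- Outputs the boxes of the rows with the same profile as the row at leaf `10`, and proceeds to the
next row. -/
def runProg (q : Kind) : Prog :=
  valProg ;; boundProg q ;; nextProg ;;
    (set 37 (emin (reg 37) (reg 9)) ;; set 42 (arr 21 (arr 22 (reg 10 - reg 3 - nat 1))) ;;
      set 43 (arr 21 (arr 22 (reg 37 - reg 3 - nat 1)))) ;;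
    boxAtProg q.side (emax (emax (reg (15 + q.num)) (reg (15 + q.cross.num))) (reg 8))
      (emin (emin (reg 7) (reg 2 - reg (15 + q.opp.num))) (reg 2 - reg (15 + q.copp.num))) 11 12 ;;
    boxAtProg q.side (emax (reg (15 + q.num)) (reg 8))
      (emin (emin (reg 7) (reg 2 - reg (15 + q.opp.num))) (reg (15 + q.cross.num))) 13 14 ;;
    boxAtProg q.side (emax (emax (reg (15 + q.num)) (reg (15 + q.cross.num)))
      (emax (reg 8) (reg 2 - reg (15 + q.copp.num))))
      (emin (reg 7) (reg 2 - reg (15 + q.opp.num))) 13 14 ;; set 10 (reg 37)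

/-- Outputs the region of a piece of kind `q`. -/
def emitProg (q : Kind) : Prog := .while (lt (reg 10) (reg 9)) (runProg q)

/-- The memory describes the piece whose region is to be output. -/
structure EventAt (n K : ℕ) (a base r₂ za zb w1 w2 : ℕ) (V : Kind → ℕ → ℕ) (Y : ℕ → ℕ)
    (σ : State) : Prop where
  reg1 : σ.natReg 1 = n
  reg2 : σ.natReg 2 = 2 * n
  sorted : ∀ d < 3, IsSort (2 * n) (σ.realArr d) (σ.natArr (9 + d)) (σ.natArr (12 + d))
  forest : Forest K σ
  reg7 : σ.natReg 7 = a
  reg8 : σ.natReg 8 = base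
  reg9 : σ.natReg 9 = 2 ^ K + 1 + r₂
  reg11 : σ.natReg 11 = za
  reg12 : σ.natReg 12 = zb
  reg13 : σ.natReg 13 = w1
  reg14 : σ.natReg 14 = w2
  val : ∀ (q : Kind) (r : ℕ), 2 ^ K + 1 + r < 2 ^ (K + 1) →
    leafVal K σ q.num (2 ^ K + 1 + r) = V q r
  key : ∀ r ≤ r₂, σ.natArr 21 (σ.natArr 22 r) = Y r

/-- The numbers that describe a piece are in their ranges. -/
structure EventNum (n K : ℕ) (q : Kind) (a base r₁ r₂ za zb w1 w2 : ℕ) (V : Kind → ℕ → ℕ)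
    (Y : ℕ → ℕ) : Prop where
  a_le : a ≤ 2 * n
  a_lt : q.side = false → a < 2 * n
  base_pos : q.side = true → 0 < base
  V_le : ∀ q r, V q r ≤ 2 * n
  r₂_lt : 2 ^ K + 1 + r₂ < 2 ^ (K + 1)
  Y_lt : ∀ r ≤ r₂, r₁ ≤ r → Y r < 2 * n
  Y_le : ∀ r, r₁ ≤ r → r < r₂ → Y r ≤ Y (r + 1)
  za_lt : za < 2 * n
  zb_lt : zb < 2 * n
  w1_lt : w1 < 2 * n
  w2_lt : w2 < 2 * n

/-- `τ` agrees with `σ` on everything that the output of a region does not change. -/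
structure Kept (σ τ : State) : Prop extends Static σ τ where
  trees : ∀ a, 24 ≤ a → τ.natArr a = σ.natArr a
  regs : ∀ r, r < 15 → r ≠ 10 → r ≠ 0 → τ.natReg r = σ.natReg r

theorem Kept.refl (σ : State) : Kept σ σ :=
  ⟨⟨rfl, rfl, rfl, fun _ _ _ => rfl, fun _ _ => rfl⟩, fun _ _ => rfl, fun _ _ _ _ => rfl⟩

theorem Kept.trans {σ τ ρ : State} (h : Kept σ τ) (h' : Kept τ ρ) : Kept σ ρ :=
  ⟨h.1.trans h'.1, fun a ha => (h'.trees a ha).trans (h.trees a ha),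
    fun r h1 h2 h3 => (h'.regs r h1 h2 h3).trans (h.regs r h1 h2 h3)⟩

theorem Frame.kept {P : Prog} {σ τ : State} (h : Frame P σ τ)
    (h1 : ∀ r ∈ P.wN, r = 0 ∨ r = 10 ∨ 15 ≤ r) (h2 : ∀ a ∈ P.wNA, a < 6)
    (h3 : ∀ a ∈ P.wRA, 3 ≤ a) : Kept σ τ :=
  ⟨h.static (fun r hr hm => by have := h1 r hm; simp at hr; omega)
    (fun a ha => .inl (h2 a ha)) h3, fun a ha => h.natArr a fun hm => by have := h2 a hm; omega,
    fun r hr h4 h5 => h.natReg r fun hm => by have := h1 r hm; omega⟩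

theorem Kept.iota {σ τ : State} (h : Kept σ τ) (n : ℕ) : τ.iota n = σ.iota n := by
  funext d
  simp only [State.iota]
  rw [h.realArr d d.2, h.natArr _ (by omega) (by omega)]

theorem leafVal_congr {K k p : ℕ} {σ τ : State} (h : τ.natArr (24 + k) = σ.natArr (24 + k)) :
    leafVal K τ k p = leafVal K σ k p := by rw [leafVal, h, leafVal]

theorem EventAt.congr {n K a base r₂ za zb w1 w2 : ℕ} {V : Kind → ℕ → ℕ} {Y : ℕ → ℕ}
    {σ τ : State} (h : EventAt n K a base r₂ za zb w1 w2 V Y σ) (hk : Kept σ τ) :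
    EventAt n K a base r₂ za zb w1 w2 V Y τ := by
  have e := fun r => hk.regs r
  refine ⟨by rw [hk.reg1, h.reg1], by rw [hk.reg2, h.reg2], fun d hd => ?_, ?_,
    by rw [e 7 (by norm_num) (by norm_num) (by norm_num), h.reg7],
    by rw [e 8 (by norm_num) (by norm_num) (by norm_num), h.reg8],
    by rw [e 9 (by norm_num) (by norm_num) (by norm_num), h.reg9],
    by rw [e 11 (by norm_num) (by norm_num) (by norm_num), h.reg11],
    by rw [e 12 (by norm_num) (by norm_num) (by norm_num), h.reg12],
    by rw [e 13 (by norm_num) (by norm_num) (by norm_num), h.reg13],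
    by rw [e 14 (by norm_num) (by norm_num) (by norm_num), h.reg14], fun q r hr => ?_,
    fun r hr => ?_⟩
  · rw [hk.realArr d hd, hk.natArr _ (by omega) (by omega), hk.natArr _ (by omega) (by omega)]
    exact h.sorted d hd
  · refine h.forest.congr hk.reg3 fun a ha => ?_
    rcases ha with rfl | rfl | ha
    · exact hk.natArr 6 (by norm_num) (by norm_num)
    · exact hk.natArr 7 (by norm_num) (by norm_num)
    · exact hk.trees a ha.1
  · rw [leafVal_congr (hk.trees _ (by omega)), h.val q r hr]
  · rw [hk.natArr 21 (by norm_num) (by norm_num), hk.natArr 22 (by norm_num) (by norm_num),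
      h.key r hr]

theorem runs_boxAtProg {n x1 x2 y1 y2 z1 z2 a b : ℕ} {side : Bool} {e1 e2 : NatExpr} {σ ρ : State}
    {R : Set (Fin 3 → ℝ)} (h1 : σ.natReg 1 = n) (h2 : σ.natReg 2 = 2 * n)
    (hs : ∀ d < 3, IsSort (2 * n) (σ.realArr d) (σ.natArr (9 + d)) (σ.natArr (12 + d)))
    (hk : Kept σ ρ) (hk' : ∀ r, 15 ≤ r → r < 40 → ρ.natReg r = σ.natReg r)
    (he : ∀ τ : State, (∀ r, 0 < r → r < 40 → r ≠ 10 → τ.natReg r = σ.natReg r) →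
      e1.eval τ = x1 ∧ e2.eval τ = x2)
    (hc : e1.cost ≤ 20) (hc' : e2.cost ≤ 21)
    (hx1 : side = true → 0 < x1) (hx2 : side = false → x2 < 2 * n) (hx3 : x2 ≤ 2 * n)
    (hy1 : y1 < 2 * n) (hy2 : y2 < 2 * n)
    (hz1 : z1 < 2 * n) (hz2 : z2 < 2 * n) (r42 : ρ.natReg 42 = y1) (r43 : ρ.natReg 43 = y2)
    (ha : 10 < a ∧ a < 15) (hb : 10 < b ∧ b < 15)
    (r44 : σ.natReg a = z1) (r45 : σ.natReg b = z2)
    (hR : OutPart ρ R) (hdis : Disjoint R (sideBox (σ.iota n) (2 * n) side x1 x2 y1 y2 z1 z2)) :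
    Runs (boxAtProg side e1 e2 a b) ρ 330 fun τ =>
      OutPart τ (R ∪ sideBox (σ.iota n) (2 * n) side x1 x2 y1 y2 z1 z2) ∧
      τ.natReg 0 ≤ ρ.natReg 0 + 1 ∧ Kept σ τ ∧ (∀ r, 15 ≤ r → r < 40 → τ.natReg r = σ.natReg r) ∧
      τ.natReg 42 = y1 ∧ τ.natReg 43 = y2 ∧ τ.natReg 10 = ρ.natReg 10 := by
  have hreg : ∀ r, 0 < r → r < 40 → r ≠ 10 → ρ.natReg r = σ.natReg r := fun r q1 q2 q3 => by
    rcases Nat.lt_or_ge r 15 with h | h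
    · exact hk.regs r h q3 (by omega)
    · exact hk' r h q2
  refine Runs.seq_of (T₁ := 60) (T₂ := 270) (R := fun τ => τ = (((ρ.setNat 40 x1).setNat 41
    x2).setNat 44 z1).setNat 45 z2) (Runs.line rfl (by
      simp [Prog.maxCost, NatExpr.cost]; omega) ?_) (fun τ hτ hF => ?_) (by omega)
  · have p1 := (he ρ hreg).1
    have p2 := (he (ρ.setNat 40 x1) fun r q1 q2 q3 => by
      rw [setNat_natReg, if_neg (by omega), hreg r q1 q2 q3]).2
    have n1 : a ≠ 40 := by omega
    have n2 : a ≠ 41 := by omega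
    have n3 : b ≠ 40 := by omega
    have n4 : b ≠ 41 := by omega
    have n5 : b ≠ 44 := by omega
    simp [p1, p2, n1, n2, n3, n4, n5, hreg a (by omega) (by omega) (by omega), r44,
      hreg b (by omega) (by omega) (by omega), r45]
  · have eι : τ.iota n = σ.iota n := by rw [← hk.iota n, hτ]; rfl
    refine (runs_boxProg (n := n) (x1 := x1) (x2 := x2) (y1 := y1) (y2 := y2) (z1 := z1) (z2 := z2)
      (side := side) (R := R)
      (by simp [hτ, hk.reg1, h1]) (by simp [hτ, hk.reg2, h2]) (fun d hd => ?_) hx1 hx2 hx3 hy1 hy2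
      hz1 hz2 (by simp [hτ]) (by simp [hτ]) (by simp [hτ, r42]) (by simp [hτ, r43]) (by simp [hτ])
      (by simp [hτ]) (hR.congr (by simp [hτ]) (by simp [hτ]) (by simp [hτ])) (by rwa [eι])).frame.mono
      le_rfl fun τ' ⟨⟨k1, k2⟩, hF'⟩ => ?_
    · simpa [hτ, hk.realArr d hd, hk.natArr (9 + d) (by omega) (by omega),
        hk.natArr (12 + d) (by omega) (by omega)] using hs d hd
    · have w : ∀ r ∈ (boxProg side).wN, r = 0 ∨ r = 46 ∨ r = 47 := by cases side <;> decide
      have w' : ∀ r, r ≠ 0 → r ≠ 46 → r ≠ 47 → τ'.natReg r = τ.natReg r := fun r q1 q2 q3 =>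
        hF'.natReg r fun hm => by have := w r hm; omega
      refine ⟨by rwa [eι] at k1, by simpa [hτ] using k2, (hk.trans (hF.kept (by simp [Prog.wN])
        (by simp [Prog.wNA]) (by simp [Prog.wRA]))).trans (hF'.kept (fun r hr => by
          have := w r hr; omega) (by cases side <;> decide) (by cases side <;> decide)), ?_, ?_, ?_, ?_⟩
      · intro r q1 q2
        rw [w' r (by omega) (by omega) (by omega), ← hk' r q1 q2, hτ]
        have n1 : r ≠ 40 := by omega
        have n2 : r ≠ 41 := by omega
        have n3 : r ≠ 44 := by omega
        have n4 : r ≠ 45 := by omega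
        simp [n1, n2, n3, n4]
      · rw [w' 42 (by norm_num) (by norm_num) (by norm_num)]; simp [hτ, r42]
      · rw [w' 43 (by norm_num) (by norm_num) (by norm_num)]; simp [hτ, r43]
      · rw [w' 10 (by norm_num) (by norm_num) (by norm_num)]; simp [hτ]

theorem not_bad_iff {n K r u : ℕ} {q : Kind} {a : ℕ} {A B : ℕ → ℕ} {V : Kind → ℕ → ℕ} {σ : State}
    (hV : ∀ q r, V q r ≤ 2 * n)
    (hval : ∀ (q : Kind), leafVal K σ q.num (2 ^ K + 1 + r) = V q r)
    (h : ∀ v' : Kind → ℕ, (∀ q, v' q ≤ 2 * n) → ((∀ q, A q.num ≤ v' q ∧ v' q ≤ B q.num) ↔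
        prof (2 * n) a q v' = prof (2 * n) a q fun q => V q u)) :
    ¬ Bad K σ A B (2 ^ K + 1 + r) ↔
      prof (2 * n) a q (fun q => V q r) = prof (2 * n) a q fun q => V q u := by
  rw [← h _ fun q => hV q r]
  simp only [Bad, not_exists, not_and, not_or, not_lt]
  constructor
  · intro hb q
    rw [← hval q]
    exact hb _ q.num_lt
  · intro hb k hk
    obtain ⟨q, rfl⟩ := Kind.exists_num hk
    rw [hval q]
    exact hb q

/-- The values at row `u` give the bounds that characterize its profile, and the search returns the
first later row that violates them. So the output covers a maximal run, and the last clause charges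
it to a change of profile unless it is the final run. -/
theorem runs_runProg {n K a base r₁ r₂ za zb w1 w2 u : ℕ} {q : Kind} {V : Kind → ℕ → ℕ} {Y : ℕ → ℕ}
    {σ : State} {R : Set (Fin 3 → ℝ)} (hE : EventAt n K a base r₂ za zb w1 w2 V Y σ)
    (hN : EventNum n K q a base r₁ r₂ za zb w1 w2 V Y) (hu : r₁ ≤ u) (hu' : u < r₂)
    (h10 : σ.natReg 10 = 2 ^ K + 1 + u) (hR : OutPart σ R)
    (hdis : Disjoint R (rowRegion (σ.iota n) (2 * n) a base q V Y za zb w1 w2 u r₂)) :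
    Runs (runProg q) σ (2000 * (K + 1)) fun τ => ∃ u', u < u' ∧ u' ≤ r₂ ∧
      τ.natReg 10 = 2 ^ K + 1 + u' ∧ Kept σ τ ∧
      OutPart τ (R ∪ rowRegion (σ.iota n) (2 * n) a base q V Y za zb w1 w2 u u') ∧
      τ.natReg 0 ≤ σ.natReg 0 + 3 ∧
      (u' < r₂ → prof (2 * n) a q (fun q => V q (u' - 1)) ≠ prof (2 * n) a q fun q => V q u') := by
  have hr2 := hN.r₂_lt
  have hc : Lvl K 0 (2 ^ K + 1 + u) := lvl_leaf.2 ⟨by omega, by omega⟩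
  refine Runs.seq_of (T₂ := 1920 * (K + 1)) (runs_valProg hc hE.forest.tree h10)
    (fun σ1 h1 hF1 => ?_) (by omega)
  have k1 : Kept σ σ1 := hF1.kept (by decide) (by decide) (by decide)
  have hv1 : ∀ q, σ1.natReg (15 + q.num) = V q u := fun q => by
    rw [h1 _ q.num_lt, hE.val q u (by omega)]
  refine Runs.seq_of (T₂ := 1840 * (K + 1)) (runs_boundProg hN.a_le (by rw [k1.reg2, hE.reg2])
    (by rw [k1.regs 7 (by norm_num) (by norm_num) (by norm_num), hE.reg7]) hv1)
    (fun σ2 ⟨A, B, hA, hB, hAB⟩ hF2 => ?_) (by omega)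
  have wb : ∀ r ∈ (boundProg q).wN, 19 ≤ r ∧ r < 27 := by
    obtain ⟨_ | _, _ | _⟩ := q <;> decide
  have k2 : Kept σ σ2 := k1.trans (hF2.kept (fun r hr => by have := wb r hr; omega)
    (by obtain ⟨_ | _, _ | _⟩ := q <;> decide) (by obtain ⟨_ | _, _ | _⟩ := q <;> decide))
  have hE2 := hE.congr k2
  have f10 : σ2.natReg 10 = 2 ^ K + 1 + u := by
    rw [hF2.natReg 10 (fun hm => by have := wb 10 hm; omega), hF1.natReg 10 (by decide), h10]
  have hv2 : ∀ q, σ2.natReg (15 + q.num) = V q u := fun q => by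
    have := q.num_lt
    rw [hF2.natReg _ (fun hm => by have := wb _ hm; omega), hv1]
  refine Runs.seq_of (T₂ := 1320 * (K + 1)) (runs_nextProg hc hE2.forest f10 hA hB)
    (fun σ3 ⟨n1, n2, n3, n4⟩ hF3 => ?_) (by omega)
  have k3 : Kept σ σ3 := k2.trans (hF3.kept (by decide) (by decide) (by decide))
  have hE3 := hE.congr k3
  have g10 : σ3.natReg 10 = 2 ^ K + 1 + u := by rw [hF3.natReg 10 (by decide), f10]
  have hv3 : ∀ q, σ3.natReg (15 + q.num) = V q u := fun q => by
    rw [hF3.natReg _ ?_, hv2]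
    have := q.num_lt
    generalize q.num = k at *
    revert k
    decide
  -- The search does not know `r₂`, so its answer is clipped there; only an answer that was not
  -- clipped certifies a change of profile.
  obtain ⟨u', hu1, hu2, hu3, hu4⟩ : ∃ u', u < u' ∧ u' ≤ r₂ ∧
      min (σ3.natReg 37) (2 ^ K + 1 + r₂) = 2 ^ K + 1 + u' ∧ (u' < r₂ → σ3.natReg 37 = 2 ^ K + 1 + u') :=
    ⟨min (σ3.natReg 37) (2 ^ K + 1 + r₂) - (2 ^ K + 1), by omega, by omega, by omega, by omega⟩
  have hbad := fun r (hr : r ≤ r₂) => not_bad_iff (K := K) (σ := σ2) (r := r) (A := A) (B := B) hN.V_le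
    (fun q => hE2.val q r (by omega)) hAB
  have hsame : ∀ r, u ≤ r → r < u' →
      prof (2 * n) a q (fun q => V q r) = prof (2 * n) a q fun q => V q u := fun r q1 q2 => by
    rcases Nat.lt_or_eq_of_le q1 with h | rfl
    · exact (hbad r (by omega)).1 (n3 _ (by omega) (by omega))
    · rfl
  have hdiff : u' < r₂ →
      prof (2 * n) a q (fun q => V q (u' - 1)) ≠ prof (2 * n) a q fun q => V q u' := fun hlt e => by
    rw [hsame (u' - 1) (by omega) (by omega)] at e
    have e' := hu4 hlt
    have := n4 (by omega)
    rw [e'] at this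
    exact (hbad u' (by omega)).2 e.symm this
  have hYm : ∀ r, u ≤ r → r < u' → Y r ≤ Y (r + 1) := fun r q1 q2 => hN.Y_le r (by omega) (by omega)
  have hreg := rowRegion_eq (ι := σ.iota n) (base := base) (za := za) (zb := zb) (w1 := w1)
    (w2 := w2) (V := V) hN.a_le hu1 hYm hsame
  have hdis' : Disjoint R (rowRegion (σ.iota n) (2 * n) a base q V Y za zb w1 w2 u u') :=
    hdis.mono_right (by rw [rowRegion_append (r₂ := r₂) hu1.le hu2]; exact Set.subset_union_left)
  rw [hreg] at hdis'
  obtain ⟨d1, d2, d3⟩ := boxA_disjoint (ι := σ.iota n) (N := 2 * n) (a := a) (base := base) (q := q)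
    (za := za) (zb := zb) (w1 := w1) (w2 := w2) (v := fun q => V q u) (y1 := Y u) (y2 := Y u')
  rw [Set.disjoint_union_right, Set.disjoint_union_right] at hdis'
  obtain ⟨d4, d5, d6⟩ := hdis'
  refine Runs.seq_of (T₁ := 40) (T₂ := 1280 * (K + 1)) (R := fun ρ => ρ = ((σ3.setNat 37
    (2 ^ K + 1 + u')).setNat 42 (Y u)).setNat 43 (Y u')) (Runs.line rfl (by decide) ?_)
    (fun σ4 hσ4 hF4 => ?_) (by omega)
  · have e1 : 2 ^ K + 1 + u - 2 ^ K - 1 = u := by omega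
    have e2 : 2 ^ K + 1 + u' - 2 ^ K - 1 = u' := by omega
    simp [hE3.reg9, hu3, g10, hE3.forest.tree.size, e1, e2, hE3.key u (by omega), hE3.key u' hu2]
  have k4 : Kept σ σ4 := k3.trans (hF4.kept (by decide) (by decide) (by decide))
  have hE4 := hE.congr k4
  have g37 : σ4.natReg 37 = 2 ^ K + 1 + u' := by simp [hσ4]
  have hv4 : ∀ q, σ4.natReg (15 + q.num) = V q u := fun q => by
    have := q.num_lt
    rw [hF4.natReg _ ?_, hv3]
    simp [Prog.wN]; omega
  have eι : σ4.iota n = σ.iota n := k4.iota n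
  have hout : OutPart σ4 R := hR.congr
    (by
      rw [hF4.natReg _ (by decide), hF3.natReg _ (by decide),
        hF2.natReg _ (fun hm => by have := wb _ hm; omega), hF1.natReg _ (by decide)])
    (fun b hb => by
      rw [hF4.natArr _ (by revert b; decide), hF3.natArr _ (by revert b; decide), hF2.natArr _ ?_,
        hF1.natArr _ (by revert b; decide)]
      obtain ⟨_ | _, _ | _⟩ := q <;> simp [boundProg, clampProg, forK, Prog.wNA])
    (fun b hb hb' => by
      rw [hF4.realArr _ (by simp [Prog.wRA]), hF3.realArr _ ?_, hF2.realArr _ ?_, hF1.realArr _ ?_]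
      · simp [valProg, forK, Prog.wRA]
      · obtain ⟨_ | _, _ | _⟩ := q <;> simp [boundProg, clampProg, forK, Prog.wRA]
      · simp [nextProg, pathProg, descendProg, forK, Prog.wRA])
  have h0 : σ4.natReg 0 = σ.natReg 0 := by
    rw [hF4.natReg _ (by decide), hF3.natReg _ (by decide),
        hF2.natReg _ (fun hm => by have := wb _ hm; omega), hF1.natReg _ (by decide)]
  have hev : ∀ τ : State, (∀ r, 0 < r → r < 40 → r ≠ 10 → τ.natReg r = σ4.natReg r) →
      (∀ q : Kind, τ.natReg (15 + q.num) = V q u) ∧ τ.natReg 7 = a ∧ τ.natReg 8 = base ∧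
      τ.natReg 2 = 2 * n := fun τ hτ => by
    refine ⟨fun q => ?_, ?_, ?_, ?_⟩
    · have := q.num_lt
      rw [hτ _ (by omega) (by omega) (by omega), hv4]
    · rw [hτ _ (by omega) (by omega) (by omega), hE4.reg7]
    · rw [hτ _ (by omega) (by omega) (by omega), hE4.reg8]
    · rw [hτ _ (by omega) (by omega) (by omega), hE4.reg2]
  have ha := hN.a_le
  have ha' := hN.a_lt
  have hb := hN.base_pos
  refine Runs.seq_of (T₂ := 950 * (K + 1)) (runs_boxAtProg (σ := σ4)
    (x1 := max (max (V q u) (V q.cross u)) base)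
    (x2 := min (min a (2 * n - V q.opp u)) (2 * n - V q.copp u)) hE4.reg1 hE4.reg2 hE4.sorted
    (Kept.refl _) (fun _ _ _ => rfl) (fun τ hτ => by
      obtain ⟨e1, e2, e3, e4⟩ := hev τ hτ
      simp only [eval_emax, eval_emin, eval_sub, eval_reg, e1, e2, e3, e4, and_self]) (by simp [emax, NatExpr.cost]) (by simp [emin, NatExpr.cost])
    (fun h => by have := hb h; omega)
    (fun h => by have := ha' h; omega) (by omega) (hN.Y_lt u (by omega) hu)
    (hN.Y_lt u' hu2 (by omega)) hN.za_lt hN.zb_lt (by simp [hσ4]) (by simp [hσ4])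
    (by norm_num) (by norm_num) hE4.reg11 hE4.reg12 hout (by rw [eι]; exact d4))
    (fun σ5 ⟨b1, b2, b3, b4, b5, b6, b7⟩ _ => ?_) (by omega)
  refine Runs.seq_of (T₂ := 620 * (K + 1)) (runs_boxAtProg (σ := σ4) (x1 := max (V q u) base)
    (x2 := min (min a (2 * n - V q.opp u)) (V q.cross u)) hE4.reg1 hE4.reg2 hE4.sorted
    b3 b4 (fun τ hτ => by
      obtain ⟨e1, e2, e3, e4⟩ := hev τ hτ
      simp only [eval_emax, eval_emin, eval_sub, eval_reg, e1, e2, e3, e4, and_self]) (by simp [emax, NatExpr.cost]) (by simp [emin, NatExpr.cost])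
    (fun h => by have := hb h; omega)
    (fun h => by have := ha' h; omega) (by omega) (hN.Y_lt u (by omega) hu)
    (hN.Y_lt u' hu2 (by omega)) hN.w1_lt hN.w2_lt b5 b6
    (by norm_num) (by norm_num) hE4.reg13 hE4.reg14 b1
    (by rw [eι]; exact Set.disjoint_union_left.2 ⟨d5, d1⟩))
    (fun σ6 ⟨c1, c2, c3, c4, c5, c6, c7⟩ _ => ?_) (by omega)
  refine Runs.seq_of (T₂ := 2) (runs_boxAtProg (σ := σ4)
    (x1 := max (max (V q u) (V q.cross u)) (max base (2 * n - V q.copp u)))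
    (x2 := min a (2 * n - V q.opp u)) hE4.reg1 hE4.reg2 hE4.sorted
    c3 c4 (fun τ hτ => by
      obtain ⟨e1, e2, e3, e4⟩ := hev τ hτ
      simp only [eval_emax, eval_emin, eval_sub, eval_reg, e1, e2, e3, e4, and_self]) (by simp [emax, NatExpr.cost]) (by simp [emin, NatExpr.cost])
    (fun h => by have := hb h; omega)
    (fun h => by have := ha' h; omega) (by omega) (hN.Y_lt u (by omega) hu)
    (hN.Y_lt u' hu2 (by omega)) hN.w1_lt hN.w2_lt c5 c6
    (by norm_num) (by norm_num) hE4.reg13 hE4.reg14 c1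
    (by rw [eι]; exact Set.disjoint_union_left.2 ⟨Set.disjoint_union_left.2 ⟨d6, d2⟩, d3⟩))
    (fun σ7 ⟨e1, e2, e3, e4, e5, e6, e7⟩ _ => ?_) (by omega)
  refine (Runs.line (Q := fun τ => τ = σ7.setNat 10 (2 ^ K + 1 + u')) rfl (by decide) (by
    simp [e4 37 (by norm_num) (by norm_num), g37])).frame.mono le_rfl fun τ ⟨hτ, hFτ⟩ =>
    ⟨u', hu1, hu2, by simp [hτ], (k4.trans e3).trans (hFτ.kept (by decide) (by decide) (by decide)),
      ?_, ?_, hdiff⟩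
  · rw [eι] at e1
    rw [hreg, ← Set.union_assoc, ← Set.union_assoc]
    exact e1.congr (by simp [hτ]) (by simp [hτ]) (by simp [hτ])
  · simp [hτ]
    omega

/-- There is one run more than there are changes of profile, and a run costs one search and at most
three boxes. The function `g` in the proof bounds the number of remaining runs and serves as the
budget of the loop. -/
theorem runs_emitProg {n K a base r₁ r₂ za zb w1 w2 : ℕ} {q : Kind} {V : Kind → ℕ → ℕ} {Y : ℕ → ℕ}
    {σ : State} {R : Set (Fin 3 → ℝ)} (hE : EventAt n K a base r₂ za zb w1 w2 V Y σ)
    (hN : EventNum n K q a base r₁ r₂ za zb w1 w2 V Y) (hr : r₁ ≤ r₂)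
    (h10 : σ.natReg 10 = 2 ^ K + 1 + r₁) (hR : OutPart σ R)
    (hdis : Disjoint R (rowRegion (σ.iota n) (2 * n) a base q V Y za zb w1 w2 r₁ r₂)) :
    Runs (emitProg q) σ (2010 * (K + 1) *
      (cutCount (fun r => prof (2 * n) a q fun q => V q r) r₁ r₂ + 2)) fun τ => Kept σ τ ∧
      OutPart τ (R ∪ rowRegion (σ.iota n) (2 * n) a base q V Y za zb w1 w2 r₁ r₂) ∧
      τ.natReg 0 ≤ σ.natReg 0 +
        3 * (cutCount (fun r => prof (2 * n) a q fun q => V q r) r₁ r₂ + 1) := by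
  set f := fun r => prof (2 * n) a q fun q => V q r with hf
  obtain ⟨g, hg⟩ : ∃ g : ℕ → ℕ, ∀ u, g u = if u < r₂ then cutCount f u r₂ + 1 else 0 :=
    ⟨_, fun _ => rfl⟩
  refine (Runs.while_budget (fun τ => Kept σ τ ∧ ∃ u, τ.natReg 10 = 2 ^ K + 1 + u ∧ r₁ ≤ u ∧ u ≤ r₂ ∧
      OutPart τ (R ∪ rowRegion (σ.iota n) (2 * n) a base q V Y za zb w1 w2 r₁ u) ∧
      τ.natReg 0 + 3 * g u ≤ σ.natReg 0 + 3 * g r₁)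
    (fun τ => 2004 * (K + 1) * g (τ.natReg 10 - (2 ^ K + 1))) ?_ ⟨Kept.refl σ, r₁, h10, le_rfl, hr,
      ?_, le_rfl⟩).mono ?_ ?_
  · rintro τ - ⟨hk, u, hu, hu1, hu2, hout, hcnt⟩ hb
    have hE' := hE.congr hk
    simp [hu, hE'.reg9] at hb
    rw [rowRegion_append hu1 hu2, Set.disjoint_union_right] at hdis
    refine ⟨2000 * (K + 1), (runs_runProg hE' hN hu1 hb hu hout ?_).mono le_rfl ?_⟩
    · rw [hk.iota n]
      exact Set.disjoint_union_left.2 ⟨hdis.2, rowRegion_disjoint hu1 hu2 hN.Y_le⟩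
    · rintro ρ ⟨u', v1, v2, v3, v4, v5, v6, v7⟩
      have hgu : g u' + 1 ≤ g u := by
        rw [hg, hg, if_pos hb]
        split_ifs with hlt
        · have := cutCount_lt (f := f) v1 hlt (v7 hlt)
          omega
        · omega
      refine ⟨⟨hk.trans v4, u', v3, by omega, v2, ?_, by omega⟩, ?_⟩
      · rw [rowRegion_append (u := r₁) hu1 v1.le, ← Set.union_assoc]
        rwa [hk.iota n] at v5
      · have h3 : 2000 * (K + 1) + 4 ≤ 2004 * (K + 1) := by omega
        have h1 := Nat.mul_le_mul_left (2004 * (K + 1)) hgu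
        have h2 : 2004 * (K + 1) * (g u' + 1) = 2004 * (K + 1) * g u' + (2004 * (K + 1)) := by
          ring
        rw [h2] at h1
        simp only [v3, hu, Nat.add_sub_cancel_left, Test.cost, NatExpr.cost]
        exact (by rw [Nat.add_assoc]; exact (Nat.add_le_add_left h3 _).trans h1)
  · have : rowRegion (σ.iota n) (2 * n) a base q V Y za zb w1 w2 r₁ r₁ = ∅ := by
      ext x; simp [rowRegion]; omega
    rw [this, Set.union_empty]
    exact hR
  · have : g (σ.natReg 10 - (2 ^ K + 1)) ≤ cutCount f r₁ r₂ + 1 := by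
      rw [h10, Nat.add_sub_cancel_left]
      rw [hg]
      split_ifs <;> omega
    have := Nat.mul_le_mul_left (2004 * (K + 1)) this
    have e : 2010 * (K + 1) * (cutCount f r₁ r₂ + 2) = 2004 * (K + 1) * (cutCount f r₁ r₂ + 1) +
      6 * (K + 1) * (cutCount f r₁ r₂ + 1) + 2010 * (K + 1) := by ring
    simp only [Test.cost, NatExpr.cost]
    omega
  · rintro τ ⟨⟨hk, u, hu, hu1, hu2, hout, hcnt⟩, hb, -⟩
    have hE' := hE.congr hk
    simp [hu, hE'.reg9] at hb
    obtain rfl : u = r₂ := by omega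
    refine ⟨hk, hout, ?_⟩
    have : g r₁ ≤ cutCount f r₁ u + 1 := by
      rw [hg]
      split_ifs <;> omega
    omega

end RealRAM


/-! ### Amortized number of profile changes -/

/-- `f`, raised to at least `a` between `r₁` and `r₂`. -/
def raise (f : ℕ → ℕ) (a r₁ r₂ r : ℕ) : ℕ := if r₁ ≤ r ∧ r < r₂ then max (f r) a else f r

/-- Whether two numbers differ. -/
def jump (x x' : ℕ) : ℤ := if x ≠ x' then 1 else 0

/-- Whether the jump from `w` to `w'` rises above `x` and `x'`. -/
def seen (w w' x x' : ℕ) : ℤ := if w ≠ w' ∧ max x x' < max w w' then 1 else 0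

open Classical in
/-- Whether two propositions differ. -/
noncomputable def differ (P Q : Prop) : ℤ := if P ↔ Q then 0 else 1

/-- A jump is cut at the level `a`: the part below is met by the profile and then flattened, and the
part above survives. Both parts are present only if the jump crosses `a`, which the last term pays
for. -/
theorem jump_raise (a x x' : ℕ) : jump (min x a) (min x' a) + jump (max x a) (max x' a) ≤
    jump x x' + differ (a < x) (a < x') := by
  simp only [jump, differ]
  split_ifs <;> omega

/-- A jump of `w` that the profile notices sticks out above `x` below the level `a`; once `x` is
raised to `a` it is hidden, unless it crosses `a`. -/
theorem seen_raise (a x x' w w' : ℕ) :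
    (if x = x' ∧ x < a ∧ clampTo x a w ≠ clampTo x a w' then 1 else 0) +
      seen w w' (max x a) (max x' a) ≤ seen w w' x x' + differ (a < w) (a < w') := by
  simp only [seen, differ, clampTo]
  split_ifs <;> omega

theorem seen_mono {w w' x x' y y' : ℕ} (h : x ≤ y) (h' : x' ≤ y') :
    seen w w' y y' ≤ seen w w' x x' := by
  simp only [seen]
  split_ifs <;> omega

theorem seen_sub_raise (N a x x' h h' : ℕ) :
    seen (N - max x a) (N - max x' a) h h' ≤ seen (N - x) (N - x') h h' := by
  simp only [seen]
  split_ifs <;> omega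

theorem seen_le_jump (w w' x x' : ℕ) : seen w w' x x' ≤ jump w w' := by
  simp only [seen, jump]
  split_ifs <;> omega

theorem seen_sub_le_jump (N w w' x x' : ℕ) : seen (N - w) (N - w') x x' ≤ jump w w' := by
  simp only [seen, jump]
  split_ifs <;> omega

/-- A jump that remains after `w` is raised to `a` and was visible before is still visible. So
lowering `w` can create visibility only together with a new jump. In the mirrored version
`seen_sub_lower` this fails only for jumps that cross `a`. -/
theorem seen_lower (a w w' x x' : ℕ) : seen w w' x x' + jump (max w a) (max w' a) ≤
    seen (max w a) (max w' a) x x' + jump w w' := by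
  simp only [seen, jump]
  split_ifs <;> omega

theorem seen_sub_lower (N a w w' x x' : ℕ) :
    seen (N - w) (N - w') x x' + jump (max w a) (max w' a) ≤
      seen (N - max w a) (N - max w' a) x x' + jump w w' + differ (a < w) (a < w') := by
  simp only [seen, jump, differ]
  split_ifs <;> omega

theorem seen_nonneg (w w' x x' : ℕ) : 0 ≤ seen w w' x x' := by
  simp only [seen]; split_ifs <;> omega

theorem jump_nonneg (x x' : ℕ) : 0 ≤ jump x x' := by
  simp only [jump]; split_ifs <;> omega

theorem jump_le_one (x x' : ℕ) : jump x x' ≤ 1 := by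
  simp only [jump]; split_ifs <;> omega

theorem seen_le_one (w w' x x' : ℕ) : seen w w' x x' ≤ 1 := by
  simp only [seen]; split_ifs <;> omega

/-- In the interval `[r₁, r₂)`, the predicate `P` holds at a beginning and at an end. -/
def Flank (P : ℕ → Prop) (r₁ r₂ : ℕ) : Prop :=
  ∀ r, r₁ ≤ r → r < r₂ → P r → (∀ u, r₁ ≤ u → u ≤ r → P u) ∨ ∀ u, r ≤ u → u < r₂ → P u

open Classical in
/-- Whether `P` changes after `r` within `[r₁, r₂)`. -/
noncomputable def change (P : ℕ → Prop) (r₁ r₂ r : ℕ) : ℤ :=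
  if r₁ ≤ r ∧ r + 1 < r₂ then differ (P r) (P (r + 1)) else 0

theorem sum_ite_le_one {M : ℕ} {P : ℕ → Prop} [DecidablePred P] (h : ∀ r r', P r → P r' → r = r') :
    ∑ r ∈ Finset.range M, (if P r then (1 : ℤ) else 0) ≤ 1 := by
  rw [Finset.sum_boole]
  exact_mod_cast Finset.card_le_one.2 fun a ha b hb =>
    h a b (Finset.mem_filter.1 ha).2 (Finset.mem_filter.1 hb).2

/-- The predicate holds on an initial and on a final segment, so within the interval it turns false
at most once and turns true at most once. -/
theorem Flank.sum_change {P : ℕ → Prop} {r₁ r₂ : ℕ} (h : Flank P r₁ r₂) (M : ℕ) :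
    ∑ r ∈ Finset.range M, change P r₁ r₂ r ≤ 2 := by
  classical
  have h1 := sum_ite_le_one (M := M)
    (P := fun r => r₁ ≤ r ∧ r + 1 < r₂ ∧ P r ∧ ¬ P (r + 1)) fun r r' hr hr' => by
      by_contra hne
      rcases lt_or_gt_of_ne hne with hlt | hlt
      · rcases h r' hr'.1 (by omega) hr'.2.2.1 with hh | hh
        · exact hr.2.2.2 (hh _ (by omega) (by omega))
        · exact hr'.2.2.2 (hh _ (by omega) (by omega))
      · rcases h r hr.1 (by omega) hr.2.2.1 with hh | hh
        · exact hr'.2.2.2 (hh _ (by omega) (by omega))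
        · exact hr.2.2.2 (hh _ (by omega) (by omega))
  have h2 := sum_ite_le_one (M := M)
    (P := fun r => r₁ ≤ r ∧ r + 1 < r₂ ∧ ¬ P r ∧ P (r + 1)) fun r r' hr hr' => by
      by_contra hne
      rcases lt_or_gt_of_ne hne with hlt | hlt
      · rcases h (r + 1) (by omega) (by omega) hr.2.2.2 with hh | hh
        · exact hr.2.2.1 (hh _ (by omega) (by omega))
        · exact hr'.2.2.1 (hh _ (by omega) (by omega))
      · rcases h (r' + 1) (by omega) (by omega) hr'.2.2.2 with hh | hh
        · exact hr'.2.2.1 (hh _ (by omega) (by omega))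
        · exact hr.2.2.1 (hh _ (by omega) (by omega))
  have h3 : ∀ r ∈ Finset.range M, change P r₁ r₂ r ≤
      (if r₁ ≤ r ∧ r + 1 < r₂ ∧ P r ∧ ¬ P (r + 1) then 1 else 0) +
      (if r₁ ≤ r ∧ r + 1 < r₂ ∧ ¬ P r ∧ P (r + 1) then 1 else 0) := fun r _ => by
    simp only [change, differ]
    by_cases p : P r <;> by_cases p' : P (r + 1) <;> simp [p, p']
  have := Finset.sum_le_sum h3
  rw [Finset.sum_add_distrib] at this
  omega

/-- Whether one of the ends of the interval is just after `r`. -/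
def atEnd (r₁ r₂ r : ℕ) : ℤ := (if r + 1 = r₁ then 1 else 0) + if r + 1 = r₂ then 1 else 0

theorem sum_atEnd (r₁ r₂ M : ℕ) : ∑ r ∈ Finset.range M, atEnd r₁ r₂ r ≤ 2 := by
  simp only [atEnd, Finset.sum_add_distrib]
  have h1 := sum_ite_le_one (M := M) (P := fun r => r + 1 = r₁) (by intros; omega)
  have h2 := sum_ite_le_one (M := M) (P := fun r => r + 1 = r₂) (by intros; omega)
  omega

/-! ### The potential, and its change under insertion and removal of a piece -/

namespace RealRAM

theorem Kind.opp_opp (q : Kind) : q.opp.opp = q := by simp [opp]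
theorem Kind.opp_cross (q : Kind) : q.opp.cross = q.copp := rfl
theorem Kind.opp_copp (q : Kind) : q.opp.copp = q.cross := by simp [opp, copp, cross]
theorem Kind.opp_ne (q : Kind) : q.opp ≠ q := by obtain ⟨_ | _, _ | _⟩ := q <;> decide
theorem Kind.cross_ne (q : Kind) : q.cross ≠ q := by obtain ⟨_ | _, _ | _⟩ := q <;> decide
theorem Kind.copp_ne (q : Kind) : q.copp ≠ q := by obtain ⟨_ | _, _ | _⟩ := q <;> decide
theorem Kind.cross_ne_opp (q : Kind) : q.cross ≠ q.opp := by
  obtain ⟨_ | _, _ | _⟩ := q <;> decide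
theorem Kind.copp_ne_cross (q : Kind) : q.copp ≠ q.cross := by
  obtain ⟨_ | _, _ | _⟩ := q <;> decide

/-- The contribution of the values of kind `q` after row `r` to the potential. -/
def rowPot (N : ℕ) (v : Kind → ℕ → ℕ) (q : Kind) (r : ℕ) : ℤ :=
  jump (v q r) (v q (r + 1)) +
    seen (N - v q.opp r) (N - v q.opp (r + 1)) (v q r) (v q (r + 1)) +
    seen (v q.cross r) (v q.cross (r + 1)) (v q r) (v q (r + 1)) +
    seen (N - v q.copp r) (N - v q.copp (r + 1)) (v q r) (v q (r + 1)) -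
    2 * jump (v q.cross r) (v q.cross (r + 1))

/-- The potential from the view of the kinds `q` and `q.opp`. -/
def pot (N M : ℕ) (v : Kind → ℕ → ℕ) (q : Kind) : ℤ :=
  ∑ r ∈ Finset.range M, (rowPot N v q r + rowPot N v q.opp r)

theorem pot_opp (N M : ℕ) (v : Kind → ℕ → ℕ) (q : Kind) : pot N M v q.opp = pot N M v q := by
  simp only [pot, Kind.opp_opp, add_comm]

/-- Whether the profile changes after row `r`. -/
def profJump (N a : ℕ) (q : Kind) (v : Kind → ℕ → ℕ) (r₁ r₂ r : ℕ) : ℤ :=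
  if r₁ ≤ r ∧ r + 1 < r₂ ∧ prof N a q (fun q => v q r) ≠ prof N a q (fun q => v q (r + 1)) then 1
  else 0

theorem cutCount_eq (N a : ℕ) (q : Kind) (v : Kind → ℕ → ℕ) {r₁ r₂ M : ℕ} (hM : r₂ ≤ M) :
    (cutCount (fun r => prof N a q fun q => v q r) r₁ r₂ : ℤ) ≤
      ∑ r ∈ Finset.range M, profJump N a q v r₁ r₂ r := by
  simp only [profJump]
  rw [Finset.sum_boole]
  refine Int.ofNat_le.2 (Finset.card_le_card fun u hu => ?_)
  simp only [Finset.mem_filter, Finset.mem_range] at hu ⊢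
  exact ⟨by omega, hu.2⟩

/-- A change of profile is either a jump of `v q` below `a` or, with `v q` unchanged, a change of
one of the three clamped components; each possibility has its own summand. -/
theorem profJump_le {N a : ℕ} {q : Kind} {v : Kind → ℕ → ℕ} {r₁ r₂ r : ℕ} (ha : a ≤ N)
    (hv : ∀ q r, v q r ≤ N) (h : r₁ ≤ r ∧ r + 1 < r₂) :
    profJump N a q v r₁ r₂ r ≤ jump (min (v q r) a) (min (v q (r + 1)) a) +
      (if v q r = v q (r + 1) ∧ v q r < a ∧ clampTo (v q r) a (N - v q.opp r) ≠
        clampTo (v q r) a (N - v q.opp (r + 1)) then 1 else 0) +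
      (if v q r = v q (r + 1) ∧ v q r < a ∧ clampTo (v q r) a (v q.cross r) ≠
        clampTo (v q r) a (v q.cross (r + 1)) then 1 else 0) +
      (if v q r = v q (r + 1) ∧ v q r < a ∧ clampTo (v q r) a (N - v q.copp r) ≠
        clampTo (v q r) a (N - v q.copp (r + 1)) then 1 else 0) := by
  -- Reflection `w ↦ N - w` turns the clamps for the kinds of the opposite side into clamps between
  -- `v q` and `a`, the form in which `seen_raise` treats them.
  have hc : ∀ w w', w ≤ N → w' ≤ N → v q r < a → clampTo (v q r) a (N - w) =
      clampTo (v q r) a (N - w') → clampTo (N - a) (N - v q r) w = clampTo (N - a) (N - v q r) w' := by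
    intro w w' h1 h2 h3 h4
    simp only [clampTo] at h4 ⊢
    omega
  have ite_nonneg : ∀ (p : Prop) [Decidable p], (0 : ℤ) ≤ if p then 1 else 0 := fun p _ => by
    split_ifs <;> omega
  have not_of_lt : ∀ (p : Prop) [Decidable p], (if p then (1 : ℤ) else 0) < 1 → ¬ p :=
    fun p _ hp hc => by simp [hc] at hp
  by_contra hcon
  rw [not_le] at hcon
  have hj := jump_nonneg (min (v q r) a) (min (v q (r + 1)) a)
  have i1 := ite_nonneg (v q r = v q (r + 1) ∧ v q r < a ∧ clampTo (v q r) a (N - v q.opp r) ≠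
        clampTo (v q r) a (N - v q.opp (r + 1)))
  have i2 := ite_nonneg (v q r = v q (r + 1) ∧ v q r < a ∧ clampTo (v q r) a (v q.cross r) ≠
        clampTo (v q r) a (v q.cross (r + 1)))
  have i3 := ite_nonneg (v q r = v q (r + 1) ∧ v q r < a ∧ clampTo (v q r) a (N - v q.copp r) ≠
        clampTo (v q r) a (N - v q.copp (r + 1)))
  have hp1 : profJump N a q v r₁ r₂ r ≤ 1 := by rw [profJump]; split_ifs <;> omega
  have n1 := not_of_lt _ (lt_of_not_ge fun h1 => by linarith : (if v q r = v q (r + 1) ∧ v q r < a ∧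
    clampTo (v q r) a (N - v q.opp r) ≠ clampTo (v q r) a (N - v q.opp (r + 1)) then (1 : ℤ)
      else 0) < 1)
  have n2 := not_of_lt _ (lt_of_not_ge fun h1 => by linarith : (if v q r = v q (r + 1) ∧ v q r < a ∧
    clampTo (v q r) a (v q.cross r) ≠ clampTo (v q r) a (v q.cross (r + 1)) then (1 : ℤ)
      else 0) < 1)
  have n3 := not_of_lt _ (lt_of_not_ge fun h1 => by linarith : (if v q r = v q (r + 1) ∧ v q r < a ∧
    clampTo (v q r) a (N - v q.copp r) ≠ clampTo (v q r) a (N - v q.copp (r + 1)) then (1 : ℤ)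
      else 0) < 1)
  have e0 := not_of_lt (min (v q r) a ≠ min (v q (r + 1)) a) (lt_of_not_ge fun h1 => by
    have : (1 : ℤ) ≤ jump (min (v q r) a) (min (v q (r + 1)) a) := h1
    linarith)
  have hpe : prof N a q (fun q => v q r) = prof N a q (fun q => v q (r + 1)) := by
    simp only [prof]
    by_cases hlt : v q r < a
    · have e : v q r = v q (r + 1) := by omega
      rw [if_pos hlt, if_pos (e ▸ hlt), ← e]
      rw [← e] at n1 n2 n3
      simp only [hlt, true_and, ne_eq, not_not] at n1 n2 n3
      rw [hc _ _ (hv _ _) (hv _ _) hlt n1, n2, hc _ _ (hv _ _) (hv _ _) hlt n3]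
    · have hlt' : ¬ v q (r + 1) < a := by omega
      rw [if_neg hlt, if_neg hlt']
  have : profJump N a q v r₁ r₂ r = 0 := by rw [profJump, if_neg fun h => h.2.2 hpe]
  linarith

theorem differ_sub {N a x x' : ℕ} (ha : a ≤ N) (hx : x ≤ N) (hx' : x' ≤ N) :
    differ (a < N - x) (a < N - x') = differ (N - a ≤ x) (N - a ≤ x') := by
  simp only [differ]
  split_ifs <;> omega

/-- Inside the interval, the jumps that make the profile change are flattened or hidden by raising
`v q` to `a`, so the potential pays for the change; exceptions cross the level `a` (or `N - a` for
the opposite side) and are charged to the four `change` terms. In the view of `q.opp` the raised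
reach only becomes less visible. At the two ends a new jump of `v q` may arise and be visible from
the opposite side, hence `2 * atEnd`. -/
theorem rowPot_raise {N a : ℕ} {q : Kind} {v : Kind → ℕ → ℕ} {r₁ r₂ : ℕ} (ha : a ≤ N)
    (hv : ∀ q r, v q r ≤ N) (hr : r₁ ≤ r₂) (r : ℕ) :
    rowPot N (Function.update v q (raise (v q) a r₁ r₂)) q r +
      rowPot N (Function.update v q (raise (v q) a r₁ r₂)) q.opp r + profJump N a q v r₁ r₂ r ≤
    rowPot N v q r + rowPot N v q.opp r + 2 * atEnd r₁ r₂ r +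
      (change (fun r => a + 1 ≤ v q r) r₁ r₂ r + change (fun r => N - a ≤ v q.opp r) r₁ r₂ r +
      change (fun r => a + 1 ≤ v q.cross r) r₁ r₂ r + change (fun r => N - a ≤ v q.copp r) r₁ r₂ r) := by
  simp only [rowPot, Kind.opp_opp, Kind.opp_cross, Kind.opp_copp, Function.update_self, ne_eq,
    Kind.opp_ne, Kind.cross_ne, Kind.copp_ne, not_false_eq_true, Function.update_of_ne]
  set f := raise (v q) a r₁ r₂ with hf
  have hle : ∀ r, v q r ≤ f r := fun r => by
    simp only [hf, raise]; split_ifs <;> omega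
  by_cases hin : r₁ ≤ r ∧ r + 1 < r₂
  · have f1 : f r = max (v q r) a := by rw [hf, raise, if_pos (by omega)]
    have f2 : f (r + 1) = max (v q (r + 1)) a := by rw [hf, raise, if_pos (by omega)]
    simp only [change, if_pos hin, f1, f2]
    have b0 := profJump_le (q := q) ha hv hin
    have b1 := jump_raise a (v q r) (v q (r + 1))
    have b2 := seen_raise a (v q r) (v q (r + 1)) (N - v q.opp r) (N - v q.opp (r + 1))
    have b3 := seen_raise a (v q r) (v q (r + 1)) (v q.cross r) (v q.cross (r + 1))
    have b4 := seen_raise a (v q r) (v q (r + 1)) (N - v q.copp r) (N - v q.copp (r + 1))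
    have b5 := seen_sub_raise N a (v q r) (v q (r + 1)) (v q.opp r) (v q.opp (r + 1))
    rw [differ_sub ha (hv _ _) (hv _ _)] at b2 b4
    have b6 : 0 ≤ atEnd r₁ r₂ r := by simp only [atEnd]; split_ifs <;> omega
    simp only [Nat.lt_iff_add_one_le] at b1 b3
    simp only [Nat.lt_iff_add_one_le] at b0 b2 b4
    linarith
  · have p0 : profJump N a q v r₁ r₂ r = 0 := by
      rw [profJump, if_neg fun h => hin ⟨h.1, h.2.1⟩]
    simp only [change, if_neg hin, p0]
    by_cases hout : (r₁ ≤ r ∧ r < r₂) ∨ (r₁ ≤ r + 1 ∧ r + 1 < r₂)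
    · have b6 : 1 ≤ atEnd r₁ r₂ r := by simp only [atEnd]; split_ifs <;> omega
      have b1 := jump_le_one (f r) (f (r + 1))
      have b1' := jump_nonneg (v q r) (v q (r + 1))
      have b2 := seen_mono (w := N - v q.opp r) (w' := N - v q.opp (r + 1)) (hle r) (hle (r + 1))
      have b3 := seen_mono (w := v q.cross r) (w' := v q.cross (r + 1)) (hle r) (hle (r + 1))
      have b4 := seen_mono (w := N - v q.copp r) (w' := N - v q.copp (r + 1)) (hle r) (hle (r + 1))
      have b5 := seen_le_one (N - f r) (N - f (r + 1)) (v q.opp r) (v q.opp (r + 1))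
      have b5' := seen_nonneg (N - v q r) (N - v q (r + 1)) (v q.opp r) (v q.opp (r + 1))
      linarith
    · have f1 : f r = v q r := by rw [hf, raise, if_neg (by omega)]
      have f2 : f (r + 1) = v q (r + 1) := by rw [hf, raise, if_neg (by omega)]
      have b6 : 0 ≤ atEnd r₁ r₂ r := by simp only [atEnd]; split_ifs <;> omega
      rw [f1, f2]
      linarith

/-- The constant is `4 * 2`, as by `Flank` each of the four predicates changes at most twice, plus
`2 * 2` for the two ends. -/
theorem pot_raise {N M a : ℕ} {q : Kind} {v : Kind → ℕ → ℕ} {r₁ r₂ : ℕ} (ha : a ≤ N)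
    (hv : ∀ q r, v q r ≤ N) (hr : r₁ ≤ r₂) (hM : r₂ ≤ M)
    (hfl : ∀ q b, Flank (fun r => b ≤ v q r) r₁ r₂) :
    pot N M (Function.update v q (raise (v q) a r₁ r₂)) q +
      cutCount (fun r => prof N a q fun q => v q r) r₁ r₂ ≤ pot N M v q + 12 := by
  have h1 := Finset.sum_le_sum fun r (_ : r ∈ Finset.range M) =>
    rowPot_raise (q := q) (v := v) ha hv hr r
  simp only [Finset.sum_add_distrib, ← Finset.mul_sum] at h1
  have h2 := cutCount_eq N a q v (r₁ := r₁) hM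
  have h3 := (hfl q (a + 1)).sum_change M
  have h4 := (hfl q.opp (N - a)).sum_change M
  have h5 := (hfl q.cross (a + 1)).sum_change M
  have h6 := (hfl q.copp (N - a)).sum_change M
  have h7 := sum_atEnd r₁ r₂ M
  simp only [pot, Finset.sum_add_distrib]
  linarith

/-- The family `q.cross` occurs in two `seen` terms, in the views of `q` and of `q.opp`, and in `-2
* jump`. When lowering it uncovers a jump, the negative term pays for both views; this is why its
coefficient is `2`. -/
theorem rowPot_lower {N a : ℕ} {q : Kind} {v : Kind → ℕ → ℕ} {r₁ r₂ : ℕ} (r : ℕ) :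
    rowPot N v q r + rowPot N v q.opp r ≤
    rowPot N (Function.update v q.cross (raise (v q.cross) a r₁ r₂)) q r +
      rowPot N (Function.update v q.cross (raise (v q.cross) a r₁ r₂)) q.opp r +
      4 * atEnd r₁ r₂ r + change (fun r => a + 1 ≤ v q.cross r) r₁ r₂ r := by
  simp only [rowPot, Kind.opp_opp, Kind.opp_cross, Kind.opp_copp, Function.update_self, ne_eq,
    q.cross_ne_opp.symm, q.cross_ne.symm, q.copp_ne_cross, not_false_eq_true,
    Function.update_of_ne]
  set f := raise (v q.cross) a r₁ r₂ with hf
  by_cases hin : r₁ ≤ r ∧ r + 1 < r₂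
  · have f1 : f r = max (v q.cross r) a := by rw [hf, raise, if_pos (by omega)]
    have f2 : f (r + 1) = max (v q.cross (r + 1)) a := by rw [hf, raise, if_pos (by omega)]
    simp only [change, if_pos hin, f1, f2]
    have b1 := seen_lower a (v q.cross r) (v q.cross (r + 1)) (v q r) (v q (r + 1))
    have b2 := seen_sub_lower N a (v q.cross r) (v q.cross (r + 1)) (v q.opp r) (v q.opp (r + 1))
    have b6 : 0 ≤ atEnd r₁ r₂ r := by simp only [atEnd]; split_ifs <;> omega
    simp only [Nat.lt_iff_add_one_le] at b2
    linarith
  · simp only [change, if_neg hin]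
    by_cases hout : (r₁ ≤ r ∧ r < r₂) ∨ (r₁ ≤ r + 1 ∧ r + 1 < r₂)
    · have b6 : 1 ≤ atEnd r₁ r₂ r := by simp only [atEnd]; split_ifs <;> omega
      have b1 := jump_le_one (f r) (f (r + 1))
      have b2 := jump_nonneg (v q.cross r) (v q.cross (r + 1))
      have b3 := seen_le_jump (v q.cross r) (v q.cross (r + 1)) (v q r) (v q (r + 1))
      have b4 := seen_nonneg (f r) (f (r + 1)) (v q r) (v q (r + 1))
      have b5 := seen_sub_le_jump N (v q.cross r) (v q.cross (r + 1)) (v q.opp r) (v q.opp (r + 1))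
      have b7 := seen_nonneg (N - f r) (N - f (r + 1)) (v q.opp r) (v q.opp (r + 1))
      linarith
    · have f1 : f r = v q.cross r := by rw [hf, raise, if_neg (by omega)]
      have f2 : f (r + 1) = v q.cross (r + 1) := by rw [hf, raise, if_neg (by omega)]
      have b6 : 0 ≤ atEnd r₁ r₂ r := by simp only [atEnd]; split_ifs <;> omega
      rw [f1, f2]
      linarith

theorem pot_lower {N M a : ℕ} {q : Kind} {v : Kind → ℕ → ℕ} {r₁ r₂ : ℕ}
    (hfl : ∀ q b, Flank (fun r => b ≤ v q r) r₁ r₂) :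
    pot N M v q ≤ pot N M (Function.update v q.cross (raise (v q.cross) a r₁ r₂)) q + 10 := by
  have h1 := Finset.sum_le_sum fun r (_ : r ∈ Finset.range M) =>
    rowPot_lower (N := N) (a := a) (r₁ := r₁) (r₂ := r₂) (q := q) (v := v) r
  simp only [Finset.sum_add_distrib, ← Finset.mul_sum] at h1
  have h5 := (hfl q.cross (a + 1)).sum_change M
  have h7 := sum_atEnd r₁ r₂ M
  simp only [pot, Finset.sum_add_distrib]
  linarith

/-- If the two own families are empty, only the jumps of the two cross families remain. Each is seen
at most twice, and this is offset by the coefficient `-2`. -/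
theorem pot_nonpos {N M : ℕ} {q : Kind} {v : Kind → ℕ → ℕ} (h : ∀ r, v q r = 0)
    (h' : ∀ r, v q.opp r = 0) : pot N M v q ≤ 0 := by
  refine Finset.sum_nonpos fun r _ => ?_
  simp only [rowPot, Kind.opp_opp, Kind.opp_cross, Kind.opp_copp, h, h']
  have e1 : jump 0 0 = 0 := rfl
  have e2 : seen (N - 0) (N - 0) 0 0 = 0 := by simp [seen]
  have b1 := seen_le_jump (v q.cross r) (v q.cross (r + 1)) 0 0
  have b2 := seen_le_jump (v q.copp r) (v q.copp (r + 1)) 0 0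
  have b3 := seen_sub_le_jump N (v q.cross r) (v q.cross (r + 1)) 0 0
  have b4 := seen_sub_le_jump N (v q.copp r) (v q.copp (r + 1)) 0 0
  linarith

/-- If the two cross families are empty, the only negative terms vanish. -/
theorem pot_nonneg {N M : ℕ} {q : Kind} {v : Kind → ℕ → ℕ} (h : ∀ r, v q.cross r = 0)
    (h' : ∀ r, v q.copp r = 0) : 0 ≤ pot N M v q := by
  refine Finset.sum_nonneg fun r _ => ?_
  simp only [rowPot, Kind.opp_opp, Kind.opp_cross, Kind.opp_copp, h, h']
  have e1 : jump 0 0 = 0 := rfl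
  have b1 := jump_nonneg (v q r) (v q (r + 1))
  have b2 := jump_nonneg (v q.opp r) (v q.opp (r + 1))
  have c1 := seen_nonneg (N - v q.opp r) (N - v q.opp (r + 1)) (v q r) (v q (r + 1))
  have c2 := seen_nonneg (N - v q r) (N - v q (r + 1)) (v q.opp r) (v q.opp (r + 1))
  have c3 := seen_nonneg 0 0 (v q r) (v q (r + 1))
  have c4 := seen_nonneg 0 0 (v q.opp r) (v q.opp (r + 1))
  have c5 := seen_nonneg (N - 0) (N - 0) (v q r) (v q (r + 1))
  have c6 := seen_nonneg (N - 0) (N - 0) (v q.opp r) (v q.opp (r + 1))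
  linarith

end RealRAM


namespace RealRAM
open HeapTree

/-! ### The geometry of the pieces -/

/-- The ranks of the cubes, their slabs, and the rows `r1 q i ≤ r < r2 q i` of their pieces; the row
`r` is the interval `(Y r, Y (r + 1)]`. The slabs concern the dimensions `0` and `2`. -/
structure Layout (n : ℕ) where
  lo : ℕ → ℕ → ℕ
  hi : ℕ → ℕ → ℕ
  S : ℕ → ℕ → ℕ
  E : ℕ → ℕ → ℕ
  κ : ℕ → ℕ → ℕ
  r1 : Kind → ℕ → ℕ
  r2 : Kind → ℕ → ℕ
  Y : ℕ → ℕ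
  slab0 : Slabs n (lo 0) (hi 0) (S 0) (E 0) (κ 0)
  slab2 : Slabs n (lo 2) (hi 2) (S 2) (E 2) (κ 2)
  lo_inj : ∀ d < 3, ∀ i < n, ∀ j < n, lo d i = lo d j → i = j
  hi_inj : ∀ d < 3, ∀ i < n, ∀ j < n, hi d i = hi d j → i = j
  ne : ∀ d < 3, ∀ i < n, ∀ j < n, lo d i ≠ hi d j
  lo_lt_hi : ∀ d < 3, ∀ i < n, lo d i < hi d i
  hi_lt : ∀ d < 3, ∀ i < n, hi d i < 2 * n
  row_lt : ∀ q, ∀ i < n, r1 q i < r2 q i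
  r2_lt : ∀ q, ∀ i < n, r2 q i < 8 * n
  Y_r1 : ∀ q, ∀ i < n, Y (r1 q i) = lo 1 i
  Y_r2 : ∀ q, ∀ i < n, Y (r2 q i) = hi 1 i
  Y_le : ∀ q, ∀ i < n, ∀ r, r1 q i ≤ r → r < r2 q i → Y r ≤ Y (r + 1)
  covers : ∀ q, ∀ i < n, ∀ q', ∀ j < n, ∀ r y, r1 q i ≤ r → r < r2 q i → Y r < y → y ≤ Y (r + 1) →
    ((r1 q' j ≤ r ∧ r < r2 q' j) ↔
      ((if q'.side then S 0 j else E 0 j) = if q.side then S 0 i else E 0 i) ∧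
      ((if q'.down then E 2 j else S 2 j) = if q.down then E 2 i else S 2 i) ∧ lo 1 j < y ∧ y ≤ hi 1 j)
  side_eq : ∀ q, ∀ i < n, ∀ q', ∀ j < n, ∀ r, r1 q i ≤ r → r < r2 q i → r1 q' j ≤ r → r < r2 q' j →
    ((if q'.side then S 0 j else E 0 j) = if q.side then S 0 i else E 0 i)
  exists_cut : ∀ t < 2 * n, ∃ i < n, lo 2 i = t ∨ hi 2 i = t
  flank : ∀ q, ∀ i < n, ∀ q', ∀ j < n, ∀ r, r1 q i ≤ r → r < r2 q i → r1 q' j ≤ r → r < r2 q' j →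
    r1 q' j ≤ r1 q i ∨ r2 q i ≤ r2 q' j

theorem IsSort.rec_le {m : ℕ} {X Z Y ord pos : ℕ → ℕ} (h : IsSort m (recKey X Z Y) ord pos)
    {c d : ℕ} (hc : c < m) (hd : d < m) (hcd : pos c ≤ pos d) :
    X c < X d ∨ X c = X d ∧ (Z c < Z d ∨ Z c = Z d ∧ Y c ≤ Y d) := by
  have h1 := mt (h.rank_lt_rank hd hc).2 (not_lt.2 hcd)
  have h2 : ¬ recKey X Z Y d < recKey X Z Y c := fun h' =>
    h1 (Prod.Lex.toLex_lt_toLex.2 (.inl h'))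
  rw [recKey_lt] at h2
  omega

theorem IsSort.rec_lt {m : ℕ} {X Z Y ord pos : ℕ → ℕ} (h : IsSort m (recKey X Z Y) ord pos)
    {c d : ℕ} (hc : c < m) (hd : d < m) (hX : X c = X d) (hZ : Z c = Z d) (hY : Y c < Y d) :
    pos c < pos d := by
  rw [h.rank_lt_rank hc hd]
  exact Prod.Lex.toLex_lt_toLex.2 (.inl (recKey_lt.2 (.inr ⟨hX, .inr ⟨hZ, hY⟩⟩)))

theorem IsSort.rank_inj {α : Type*} [LinearOrder α] {m : ℕ} {key : ℕ → α} {ord rank : ℕ → ℕ}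
    (h : IsSort m key ord rank)
    {c d : ℕ} (hc : c < m) (hd : d < m) (hcd : rank c = rank d) : c = d := by
  rw [← h.ord_rank c hc, hcd, h.ord_rank d hd]

section
variable {n K : ℕ} {s : ℝ} {p : Fin n → Fin 3 → ℝ} {σ : State}

theorem Kind.rec_lt (q : Kind) {c : ℕ} (hc : c < 2 * n) : q.num * (2 * n) + c < 8 * n := by
  have := Nat.mul_le_mul_right (2 * n) (Nat.succ_le_of_lt q.num_lt)
  rw [Nat.succ_mul] at this
  omega

theorem Kind.num_inj {q q' : Kind} (h : q.num = q'.num) : q = q' := by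
  obtain ⟨_ | _, _ | _⟩ := q <;> obtain ⟨_ | _, _ | _⟩ := q' <;> simp_all [num]

/-- The rows of the pieces in the memory `σ`. -/
theorem Setup.rows_spec (h : Setup n K s p σ) {q : Kind} {i : ℕ} (hi : i < n) {r : ℕ}
    (h1 : σ.natArr 23 (q.num * (2 * n) + i) ≤ r) (h2 : r ≤ σ.natArr 23 (q.num * (2 * n) + (n + i))) :
    σ.natArr 19 (σ.natArr 22 r) = σ.natArr q.arrX i ∧
    σ.natArr 20 (σ.natArr 22 r) = σ.natArr q.arrZ i ∧
    σ.natArr 13 i ≤ σ.natArr 21 (σ.natArr 22 r) ∧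
    σ.natArr 21 (σ.natArr 22 r) ≤ σ.natArr 13 (n + i) := by
  have b1 := q.rec_lt (n := n) (c := i) (by omega)
  have b2 := q.rec_lt (n := n) (c := n + i) (by omega)
  have hr : r < 8 * n := h2.trans_lt (h.rows.rank_lt _ b2)
  have e1 := h.rows.rank_ord r hr
  have l1 := h.rows.rec_le b1 (h.rows.ord_lt r hr) (by rw [e1]; exact h1)
  have l2 := h.rows.rec_le (h.rows.ord_lt r hr) b2 (by rw [e1]; exact h2)
  obtain ⟨a1, a2, a3⟩ := h.recs q i (by omega)
  obtain ⟨c1, c2, c3⟩ := h.recs q (n + i) (by omega)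
  rw [a1, a2, a3] at l1
  rw [c1, c2, c3] at l2
  simp only [cubeOf, hi, if_true] at l1 l2
  rw [if_neg (by omega), Nat.add_sub_cancel_left] at l2
  omega

/-- Rows of a column are in order. -/
theorem Setup.rows_mono (h : Setup n K s p σ) {r r' : ℕ} (hr : r ≤ r') (hr' : r' < 8 * n)
    (hX : σ.natArr 19 (σ.natArr 22 r) = σ.natArr 19 (σ.natArr 22 r'))
    (hZ : σ.natArr 20 (σ.natArr 22 r) = σ.natArr 20 (σ.natArr 22 r')) :
    σ.natArr 21 (σ.natArr 22 r) ≤ σ.natArr 21 (σ.natArr 22 r') := by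
  have := h.rows.rec_le (h.rows.ord_lt r (by omega)) (h.rows.ord_lt r' hr')
    (by rw [h.rows.rank_ord r (by omega), h.rows.rank_ord r' hr']; exact hr)
  omega

/-- The layout in the memory `σ`. -/
noncomputable def Setup.layout (h : Setup n K s p σ) (hs : 0 < s) : Layout n :=
  have hsx := h.slabX.choose_spec
  have hsz := h.slabZ.choose_spec
  have inj : ∀ d < 3, ∀ c < 2 * n, ∀ c' < 2 * n, σ.natArr (12 + d) c = σ.natArr (12 + d) c' →
      c = c' := fun d hd c hc c' hc' e => (h.sorted d hd).rank_inj hc hc' e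
  have hlt : ∀ d < 3, ∀ i < n, σ.natArr (12 + d) i < σ.natArr (12 + d) (n + i) := fun d hd i hi =>
    (h.sorted d hd).lower_lt_upper hs (h.upper d hd) i hi
  have aX : ∀ q : Kind, ∀ i, σ.natArr q.arrX i = if q.side then σ.natArr 15 i else σ.natArr 16 i :=
    fun q i => by rw [Kind.arrX]; split_ifs <;> rfl
  have aZ : ∀ q : Kind, ∀ i, σ.natArr q.arrZ i = if q.down then σ.natArr 18 i else σ.natArr 17 i :=
    fun q i => by rw [Kind.arrZ]; split_ifs <;> rfl
  have b1 : ∀ q : Kind, ∀ i < n, q.num * (2 * n) + i < 8 * n := fun q i hi => q.rec_lt (by omega)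
  have b2 : ∀ q : Kind, ∀ i < n, q.num * (2 * n) + (n + i) < 8 * n := fun q i hi =>
    q.rec_lt (by omega)
  have y1 : ∀ q : Kind, ∀ i < n, σ.natArr 21 (q.num * (2 * n) + i) = σ.natArr 13 i :=
    fun q i hi => (h.recs q i (by omega)).2.2
  have y2 : ∀ q : Kind, ∀ i < n, σ.natArr 21 (q.num * (2 * n) + (n + i)) = σ.natArr 13 (n + i) :=
    fun q i hi => (h.recs q (n + i) (by omega)).2.2
  have x1 : ∀ q : Kind, ∀ i < n, σ.natArr 19 (q.num * (2 * n) + i) = σ.natArr q.arrX i ∧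
      σ.natArr 20 (q.num * (2 * n) + i) = σ.natArr q.arrZ i := fun q i hi => by
    obtain ⟨e1, e2, -⟩ := h.recs q i (by omega)
    rw [e1, e2, cubeOf, if_pos hi]
    exact ⟨rfl, rfl⟩
  have x2 : ∀ q : Kind, ∀ i < n, σ.natArr 19 (q.num * (2 * n) + (n + i)) = σ.natArr q.arrX i ∧
      σ.natArr 20 (q.num * (2 * n) + (n + i)) = σ.natArr q.arrZ i := fun q i hi => by
    obtain ⟨e1, e2, -⟩ := h.recs q (n + i) (by omega)
    rw [e1, e2, cubeOf, if_neg (by omega), Nat.add_sub_cancel_left]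
    exact ⟨rfl, rfl⟩
  { lo := fun d i => σ.natArr (12 + d) i
    hi := fun d i => σ.natArr (12 + d) (n + i)
    S := fun d i => σ.natArr (15 + d) i
    E := fun d i => σ.natArr (16 + d) i
    κ := fun d => if d = 0 then h.slabX.choose else h.slabZ.choose
    r1 := fun q i => σ.natArr 23 (q.num * (2 * n) + i)
    r2 := fun q i => σ.natArr 23 (q.num * (2 * n) + (n + i))
    Y := fun r => σ.natArr 21 (σ.natArr 22 r)
    slab0 := hsx
    slab2 := hsz
    lo_inj := fun d hd i hi j hj e => inj d hd i (by omega) j (by omega) e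
    hi_inj := fun d hd i hi j hj e => by
      have := inj d hd (n + i) (by omega) (n + j) (by omega) e
      omega
    ne := fun d hd i hi j hj e => by
      have := inj d hd i (by omega) (n + j) (by omega) e
      omega
    lo_lt_hi := hlt
    hi_lt := fun d hd i hi => (h.sorted d hd).rank_lt _ (by omega)
    row_lt := fun q i hi => by
      refine h.rows.rec_lt (b1 q i hi) (b2 q i hi) ?_ ?_ ?_
      · rw [(x1 q i hi).1, (x2 q i hi).1]
      · rw [(x1 q i hi).2, (x2 q i hi).2]
      · rw [y1 q i hi, y2 q i hi]
        exact hlt 1 (by norm_num) i hi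
    r2_lt := fun q i hi => h.rows.rank_lt _ (b2 q i hi)
    Y_r1 := fun q i hi => by
      rw [h.rows.ord_rank _ (b1 q i hi), y1 q i hi]
    Y_r2 := fun q i hi => by
      rw [h.rows.ord_rank _ (b2 q i hi), y2 q i hi]
    Y_le := fun q i hi r hr1 hr2 => by
      have := h.rows.rank_lt _ (b2 q i hi)
      obtain ⟨e1, e2, -⟩ := h.rows_spec hi hr1 hr2.le
      obtain ⟨f1, f2, -⟩ := h.rows_spec (r := r + 1) hi (by omega) hr2
      exact h.rows_mono (by omega) (by omega) (by rw [e1, f1]) (by rw [e2, f2])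
    -- Row `r` lies between two records of the column of piece `i`, so it belongs to this column.
    -- Another piece occupies the row exactly if it has the same column key and its records lie on
    -- the two sides; as records of a column are ordered by `y`, any `y` in the row decides this.
    covers := fun q i hi q' j hj r y hr1 hr2 hy1 hy2 => by
      have hr := h.rows.rank_lt _ (b2 q i hi)
      obtain ⟨e1, e2, -⟩ := h.rows_spec hi hr1 hr2.le
      obtain ⟨f1, f2, -⟩ := h.rows_spec (r := r + 1) hi (by omega) hr2
      show _ ↔ (if q'.side then σ.natArr 15 j else σ.natArr 16 j) = (if q.side then σ.natArr 15 i else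
        σ.natArr 16 i) ∧ (if q'.down then σ.natArr 18 j else σ.natArr 17 j) =
        (if q.down then σ.natArr 18 i else σ.natArr 17 i) ∧ _
      rw [← aX, ← aX, ← aZ, ← aZ, ← e1, ← e2]
      constructor
      · rintro ⟨h1, h2⟩
        obtain ⟨g1, g2, g3, -⟩ := h.rows_spec hj h1 h2.le
        obtain ⟨-, -, -, g4⟩ := h.rows_spec (r := r + 1) hj (by omega) h2
        exact ⟨g1.symm, g2.symm, g3.trans_lt hy1, hy2.trans g4⟩
      · rintro ⟨g1, g2, g3, g4⟩
        have i1 := h.rows.rank_ord r (by omega)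
        have i2 := h.rows.rank_ord (r + 1) (by omega)
        constructor
        · by_contra hc
          have := h.rows.rec_le (h.rows.ord_lt (r + 1) (by omega)) (b1 q' j hj)
            (by rw [i2]; omega)
          rw [(x1 q' j hj).1, (x1 q' j hj).2, y1 q' j hj, f1, f2, g1, g2, e1, e2] at this
          simp only [Nat.reduceAdd] at g3
          omega
        · by_contra hc
          have := h.rows.rec_le (b2 q' j hj) (h.rows.ord_lt r (by omega))
            (by rw [i1]; omega)
          rw [(x2 q' j hj).1, (x2 q' j hj).2, y2 q' j hj, g1, g2, e1, e2] at this
          simp only [Nat.reduceAdd] at g4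
          omega
    side_eq := fun q i hi q' j hj r h1 h2 h3 h4 => by
      obtain ⟨e1, -⟩ := h.rows_spec hi h1 h2.le
      obtain ⟨f1, -⟩ := h.rows_spec hj h3 h4.le
      show (if q'.side then σ.natArr 15 j else σ.natArr 16 j) = (if q.side then σ.natArr 15 i else
        σ.natArr 16 i)
      rw [← aX, ← aX, ← e1, ← f1]
    exists_cut := fun t ht => by
      have e := (h.sorted 2 (by norm_num)).rank_ord t ht
      have l := (h.sorted 2 (by norm_num)).ord_lt t ht
      by_cases hc : σ.natArr (9 + 2) t < n
      · exact ⟨_, hc, .inl e⟩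
      · refine ⟨σ.natArr (9 + 2) t - n, by omega, .inr ?_⟩
        rw [show n + (σ.natArr (9 + 2) t - n) = σ.natArr (9 + 2) t by omega]
        exact e
    -- If the rows of `j` began strictly later and ended strictly earlier, its `y`-interval would be
    -- contained in that of `i`; since upper ends come in the order of lower ends, the cubes
    -- coincide. Then so do the kinds, because `S < E` distinguishes the slabs, and the rows could
    -- not differ.
    flank := fun q i hi q' j hj r h1 h2 h3 h4 => by
      obtain ⟨e1, e2, -⟩ := h.rows_spec hi h1 h2.le
      obtain ⟨f1, f2, -⟩ := h.rows_spec hj h3 h4.le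
      have hX : σ.natArr q.arrX i = σ.natArr q'.arrX j := by rw [← e1, ← f1]
      have hZ : σ.natArr q.arrZ i = σ.natArr q'.arrZ j := by rw [← e2, ← f2]
      by_contra hc
      push Not at hc
      have l1 := h.rows.rec_le (b1 q i hi) (b1 q' j hj) hc.1.le
      rw [(x1 q i hi).1, (x1 q i hi).2, (x1 q' j hj).1, (x1 q' j hj).2, hX, hZ, y1 q i hi,
        y1 q' j hj] at l1
      have l2 := h.rows.rec_le (b2 q' j hj) (b2 q i hi) hc.2.le
      rw [(x2 q i hi).1, (x2 q i hi).2, (x2 q' j hj).1, (x2 q' j hj).2, hX, hZ, y2 q i hi,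
        y2 q' j hj] at l2
      have l3 := (h.sorted 1 (by norm_num)).upper_lt_upper (h.upper 1 (by norm_num)) i hi j hj
      simp only [Nat.reduceAdd] at l3
      have hij : i = j := inj 1 (by norm_num) i (by omega) j (by omega) (by
        simp only [Nat.reduceAdd]; omega)
      subst hij
      have s1 := hsx.le i hi
      have s2 := hsz.le i hi
      have hq : q = q' := by
        rw [aX, aX] at hX
        rw [aZ, aZ] at hZ
        obtain ⟨_ | _, _ | _⟩ := q <;> obtain ⟨_ | _, _ | _⟩ := q' <;> simp at hX hZ <;>
          first | rfl | omega
      subst hq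
      omega }

end

end RealRAM


/-! ### The pieces, and the partition of the union into their regions -/

namespace RealRAM
open HeapTree

theorem sideX_opp {N x : ℕ} (hx : x ≤ N) (side : Bool) :
    N + 1 - sideX N side x = sideX N (!side) x := by
  cases side <;> simp [sideX]
  omega

namespace Layout
variable {n : ℕ} (L : Layout n)

/-- How far a piece reaches in the direction of `x`. -/
def A (q : Kind) (i : ℕ) : ℕ := if q.side then 2 * n - L.lo 0 i else L.hi 0 i

/-- Where the `x`-slab that contains a piece begins, as seen from its side. -/
def base (q : Kind) (i : ℕ) : ℕ := if q.side then 2 * n - L.E 0 i else L.E 0 i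

/-- The projection of the piece of kind `q` of cube `i` covers `(x, y)`, and `z` lies in the slab of
the piece. -/
def Lat (q : Kind) (i x y z : ℕ) : Prop :=
  (if q.side then L.lo 0 i < x ∧ x ≤ L.E 0 i else L.E 0 i < x ∧ x ≤ L.hi 0 i) ∧
    (L.lo 1 i < y ∧ y ≤ L.hi 1 i) ∧
    if q.down then L.E 2 i < z ∧ L.κ 2 z = L.E 2 i else L.S 2 i < z ∧ L.κ 2 z = L.S 2 i

/-- The piece of kind `q` of cube `i` is present at time `t`. -/
def Active (q : Kind) (t i : ℕ) : Prop := if q.down then t ≤ L.hi 2 i else L.lo 2 i < t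

/-- The position in the sweep at which the region of a piece is output. -/
def evPos (q : Kind) (i : ℕ) : ℕ := if q.down then L.hi 2 i else L.lo 2 i

/-- The time to which the trees are set when the region of a piece is output. -/
def evTime (q : Kind) (i : ℕ) : ℕ := if q.down then L.hi 2 i + 1 else L.lo 2 i

/-- A piece of kind `q` that is present at time `t` covers the point. -/
def Cov (q : Kind) (t x y z : ℕ) : Prop := ∃ j < n, L.Active q t j ∧ L.Lat q j x y z

/-- The point belongs to the region that is output for the piece of kind `q` of cube `i`. -/
def Emit (q : Kind) (i x y z : ℕ) : Prop :=
  L.Lat q i x y z ∧ ¬ L.Cov q (L.evTime q i) x y z ∧ ¬ L.Cov q.opp (L.evTime q i) x y z ∧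
    if q.down then (¬ L.Cov q.cross (L.evTime q i) x y z ∧ ¬ L.Cov q.copp (L.evTime q i) x y z) ∧
      z ≤ L.hi 2 i
    else (¬ L.Cov q.cross (L.evTime q i) x y z ∧ ¬ L.Cov q.copp (L.evTime q i) x y z) →
      L.lo 2 i < z

/-- The point belongs to cube `i`. -/
def In (i x y z : ℕ) : Prop :=
  (L.lo 0 i < x ∧ x ≤ L.hi 0 i) ∧ (L.lo 1 i < y ∧ y ≤ L.hi 1 i) ∧ L.lo 2 i < z ∧ z ≤ L.hi 2 i

/-- The breakpoint `E` cuts the `x`-interval and the `z`-interval of the cube into two parts each,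
giving four pieces. Within its slab a piece is determined in the direction of `z` by the single
inequality at its free end. -/
theorem in_iff {i x y z : ℕ} (hi : i < n) :
    L.In i x y z ↔ ∃ q, L.Lat q i x y z ∧ if q.down then z ≤ L.hi 2 i else L.lo 2 i < z := by
  have h0 := L.slab0.le i hi
  have h2 := L.slab2.le i hi
  constructor
  · rintro ⟨a, b, c⟩
    have hx : ∃ side : Bool, if side then L.lo 0 i < x ∧ x ≤ L.E 0 i else
        L.E 0 i < x ∧ x ≤ L.hi 0 i := by
      by_cases h : x ≤ L.E 0 i
      · exact ⟨true, by simp; omega⟩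
      · exact ⟨false, by simp; omega⟩
    obtain ⟨side, hx⟩ := hx
    by_cases h : z ≤ L.E 2 i
    · exact ⟨⟨false, side⟩, ⟨hx, b, by simpa using ⟨by omega, L.slab2.own i hi z (by omega) h⟩⟩,
        by simpa using c.1⟩
    · exact ⟨⟨true, side⟩, ⟨hx, b, by simpa using ⟨by omega, L.slab2.next i hi z (by omega) c.2⟩⟩,
        by simpa using c.2⟩
  · rintro ⟨⟨down, side⟩, ⟨a, b, c⟩, d⟩
    refine ⟨?_, b, ?_⟩
    · cases side <;> simp at a <;> omega
    · cases down
      · simp at c d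
        have := L.slab2.le_of_eq i hi z c.2
        omega
      · simp at c d
        omega

theorem exists_argmin {x y z : ℕ} (h : ∃ j < n, ∃ q : Kind, q.down = false ∧ L.Lat q j x y z) :
    ∃ i < n, ∃ q : Kind, q.down = false ∧ L.Lat q i x y z ∧
      ∀ j < n, ∀ q' : Kind, q'.down = false → L.Lat q' j x y z → L.lo 2 i ≤ L.lo 2 j := by
  obtain ⟨i, ⟨hi, q, hq, hL⟩, hmin⟩ := exists_minimalFor_of_wellFoundedLT
    (fun j => j < n ∧ ∃ q : Kind, q.down = false ∧ L.Lat q j x y z) (L.lo 2)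
    (by obtain ⟨j, hj, h⟩ := h; exact ⟨j, hj, h⟩)
  refine ⟨i, hi, q, hq, hL, fun j hj q' hq' hL' => ?_⟩
  rcases le_total (L.lo 2 i) (L.lo 2 j) with h | h
  · exact h
  · exact hmin ⟨hj, q', hq', hL'⟩ h

theorem exists_argmax {x y z : ℕ} (h : ∃ j < n, ∃ q : Kind, q.down = true ∧ L.Lat q j x y z) :
    ∃ i < n, ∃ q : Kind, q.down = true ∧ L.Lat q i x y z ∧
      ∀ j < n, ∀ q' : Kind, q'.down = true → L.Lat q' j x y z → L.hi 2 j ≤ L.hi 2 i := by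
  obtain ⟨i, ⟨hi, q, hq, hL⟩, hmin⟩ := exists_minimalFor_of_wellFoundedLT
    (fun j => j < n ∧ ∃ q : Kind, q.down = true ∧ L.Lat q j x y z) (fun j => 2 * n - L.hi 2 j)
    (by obtain ⟨j, hj, h⟩ := h; exact ⟨j, hj, h⟩)
  refine ⟨i, hi, q, hq, hL, fun j hj q' hq' hL' => ?_⟩
  have hi' := L.hi_lt 2 (by norm_num) i hi
  have hj' := L.hi_lt 2 (by norm_num) j hj
  by_contra hc
  have := hmin ⟨hj, q', hq', hL'⟩ (by simp only; omega)
  simp only at this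
  omega

/-- The family of a kind does not cover the point. -/
theorem not_cov_iff {q : Kind} {t x y z : ℕ} :
    (¬ L.Cov q t x y z ∧ ¬ L.Cov q.opp t x y z) ↔
      ∀ j < n, ∀ q' : Kind, q'.down = q.down → L.Lat q' j x y z → ¬ L.Active q' t j := by
  constructor
  · rintro ⟨h1, h2⟩ j hj q' hq' hL ha
    have : q' = q ∨ q' = q.opp := by
      obtain ⟨_ | _, _ | _⟩ := q <;> obtain ⟨_ | _, _ | _⟩ := q' <;> simp_all [Kind.opp]
    rcases this with rfl | rfl
    · exact h1 ⟨j, hj, ha, hL⟩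
    · exact h2 ⟨j, hj, ha, hL⟩
  · intro h
    exact ⟨fun ⟨j, hj, ha, hL⟩ => h j hj q rfl hL ha, fun ⟨j, hj, ha, hL⟩ => h j hj q.opp rfl hL ha⟩

/-- At time `lo 2 i` the pieces reaching up that are present are those starting strictly lower, and
those reaching down are those with `lo 2 i ≤ hi 2 j`. So the responsible piece is the lowest one,
and it takes the whole slab if some piece reaching down overlaps it. -/
theorem emit_up_iff {side : Bool} {i x y z : ℕ} : L.Emit ⟨false, side⟩ i x y z ↔
    L.Lat ⟨false, side⟩ i x y z ∧
    (∀ j < n, ∀ q' : Kind, q'.down = false → L.Lat q' j x y z → L.lo 2 i ≤ L.lo 2 j) ∧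
    ((∀ j < n, ∀ q' : Kind, q'.down = true → L.Lat q' j x y z → L.hi 2 j < L.lo 2 i) →
      L.lo 2 i < z) := by
  have h1 := L.not_cov_iff (q := ⟨false, side⟩) (t := L.lo 2 i) (x := x) (y := y) (z := z)
  have h2 := L.not_cov_iff (q := Kind.cross ⟨false, side⟩) (t := L.lo 2 i) (x := x) (y := y) (z := z)
  simp only [Emit, ← and_assoc, evTime]
  simp only [Bool.false_eq_true, if_false]
  rw [and_assoc (a := L.Lat _ i x y z), h1, show Kind.copp ⟨false, side⟩ =
    (Kind.cross ⟨false, side⟩).opp by simp [Kind.copp, Kind.cross, Kind.opp], h2]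
  simp only [Active, Kind.cross, Bool.not_false]
  constructor
  · rintro ⟨⟨a, b⟩, c⟩
    exact ⟨⟨a, fun j hj q' hq' hL => by simpa [hq'] using b j hj q' hq' hL⟩, fun d => c
      fun j hj q' hq' hL => by simpa [hq'] using d j hj q' hq' hL⟩
  · rintro ⟨⟨a, b⟩, c⟩
    exact ⟨⟨a, fun j hj q' hq' hL => by simpa [hq'] using b j hj q' hq' hL⟩, fun d => c
      fun j hj q' hq' hL => by simpa [hq'] using d j hj q' hq' hL⟩

/-- The time is `hi 2 i + 1`, so that the piece itself is absent and, among those reaching down,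
exactly the ones that end strictly higher are present. -/
theorem emit_down_iff {side : Bool} {i x y z : ℕ} : L.Emit ⟨true, side⟩ i x y z ↔
    L.Lat ⟨true, side⟩ i x y z ∧
    (∀ j < n, ∀ q' : Kind, q'.down = true → L.Lat q' j x y z → L.hi 2 j ≤ L.hi 2 i) ∧
    (∀ j < n, ∀ q' : Kind, q'.down = false → L.Lat q' j x y z → L.hi 2 i < L.lo 2 j) ∧
      z ≤ L.hi 2 i := by
  have h1 := L.not_cov_iff (q := ⟨true, side⟩) (t := L.hi 2 i + 1) (x := x) (y := y) (z := z)
  have h2 := L.not_cov_iff (q := Kind.cross ⟨true, side⟩) (t := L.hi 2 i + 1) (x := x) (y := y)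
    (z := z)
  simp only [Emit, ← and_assoc, evTime]
  simp only [if_true]
  rw [and_assoc (a := L.Lat _ i x y z), h1, show Kind.copp ⟨true, side⟩ =
    (Kind.cross ⟨true, side⟩).opp by simp [Kind.copp, Kind.cross, Kind.opp], h2]
  simp only [Active, Kind.cross, Bool.not_true]
  constructor
  · rintro ⟨⟨a, b⟩, c, d⟩
    exact ⟨⟨⟨a, fun j hj q' hq' hL => by have := b j hj q' hq' hL; simp [hq'] at this; omega⟩, 
      fun j hj q' hq' hL => by have := c j hj q' hq' hL; simp [hq'] at this; omega⟩, d⟩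
  · rintro ⟨⟨⟨a, b⟩, c⟩, d⟩
    exact ⟨⟨a, fun j hj q' hq' hL => by have := b j hj q' hq' hL; simp [hq']; omega⟩,
      fun j hj q' hq' hL => by have := c j hj q' hq' hL; simp [hq']; omega, d⟩

theorem Lat.side_eq {L : Layout n} {q q' : Kind} {i x y z : ℕ}
    (h : L.Lat q i x y z) (h' : L.Lat q' i x y z) : q.side = q'.side := by
  obtain ⟨down, side⟩ := q
  obtain ⟨down', side'⟩ := q'
  have h1 := h.1
  have h2 := h'.1
  cases side <;> cases side' <;> simp at h1 h2 ⊢ <;> omega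

/-- Every point belongs to at most one region. -/
theorem Emit.unique {L : Layout n} {q q' : Kind} {i i' x y z : ℕ} (hi : i < n) (hi' : i' < n)
    (h : L.Emit q i x y z) (h' : L.Emit q' i' x y z) : q = q' ∧ i = i' := by
  have same : ∀ {q q' : Kind}, L.Lat q i x y z → L.Lat q' i' x y z → q.down = q'.down → i = i' →
      q = q' ∧ i = i' := fun {q q'} hL hL' hd e => by
    subst e
    have := hL.side_eq hL'
    obtain ⟨_, _⟩ := q
    obtain ⟨_, _⟩ := q'
    simp_all
  -- Output for a piece reaching down requires that all pieces reaching up start above it; then the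
  -- one reaching up contributes only points above its own lower end, and those are too high.
  have diff : ∀ {s s' : Bool} {i i' : ℕ}, i < n → i' < n → L.Emit ⟨false, s⟩ i x y z →
      L.Emit ⟨true, s'⟩ i' x y z → False := fun {s s' i i'} hi hi' h h' => by
    obtain ⟨a1, a2, a3⟩ := L.emit_up_iff.1 h
    obtain ⟨b1, b2, b3, b4⟩ := L.emit_down_iff.1 h'
    have := b3 i hi _ rfl a1
    have := a3 fun j hj q' hq' hL => (b2 j hj q' hq' hL).trans_lt this
    omega
  obtain ⟨_ | _, side⟩ := q <;> obtain ⟨_ | _, side'⟩ := q'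
  · obtain ⟨a1, a2, -⟩ := L.emit_up_iff.1 h
    obtain ⟨b1, b2, -⟩ := L.emit_up_iff.1 h'
    exact same a1 b1 rfl (L.lo_inj 2 (by norm_num) i hi i' hi'
      (le_antisymm (a2 i' hi' _ rfl b1) (b2 i hi _ rfl a1)))
  · exact (diff hi hi' h h').elim
  · exact (diff hi' hi h' h).elim
  · obtain ⟨a1, a2, -⟩ := L.emit_down_iff.1 h
    obtain ⟨b1, b2, -⟩ := L.emit_down_iff.1 h'
    exact same a1 b1 rfl (L.hi_inj 2 (by norm_num) i hi i' hi'
      (le_antisymm (b2 i hi _ rfl a1) (a2 i' hi' _ rfl b1)))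

/-- The regions cover the cubes. -/
theorem exists_emit_iff {x y z : ℕ} :
    (∃ q, ∃ i < n, L.Emit q i x y z) ↔ ∃ i < n, L.In i x y z := by
  constructor
  · rintro ⟨⟨_ | _, side⟩, i, hi, h⟩
    · obtain ⟨a1, a2, a3⟩ := L.emit_up_iff.1 h
      by_cases hz : L.lo 2 i < z
      · exact ⟨i, hi, (L.in_iff hi).2 ⟨_, a1, hz⟩⟩
      -- Now `z ≤ lo 2 i`, so the point was output because a piece reaching down overlaps; that
      -- piece contains the point, as `z ≤ lo 2 i ≤ hi 2 j`.
      · have := mt a3 hz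
        push Not at this
        obtain ⟨j, hj, q', hq', hL, hlt⟩ := this
        exact ⟨j, hj, (L.in_iff hj).2 ⟨q', hL, by simp only [hq']; simp; omega⟩⟩
    · obtain ⟨a1, a2, a3, a4⟩ := L.emit_down_iff.1 h
      exact ⟨i, hi, (L.in_iff hi).2 ⟨_, a1, a4⟩⟩
  · rintro ⟨i, hi, h⟩
    obtain ⟨q, hL, hz⟩ := (L.in_iff hi).1 h
    by_cases hU : ∃ j < n, ∃ q : Kind, q.down = false ∧ L.Lat q j x y z
    · obtain ⟨j, hj, ⟨down, side⟩, hq', hLj, hmin⟩ := L.exists_argmin hU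
      obtain rfl : down = false := hq'
      by_cases hE : L.Emit ⟨false, side⟩ j x y z
      · exact ⟨_, j, hj, hE⟩
      -- If the lowest piece reaching up is not responsible, it overlaps no piece reaching down and
      -- starts at or above `z`. Hence the point lies in a piece reaching down, and the highest of
      -- these is responsible.
      · rw [emit_up_iff] at hE
        push Not at hE
        obtain ⟨hcr, hle⟩ := hE hLj hmin
        have hd : q.down = true := by
          by_contra hd
          have hd' : q.down = false := by simpa using hd
          have := hmin i hi q hd' hL
          simp only [hd'] at hz
          simp at hz
          omega
        obtain ⟨k, hk, ⟨down, side'⟩, hq', hLk, hmax⟩ := L.exists_argmax ⟨i, hi, q, hd, hL⟩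
        obtain rfl : down = true := hq'
        refine ⟨_, k, hk, L.emit_down_iff.2 ⟨hLk, hmax, fun m hm q' hq' hLm => ?_, ?_⟩⟩
        · exact (hcr k hk _ rfl hLk).trans_le (hmin m hm q' hq' hLm)
        · have := hmax i hi q hd hL
          simp only [hd] at hz
          simp at hz
          omega
    · push Not at hU
      have hd : q.down = true := by
        by_contra hd
        exact hU i hi q (by simpa using hd) hL
      obtain ⟨k, hk, ⟨down, side'⟩, hq', hLk, hmax⟩ := L.exists_argmax ⟨i, hi, q, hd, hL⟩
      obtain rfl : down = true := hq'
      refine ⟨_, k, hk, L.emit_down_iff.2 ⟨hLk, hmax, fun m hm q' hq' hLm => ?_, ?_⟩⟩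
      · exact (hU m hm q' hq' hLm).elim
      · have := hmax i hi q hd hL
        simp only [hd] at hz
        simp at hz
        omega

end Layout

end RealRAM


/-! ### Reaches of the rows: how they express coverage, and how they change -/

namespace RealRAM
open HeapTree

namespace Layout
variable {n : ℕ} (L : Layout n)

/-- The greatest reach, at row `r`, of the pieces of kind `q` of the cubes in `T q`. -/
def rowVal (T : Kind → Finset ℕ) (q : Kind) (r : ℕ) : ℕ :=
  (T q).sup fun j => if L.r1 q j ≤ r ∧ r < L.r2 q j then L.A q j else 0

open Classical in
/-- The cubes whose pieces of kind `q` are present at time `t`. -/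
noncomputable def act (t : ℕ) (q : Kind) : Finset ℕ := (Finset.range n).filter (L.Active q t)

theorem mem_act {t : ℕ} {q : Kind} {i : ℕ} : i ∈ L.act t q ↔ i < n ∧ L.Active q t i := by
  simp [act]

theorem le_rowVal_iff {T : Kind → Finset ℕ} {q : Kind} {r b : ℕ} (hb : 0 < b) :
    b ≤ L.rowVal T q r ↔ ∃ j ∈ T q, (L.r1 q j ≤ r ∧ r < L.r2 q j) ∧ b ≤ L.A q j := by
  rw [rowVal, Finset.le_sup_iff (by simpa using hb)]
  refine exists_congr fun j => and_congr_right fun _ => ?_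
  split_ifs with h
  · simp [h]
  · simp [h]; omega

theorem A_le {q : Kind} {i : ℕ} (hi : i < n) : L.A q i ≤ 2 * n := by
  have := L.hi_lt 0 (by norm_num) i hi
  simp only [A]
  split_ifs <;> omega

theorem rowVal_le {T : Kind → Finset ℕ} (hT : ∀ q, ∀ j ∈ T q, j < n) (q : Kind) (r : ℕ) :
    L.rowVal T q r ≤ 2 * n := by
  refine Finset.sup_le fun j hj => ?_
  split_ifs
  · exact L.A_le (hT q j hj)
  · omega

/-- A superlevel set is a union of row intervals of pieces, and by `Layout.flank` each one that
meets the rows of piece `i` contains their beginning or their end. -/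
theorem rowVal_flank {T : Kind → Finset ℕ} (hT : ∀ q, ∀ j ∈ T q, j < n) {q : Kind} {i : ℕ}
    (hi : i < n) (q' : Kind) (b : ℕ) :
    Flank (fun r => b ≤ L.rowVal T q' r) (L.r1 q i) (L.r2 q i) := by
  intro r h1 h2 h
  rcases Nat.eq_zero_or_pos b with rfl | hb
  · exact .inl fun _ _ _ => Nat.zero_le _
  · obtain ⟨j, hj, ⟨h3, h4⟩, h5⟩ := (L.le_rowVal_iff hb).1 h
    rcases L.flank q i hi q' j (hT q' j hj) r h1 h2 h3 h4 with h6 | h6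
    · exact .inl fun u _ _ => (L.le_rowVal_iff hb).2 ⟨j, hj, ⟨by omega, by omega⟩, h5⟩
    · exact .inr fun u _ _ => (L.le_rowVal_iff hb).2 ⟨j, hj, ⟨by omega, by omega⟩, h5⟩

/-- The column of a piece, in terms of the point. -/
theorem lat_iff {q : Kind} {i x y z : ℕ} (hi : i < n) (hx : x ≤ 2 * n) (hx0 : 0 < x) (hz : 0 < z) :
    L.Lat q i x y z ↔ ((if q.side then L.S 0 i else L.E 0 i) = L.κ 0 x ∧
      sideX (2 * n) q.side x ≤ L.A q i) ∧ (L.lo 1 i < y ∧ y ≤ L.hi 1 i) ∧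
      (if q.down then L.E 2 i else L.S 2 i) = L.κ 2 z := by
  have h0 := L.slab0.le i hi
  have h0' := L.hi_lt 0 (by norm_num) i hi
  have a1 := L.slab0.own i hi x
  have a2 := L.slab0.next i hi x
  have a3 := L.slab0.le_of_eq i hi x
  have a4 := L.slab0.lt x hx0
  have b4 := L.slab2.lt z hz
  refine and_congr ?_ (and_congr_right fun _ => ?_)
  · simp only [sideX, A]
    cases q.side <;> simp <;> omega
  · cases q.down <;> simp <;> omega

/-- All pieces of one kind in a column touch the same wall, so in a given row they cover a point
exactly if its distance from the wall is at most the greatest reach. `covers` restricts the maximum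
to the pieces of the right column. -/
theorem sideX_le_rowVal {q : Kind} {i x y z r t : ℕ} (hi : i < n) (hx : x ≤ 2 * n)
    (h1 : L.r1 q i ≤ r) (h2 : r < L.r2 q i) (h3 : L.Y r < y) (h4 : y ≤ L.Y (r + 1))
    (hL : L.Lat q i x y z) (q' : Kind) :
    sideX (2 * n) q'.side x ≤ L.rowVal (L.act t) q' r ↔ L.Cov q' t x y z := by
  have hx0 : 0 < x := by
    have := hL.1
    split_ifs at this <;> omega
  have hz : 0 < z := by
    have := hL.2.2
    split_ifs at this <;> omega
  have hX : 0 < sideX (2 * n) q'.side x := by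
    simp only [sideX]
    split_ifs <;> omega
  rw [L.le_rowVal_iff hX]
  obtain ⟨⟨c1, -⟩, -, c2⟩ := (L.lat_iff hi hx hx0 hz).1 hL
  constructor
  · rintro ⟨j, hj, hr, hA⟩
    obtain ⟨hj, ha⟩ := L.mem_act.1 hj
    obtain ⟨d1, d2, d3⟩ := (L.covers q i hi q' j hj r y h1 h2 h3 h4).1 hr
    exact ⟨j, hj, ha, (L.lat_iff hj hx hx0 hz).2 ⟨⟨d1.trans c1, hA⟩, d3, d2.trans c2⟩⟩
  · rintro ⟨j, hj, ha, hL'⟩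
    obtain ⟨⟨d1, d2⟩, d3, d4⟩ := (L.lat_iff hj hx hx0 hz).1 hL'
    exact ⟨j, L.mem_act.2 ⟨hj, ha⟩, (L.covers q i hi q' j hj r y h1 h2 h3 h4).2
      ⟨d1.trans c1.symm, d4.trans c2.symm, d3⟩, d2⟩

/-- The lower bound in the direction of `z` of the region of a piece where its cross pieces are
absent. -/
def za (q : Kind) (i : ℕ) : ℕ := if q.down then L.E 2 i else L.lo 2 i

/-- The upper bound in the direction of `z` of the region of a piece where its cross pieces are
absent. -/
def zb (q : Kind) (i : ℕ) : ℕ := if q.down then L.hi 2 i else L.E 2 i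

/-- The lower bound in the direction of `z` of the region of a piece where a cross piece is
present. -/
def w1 (q : Kind) (i : ℕ) : ℕ := if q.down then 0 else L.S 2 i

/-- The upper bound in the direction of `z` of the region of a piece where a cross piece is
present. -/
def w2 (q : Kind) (i : ℕ) : ℕ := if q.down then 0 else L.E 2 i

theorem lat_of_cond {q : Kind} {i x y z r : ℕ} {v : Kind → ℕ} (hi : i < n) (hx : x ≤ 2 * n)
    (h1 : L.r1 q i ≤ r) (h2 : r < L.r2 q i) (h3 : L.Y r < y) (h4 : y ≤ L.Y (r + 1))
    (h : Cond (2 * n) (L.A q i) (L.base q i) q v (L.za q i) (L.zb q i) (L.w1 q i) (L.w2 q i)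
      (sideX (2 * n) q.side x) z) : L.Lat q i x y z := by
  obtain ⟨a1, a2, -, -, a3⟩ := h
  have s0 := L.slab0.le i hi
  have s2 := L.slab2.le i hi
  have h0' := L.hi_lt 0 (by norm_num) i hi
  refine ⟨?_, ((L.covers q i hi q i hi r y h1 h2 h3 h4).1 ⟨h1, h2⟩).2.2, ?_⟩
  · simp only [sideX, base, A] at a1 a2
    cases hs : q.side <;> simp only [hs] at a1 a2 ⊢ <;> simp at a1 a2 ⊢ <;> omega
  · have b1 := L.slab2.own i hi z
    have b2 := L.slab2.next i hi z
    simp only [za, zb, w1, w2] at a3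
    cases hs : q.down <;> simp only [hs] at a3 ⊢ <;> simp at a3 ⊢ <;> omega

/-- Each comparison of `X` with a row value translates into absence of coverage by that kind; the
remaining inequalities describe the piece itself. When a cross piece is present, the bounds `w1` and
`w2` give the whole slab for a piece reaching up and nothing for one reaching down. -/
theorem cond_iff {q : Kind} {i x y z r : ℕ} (hi : i < n) (hx : x ≤ 2 * n)
    (h1 : L.r1 q i ≤ r) (h2 : r < L.r2 q i) (h3 : L.Y r < y) (h4 : y ≤ L.Y (r + 1)) :
    Cond (2 * n) (L.A q i) (L.base q i) q (fun q' => L.rowVal (L.act (L.evTime q i)) q' r)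
      (L.za q i) (L.zb q i) (L.w1 q i) (L.w2 q i) (sideX (2 * n) q.side x) z ↔ L.Emit q i x y z := by
  have key : L.Lat q i x y z → (Cond (2 * n) (L.A q i) (L.base q i) q
      (fun q' => L.rowVal (L.act (L.evTime q i)) q' r)
      (L.za q i) (L.zb q i) (L.w1 q i) (L.w2 q i) (sideX (2 * n) q.side x) z ↔
      L.Emit q i x y z) := fun hL => by
    have hc := fun q' => not_congr (L.sideX_le_rowVal (t := L.evTime q i) hi hx h1 h2 h3 h4 hL q')
    simp only [not_le] at hc
    simp only [Cond, Emit, sideX_opp hx]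
    rw [hc q, show (!q.side) = q.opp.side from rfl, hc q.opp, show q.side = q.cross.side from rfl,
      hc q.cross, show q.opp.side = q.copp.side from rfl, hc q.copp]
    have hz0 : 0 < z := by
      have := hL.2.2
      split_ifs at this <;> omega
    have hb : L.base q i < sideX (2 * n) q.cross.side x ∧ sideX (2 * n) q.cross.side x ≤ L.A q i := by
      have := hL.1
      have s0 := L.slab0.le i hi
      have h0' := L.hi_lt 0 (by norm_num) i hi
      simp only [sideX, base, A, Kind.cross]
      by_cases hs : q.side = true
      · simp only [hs, if_true] at this ⊢
        omega
      · simp only [hs] at this ⊢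
        simp at this ⊢
        omega
    have hz := hL.2.2
    have s2 := L.slab2.le i hi
    have b3 := L.slab2.le_of_eq i hi z
    simp only [hb.1, hb.2, hL, true_and]
    refine and_congr_right fun _ => and_congr_right fun _ => ?_
    generalize L.Cov q.cross (L.evTime q i) x y z = Q
    generalize L.Cov q.copp (L.evTime q i) x y z = Q'
    simp only [za, zb, w1, w2]
    by_cases hQ : Q <;> by_cases hQ' : Q' <;> cases hs : q.down <;>
      simp only [hs, hQ, hQ'] at hz ⊢ <;> simp at hz ⊢ <;> omega
  exact ⟨fun h => (key (L.lat_of_cond hi hx h1 h2 h3 h4 h)).1 h, fun h => (key h.1).2 h⟩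

theorem rowRegion_eq_emit {ι : Fin 3 → ℝ → ℕ} (hι : ∀ d x, ι d x ≤ 2 * n) {q : Kind} {i : ℕ}
    (hi : i < n) : rowRegion ι (2 * n) (L.A q i) (L.base q i) q (L.rowVal (L.act (L.evTime q i))) L.Y
      (L.za q i) (L.zb q i) (L.w1 q i) (L.w2 q i) (L.r1 q i) (L.r2 q i) =
    {x | L.Emit q i (ι 0 (x 0)) (ι 1 (x 1)) (ι 2 (x 2))} := by
  ext x
  constructor
  · rintro ⟨r, h1, h2, h3, h4, h5⟩
    exact (L.cond_iff hi (hι 0 _) h1 h2 h3 h4).1 h5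
  · intro h
    obtain ⟨r, h1, h2, h3, h4⟩ := (exists_row (L.row_lt q i hi).le (L.Y_le q i hi)
      (y := ι 1 (x 1))).2 (by rw [L.Y_r1 q i hi, L.Y_r2 q i hi]; exact h.1.2.1)
    exact ⟨r, h1, h2, h3, h4, (L.cond_iff hi (hι 0 _) h1 h2 h3 h4).2 h⟩

/-! ### The number of changes of the profile -/

/-- The cubes `T` with the pieces of cube `i` in the family of `q` added. -/
def add2 (T : Kind → Finset ℕ) (q : Kind) (i : ℕ) (q' : Kind) : Finset ℕ :=
  if q'.down = q.down then insert i (T q') else T q'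

theorem rowVal_insert (T : Kind → Finset ℕ) (q : Kind) (i : ℕ) :
    L.rowVal (Function.update T q (insert i (T q))) =
      Function.update (L.rowVal T) q (raise (L.rowVal T q) (L.A q i) (L.r1 q i) (L.r2 q i)) := by
  funext q' r
  by_cases h : q' = q
  · subst h
    simp only [rowVal, Function.update_self, Finset.sup_insert, raise]
    split_ifs <;> simp [max_comm]
  · simp [rowVal, h]

theorem add2_eq (T : Kind → Finset ℕ) (q : Kind) (i : ℕ) :
    add2 T q i = Function.update (Function.update T q (insert i (T q))) q.opp
      (insert i (Function.update T q (insert i (T q)) q.opp)) := by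
  funext q'
  rw [Function.update_of_ne q.opp_ne]
  simp only [add2, Function.update_apply]
  have : q'.down = q.down ↔ q' = q.opp ∨ q' = q := by
    obtain ⟨_ | _, _ | _⟩ := q <;> obtain ⟨_ | _, _ | _⟩ := q' <;> decide
  by_cases h1 : q' = q.opp
  · subst h1; simp [this]
  · by_cases h2 : q' = q
    · subst h2; simp [h1]
    · simp [this, h1, h2]

/-- The number of changes of the profile in the rows of a piece. -/
def cuts (T : Kind → Finset ℕ) (q : Kind) (i : ℕ) : ℕ :=
  cutCount (fun r => prof (2 * n) (L.A q i) q fun q' => L.rowVal T q' r) (L.r1 q i) (L.r2 q i)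

/-- The two pieces lie in different `x`-slabs, since `S 0 i < E 0 i`, so they share no row. Hence it
does not matter for the count whether the first is inserted before the second is output. -/
theorem cuts_insert_opp {T : Kind → Finset ℕ} {q : Kind} {i : ℕ} (hi : i < n) :
    L.cuts (Function.update T q (insert i (T q))) q.opp i = L.cuts T q.opp i := by
  have : ∀ r, L.r1 q.opp i ≤ r → r < L.r2 q.opp i → ∀ q',
      L.rowVal (Function.update T q (insert i (T q))) q' r = L.rowVal T q' r := by
    intro r h1 h2 q'
    rw [rowVal_insert]
    by_cases h : q' = q
    · subst h
      rw [Function.update_self, raise, if_neg]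
      rintro ⟨h3, h4⟩
      have := L.side_eq q' i hi q'.opp i hi r h3 h4 h1 h2
      have s0 := L.slab0.le i hi
      simp only [Kind.opp] at this
      cases hs : q'.side <;> simp [hs] at this <;> omega
    · rw [Function.update_of_ne h]
  simp only [cuts, cutCount]
  congr 1
  refine Finset.filter_congr fun u _ => ?_
  constructor
  · rintro ⟨h1, h2, h3⟩
    simp only [this u h1 (by omega), this (u + 1) (by omega) h2] at h3
    exact ⟨h1, h2, h3⟩
  · rintro ⟨h1, h2, h3⟩
    simp only [← this u h1 (by omega), ← this (u + 1) (by omega) h2] at h3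
    exact ⟨h1, h2, h3⟩

theorem insert_lt {T : Kind → Finset ℕ} (hT : ∀ q, ∀ j ∈ T q, j < n) {i : ℕ} (hi : i < n) (q : Kind) :
    ∀ q', ∀ j ∈ Function.update T q (insert i (T q)) q', j < n := by
  intro q' j hj
  by_cases h : q' = q
  · subst h
    rw [Function.update_self, Finset.mem_insert] at hj
    rcases hj with rfl | hj
    · exact hi
    · exact hT _ j hj
  · rw [Function.update_of_ne h] at hj
    exact hT _ j hj

/-- Two applications of `pot_raise`, one for each side; `pot_opp` allows one potential to serve
both. -/
theorem pot_add2 {T : Kind → Finset ℕ} (hT : ∀ q, ∀ j ∈ T q, j < n) {i : ℕ} (hi : i < n) (q : Kind) :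
    pot (2 * n) (8 * n) (L.rowVal (add2 T q i)) q + (L.cuts T q i + L.cuts T q.opp i) ≤
      pot (2 * n) (8 * n) (L.rowVal T) q + 24 := by
  have h1 := pot_raise (N := 2 * n) (M := 8 * n) (q := q) (L.A_le (q := q) hi) (L.rowVal_le hT)
    (L.row_lt q i hi).le (L.r2_lt q i hi).le fun q' b => L.rowVal_flank hT hi q' b
  rw [← rowVal_insert] at h1
  have hT' := insert_lt hT hi q
  have h2 := pot_raise (N := 2 * n) (M := 8 * n) (q := q.opp) (L.A_le (q := q.opp) hi)
    (L.rowVal_le hT')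
    (L.row_lt q.opp i hi).le (L.r2_lt q.opp i hi).le fun q' b => L.rowVal_flank hT' hi q' b
  rw [← rowVal_insert, ← add2_eq, pot_opp, pot_opp] at h2
  have h3 := L.cuts_insert_opp (T := T) (q := q) hi
  simp only [cuts] at h3 ⊢
  omega

/-- Two applications of `pot_lower`. Read from right to left, it bounds the effect of removing the
two pieces that reach the other way. -/
theorem pot_add2_cross {T : Kind → Finset ℕ} (hT : ∀ q, ∀ j ∈ T q, j < n) {i : ℕ} (hi : i < n)
    (q : Kind) : pot (2 * n) (8 * n) (L.rowVal T) q ≤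
      pot (2 * n) (8 * n) (L.rowVal (add2 T q.cross i)) q + 20 := by
  have h1 := pot_lower (N := 2 * n) (M := 8 * n) (q := q) (a := L.A q.cross i)
    fun q' b => L.rowVal_flank hT (q := q.cross) hi q' b
  rw [← rowVal_insert] at h1
  have hT' := insert_lt hT hi q.cross
  have h2 := pot_lower (N := 2 * n) (M := 8 * n) (q := q.opp) (a := L.A q.opp.cross i)
    fun q' b => L.rowVal_flank hT' (q := q.opp.cross) hi q' b
  rw [← rowVal_insert, show q.opp.cross = q.cross.opp from rfl, ← add2_eq, pot_opp, pot_opp] at h2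
  omega

end Layout

end RealRAM


/-! ### Summation over the sweep, and the regions in the order of output -/

namespace RealRAM
open HeapTree

namespace Layout
variable {n : ℕ} (L : Layout n)

theorem act_lt (t : ℕ) : ∀ q, ∀ j ∈ L.act t q, j < n := fun _ _ hj => (L.mem_act.1 hj).1

/-- All ends in the direction of `z` have different ranks, so passing a lower end affects a single
cube and only its two pieces that reach up; `add2` adds both sides at once. -/
theorem act_succ_of_lo {i : ℕ} (hi : i < n) :
    L.act (L.lo 2 i + 1) = add2 (L.act (L.lo 2 i)) ⟨false, false⟩ i := by
  funext q
  ext j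
  have hn := fun j hj => L.ne 2 (by norm_num) i hi j hj
  have hin := fun j hj => L.lo_inj 2 (by norm_num) i hi j hj
  simp only [add2, mem_act, Active]
  cases hq : q.down
  · simp [mem_act, Active, hq]
    constructor
    · rintro ⟨hj, h⟩
      rcases Nat.lt_or_ge (L.lo 2 j) (L.lo 2 i) with h' | h'
      · exact .inr ⟨hj, h'⟩
      · exact .inl (hin j hj (by omega)).symm
    · rintro (rfl | ⟨hj, h⟩)
      · exact ⟨hi, le_rfl⟩
      · exact ⟨hj, by omega⟩
  · simp [mem_act, Active, hq]
    intro hj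
    have := hn j hj
    omega

theorem act_of_hi {i : ℕ} (hi : i < n) :
    L.act (L.hi 2 i) = add2 (L.act (L.hi 2 i + 1)) ⟨true, false⟩ i := by
  funext q
  ext j
  have hn := fun j hj => L.ne 2 (by norm_num) j hj i hi
  have hin := fun j hj => L.hi_inj 2 (by norm_num) i hi j hj
  simp only [add2, mem_act, Active]
  cases hq : q.down
  · simp [mem_act, Active, hq]
    intro hj
    have := hn j hj
    omega
  · simp [mem_act, Active, hq]
    constructor
    · rintro ⟨hj, h⟩
      rcases Nat.lt_or_ge (L.hi 2 i) (L.hi 2 j) with h' | h'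
      · exact .inr ⟨hj, h'⟩
      · exact .inl (hin j hj (by omega)).symm
    · rintro (rfl | ⟨hj, h⟩)
      · exact ⟨hi, le_rfl⟩
      · exact ⟨hj, by omega⟩

theorem act_zero {q : Kind} (hq : q.down = false) : L.act 0 q = ∅ := by
  ext j
  simp [mem_act, Active, hq]

theorem act_end {q : Kind} (hq : q.down = true) : L.act (2 * n) q = ∅ := by
  ext j
  simp only [mem_act, Active, hq, if_true, Finset.notMem_empty, iff_false, not_and]
  intro hj
  have := L.hi_lt 2 (by norm_num) j hj
  omega

theorem rowVal_of_empty {T : Kind → Finset ℕ} {q : Kind} (h : T q = ∅) (r : ℕ) :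
    L.rowVal T q r = 0 := by simp [rowVal, h]

open Classical in
/-- The number of changes of the profiles for the pieces at `t` that reach up. -/
noncomputable def upCuts (t : ℕ) : ℕ :=
  if h : ∃ i < n, L.lo 2 i = t then L.cuts (L.act t) ⟨false, false⟩ h.choose +
    L.cuts (L.act t) ⟨false, true⟩ h.choose else 0

open Classical in
/-- The number of changes of the profiles for the pieces at `t` that reach down. -/
noncomputable def downCuts (t : ℕ) : ℕ :=
  if h : ∃ i < n, L.hi 2 i = t then L.cuts (L.act (t + 1)) ⟨true, false⟩ h.choose +
    L.cuts (L.act (t + 1)) ⟨true, true⟩ h.choose else 0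

theorem upCuts_eq {i : ℕ} (hi : i < n) : L.upCuts (L.lo 2 i) =
    L.cuts (L.act (L.lo 2 i)) ⟨false, false⟩ i + L.cuts (L.act (L.lo 2 i)) ⟨false, true⟩ i := by
  have h : ∃ j < n, L.lo 2 j = L.lo 2 i := ⟨i, hi, rfl⟩
  have e : h.choose = i := L.lo_inj 2 (by norm_num) _ h.choose_spec.1 i hi h.choose_spec.2
  rw [upCuts, dif_pos h, e]

theorem downCuts_eq {i : ℕ} (hi : i < n) : L.downCuts (L.hi 2 i) =
    L.cuts (L.act (L.hi 2 i + 1)) ⟨true, false⟩ i +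
      L.cuts (L.act (L.hi 2 i + 1)) ⟨true, true⟩ i := by
  have h : ∃ j < n, L.hi 2 j = L.hi 2 i := ⟨i, hi, rfl⟩
  have e : h.choose = i := L.hi_inj 2 (by norm_num) _ h.choose_spec.1 i hi h.choose_spec.2
  rw [downCuts, dif_pos h, e]

theorem upCuts_hi {i : ℕ} (hi : i < n) : L.upCuts (L.hi 2 i) = 0 := by
  rw [upCuts, dif_neg]
  rintro ⟨j, hj, h⟩
  exact L.ne 2 (by norm_num) j hj i hi h

theorem downCuts_lo {i : ℕ} (hi : i < n) : L.downCuts (L.lo 2 i) = 0 := by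
  rw [downCuts, dif_neg]
  rintro ⟨j, hj, h⟩
  exact L.ne 2 (by norm_num) i hi j hj h.symm

/-- Along the sweep each step raises potential plus accumulated changes by at most `24`: at a lower
end pieces are inserted, at an upper end pieces of the cross families are removed. At the start
nothing reaches up, so the potential is nonpositive; at the end nothing reaches down, so it is
nonnegative. -/
theorem sum_upCuts_le : ∑ t ∈ Finset.range (2 * n), L.upCuts t ≤ 48 * n := by
  have key : ∀ t ≤ 2 * n, pot (2 * n) (8 * n) (L.rowVal (L.act t)) ⟨false, false⟩ +
      ((∑ u ∈ Finset.range t, L.upCuts u : ℕ) : ℤ) ≤ 24 * t := by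
    intro t
    induction t with
    | zero =>
      intro _
      have := pot_nonpos (N := 2 * n) (M := 8 * n) (v := L.rowVal (L.act 0))
        (q := ⟨false, false⟩) (fun r => L.rowVal_of_empty (L.act_zero rfl) r)
        (fun r => L.rowVal_of_empty (L.act_zero rfl) r)
      simpa using this
    | succ t ih =>
      intro ht
      have ih := ih (by omega)
      rw [Finset.sum_range_succ]
      obtain ⟨i, hi, rfl | rfl⟩ := L.exists_cut t (by omega)
      · have := L.pot_add2 (L.act_lt (L.lo 2 i)) hi ⟨false, false⟩
        rw [← L.act_succ_of_lo hi] at this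
        rw [L.upCuts_eq hi]
        simp only [Kind.opp, Bool.not_false] at this
        push_cast at ih ⊢
        omega
      · have := L.pot_add2_cross (L.act_lt (L.hi 2 i + 1)) hi ⟨false, false⟩
        rw [show Kind.cross ⟨false, false⟩ = ⟨true, false⟩ from rfl, ← L.act_of_hi hi] at this
        rw [L.upCuts_hi hi]
        push_cast at ih ⊢
        omega
  have h1 := key (2 * n) le_rfl
  have h2 := pot_nonneg (N := 2 * n) (M := 8 * n) (v := L.rowVal (L.act (2 * n)))
    (q := ⟨false, false⟩) (fun r => L.rowVal_of_empty (L.act_end rfl) r)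
    (fun r => L.rowVal_of_empty (L.act_end rfl) r)
  push_cast at h1
  refine Int.ofNat_le.1 ?_
  push_cast
  linarith

/-- The same argument with time reversed: backward in time, pieces reaching down are inserted and
pieces reaching up are removed. -/
theorem sum_downCuts_le : ∑ t ∈ Finset.range (2 * n), L.downCuts t ≤ 48 * n := by
  have key : ∀ t ≤ 2 * n, pot (2 * n) (8 * n) (L.rowVal (L.act 0)) ⟨true, false⟩ +
      ((∑ u ∈ Finset.range t, L.downCuts u : ℕ) : ℤ) ≤
      pot (2 * n) (8 * n) (L.rowVal (L.act t)) ⟨true, false⟩ + 24 * t := by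
    intro t
    induction t with
    | zero => simp
    | succ t ih =>
      intro ht
      have ih := ih (by omega)
      rw [Finset.sum_range_succ]
      obtain ⟨i, hi, rfl | rfl⟩ := L.exists_cut t (by omega)
      · have := L.pot_add2_cross (L.act_lt (L.lo 2 i)) hi ⟨true, false⟩
        rw [show Kind.cross ⟨true, false⟩ = ⟨false, false⟩ from rfl, ← L.act_succ_of_lo hi] at this
        rw [L.downCuts_lo hi]
        push_cast at ih ⊢
        omega
      · have := L.pot_add2 (L.act_lt (L.hi 2 i + 1)) hi ⟨true, false⟩
        rw [← L.act_of_hi hi] at this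
        rw [L.downCuts_eq hi]
        simp only [Kind.opp, Bool.not_false] at this
        push_cast at ih ⊢
        omega
  have h1 := key (2 * n) le_rfl
  have h2 := pot_nonneg (N := 2 * n) (M := 8 * n) (v := L.rowVal (L.act 0))
    (q := ⟨true, false⟩) (fun r => L.rowVal_of_empty (L.act_zero rfl) r)
    (fun r => L.rowVal_of_empty (L.act_zero rfl) r)
  have h3 := pot_nonpos (N := 2 * n) (M := 8 * n) (v := L.rowVal (L.act (2 * n)))
    (q := ⟨true, false⟩) (fun r => L.rowVal_of_empty (L.act_end rfl) r)
    (fun r => L.rowVal_of_empty (L.act_end rfl) r)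
  push_cast at h1
  refine Int.ofNat_le.1 ?_
  push_cast
  linarith

/-! ### The regions in the order of the sweep -/

/-- The region of a piece. -/
def region (ι : Fin 3 → ℝ → ℕ) (q : Kind) (i : ℕ) : Set (Fin 3 → ℝ) :=
  {x | L.Emit q i (ι 0 (x 0)) (ι 1 (x 1)) (ι 2 (x 2))}

/-- The union of the regions before position `t`. -/
def regions (ι : Fin 3 → ℝ → ℕ) (t : ℕ) : Set (Fin 3 → ℝ) :=
  {x | ∃ q, ∃ i < n, L.evPos q i < t ∧ x ∈ L.region ι q i}

variable {ι : Fin 3 → ℝ → ℕ}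

theorem region_disjoint_opp {q : Kind} {i : ℕ} (hi : i < n) :
    Disjoint (L.region ι q i) (L.region ι q.opp i) :=
  Set.disjoint_left.2 fun _ h h' => q.opp_ne (h.unique hi hi h').1.symm

theorem regions_disjoint {q : Kind} {i : ℕ} (hi : i < n) :
    Disjoint (L.regions ι (L.evPos q i)) (L.region ι q i) := by
  refine Set.disjoint_left.2 ?_
  rintro x ⟨q', j, hj, hlt, h⟩ h'
  obtain ⟨rfl, rfl⟩ := h.unique hj hi h'
  exact lt_irrefl _ hlt

theorem evPos_opp (q : Kind) (i : ℕ) : L.evPos q.opp i = L.evPos q i := rfl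

theorem evPos_eq_iff {q q' : Kind} {i j : ℕ} (hi : i < n) (hj : j < n) :
    L.evPos q' j = L.evPos q i ↔ j = i ∧ (q' = q ∨ q' = q.opp) := by
  have h1 := L.ne 2 (by norm_num) i hi j hj
  have h2 := L.ne 2 (by norm_num) j hj i hi
  have h3 := L.lo_inj 2 (by norm_num) j hj i hi
  have h4 := L.hi_inj 2 (by norm_num) j hj i hi
  constructor
  · intro h
    obtain ⟨_ | _, _ | _⟩ := q <;> obtain ⟨_ | _, _ | _⟩ := q' <;>
      simp [evPos, Kind.opp] at h ⊢ <;> first | exact h3 h | exact h4 h | omega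
  · rintro ⟨rfl, rfl | rfl⟩ <;> rfl

theorem regions_succ {q : Kind} {i : ℕ} (hi : i < n) : L.regions ι (L.evPos q i + 1) =
    L.regions ι (L.evPos q i) ∪ L.region ι q i ∪ L.region ι q.opp i := by
  ext x
  constructor
  · rintro ⟨q', j, hj, hlt, h⟩
    rcases Nat.lt_succ_iff_lt_or_eq.1 hlt with h' | h'
    · exact .inl (.inl ⟨q', j, hj, h', h⟩)
    · obtain ⟨rfl, rfl | rfl⟩ := (L.evPos_eq_iff hi hj).1 h'
      · exact .inl (.inr h)
      · exact .inr h
  · rintro ((⟨q', j, hj, hlt, h⟩ | h) | h)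
    · exact ⟨q', j, hj, by omega, h⟩
    · exact ⟨q, i, hi, by omega, h⟩
    · exact ⟨q.opp, i, hi, by rw [evPos_opp]; omega, h⟩

theorem regions_zero : L.regions ι 0 = ∅ := by
  ext x
  simp [regions]

theorem mem_regions_end {x : Fin 3 → ℝ} :
    x ∈ L.regions ι (2 * n) ↔ ∃ i < n, L.In i (ι 0 (x 0)) (ι 1 (x 1)) (ι 2 (x 2)) := by
  rw [← exists_emit_iff]
  constructor
  · rintro ⟨q, i, hi, -, h⟩
    exact ⟨q, i, hi, h⟩
  · rintro ⟨q, i, hi, h⟩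
    refine ⟨q, i, hi, ?_, h⟩
    have h1 := L.hi_lt 2 (by norm_num) i hi
    have h2 := L.lo_lt_hi 2 (by norm_num) i hi
    simp only [evPos]
    split_ifs <;> omega

end Layout

/-- In each dimension, `lo < rank` says that the lower face has been passed and `rank ≤ hi` that the
upper face has not; by the convention in `Passed` these are the closed inequalities. -/
theorem Setup.in_iff {n K : ℕ} {s : ℝ} {p : Fin n → Fin 3 → ℝ} {σ : State}
    (h : Setup n K s p σ) (hs : 0 < s) (x : Fin 3 → ℝ) :
    (∃ i < n, (h.layout hs).In i (σ.iota n 0 (x 0)) (σ.iota n 1 (x 1)) (σ.iota n 2 (x 2))) ↔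
      x ∈ ⋃ i, closedCube (p i) s := by
  have key : ∀ d : Fin 3, ∀ i : Fin n, (h.layout hs).lo d i < σ.iota n d (x d) ∧
      σ.iota n d (x d) ≤ (h.layout hs).hi d i ↔ p i d ≤ x d ∧ x d ≤ p i d + s := by
    intro d i
    have hS := h.sorted d d.2
    have a1 := hS.passed_iff (hS.rank_lt i (by omega)) (x d)
    have a2 := hS.passed_iff (hS.rank_lt (n + i) (by omega)) (x d)
    rw [hS.ord_rank i (by omega)] at a1
    rw [hS.ord_rank (n + i) (by omega)] at a2
    have e1 := h.lower d i
    have e2 := h.upper d d.2 i i.2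
    rw [e1] at e2
    show σ.natArr (12 + d) i < _ ∧ _ ≤ σ.natArr (12 + d) (n + i) ↔ _
    rw [State.iota, ← a1, ← not_lt, ← a2, not_passed, Passed, e1, e2]
    refine and_congr ?_ ?_
    · rw [le_iff_lt_or_eq]
      exact or_congr_right ⟨fun h => h.2.symm, fun h => ⟨i.2, h.symm⟩⟩
    · rw [le_iff_lt_or_eq]
      exact or_congr_right ⟨fun h => h.2, fun h => ⟨by omega, h⟩⟩
  rw [Set.mem_iUnion]
  constructor
  · rintro ⟨i, hi, h0, h1, h2⟩
    refine ⟨⟨i, hi⟩, fun d => (key d ⟨i, hi⟩).1 ?_⟩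
    fin_cases d
    · exact h0
    · exact h1
    · exact h2
  · rintro ⟨i, hx⟩
    exact ⟨i, i.2, (key 0 i).2 (hx 0), (key 1 i).2 (hx 1), (key 2 i).2 (hx 2)⟩

end RealRAM


namespace RealRAM
open HeapTree

/-! ### Programs for single pieces -/

/-- A multiple of the content of register `2`. -/
def timesN : ℕ → NatExpr
  | 0 => nat 0
  | k + 1 => timesN k + reg 2

@[simp] theorem eval_timesN (σ : State) (k : ℕ) : (timesN k).eval σ = k * σ.natReg 2 := by
  induction k with
  | zero => simp [timesN]
  | succ k ih => simp [timesN, ih, Nat.succ_mul]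

/-- Loads the rows and the reach of the piece of kind `q` of the cube in register `6`. -/
def setPiece (q : Kind) : Prog :=
  set 55 (reg 3 + arr 23 (timesN q.num + reg 6)) ;;
    set 56 (reg 3 + nat 1 + arr 23 (timesN q.num + (reg 1 + reg 6))) ;;
    set 7 (bif q.side then reg 2 - arr 12 (reg 6) else arr 12 (reg 1 + reg 6))

/-- Loads the remaining numbers that describe the region of this piece. -/
def setRegion (q : Kind) : Prog :=
  set 8 (bif q.side then reg 2 - arr 16 (reg 6) else arr 16 (reg 6)) ;; set 9 (reg 56) ;;
    set 10 (reg 55 + nat 1) ;;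
    set 11 (bif q.down then arr 18 (reg 6) else arr 14 (reg 6)) ;;
    set 12 (bif q.down then arr 14 (reg 1 + reg 6) else arr 18 (reg 6)) ;;
    set 13 (bif q.down then nat 0 else arr 17 (reg 6)) ;;
    set 14 (bif q.down then nat 0 else arr 18 (reg 6))

/-- Outputs the region of a piece. -/
def emitPiece (q : Kind) : Prog := setPiece q ;; setRegion q ;; emitProg q

/-- Updates a tree in the rows of a piece. -/
def updPiece (q : Kind) (e : NatExpr) : Prog := setPiece q ;; updProg q.num e

/-- The tags of the tree number `q.num` when the pieces of the cubes in `T q` are present. -/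
noncomputable def Layout.tag {n : ℕ} (L : Layout n) (K : ℕ) (T : Kind → Finset ℕ) (q : Kind) :
    ℕ → ℕ :=
  tagOf K (T q) (fun j => 2 ^ K + L.r1 q j) (fun j => 2 ^ K + 1 + L.r2 q j) (L.A q)

/-- `v` is a maximal node between the ends of the rows of a piece. -/
def Layout.Touched {n : ℕ} (L : Layout n) (K : ℕ) (q : Kind) (i v : ℕ) : Prop :=
  Acted K (2 ^ K + L.r1 q i) (2 ^ K + 1 + L.r2 q i) v

/-- The memory `τ` of the sweep in which the pieces of kind `q` of the cubes in `T q` are present. -/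
structure SweepAt {n : ℕ} (L : Layout n) (K : ℕ) (σ : State) (T : Kind → Finset ℕ) (τ : State) :
    Prop where
  static : Static σ τ
  forest : Forest K τ
  tags : ∀ q : Kind, τ.natArr (24 + q.num) = L.tag K T q
  lt : ∀ q, ∀ j ∈ T q, j < n

theorem Static.iota {σ τ : State} (h : Static σ τ) (n : ℕ) : τ.iota n = σ.iota n := by
  funext d
  simp only [State.iota]
  rw [h.realArr d d.2, h.natArr _ (by omega) (by omega)]

section
variable {n K : ℕ} {s : ℝ} {p : Fin n → Fin 3 → ℝ} {σ ρ : State} {T : Kind → Finset ℕ}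
  {q : Kind} {i : ℕ}

/-- Row `r` sits at leaf `2 ^ K + 1 + r`. The shift by one makes room for an excluded left end even
in front of row `0`: the leaves strictly between `2 ^ K + r1` and `2 ^ K + 1 + r2` are the rows `r1
≤ r < r2`. -/
theorem Setup.leaf_left (h : Setup n K s p σ) (hs : 0 < s) (hi : i < n) :
    Lvl K 0 (2 ^ K + (h.layout hs).r1 q i) := by
  have h1 := (h.layout hs).row_lt q i hi
  have h2 := (h.layout hs).r2_lt q i hi
  have h3 := h.size
  exact lvl_leaf.2 ⟨by omega, by rw [pow_succ]; omega⟩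

theorem Setup.leaf_right (h : Setup n K s p σ) (hs : 0 < s) (hi : i < n) :
    Lvl K 0 (2 ^ K + 1 + (h.layout hs).r2 q i) := by
  have h2 := (h.layout hs).r2_lt q i hi
  have h3 := h.size
  exact lvl_leaf.2 ⟨by omega, by rw [pow_succ]; omega⟩

theorem SweepAt.leafVal (h : Setup n K s p σ) (hs : 0 < s) (hS : SweepAt (h.layout hs) K σ T ρ)
    {r : ℕ} (hr : 2 ^ K + 1 + r < 2 ^ (K + 1)) :
    leafVal K ρ q.num (2 ^ K + 1 + r) = (h.layout hs).rowVal T q r := by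
  rw [RealRAM.leafVal, hS.tags, Layout.tag, pathMax_tagOf
    (fun j hj => h.leaf_left hs (hS.lt q j hj)) (lvl_leaf.2 ⟨by omega, hr⟩), Layout.rowVal]
  refine Finset.sup_congr rfl fun j _ => ?_
  have : (2 ^ K + (h.layout hs).r1 q j < 2 ^ K + 1 + r ∧
      2 ^ K + 1 + r < 2 ^ K + 1 + (h.layout hs).r2 q j) ↔
      ((h.layout hs).r1 q j ≤ r ∧ r < (h.layout hs).r2 q j) := by omega
  simp only [this]

theorem runs_setPiece (h : Setup n K s p σ) (hs : 0 < s) (hS : Static σ ρ) (h6 : ρ.natReg 6 = i) :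
    Runs (setPiece q) ρ 60 fun τ => τ.natReg 55 = 2 ^ K + (h.layout hs).r1 q i ∧
      τ.natReg 56 = 2 ^ K + 1 + (h.layout hs).r2 q i ∧ τ.natReg 7 = (h.layout hs).A q i := by
  have e1 : ρ.natReg 1 = n := by rw [hS.reg1, h.reg1]
  have e2 : ρ.natReg 2 = 2 * n := by rw [hS.reg2, h.reg2]
  have e3 : ρ.natReg 3 = 2 ^ K := by rw [hS.reg3, h.tree.size]
  have e4 : ρ.natArr 23 = σ.natArr 23 := hS.natArr 23 (by norm_num) (by norm_num)
  have e5 : ρ.natArr 12 = σ.natArr 12 := hS.natArr 12 (by norm_num) (by norm_num)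
  refine Runs.line rfl (by obtain ⟨_ | _, _ | _⟩ := q <;> decide) ⟨?_, ?_, ?_⟩
  · simp [setPiece, e2, e3, e4, h6]
    rfl
  · simp [setPiece, e1, e2, e3, e4, h6]
    rfl
  · cases hq : q.side
    · simp [setPiece, e1, e5, h6, hq, Layout.A]
      rfl
    · simp [setPiece, e2, e5, h6, hq, Layout.A]
      rfl

theorem runs_emitPiece (h : Setup n K s p σ) (hs : 0 < s) (hi : i < n)
    (hT : T = (h.layout hs).act ((h.layout hs).evTime q i))
    (hS : SweepAt (h.layout hs) K σ T ρ) (h6 : ρ.natReg 6 = i) {R : Set (Fin 3 → ℝ)}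
    (hR : OutPart ρ R) (hdis : Disjoint R ((h.layout hs).region (σ.iota n) q i)) :
    Runs (emitPiece q) ρ (2010 * (K + 1) * ((h.layout hs).cuts T q i + 2) + 120) fun τ =>
      SweepAt (h.layout hs) K σ T τ ∧ (∀ r, 3 < r → r < 7 → τ.natReg r = ρ.natReg r) ∧
      (∀ a, 24 ≤ a → τ.natArr a = ρ.natArr a) ∧
      OutPart τ (R ∪ (h.layout hs).region (σ.iota n) q i) ∧
      τ.natReg 0 ≤ ρ.natReg 0 + 3 * ((h.layout hs).cuts T q i + 1) := by
  set L := h.layout hs with hL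
  have hι : ∀ d x, σ.iota n d x ≤ 2 * n := fun d x => rankOf_le
  have hreg := L.rowRegion_eq_emit hι (q := q) hi
  rw [← hT] at hreg
  change _ = L.region (σ.iota n) q i at hreg
  refine Runs.seq_of (T₂ := 2010 * (K + 1) * (L.cuts T q i + 2) + 60)
    (runs_setPiece (q := q) h hs hS.static h6) (fun ρ1 ⟨a1, a2, a3⟩ hF1 => ?_) (by omega)
  rw [← hL] at a1 a2 a3
  have s1 : ∀ r ∈ [1, 2, 3, 4, 5, 6, 0], ρ1.natReg r = ρ.natReg r := fun r hr =>
    hF1.natReg r (by revert r; simp [setPiece, Prog.wN])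
  have s2 : ∀ a, ρ1.natArr a = ρ.natArr a := fun a => hF1.natArr a (by simp [setPiece, Prog.wNA])
  have s3 : ∀ a, ρ1.realArr a = ρ.realArr a := fun a => hF1.realArr a (by simp [setPiece, Prog.wRA])
  have e1 : ρ1.natReg 1 = n := by rw [s1 1 (by simp), hS.static.reg1, h.reg1]
  have e2 : ρ1.natReg 2 = 2 * n := by rw [s1 2 (by simp), hS.static.reg2, h.reg2]
  have e6 : ρ1.natReg 6 = i := by rw [s1 6 (by simp), h6]
  have ar : ∀ a, 6 ≤ a → a < 24 → ρ1.natArr a = σ.natArr a := fun a b1 b2 => by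
    rw [s2, hS.static.natArr a b1 b2]
  refine Runs.seq_of (T₁ := 60) (T₂ := 2010 * (K + 1) * (L.cuts T q i + 2)) (R := fun τ => τ.natReg 8 = L.base q i ∧
      τ.natReg 9 = 2 ^ K + 1 + L.r2 q i ∧ τ.natReg 10 = 2 ^ K + 1 + L.r1 q i ∧
      τ.natReg 11 = L.za q i ∧ τ.natReg 12 = L.zb q i ∧ τ.natReg 13 = L.w1 q i ∧
      τ.natReg 14 = L.w2 q i) (Runs.line rfl (by obtain ⟨_ | _, _ | _⟩ := q <;> decide) ?_)
      (fun ρ2 ⟨b1, b2, b3, b4, b5, b6, b7⟩ hF2 => ?_) (by omega)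
  · have q14 := ar 14 (by norm_num) (by norm_num)
    have q16 := ar 16 (by norm_num) (by norm_num)
    have q17 := ar 17 (by norm_num) (by norm_num)
    have q18 := ar 18 (by norm_num) (by norm_num)
    refine ⟨?_, ?_, ?_, ?_, ?_, ?_, ?_⟩
    · cases hq : q.side <;> simp [setRegion, e2, e6, hq, Layout.base, q16] <;> rfl
    · simp [setRegion, a2]
    · simp [setRegion, a1]
      omega
    all_goals
      cases hq : q.down <;>
      simp [setRegion, e1, e6, hq, Layout.za, Layout.zb, Layout.w1, Layout.w2, q14, q17, q18] <;> rfl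
  have u1 : ∀ r ∈ [1, 2, 3, 4, 5, 6, 0, 7], ρ2.natReg r = ρ1.natReg r := fun r hr =>
    hF2.natReg r (by revert r; simp [setRegion, Prog.wN])
  have u2 : ∀ a, ρ2.natArr a = ρ.natArr a := fun a => by
    rw [hF2.natArr a (by simp [setRegion, Prog.wNA]), s2]
  have u3 : ∀ a, ρ2.realArr a = ρ.realArr a := fun a => by
    rw [hF2.realArr a (by simp [setRegion, Prog.wRA]), s3]
  have v1 : ∀ r ∈ [1, 2, 3, 4, 5, 6, 0], ρ2.natReg r = ρ.natReg r := fun r hr => by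
    rw [u1 r (by revert r; decide), s1 r hr]
  have hst : Static σ ρ2 := hS.static.trans ⟨v1 1 (by simp), v1 2 (by simp), v1 3 (by simp),
    fun a _ _ => u2 a, fun a _ => u3 a⟩
  have hfor : Forest K ρ2 := hS.forest.congr (v1 3 (by simp)) fun a _ => u2 a
  have hS2 : SweepAt L K σ T ρ2 := ⟨hst, hfor, fun q => by rw [u2, hS.tags], hS.lt⟩
  have z0 := L.slab0.le i hi
  have z2 := L.slab2.le i hi
  have w0 := L.hi_lt 0 (by norm_num) i hi
  have w2 := L.hi_lt 2 (by norm_num) i hi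
  have hsz := h.size
  have hr2 := L.r2_lt q i hi
  have hE : EventAt n K (L.A q i) (L.base q i) (L.r2 q i) (L.za q i) (L.zb q i) (L.w1 q i)
      (L.w2 q i) (L.rowVal T) L.Y ρ2 := by
    refine ⟨by rw [hst.reg1, h.reg1], by rw [hst.reg2, h.reg2], fun d hd => ?_, hfor,
      by rw [u1 7 (by simp), a3], b1, b2, b4, b5, b6, b7, fun q r hr => hS2.leafVal h hs hr,
      fun r _ => ?_⟩
    · rw [hst.realArr d hd, hst.natArr _ (by omega) (by omega), hst.natArr _ (by omega) (by omega)]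
      exact h.sorted d hd
    · rw [hst.natArr 21 (by norm_num) (by norm_num), hst.natArr 22 (by norm_num) (by norm_num)]
      rfl
  have hN : EventNum n K q (L.A q i) (L.base q i) (L.r1 q i) (L.r2 q i) (L.za q i) (L.zb q i)
      (L.w1 q i) (L.w2 q i) (L.rowVal T) L.Y := by
    refine ⟨L.A_le hi, fun hq => ?_, fun hq => ?_, L.rowVal_le hS.lt, ?_, fun r q1 q2 => ?_,
      L.Y_le q i hi, ?_, ?_, ?_, ?_⟩
    · simp [Layout.A, hq]; exact w0
    · simp [Layout.base, hq]; omega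
    · rw [pow_succ]; omega
    · have := le_of_rows q1 fun r' c1 c2 => L.Y_le q i hi r' (by omega) c2
      rw [L.Y_r2 q i hi] at this
      have := L.hi_lt 1 (by norm_num) i hi
      omega
    · simp only [Layout.za]; split_ifs <;> omega
    · simp only [Layout.zb]; split_ifs <;> omega
    · simp only [Layout.w1]; split_ifs <;> omega
    · simp only [Layout.w2]; split_ifs <;> omega
  have hι2 := hst.iota n
  refine (runs_emitProg hE hN (L.row_lt q i hi).le b3
    (hR.congr (v1 0 (by simp)) (fun a _ => u2 a) fun a _ _ => u3 a)
    (by rw [hι2, hreg]; exact hdis)).mono le_rfl fun τ ⟨hk, hout, hcnt⟩ => ⟨?_, ?_, ?_, ?_, ?_⟩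
  · refine ⟨hst.trans hk.1, hfor.congr hk.reg3 fun a ha => ?_, fun q => ?_, hS.lt⟩
    · rcases ha with rfl | rfl | ha
      · exact hk.natArr 6 (by norm_num) (by norm_num)
      · exact hk.natArr 7 (by norm_num) (by norm_num)
      · exact hk.trees a ha.1
    · rw [hk.trees _ (by omega), hS2.tags]
  · intro r r1 r2
    rw [hk.regs r (by omega) (by omega) (by omega), v1 r (by
      have : r = 4 ∨ r = 5 ∨ r = 6 := by omega
      rcases this with rfl | rfl | rfl <;> simp)]
  · intro a ha
    rw [hk.trees a ha, u2]
  · rw [hι2, hreg] at hout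
    exact hout
  · rw [v1 0 (by simp)] at hcnt
    exact hcnt

theorem mem_wNA_updProg {k a : ℕ} {e : NatExpr} (h : a ∈ (updProg k e).wNA) :
    a = 24 + k ∨ a = 28 + k ∨ a = 32 + k ∨ a = 36 + k := by
  simp [updProg, actsProg, actNode, pullNode, climbProg, Prog.wNA] at h
  omega

theorem mem_wN_updProg {k r : ℕ} {e : NatExpr} (h : r ∈ (updProg k e).wN) : 40 ≤ r := by
  simp [updProg, actsProg, actNode, pullNode, climbProg, Prog.wN] at h
  omega

/-- Insertion and undoing differ only in the expression for the new tag. The set `U` lists the cubes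
present afterwards; `hg` and `hg'` say that touched nodes receive, and the others already have, the
tags belonging to `U`. -/
theorem runs_updPiece (h : Setup n K s p σ) (hs : 0 < s) (hi : i < n)
    (hS : SweepAt (h.layout hs) K σ T ρ) (h6 : ρ.natReg 6 = i) {st : ℕ} (h5 : ρ.natReg 5 = st)
    {U : Finset ℕ} (hU : ∀ j ∈ U, j < n) {e : NatExpr} {g : ℕ → ℕ}
    (he : ∀ v, ∀ ρ' : State, ρ'.natReg 48 = v → ρ'.natReg 5 = st →
      ρ'.natReg 7 = (h.layout hs).A q i → ρ'.natArr (24 + q.num) v = (h.layout hs).tag K T q v →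
      ρ'.natArr (36 + q.num) (st + v) = ρ.natArr (36 + q.num) (st + v) → e.eval ρ' = g v)
    (hg : ∀ v, (h.layout hs).Touched K q i v →
      g v = (h.layout hs).tag K (Function.update T q U) q v)
    (hg' : ∀ v, ¬ (h.layout hs).Touched K q i v →
      (h.layout hs).tag K T q v = (h.layout hs).tag K (Function.update T q U) q v) :
    Runs (updPiece q e) ρ ((K + 1) * (2 * e.cost + 440)) fun τ =>
      SweepAt (h.layout hs) K σ (Function.update T q U) τ ∧
      (∀ r ≤ 6, τ.natReg r = ρ.natReg r) ∧ (∀ R, OutPart ρ R → OutPart τ R) ∧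
      (∀ q' ≠ q, τ.natArr (36 + q'.num) = ρ.natArr (36 + q'.num)) ∧
      (∀ v, (h.layout hs).Touched K q i v →
        τ.natArr (36 + q.num) (st + v) = (h.layout hs).tag K T q v) ∧
      ∀ c, (∀ v < 2 ^ (K + 1), c ≠ st + v) →
        τ.natArr (36 + q.num) c = ρ.natArr (36 + q.num) c := by
  set L := h.layout hs with hL
  have e0 : (K + 1) * (2 * e.cost + 440) = (K + 1) * (2 * e.cost + 380) + 60 * K + 60 := by ring
  rw [e0]
  refine Runs.seq_of (T₂ := (K + 1) * (2 * e.cost + 380)) (runs_setPiece (q := q) h hs hS.static h6)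
    (fun ρ1 ⟨a1, a2, a3⟩ hF1 => ?_) (by omega)
  have s1 : ∀ r ≤ 6, ρ1.natReg r = ρ.natReg r := fun r hr =>
    hF1.natReg r (by interval_cases r <;> simp [setPiece, Prog.wN])
  have s2 : ∀ a, ρ1.natArr a = ρ.natArr a := fun a => hF1.natArr a (by simp [setPiece, Prog.wNA])
  have s3 : ∀ a, ρ1.realArr a = ρ.realArr a := fun a => hF1.realArr a (by simp [setPiece, Prog.wRA])
  have hst : Static σ ρ1 := hS.static.trans ⟨s1 1 (by simp), s1 2 (by simp), s1 3 (by simp),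
    fun a _ _ => s2 a, fun a _ => s3 a⟩
  have hfor : Forest K ρ1 := hS.forest.congr (s1 3 (by simp)) fun a _ => s2 a
  refine (runs_updProg (h.leaf_left hs hi) (h.leaf_right hs hi) hfor.tree (st := st)
    (by rw [s1 5 (by simp), h5]) a1 a2 a3 (tag := L.tag K T q)
    (by rw [s2, hS.tags]) rfl (hfor.agg q.num q.num_lt) (g := g) (by rw [s2]; exact he)).frame.mono le_rfl
    fun τ ⟨⟨c1, c2, c3, c4, c5⟩, hF⟩ => ?_
  have t1 : ∀ r ≤ 6, τ.natReg r = ρ1.natReg r := fun r hr => hF.natReg r fun hm => by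
    have := mem_wN_updProg hm
    omega
  have t2 : ∀ a, a ≠ 24 + q.num → a ≠ 28 + q.num → a ≠ 32 + q.num → a ≠ 36 + q.num →
      τ.natArr a = ρ1.natArr a := fun a d1 d2 d3 d4 => hF.natArr a fun hm => by
    have := mem_wNA_updProg hm
    omega
  have t3 : ∀ a, τ.realArr a = ρ1.realArr a := fun a => hF.realArr a (by
    simp [updProg, actsProg, actNode, pullNode, climbProg, Prog.wRA])
  have hq4 := q.num_lt
  have hne : ∀ q' : Kind, q' ≠ q → q'.num ≠ q.num := fun q' h' e => h' (Kind.num_inj e)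
  refine ⟨⟨hst.trans ⟨t1 1 (by simp), t1 2 (by simp), t1 3 (by simp), fun a d1 d2 =>
    t2 a (by omega) (by omega) (by omega) (by omega), fun a _ => t3 a⟩, ⟨hfor.tree.congr
    (t1 3 (by simp)) (t2 6 (by omega) (by omega) (by omega) (by omega))
    (t2 7 (by omega) (by omega) (by omega) (by omega)), fun k hk u hu => ?_⟩, fun q' => ?_,
    fun q' j hj => ?_⟩, fun r hr => by rw [t1 r hr, s1 r hr], fun R hR => hR.congr
      (by rw [t1 0 (by simp), s1 0 (by simp)]) (fun a ha => by
        rw [t2 a (by omega) (by omega) (by omega) (by omega), s2]) (fun a _ _ => by rw [t3, s3]),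
    fun q' hq' => ?_, c3, fun c hc => ?_⟩
  · by_cases e : k = q.num
    · subst e
      exact c5 u hu
    · have := hfor.agg k hk u hu
      rwa [AggOk, t2 (24 + k) (by omega) (by omega) (by omega) (by omega),
        t2 (28 + k) (by omega) (by omega) (by omega) (by omega),
        t2 (32 + k) (by omega) (by omega) (by omega) (by omega)]
  · by_cases e : q' = q
    · subst e
      funext v
      by_cases hv : L.Touched K q' i v
      · rw [c1 v hv, hg v hv]
      · rw [c2 v hv, hg' v hv]
    · have := hne q' e
      have := q'.num_lt
      rw [t2 _ (by omega) (by omega) (by omega) (by omega), s2, hS.tags, Layout.tag, Layout.tag,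
        Function.update_of_ne e]
  · by_cases e : q' = q
    · subst e
      rw [Function.update_self] at hj
      exact hU j hj
    · rw [Function.update_of_ne e] at hj
      exact hS.lt q' j hj
  · have := hne q' hq'
    have := q'.num_lt
    rw [t2 _ (by omega) (by omega) (by omega) (by omega), s2]
  · rw [c4 c, s2]
    intro v hv
    obtain ⟨m, hm, hv, -⟩ := hv
    exact hc v hv.lt

/-- The new tag when a piece is inserted. -/
def insE (q : Kind) : NatExpr := emax (arr (24 + q.num) (reg 48)) (reg 7)

/-- The old tag that is restored. -/
def undoE (q : Kind) : NatExpr := arr (36 + q.num) (reg 5 + reg 48)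

theorem runs_insPiece (h : Setup n K s p σ) (hs : 0 < s) (hi : i < n)
    (hS : SweepAt (h.layout hs) K σ T ρ) (h6 : ρ.natReg 6 = i) {st : ℕ} (h5 : ρ.natReg 5 = st) :
    Runs (updPiece q (insE q)) ρ (460 * (K + 1)) fun τ =>
      SweepAt (h.layout hs) K σ (Function.update T q (insert i (T q))) τ ∧
      (∀ r ≤ 6, τ.natReg r = ρ.natReg r) ∧ (∀ R, OutPart ρ R → OutPart τ R) ∧
      (∀ q' ≠ q, τ.natArr (36 + q'.num) = ρ.natArr (36 + q'.num)) ∧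
      (∀ v, (h.layout hs).Touched K q i v →
        τ.natArr (36 + q.num) (st + v) = (h.layout hs).tag K T q v) ∧
      ∀ c, (∀ v < 2 ^ (K + 1), c ≠ st + v) →
        τ.natArr (36 + q.num) c = ρ.natArr (36 + q.num) c := by
  classical
  refine (runs_updPiece h hs hi hS h6 h5 (U := insert i (T q)) (e := insE q)
    (g := fun v => max ((h.layout hs).tag K T q v) ((h.layout hs).A q i)) ?_ ?_ ?_ ?_).mono
    (by simp only [insE, emax, cost_add, cost_sub, NatExpr.cost]; omega) fun _ h => h
  · intro j hj
    rcases Finset.mem_insert.1 hj with rfl | hj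
    · exact hi
    · exact hS.lt q j hj
  · intro v ρ' e1 e2 e3 e4 e5
    simp [insE, e1, e3, e4]
  · intro v hv
    rw [Layout.Touched] at hv
    simp only [Layout.tag, Function.update_self]
    rw [tagOf_insert, if_pos hv]
  · intro v hv
    rw [Layout.Touched] at hv
    simp only [Layout.tag, Function.update_self]
    rw [tagOf_insert, if_neg hv]

/-- A maximum does not remember its smaller argument, so the touched nodes are restored from the
log; at every other node the piece had no influence on the tag. -/
theorem runs_undoPiece (h : Setup n K s p σ) (hs : 0 < s) (hi : i < n)
    (hS : SweepAt (h.layout hs) K σ T ρ) (h6 : ρ.natReg 6 = i) {st : ℕ} (h5 : ρ.natReg 5 = st)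
    {T' : Kind → Finset ℕ} (hT : T q = insert i (T' q))
    (hlog : ∀ v, (h.layout hs).Touched K q i v →
      ρ.natArr (36 + q.num) (st + v) = (h.layout hs).tag K T' q v) :
    Runs (updPiece q (undoE q)) ρ (460 * (K + 1)) fun τ =>
      SweepAt (h.layout hs) K σ (Function.update T q (T' q)) τ ∧
      (∀ r ≤ 6, τ.natReg r = ρ.natReg r) ∧ (∀ R, OutPart ρ R → OutPart τ R) ∧
      (∀ q' ≠ q, τ.natArr (36 + q'.num) = ρ.natArr (36 + q'.num)) ∧
      ∀ c, (∀ v < 2 ^ (K + 1), c ≠ st + v) →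
        τ.natArr (36 + q.num) c = ρ.natArr (36 + q.num) c := by
  classical
  refine (runs_updPiece h hs hi hS h6 h5 (U := T' q) (e := undoE q)
    (g := fun v => ρ.natArr (36 + q.num) (st + v)) ?_ ?_ ?_ ?_).mono
    (by simp only [undoE, cost_add, NatExpr.cost]; omega)
    fun _ ⟨c1, c2, c3, c4, _, c6⟩ => ⟨c1, c2, c3, c4, c6⟩
  · intro j hj
    exact hS.lt q j (by rw [hT]; exact Finset.mem_insert_of_mem hj)
  · intro v ρ' e1 e2 e3 e4 e5
    simp [undoE, e1, e2, e5]
  · intro v hv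
    rw [hlog v hv]
    simp only [Layout.tag, Function.update_self]
  · intro v hv
    rw [Layout.Touched] at hv
    simp only [Layout.tag, Function.update_self]
    rw [hT, tagOf_insert, if_neg hv]

end

end RealRAM


/-! ### Logs of the pieces that reach down, and the backward pass -/

namespace RealRAM
open HeapTree

namespace Layout
variable {n : ℕ} (L : Layout n)

/-- The cubes whose pieces are present at time `t` and reach down. -/
noncomputable def downAct (t : ℕ) (q : Kind) : Finset ℕ := if q.down then L.act t q else ∅

theorem downAct_of_hi {i : ℕ} (hi : i < n) :
    L.downAct (L.hi 2 i) = add2 (L.downAct (L.hi 2 i + 1)) ⟨true, false⟩ i := by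
  funext q
  have := congrFun (L.act_of_hi hi) q
  simp only [downAct, add2] at this ⊢
  cases hq : q.down <;> simp_all

theorem downAct_of_lo {i : ℕ} (hi : i < n) :
    L.downAct (L.lo 2 i) = L.downAct (L.lo 2 i + 1) := by
  funext q
  have := congrFun (L.act_succ_of_lo hi) q
  simp only [downAct, add2] at this ⊢
  cases hq : q.down <;> simp_all

theorem downAct_zero : L.downAct 0 = L.act 0 := by
  funext q
  cases hq : q.down
  · simp [downAct, hq, L.act_zero hq]
  · simp [downAct, hq]

theorem downAct_end : L.downAct (2 * n) = fun _ => ∅ := by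
  funext q
  cases hq : q.down
  · simp [downAct, hq]
  · simp [downAct, hq, L.act_end hq]

theorem tag_congr {K : ℕ} {T T' : Kind → Finset ℕ} {q : Kind} (h : T q = T' q) :
    L.tag K T q = L.tag K T' q := by rw [tag, tag, h]

/-- The logs of the tree for the pieces that reach down hold the tags before the insertions at the
positions from `t` on. -/
def Logged (K t : ℕ) (ρ : State) : Prop :=
  ∀ side : Bool, ∀ i < n, t ≤ L.hi 2 i → ∀ v, L.Touched K ⟨true, side⟩ i v →
    ρ.natArr (36 + Kind.num ⟨true, side⟩) (L.hi 2 i * 2 ^ (K + 1) + v) =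
      L.tag K (L.act (L.hi 2 i + 1)) ⟨true, side⟩ v

variable {L}

theorem Logged.congr {K t : ℕ} {ρ τ : State} (h : L.Logged K t ρ)
    (ha : ∀ side : Bool, τ.natArr (36 + Kind.num ⟨true, side⟩) =
      ρ.natArr (36 + Kind.num ⟨true, side⟩)) : L.Logged K t τ := fun side i hi ht v hv => by
  rw [ha]; exact h side i hi ht v hv

theorem Logged.mono {K t t' : ℕ} {ρ : State} (h : L.Logged K t ρ) (ht : t ≤ t') :
    L.Logged K t' ρ := fun side i hi ht' v hv => h side i hi (ht.trans ht') v hv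

/-- Each position owns a block of `2 ^ (K + 1)` log cells, one for each node, and blocks of
different positions are disjoint. So writing in the block of `t` leaves the later ones intact. -/
theorem Logged.keep {K t : ℕ} {ρ τ : State} (h : L.Logged K (t + 1) ρ)
    (ha : ∀ side : Bool, ∀ c, (∀ v < 2 ^ (K + 1), c ≠ t * 2 ^ (K + 1) + v) →
      τ.natArr (36 + Kind.num ⟨true, side⟩) c = ρ.natArr (36 + Kind.num ⟨true, side⟩) c) :
    L.Logged K (t + 1) τ := fun side i hi ht v hv => by
  rw [ha]
  · exact h side i hi ht v hv
  · intro u hu e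
    have := Nat.mul_le_mul_right (2 ^ (K + 1)) ht
    rw [Nat.succ_mul] at this
    omega

end Layout

theorem SweepAt.congr {n K : ℕ} {L : Layout n} {σ ρ τ : State} {T : Kind → Finset ℕ}
    (h : SweepAt L K σ T ρ) (hr : ∀ r < 4, 0 < r → τ.natReg r = ρ.natReg r)
    (ha : τ.natArr = ρ.natArr) (hra : τ.realArr = ρ.realArr) : SweepAt L K σ T τ :=
  ⟨h.static.trans ⟨hr 1 (by simp) (by simp), hr 2 (by simp) (by simp), hr 3 (by simp) (by simp),
    fun a _ _ => by rw [ha], fun a _ => by rw [hra]⟩,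
    h.forest.congr (hr 3 (by simp) (by simp)) fun a _ => by rw [ha],
    fun q => by rw [ha, h.tags], h.lt⟩

theorem Setup.cut_id {n K : ℕ} {s : ℝ} {p : Fin n → Fin 3 → ℝ} {σ : State}
    (h : Setup n K s p σ) (hs : 0 < s) {t : ℕ} (ht : t < 2 * n) :
    (σ.natArr 11 t < n ∧ (h.layout hs).lo 2 (σ.natArr 11 t) = t) ∨
      ¬ σ.natArr 11 t < n ∧ σ.natArr 11 t - n < n ∧ (h.layout hs).hi 2 (σ.natArr 11 t - n) = t := by
  have e := (h.sorted 2 (by norm_num)).rank_ord t ht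
  have l := (h.sorted 2 (by norm_num)).ord_lt t ht
  simp only [Nat.reduceAdd] at e l
  by_cases hc : σ.natArr 11 t < n
  · exact .inl ⟨hc, e⟩
  · refine .inr ⟨hc, by omega, ?_⟩
    show σ.natArr (12 + 2) (n + (σ.natArr 11 t - n)) = t
    rw [show n + (σ.natArr 11 t - n) = σ.natArr 11 t by omega]
    exact e

/-! ### The sweep -/

/-- Proceeds to the end of the sweep. -/
def endProg : Prog :=
  (set 4 (nat 0) ;; set 5 (nat 0)) ;; .while (lt (reg 4) (reg 2))
    (set 4 (reg 4 + nat 1) ;; set 5 (reg 5 + (reg 3 + reg 3)))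

/-- Inserts the pieces that reach down at the previous position. -/
def prepStep : Prog :=
  (set 4 (reg 4 - nat 1) ;; set 5 (reg 5 - (reg 3 + reg 3)) ;; set 6 (arr 11 (reg 4))) ;;
    .ite (lt (reg 6) (reg 1)) .skip (set 6 (reg 6 - reg 1) ;;
      updPiece ⟨true, false⟩ (insE ⟨true, false⟩) ;; updPiece ⟨true, true⟩ (insE ⟨true, true⟩))

/-- Inserts all pieces that reach down, from the end of the sweep to its beginning. -/
def prepProg : Prog := .while (lt (nat 0) (reg 4)) prepStep

/-- Outputs the regions of the two pieces of the cube in register `6` that reach up or down. -/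
def emitBoth (b : Bool) : Prog := emitPiece ⟨b, false⟩ ;; emitPiece ⟨b, true⟩

/-- Treats the lower end of the cube in register `6`. -/
def lowerStep : Prog :=
  emitBoth false ;;
    updPiece ⟨false, false⟩ (insE ⟨false, false⟩) ;; updPiece ⟨false, true⟩ (insE ⟨false, true⟩)

/-- Treats the upper end of the cube in register `6`. -/
def upperStep : Prog :=
  updPiece ⟨true, false⟩ (undoE ⟨true, false⟩) ;; updPiece ⟨true, true⟩ (undoE ⟨true, true⟩) ;;
    emitBoth true

/-- Treats the current position of the sweep and proceeds to the next one. -/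
def sweepStep : Prog :=
  set 6 (arr 11 (reg 4)) ;;
    .ite (lt (reg 6) (reg 1)) lowerStep (set 6 (reg 6 - reg 1) ;; upperStep) ;;
    set 4 (reg 4 + nat 1) ;; set 5 (reg 5 + (reg 3 + reg 3))

/-- Outputs the regions of all pieces. -/
def sweepProg : Prog := .while (lt (reg 4) (reg 2)) sweepStep

/-- The state of the sweep at position `t`. -/
structure AtPos {n : ℕ} (L : Layout n) (K : ℕ) (σ : State) (T : Kind → Finset ℕ)
    (R : Set (Fin 3 → ℝ)) (t : ℕ) (ρ : State) : Prop where
  at_ : SweepAt L K σ T ρ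
  reg4 : ρ.natReg 4 = t
  reg5 : ρ.natReg 5 = t * 2 ^ (K + 1)
  out : OutPart ρ R

section
variable {n K : ℕ} {s : ℝ} {p : Fin n → Fin 3 → ℝ} {σ ρ : State} {T : Kind → Finset ℕ}
  {R : Set (Fin 3 → ℝ)} {t i : ℕ}

/-- Natural numbers cannot be multiplied by the machine, so the log offset `t * 2 ^ (K + 1)` is
accumulated together with the position. -/
theorem runs_endProg (h : Setup n K s p σ) (hs : 0 < s)
    (hA : SweepAt (h.layout hs) K σ T ρ) (hR : OutPart ρ R) :
    Runs endProg ρ (40 * (n + 1)) fun τ => AtPos (h.layout hs) K σ T R (2 * n) τ ∧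
      τ.natReg 0 = ρ.natReg 0 := by
  have e2 : ρ.natReg 2 = 2 * n := by rw [hA.static.reg2, h.reg2]
  have e3 : ρ.natReg 3 = 2 ^ K := by rw [hA.static.reg3, h.tree.size]
  refine Runs.seq_of (T₁ := 4) (T₂ := 40 * n + 30) (R := fun τ => τ.natReg 4 = 0 ∧ τ.natReg 5 = 0)
    (Runs.line rfl (by decide) (by simp)) (fun ρ1 ⟨a1, a2⟩ hF1 => ?_) (by omega)
  refine Runs.while_of (fun τ => τ.natReg 2 = 2 * n ∧ τ.natReg 3 = 2 ^ K ∧ τ.natReg 4 ≤ 2 * n ∧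
    τ.natReg 5 = τ.natReg 4 * 2 ^ (K + 1)) (fun τ => 2 * n - τ.natReg 4) 12
    ⟨by rw [hF1.natReg 2 (by decide), e2], by rw [hF1.natReg 3 (by decide), e3], by omega,
      by simp [a1, a2]⟩ ?_ ?_ ?_
  · rintro τ - ⟨b1, b2, b3, b4⟩ hb
    simp [b1] at hb
    refine Runs.line rfl (by decide) ?_
    simp [b1, b2, b4]
    refine ⟨⟨by omega, ?_⟩, by omega⟩
    rw [pow_succ]; ring
  · rintro τ hF ⟨b1, b2, b3, b4⟩ hb
    simp [b1] at hb
    have e4 : τ.natReg 4 = 2 * n := by omega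
    have hr : ∀ r, r ≠ 4 → r ≠ 5 → τ.natReg r = ρ.natReg r := fun r q1 q2 => by
      rw [hF.natReg r (by simp [Prog.wN, q1, q2]), hF1.natReg r (by simp [Prog.wN, q1, q2])]
    have ha : τ.natArr = ρ.natArr := funext fun a => by
      rw [hF.natArr a (by simp [Prog.wNA]), hF1.natArr a (by simp [Prog.wNA])]
    have hra : τ.realArr = ρ.realArr := funext fun a => by
      rw [hF.realArr a (by simp [Prog.wRA]), hF1.realArr a (by simp [Prog.wRA])]
    have h0 := hr 0 (by norm_num) (by norm_num)
    exact ⟨⟨hA.congr (fun r q1 q2 => hr r (by omega) (by omega)) ha hra, e4, by rw [b4, e4],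
      hR.congr h0 (fun a _ => by rw [ha]) fun a _ _ => by rw [hra]⟩, h0⟩
  · simp [a1, Test.cost, NatExpr.cost]
    omega

/-- Only pieces reaching down are in the trees during the backward pass. The kinds have separate
trees, so for these kinds the tags, and hence the logs, are the ones that the forward sweep will
need. -/
theorem runs_prepStep (h : Setup n K s p σ) (hs : 0 < s) (ht : t < 2 * n)
    (hA : AtPos (h.layout hs) K σ ((h.layout hs).downAct (t + 1)) R (t + 1) ρ)
    (hlog : (h.layout hs).Logged K (t + 1) ρ) :
    Runs prepStep ρ (1000 * (K + 1)) fun τ =>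
      AtPos (h.layout hs) K σ ((h.layout hs).downAct t) R t τ ∧ (h.layout hs).Logged K t τ ∧
      τ.natReg 0 = ρ.natReg 0 := by
  have e1 : ρ.natReg 1 = n := by rw [hA.at_.static.reg1, h.reg1]
  have e3 : ρ.natReg 3 = 2 ^ K := by rw [hA.at_.static.reg3, h.tree.size]
  have e11 : ρ.natArr 11 = σ.natArr 11 := hA.at_.static.natArr 11 (by norm_num) (by norm_num)
  have hM : (t + 1) * 2 ^ (K + 1) - (2 ^ K + 2 ^ K) = t * 2 ^ (K + 1) := by
    rw [Nat.succ_mul, pow_succ]; omega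
  refine Runs.seq_of (T₁ := 14) (T₂ := 980 * (K + 1)) (R := fun τ => τ.natReg 6 = σ.natArr 11 t ∧
    τ.natReg 4 = t ∧ τ.natReg 5 = t * 2 ^ (K + 1))
    (Runs.line rfl (by decide) (by simp [hA.reg4, hA.reg5, e3, e11, hM]))
    (fun ρ1 ⟨a1, a2, a3⟩ hF1 => ?_) (by omega)
  have hr : ∀ r < 4, ρ1.natReg r = ρ.natReg r := fun r q => hF1.natReg r (by
    interval_cases r <;> decide)
  have ha : ρ1.natArr = ρ.natArr := funext fun a => hF1.natArr a (by simp [Prog.wNA])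
  have hra : ρ1.realArr = ρ.realArr := funext fun a => hF1.realArr a (by simp [Prog.wRA])
  have hS1 := hA.at_.congr (fun r q _ => hr r q) ha hra
  have hO1 : OutPart ρ1 R := hA.out.congr (hr 0 (by norm_num)) (fun a _ => by rw [ha])
    fun a _ _ => by rw [hra]
  have hL1 : (h.layout hs).Logged K (t + 1) ρ1 := hlog.congr fun side => by rw [ha]
  have e1' : ρ1.natReg 1 = n := by rw [hr 1 (by norm_num), e1]
  refine (Runs.ite (T := 960 * (K + 1)) (fun hb => ?_) fun hb => ?_).mono
    (by simp [Test.cost, NatExpr.cost]; omega) fun _ h => h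
  · simp [a1, e1'] at hb
    rcases h.cut_id hs ht with ⟨-, hid⟩ | ⟨hid, -⟩
    · refine Runs.line rfl (by simp [Prog.maxCost]; omega) ⟨⟨?_, a2, a3, hO1⟩, ?_, hr 0 (by norm_num)⟩
      · have := (h.layout hs).downAct_of_lo hb
        rw [hid] at this
        rw [this]
        exact hS1
      · intro side i hi hti v hv
        refine hL1 side i hi ?_ v hv
        have := (h.layout hs).ne 2 (by norm_num) _ hb i hi
        rw [hid] at this
        omega
    · omega
  · simp [a1, e1'] at hb
    rcases h.cut_id hs ht with ⟨hid, -⟩ | ⟨-, hi, hid⟩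
    · omega
    set i := σ.natArr 11 t - n with hi_def
    refine Runs.seq_of (T₁ := 4) (T₂ := 940 * (K + 1)) (R := fun τ => τ = ρ1.setNat 6 i)
      (Runs.line rfl (by decide) (by simp [a1, e1', hi_def])) (fun ρ2 hρ2 _ => ?_) (by omega)
    have hS2 : SweepAt (h.layout hs) K σ ((h.layout hs).downAct (t + 1)) ρ2 := hS1.congr
      (fun r q _ => by rw [hρ2, setNat_natReg, if_neg (by omega)]) (by simp [hρ2]) (by simp [hρ2])
    have hO2 : OutPart ρ2 R := hO1.congr (by simp [hρ2]) (by simp [hρ2]) (by simp [hρ2])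
    have hL2 : (h.layout hs).Logged K (t + 1) ρ2 := hL1.congr (by simp [hρ2])
    refine Runs.seq_of (T₁ := 460 * (K + 1)) (T₂ := 460 * (K + 1))
      (runs_insPiece h hs hi hS2 (by simp [hρ2]) (st := t * 2 ^ (K + 1)) (by simp [hρ2, a3]))
      (fun ρ3 ⟨b1, b2, b3, b4, b5, b6⟩ _ => ?_) (by omega)
    refine (runs_insPiece (q := ⟨true, true⟩) h hs hi b1 (by rw [b2 6 (by norm_num)]; simp [hρ2])
      (st := t * 2 ^ (K + 1)) (by rw [b2 5 (by norm_num)]; simp [hρ2, a3])).mono le_rfl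
      fun τ ⟨c1, c2, c3, c4, c5, c6⟩ => ?_
    have hT := (h.layout hs).downAct_of_hi hi
    rw [hid, Layout.add2_eq] at hT
    refine ⟨⟨by rw [hT]; exact c1, ?_, ?_, c3 _ (b3 _ hO2)⟩, ?_, ?_⟩
    · rw [c2 4 (by norm_num), b2 4 (by norm_num)]; simp [hρ2, a2]
    · rw [c2 5 (by norm_num), b2 5 (by norm_num)]; simp [hρ2, a3]
    · have hkeep : (h.layout hs).Logged K (t + 1) τ := hL2.keep fun side c hc => by
        cases side
        · rw [c4 ⟨true, false⟩ (by decide), b6 c hc]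
        · rw [c6 c hc, b4 ⟨true, true⟩ (by decide)]
      intro side j hj htj v hv
      rcases Nat.eq_or_lt_of_le htj with e | hlt
      · obtain rfl : j = i := (h.layout hs).hi_inj 2 (by norm_num) j hj i hi (by rw [hid, e])
        rw [← e]
        cases side
        · rw [c4 ⟨true, false⟩ (by decide), b5 v hv]
          exact congrFun ((h.layout hs).tag_congr (by simp [Layout.downAct])) v
        · rw [c5 v hv]
          exact congrFun ((h.layout hs).tag_congr (by simp [Layout.downAct])) v
      · exact hkeep side j hj hlt v hv
    · rw [c2 0 (by norm_num), b2 0 (by norm_num), hρ2, setNat_natReg, if_neg (by norm_num),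
        hr 0 (by norm_num)]

theorem runs_prepProg (h : Setup n K s p σ) (hs : 0 < s)
    (hA : AtPos (h.layout hs) K σ (fun _ => ∅) R (2 * n) ρ) :
    Runs prepProg ρ (2010 * (n + 1) * (K + 1)) fun τ =>
      AtPos (h.layout hs) K σ ((h.layout hs).act 0) R 0 τ ∧ (h.layout hs).Logged K 0 τ ∧
      τ.natReg 0 = ρ.natReg 0 := by
  refine Runs.while_of (fun τ => ∃ t ≤ 2 * n, AtPos (h.layout hs) K σ ((h.layout hs).downAct t) R t τ ∧
    (h.layout hs).Logged K t τ ∧ τ.natReg 0 = ρ.natReg 0) (fun τ => τ.natReg 4) (1000 * (K + 1))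
    ⟨2 * n, le_rfl, by rwa [Layout.downAct_end], ?_, rfl⟩ ?_ ?_ ?_
  · intro side i hi ht
    have := (h.layout hs).hi_lt 2 (by norm_num) i hi
    omega
  · rintro τ - ⟨t, ht, hP, hlog, h0⟩ hb
    simp [hP.reg4] at hb
    obtain ⟨t, rfl⟩ : ∃ u, t = u + 1 := ⟨t - 1, by omega⟩
    refine (runs_prepStep h hs (by omega) hP hlog).mono le_rfl fun τ' ⟨c1, c2, c3⟩ =>
      ⟨⟨t, by omega, c1, c2, by rw [c3, h0]⟩, ?_⟩
    rw [c1.reg4, hP.reg4]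
    omega
  · rintro τ - ⟨t, ht, hP, hlog, h0⟩ hb
    simp [hP.reg4] at hb
    subst hb
    rw [Layout.downAct_zero] at hP
    exact ⟨hP, hlog, h0⟩
  · rw [hA.reg4]
    simp only [Test.cost, NatExpr.cost]
    have e : 2010 * (n + 1) * (K + 1) = 2 * n * (1000 * (K + 1) + (1 + 1 + 1 + 1)) + 4 +
      (2 * n * K + 2 * n * 1 + 2010 * K + 2006 + 8 * n * K) := by ring
    omega

end

end RealRAM


/-! ### The forward sweep, the whole program and its running time -/

namespace RealRAM
open HeapTree

section
variable {n K : ℕ} {s : ℝ} {p : Fin n → Fin 3 → ℝ} {σ ρ : State} {T : Kind → Finset ℕ}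
  {t i : ℕ}

theorem runs_emitBoth (h : Setup n K s p σ) (hs : 0 < s) (hi : i < n) {b : Bool}
    (hT : T = (h.layout hs).act ((h.layout hs).evTime ⟨b, false⟩ i))
    (ht : (h.layout hs).evPos ⟨b, false⟩ i = t)
    (hS : SweepAt (h.layout hs) K σ T ρ) (h6 : ρ.natReg 6 = i)
    (hR : OutPart ρ ((h.layout hs).regions (σ.iota n) t)) :
    Runs (emitBoth b) ρ (2010 * (K + 1) * ((h.layout hs).cuts T ⟨b, false⟩ i +
        (h.layout hs).cuts T ⟨b, true⟩ i + 4) + 240) fun τ =>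
      SweepAt (h.layout hs) K σ T τ ∧ (∀ r, 3 < r → r < 7 → τ.natReg r = ρ.natReg r) ∧
      (∀ a, 24 ≤ a → τ.natArr a = ρ.natArr a) ∧
      OutPart τ ((h.layout hs).regions (σ.iota n) (t + 1)) ∧
      τ.natReg 0 ≤ ρ.natReg 0 + 3 * ((h.layout hs).cuts T ⟨b, false⟩ i +
        (h.layout hs).cuts T ⟨b, true⟩ i + 2) := by
  subst ht
  refine Runs.seq_of (runs_emitPiece h hs hi hT hS h6 hR ((h.layout hs).regions_disjoint hi))
    (T₂ := 2010 * (K + 1) * ((h.layout hs).cuts T ⟨b, true⟩ i + 2) + 120)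
    (fun ρ1 ⟨a1, a2, a3, a4, a5⟩ _ => ?_) (by ring_nf; omega)
  refine (runs_emitPiece (q := ⟨b, true⟩) h hs hi hT a1
    (by rw [a2 6 (by norm_num) (by norm_num), h6]) a4 ?_).mono le_rfl
    fun τ ⟨b1, b2, b3, b4, b5⟩ => ⟨b1, fun r h1 h2 => by rw [b2 r h1 h2, a2 r h1 h2],
      fun a ha => by rw [b3 a ha, a3 a ha], ?_, by omega⟩
  · exact Disjoint.union_left
      ((h.layout hs).regions_disjoint (q := ⟨b, true⟩) hi)
      ((h.layout hs).region_disjoint_opp (q := ⟨b, false⟩) hi)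
  · rw [(h.layout hs).regions_succ hi]
    exact b4

/-- The bound for the number of changes of the profiles at `t`. -/
noncomputable def Layout.stepCuts {n : ℕ} (L : Layout n) (t : ℕ) : ℕ := L.upCuts t + L.downCuts t

/-- Output precedes insertion: the regions refer to the pieces present at time `t = lo 2 i`, before
the cube itself appears. -/
theorem runs_lowerStep (h : Setup n K s p σ) (hs : 0 < s) (hi : i < n)
    (ht : (h.layout hs).lo 2 i = t)
    (hA : AtPos (h.layout hs) K σ ((h.layout hs).act t) ((h.layout hs).regions (σ.iota n) t) t ρ)
    (hlog : (h.layout hs).Logged K t ρ) (h6 : ρ.natReg 6 = i) :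
    Runs lowerStep ρ (2010 * (K + 1) * ((h.layout hs).stepCuts t + 5)) fun τ =>
      SweepAt (h.layout hs) K σ ((h.layout hs).act (t + 1)) τ ∧
      τ.natReg 4 = t ∧ τ.natReg 5 = t * 2 ^ (K + 1) ∧
      OutPart τ ((h.layout hs).regions (σ.iota n) (t + 1)) ∧ (h.layout hs).Logged K (t + 1) τ ∧
      τ.natReg 0 ≤ ρ.natReg 0 + 3 * ((h.layout hs).stepCuts t + 2) := by
  have hc : (h.layout hs).stepCuts t = (h.layout hs).cuts ((h.layout hs).act t) ⟨false, false⟩ i +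
      (h.layout hs).cuts ((h.layout hs).act t) ⟨false, true⟩ i := by
    rw [← ht, Layout.stepCuts, Layout.upCuts_eq _ hi, Layout.downCuts_lo _ hi, add_zero]
  rw [hc]
  have hT := (h.layout hs).act_succ_of_lo hi
  rw [ht, Layout.add2_eq] at hT
  refine Runs.seq_of (T₂ := 920 * (K + 1))
    (runs_emitBoth (t := t) h hs hi (by rw [← ht]; rfl) ht hA.at_ h6 hA.out)
    (fun ρ1 ⟨a1, a2, a3, a4, a5⟩ _ => ?_) (by ring_nf; omega)
  refine Runs.seq_of (T₁ := 460 * (K + 1)) (T₂ := 460 * (K + 1))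
    (runs_insPiece h hs hi a1 (by rw [a2 6 (by norm_num) (by norm_num), h6]) rfl)
    (fun ρ2 ⟨b1, b2, b3, b4, _⟩ _ => ?_) (by omega)
  refine (runs_insPiece (q := ⟨false, true⟩) h hs hi b1
    (by rw [b2 6 (by norm_num), a2 6 (by norm_num) (by norm_num), h6]) rfl).mono le_rfl
    fun τ ⟨c1, c2, c3, c4, _⟩ => ⟨by rw [hT]; exact c1, ?_, ?_, c3 _ (b3 _ a4), ?_, ?_⟩
  · rw [c2 4 (by norm_num), b2 4 (by norm_num), a2 4 (by norm_num) (by norm_num), hA.reg4]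
  · rw [c2 5 (by norm_num), b2 5 (by norm_num), a2 5 (by norm_num) (by norm_num), hA.reg5]
  · refine (hlog.mono (Nat.le_succ t)).congr fun side => ?_
    rw [c4 _ (by simp), b4 _ (by simp), a3 _ (by omega)]
  · rw [c2 0 (by norm_num), b2 0 (by norm_num)]
    exact a5

/-- Removal precedes output: the regions refer to time `t + 1`, when the cube itself has gone. The
tags restored from the log are those with which the backward pass arrived at this position. -/
theorem runs_upperStep (h : Setup n K s p σ) (hs : 0 < s) (hi : i < n)
    (ht : (h.layout hs).hi 2 i = t)
    (hA : AtPos (h.layout hs) K σ ((h.layout hs).act t) ((h.layout hs).regions (σ.iota n) t) t ρ)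
    (hlog : (h.layout hs).Logged K t ρ) (h6 : ρ.natReg 6 = i) :
    Runs upperStep ρ (2010 * (K + 1) * ((h.layout hs).stepCuts t + 5)) fun τ =>
      SweepAt (h.layout hs) K σ ((h.layout hs).act (t + 1)) τ ∧
      τ.natReg 4 = t ∧ τ.natReg 5 = t * 2 ^ (K + 1) ∧
      OutPart τ ((h.layout hs).regions (σ.iota n) (t + 1)) ∧ (h.layout hs).Logged K (t + 1) τ ∧
      τ.natReg 0 ≤ ρ.natReg 0 + 3 * ((h.layout hs).stepCuts t + 2) := by
  have hc : (h.layout hs).stepCuts t =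
      (h.layout hs).cuts ((h.layout hs).act (t + 1)) ⟨true, false⟩ i +
      (h.layout hs).cuts ((h.layout hs).act (t + 1)) ⟨true, true⟩ i := by
    rw [← ht, Layout.stepCuts, Layout.upCuts_hi _ hi, Layout.downCuts_eq _ hi, zero_add]
  rw [hc]
  have hT := (h.layout hs).act_of_hi hi
  rw [ht] at hT
  have hT1 := congrFun hT ⟨true, false⟩
  have hT2 := congrFun hT ⟨true, true⟩
  rw [Layout.add2_eq, Function.update_of_ne (by decide), Function.update_self] at hT1
  rw [Layout.add2_eq, show (⟨true, true⟩ : Kind) = Kind.opp ⟨true, false⟩ from rfl,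
    Function.update_self, Function.update_of_ne (by decide)] at hT2
  change (h.layout hs).act t ⟨true, true⟩ =
    insert i ((h.layout hs).act (t + 1) ⟨true, true⟩) at hT2
  have hT' : Function.update (Function.update ((h.layout hs).act t) ⟨true, false⟩
      ((h.layout hs).act (t + 1) ⟨true, false⟩)) ⟨true, true⟩
      ((h.layout hs).act (t + 1) ⟨true, true⟩) = (h.layout hs).act (t + 1) := by
    funext q
    rcases eq_or_ne q ⟨true, true⟩ with rfl | h2
    · rw [Function.update_self]
    rw [Function.update_of_ne h2]
    rcases eq_or_ne q ⟨true, false⟩ with rfl | h1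
    · rw [Function.update_self]
    rw [Function.update_of_ne h1, hT, Layout.add2_eq,
      Function.update_of_ne (show q ≠ Kind.opp ⟨true, false⟩ from h2), Function.update_of_ne h1]
  have hl : ∀ side v, (h.layout hs).Touched K ⟨true, side⟩ i v →
      ρ.natArr (36 + Kind.num ⟨true, side⟩) (t * 2 ^ (K + 1) + v) =
        (h.layout hs).tag K ((h.layout hs).act (t + 1)) ⟨true, side⟩ v := fun side v hv => by
    have := hlog side i hi ht.ge v hv
    rwa [ht] at this
  refine Runs.seq_of (T₁ := 460 * (K + 1)) (T₂ := 2010 * (K + 1) *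
      ((h.layout hs).cuts ((h.layout hs).act (t + 1)) ⟨true, false⟩ i +
        (h.layout hs).cuts ((h.layout hs).act (t + 1)) ⟨true, true⟩ i + 4) + 240 + 460 * (K + 1))
    (runs_undoPiece h hs hi hA.at_ h6 hA.reg5 hT1 (hl false))
    (fun ρ1 ⟨a1, a2, a3, a4, a5⟩ _ => ?_) (by ring_nf; omega)
  refine Runs.seq_of (T₁ := 460 * (K + 1)) (T₂ := 2010 * (K + 1) *
      ((h.layout hs).cuts ((h.layout hs).act (t + 1)) ⟨true, false⟩ i +
        (h.layout hs).cuts ((h.layout hs).act (t + 1)) ⟨true, true⟩ i + 4) + 240)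
    (runs_undoPiece (q := ⟨true, true⟩) (st := t * 2 ^ (K + 1)) (T' := (h.layout hs).act (t + 1)) h hs hi a1
      (by rw [a2 6 (by norm_num), h6]) (by rw [a2 5 (by norm_num), hA.reg5])
      (by rw [Function.update_of_ne (by decide), hT2]) fun v hv => by
        rw [a4 _ (by decide)]; exact hl true v hv)
    (fun ρ2 ⟨b1, b2, b3, b4, b5⟩ _ => ?_) (by omega)
  rw [hT'] at b1
  refine (runs_emitBoth (b := true) (t := t) h hs hi (by rw [← ht]; rfl) ht b1
    (by rw [b2 6 (by norm_num), a2 6 (by norm_num), h6]) (b3 _ (a3 _ hA.out))).mono le_rfl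
    fun τ ⟨c1, c2, c3, c4, c5⟩ => ⟨c1, ?_, ?_, c4, ?_, ?_⟩
  · rw [c2 4 (by norm_num) (by norm_num), b2 4 (by norm_num), a2 4 (by norm_num), hA.reg4]
  · rw [c2 5 (by norm_num) (by norm_num), b2 5 (by norm_num), a2 5 (by norm_num), hA.reg5]
  · refine (hlog.mono (Nat.le_succ t)).keep fun side c hc => ?_
    rw [c3 _ (by omega)]
    cases side
    · rw [b4 ⟨true, false⟩ (by decide), a5 c hc]
    · rw [b5 c hc, a4 ⟨true, true⟩ (by decide)]
  · rw [b2 0 (by norm_num), a2 0 (by norm_num)] at c5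
    exact c5

theorem runs_sweepStep (h : Setup n K s p σ) (hs : 0 < s) (ht : t < 2 * n)
    (hA : AtPos (h.layout hs) K σ ((h.layout hs).act t) ((h.layout hs).regions (σ.iota n) t) t ρ)
    (hlog : (h.layout hs).Logged K t ρ) :
    Runs sweepStep ρ (2010 * (K + 1) * ((h.layout hs).stepCuts t + 5) + 40) fun τ =>
      AtPos (h.layout hs) K σ ((h.layout hs).act (t + 1))
        ((h.layout hs).regions (σ.iota n) (t + 1)) (t + 1) τ ∧
      (h.layout hs).Logged K (t + 1) τ ∧
      τ.natReg 0 ≤ ρ.natReg 0 + 3 * ((h.layout hs).stepCuts t + 2) := by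
  have e1 : ρ.natReg 1 = n := by rw [hA.at_.static.reg1, h.reg1]
  have e11 : ρ.natArr 11 = σ.natArr 11 := hA.at_.static.natArr 11 (by norm_num) (by norm_num)
  have hA' : ∀ v, AtPos (h.layout hs) K σ ((h.layout hs).act t)
      ((h.layout hs).regions (σ.iota n) t) t (ρ.setNat 6 v) := fun v =>
    ⟨hA.at_.congr (fun r h1 h2 => by rw [setNat_natReg, if_neg (by omega)]) rfl rfl,
      by simp [hA.reg4], by simp [hA.reg5], hA.out.congr (by simp) (by simp) (by simp)⟩
  have hlog' : ∀ v, (h.layout hs).Logged K t (ρ.setNat 6 v) := fun v => hlog.congr fun _ => rfl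
  refine Runs.seq_of (T₁ := 4) (T₂ := 2010 * (K + 1) * ((h.layout hs).stepCuts t + 5) + 30)
    (R := fun τ => τ = ρ.setNat 6 (σ.natArr 11 t))
    (Runs.line rfl (by decide) (by simp [hA.reg4, e11])) (fun ρ1 hρ1 _ => ?_) (by omega)
  subst hρ1
  refine Runs.seq_of (T₁ := 4 + (2010 * (K + 1) * ((h.layout hs).stepCuts t + 5) + 4)) (T₂ := 20)
    (R := fun τ => SweepAt (h.layout hs) K σ ((h.layout hs).act (t + 1)) τ ∧
      τ.natReg 4 = t ∧ τ.natReg 5 = t * 2 ^ (K + 1) ∧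
      OutPart τ ((h.layout hs).regions (σ.iota n) (t + 1)) ∧ (h.layout hs).Logged K (t + 1) τ ∧
      τ.natReg 0 ≤ ρ.natReg 0 + 3 * ((h.layout hs).stepCuts t + 2))
    (Runs.ite (fun hb => ?_) fun hb => ?_) (fun ρ2 ⟨a1, a2, a3, a4, a5, a6⟩ _ => ?_) (by omega)
  · simp [e1] at hb
    rcases h.cut_id hs ht with ⟨-, hid⟩ | ⟨hid, -⟩
    · exact (runs_lowerStep h hs hb hid (hA' _) (hlog' _) (by simp)).mono (by omega)
        fun τ hτ => by simpa using hτ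
    · omega
  · simp [e1] at hb
    rcases h.cut_id hs ht with ⟨hid, -⟩ | ⟨-, hi, hid⟩
    · omega
    refine Runs.seq_of (T₁ := 4) (T₂ := 2010 * (K + 1) * ((h.layout hs).stepCuts t + 5))
      (R := fun τ => τ = ρ.setNat 6 (σ.natArr 11 t - n))
      (Runs.line rfl (by decide) (by simp [e1, State.setNat])) (fun ρ2 hρ2 _ => ?_) (by omega)
    subst hρ2
    exact (runs_upperStep h hs hi hid (hA' _) (hlog' _) (by simp)).mono le_rfl
      fun τ hτ => by simpa using hτ
  · have e3 : ρ2.natReg 3 = 2 ^ K := by rw [a1.static.reg3, h.tree.size]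
    refine Runs.line rfl (by decide) ⟨⟨?_, ?_, ?_, ?_⟩, ?_, ?_⟩
    · exact a1.congr (fun r h1 h2 => by
        interval_cases r <;> simp) (by simp) (by simp)
    · simp [a2]
    · simp [a3, e3]
      rw [Nat.succ_mul, pow_succ]; omega
    · exact a4.congr (by simp) (by simp) (by simp)
    · exact a5.congr (by simp)
    · simpa using a6

/-- The bound for the time from position `t` on. -/
noncomputable def Layout.timeFrom {n : ℕ} (L : Layout n) (K t : ℕ) : ℕ :=
  ∑ u ∈ Finset.Ico t (2 * n), (2010 * (K + 1) * (L.stepCuts u + 5) + 50)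

theorem Layout.sum_stepCuts_le {n : ℕ} (L : Layout n) :
    ∑ t ∈ Finset.range (2 * n), L.stepCuts t ≤ 96 * n := by
  have h1 := L.sum_upCuts_le
  have h2 := L.sum_downCuts_le
  simp only [Layout.stepCuts, Finset.sum_add_distrib]
  omega

/-- A single step may be expensive; only the sum of the changes is bounded, so the loop is run on
the budget `timeFrom`. The constants are `213060 = 2010 * (96 + 10)` and `300 = 3 * (96 + 4)`, where
`96 n` bounds the changes and the rest is a fixed share of each of the `2 n` steps. -/
theorem runs_sweepProg (h : Setup n K s p σ) (hs : 0 < s) (h0 : ρ.natReg 0 = 0)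
    (hA : AtPos (h.layout hs) K σ ((h.layout hs).act 0) ∅ 0 ρ)
    (hlog : (h.layout hs).Logged K 0 ρ) :
    Runs sweepProg ρ (213060 * (K + 1) * n + 100 * n + 4) fun τ =>
      OutPart τ ((h.layout hs).regions (σ.iota n) (2 * n)) ∧ τ.natReg 0 ≤ 300 * n := by
  set L := h.layout hs with hL
  have hsum := L.sum_stepCuts_le
  refine (Runs.while_budget (fun τ => ∃ t ≤ 2 * n,
      AtPos L K σ (L.act t) (L.regions (σ.iota n) t) t τ ∧ L.Logged K t τ ∧
      τ.natReg 0 ≤ 3 * ∑ u ∈ Finset.range t, (L.stepCuts u + 2))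
    (fun τ => L.timeFrom K (τ.natReg 4)) ?_ ⟨0, by omega, ?_, hlog, by simp [h0]⟩).mono ?_ ?_
  · rintro τ - ⟨t, ht, hP, hl, hc⟩ hb
    have e2 : τ.natReg 2 = 2 * n := by rw [hP.at_.static.reg2, h.reg2]
    simp [hP.reg4, e2] at hb
    refine ⟨_, (runs_sweepStep h hs hb hP hl).mono le_rfl fun τ' ⟨c1, c2, c3⟩ =>
      ⟨⟨t + 1, hb, c1, c2, ?_⟩, ?_⟩⟩
    · rw [Finset.sum_range_succ]
      rw [← hL] at c3
      omega
    · rw [c1.reg4, hP.reg4, Layout.timeFrom, Layout.timeFrom, Finset.sum_eq_sum_Ico_succ_bot hb]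
      simp only [Test.cost, NatExpr.cost]
      rw [← hL]
      omega
  · rwa [Layout.regions_zero]
  · have e : L.timeFrom K 0 = 2010 * (K + 1) * (∑ u ∈ Finset.range (2 * n), L.stepCuts u) +
        2010 * (K + 1) * (10 * n) + 100 * n := by
      rw [Layout.timeFrom, ← Finset.range_eq_Ico, Finset.sum_add_distrib, ← Finset.mul_sum,
        Finset.sum_add_distrib]
      simp
      ring
    have := Nat.mul_le_mul_left (2010 * (K + 1)) hsum
    rw [hA.reg4, e]
    simp only [Test.cost, NatExpr.cost]
    calc _ ≤ 2010 * (K + 1) * (96 * n) + 2010 * (K + 1) * (10 * n) + 100 * n + 4 := by omega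
      _ = _ := by ring
  · rintro τ ⟨⟨t, ht, hP, hl, hc⟩, hb, -⟩
    have e2 : τ.natReg 2 = 2 * n := by rw [hP.at_.static.reg2, h.reg2]
    simp [hP.reg4, e2] at hb
    obtain rfl : t = 2 * n := by omega
    refine ⟨hP.out, hc.trans ?_⟩
    rw [Finset.sum_add_distrib]
    simp
    omega

/-- Before the sweep, no piece is present. -/
theorem Setup.sweepAt (h : Setup n K s p σ) (hs : 0 < s) (h0 : ∀ a, 24 ≤ a → σ.natArr a = fun _ => 0) :
    SweepAt (h.layout hs) K σ (fun _ => ∅) σ := by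
  refine ⟨⟨rfl, rfl, rfl, fun _ _ _ => rfl, fun _ _ => rfl⟩, ⟨h.tree, fun k hk u hu => ?_⟩,
    fun q => ?_, by simp⟩
  · rw [AggOk, h0 _ (by omega), h0 _ (by omega), h0 _ (by omega)]
    exact ⟨fun _ => ⟨rfl, rfl⟩, fun _ => ⟨rfl, rfl⟩⟩
  · rw [h0 _ (by omega)]
    funext v
    simp [Layout.tag, tagOf]

set_option maxRecDepth 10000 in
theorem cutProg_writes : ∀ a ∈ cutProg.wNA, a < 24 := by decide

set_option maxRecDepth 10000 in
theorem layoutProg_writes : 0 ∉ layoutProg.wN ∧ ∀ a ∈ layoutProg.wNA, a < 24 := by decide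

/-- Decomposes the union of the cubes. -/
def unionProg : Prog := cutProg ;; layoutProg ;; endProg ;; prepProg ;; sweepProg

/-- The setup writes only natural-number arrays below `24`, so the trees and logs are still zero
when the sweep is prepared, which represents the absence of all pieces. -/
theorem runs_unionProg (p : Fin n → Fin 3 → ℝ) (hs : 0 < s) :
    Runs unionProg (cubesInput s p) (400000 * (n + 1) * (Nat.log 2 (16 * n + 4) + 1)) fun τ =>
      OutPart τ (⋃ i, closedCube (p i) s) ∧ τ.natReg 0 ≤ 300 * n := by
  set M := Nat.log 2 (16 * n + 4) with hM
  have hz : n + 1 ≤ (n + 1) * (M + 1) := Nat.le_mul_of_pos_right _ (by omega)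
  have e0 : ∀ c, c * (n + 1) * (M + 1) = c * ((n + 1) * (M + 1)) := fun c => by ring
  rw [e0]
  refine Runs.seq_of (T₂ := 300000 * ((n + 1) * (M + 1))) (runs_cutProg p)
    (fun σ1 ⟨K, hK, hC, h0⟩ hF1 => ?_) (by rw [← hM, e0]; omega)
  rw [← hM] at hK
  have hKM : ∀ c, c * (n + 1) * (K + 1) ≤ c * ((n + 1) * (M + 1)) := fun c => by
    rw [mul_assoc]; gcongr
  refine Runs.seq_of (T₂ := 280000 * ((n + 1) * (M + 1))) (runs_layoutProg hs hC)
    (fun σ hS hF2 => ?_) (le_trans (Nat.add_le_add_right (hKM _) _) (by omega))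
  have z0 : σ.natReg 0 = 0 := by rw [hF2.natReg 0 layoutProg_writes.1, h0]
  have zA : ∀ a, 24 ≤ a → σ.natArr a = fun _ => 0 := fun a ha => by
    rw [hF2.natArr a (fun hb => absurd (layoutProg_writes.2 a hb) (by omega)),
      hF1.natArr a (fun hb => absurd (cutProg_writes a hb) (by omega))]
    rfl
  refine Runs.seq_of (T₂ := 270000 * ((n + 1) * (M + 1))) (runs_endProg (R := ∅) hS hs
    (hS.sweepAt hs zA) ⟨by simp [State.outCount, z0], by simp [State.outCount, z0],
      by simp [State.outCount, z0]⟩) (fun ρ1 ⟨a1, a2⟩ _ => ?_) (by omega)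
  refine Runs.seq_of (T₂ := 260000 * ((n + 1) * (M + 1))) (runs_prepProg hS hs a1)
    (fun ρ2 ⟨b1, b2, b3⟩ _ => ?_) (le_trans (Nat.add_le_add_right (hKM _) _) (by omega))
  refine (runs_sweepProg hS hs (by rw [b3, a2, z0]) b1 b2).mono ?_ fun τ ⟨c1, c2⟩ => ⟨?_, c2⟩
  · have e : 213060 * (K + 1) * n ≤ 213060 * ((n + 1) * (M + 1)) :=
      le_trans (by rw [mul_right_comm]; gcongr; omega) (hKM 213060)
    omega
  · have : (hS.layout hs).regions (σ.iota n) (2 * n) = ⋃ i, closedCube (p i) s := by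
      ext x
      rw [Layout.mem_regions_end, hS.in_iff hs]
    rwa [← this]

end

/-- The time bound is of order `n log n`; one factor `log n ≥ 1` is given away. -/
theorem isBigO_time : (fun n : ℕ => ((400000 * (n + 1) * (Nat.log 2 (16 * n + 4) + 1) : ℕ) : ℝ))
    =O[atTop] fun n : ℕ => (n : ℝ) * Real.log (n : ℝ) ^ 2 := by
  -- The factor `2` comes from `n + 1 ≤ 2 n`, and `20` leaves room for `4 log n + 1 ≤ 20 (log n) ^
  -- 2`.
  refine IsBigO.of_bound (400000 * 2 * 20) ?_
  filter_upwards [eventually_ge_atTop 20] with n hn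
  have hn' : (20 : ℝ) ≤ n := by exact_mod_cast hn
  have h1 : 1 ≤ Real.log n := by
    rw [Real.le_log_iff_exp_le (by linarith)]
    have := Real.exp_one_lt_d9
    linarith
  have h2 : (Nat.log 2 (16 * n + 4) : ℝ) ≤ 4 * Real.log n := by
    have hb : 2 ^ Nat.log 2 (16 * n + 4) ≤ 16 * n + 4 := Nat.pow_log_le_self 2 (by omega)
    have hb' : ((2 : ℝ) ^ Nat.log 2 (16 * n + 4)) ≤ (n : ℝ) ^ 2 := by
      -- With `n ^ 2` in place of `16 n + 4`, the binary logarithm is at most `2 log n / log 2 ≤ 4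
      -- log n`.
      have : 16 * n + 4 ≤ n ^ 2 := by nlinarith
      exact_mod_cast hb.trans this
    have := Real.log_le_log (by positivity) hb'
    rw [Real.log_pow, Real.log_pow] at this
    have h3 := Real.log_two_gt_d9
    have h4 : (Nat.log 2 (16 * n + 4) : ℝ) * (1 / 2) ≤
        (Nat.log 2 (16 * n + 4) : ℝ) * Real.log 2 := by gcongr; linarith
    push_cast at this
    linarith
  rw [Real.norm_of_nonneg (by positivity), Real.norm_of_nonneg (by positivity)]
  push_cast
  have h5 : Real.log n ≤ Real.log n ^ 2 := by nlinarith
  calc (400000 : ℝ) * (n + 1) * (Nat.log 2 (16 * n + 4) + 1)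
      ≤ 400000 * (2 * n) * (20 * Real.log n ^ 2) := by gcongr <;> linarith
    _ = _ := by ring

end RealRAM

/-- One real-RAM program decomposes the union of any `n` congruent axis-aligned cubes in `ℝ³` into
`O(n)` pairwise disjoint boxes in time `O(n log² n)`. -/
theorem mainTheorem9 :
    ∃ (P : RealRAM.Prog) (K : ℕ) (T : ℕ → ℕ),
      ((fun n : ℕ => (T n : ℝ)) =O[atTop] fun n : ℕ => (n : ℝ) * Real.log (n : ℝ) ^ 2) ∧
      ∀ (n : ℕ) (s : ℝ) (p : Fin n → Fin 3 → ℝ), 0 < s →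
        ∃ (t : ℕ) (τ : RealRAM.State),
          RealRAM.Exec P (RealRAM.cubesInput s p) t τ ∧
          t ≤ T n ∧
          τ.outCount ≤ K * n ∧
          IsDisjointBoxDecomposition (fun k : Fin τ.outCount => τ.outBox k)
            (⋃ i, closedCube (p i) s) := by
  refine ⟨RealRAM.unionProg, 300, fun n => 400000 * (n + 1) * (Nat.log 2 (16 * n + 4) + 1),
    RealRAM.isBigO_time, fun n s p hs => ?_⟩
  obtain ⟨t, τ, h1, h2, h3, h4⟩ := RealRAM.runs_unionProg p hs
  exact ⟨t, τ, h1, h2, h4, h3.decomposition⟩
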